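/- **Setting.** Let $n\ge1$, let $\Omega\subset\mathbb R^n$ be an open bounded Lipschitz polytope with outward unit normal $\mathbf n_\Omega^x$, $T>0$, $Q=\Omega\times(0,T)$. Let $\partial\Omega=\Gamma_D\cup\Gamma_N\cup\Gamma_R$, where the parts overlap in null sets only and some may be empty, let $c=c(\mathbf x)\ge c_0>0$ be a piecewise constant wave speed independent of $t$, and let $\vartheta\in L^\infty(\Gamma_R\times[0,T])$ be uniformly positive. Given $L^2$ data $v_0,\boldsymbol\sigma_0,g_D,g_N,g_R$, consider $$\nabla v+\partial_t\boldsymbol\sigma=0,\quad \nabla\cdot\boldsymbol\sigma+c^{-2}\partial_t v=0\ \text{ in }Q,\qquad v(\cdot,0)=v_0,\ \boldsymbol\sigma(\cdot,0)=\boldsymbol\sigma_0\ \text{ on }\Omega,$$ $$v=g_D\ \text{on }\Gamma_D\times[0,T],\quad \boldsymbol\sigma\cdot\mathbf n_\Omega^x=g_N\ \text{on }\Gamma_N\times[0,T],\quad \tfrac{\vartheta}{c}v-\boldsymbol\sigma\cdot\mathbf n_\Omega^x=g_R\ \text{on }\Gamma_R\times[0,T].\tag{1}$$ **Mesh.** Let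 $\mathcal T_h$ be a finite partition of $Q$ into Lipschitz polytopes $K\subset\mathbb R^{n+1}$, with $c$ constant in each $K$ and with outward unit normals $(\mathbf n_K^x,n_K^t)$. Every internal face $F$, with unit normal $(\mathbf n_F^x,n_F^t)$, is assumed to be either space-like ($c|\mathbf n_F^x|<n_F^t$) or time-like ($n_F^t=0$). Let $\mathcal F^{\rm space}$, $\mathcal F^{\rm time}$ be the unions of the internal space-like and time-like faces, $\mathcal F^0=\Omega\times\{0\}$, $\mathcal F^T=\Omega\times\{T\}$, and $\mathcal F^{D}=\Gamma_D\times[0,T]$, $\mathcal F^{N}=\Gamma_N\times[0,T]$, $\mathcal F^{R}=\Gamma_R\times[0,T]$. On a face between $K_1$ and $K_2$ set $$\{\!\!\{w\}\!\!\}=\tfrac12(w_{|K_1}+w_{|K_2}),\quad [\![w]\!]_N=w_{|K_1}\mathbf n^x_{K_1}+w_{|K_2}\mathbf n^x_{K_2},\quad [\![w]\!]_t=w_{|K_1}n^t_{K_1}+w_{|K_2}n^t_{K_2},$$ and for vector fields let $\{\!\!\{\boldsymbol\tau\}\!\!\}$ and $[\![\boldsymbol\tau]\!]_t$ be defined in the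 same way and $[\![\boldsymbol\tau]\!]_N=\boldsymbol\tau_{|K_1}\cdot\mathbf n^x_{K_1}+\boldsymbol\tau_{|K_2}\cdot\mathbf n^x_{K_2}$. On $\mathcal F^{\rm space}$ let $w^-,\boldsymbol\tau^-$ be the traces from the element at lower times and $\gamma=c|\mathbf n_F^x|/n_F^t\in[0,1)$. **Trefftz space.** $\mathbf T(\mathcal T_h)$ is the space of all $(w,\boldsymbol\tau)\in L^2(Q)^{1+n}$ such that, for each $K\in\mathcal T_h$: $\nabla w,\partial_t w,\nabla\cdot\boldsymbol\tau,\partial_t\boldsymbol\tau$ are square integrable in $K$, the trace of $\boldsymbol\tau$ on $\partial K$ exists and lies in $L^2(\partial K)^n$, and $\nabla w+\partial_t\boldsymbol\tau=0$, $\nabla\cdot\boldsymbol\tau+c^{-2}\partial_t w=0$ in $K$. (Here the trace of $\boldsymbol\tau$ is its boundary value almost everywhere on $\partial K$, as a limit of means over small half balls in $K$, and it is required that the formulas of integration by parts for $\nabla\cdot\boldsymbol\tau$ and $\partial_t\boldsymbol\tau$ hold with these boundary values.) **Method.** Let $\alpha\in L^\infty(\mathcal F^{\rm time}\cup\mathcal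 F^D)$, $\beta\in L^\infty(\mathcal F^{\rm time}\cup\mathcal F^N)$ and $\delta\in L^\infty(\mathcal F^R)$ be uniformly positive with $\|\delta\|_{L^\infty(\mathcal F^R)}<1$, and let $$\begin{aligned} \mathcal A(v,\boldsymbol\sigma;w,\boldsymbol\tau)=&\int_{\mathcal F^{\rm space}}\big(c^{-2}v^-[\![w]\!]_t+\boldsymbol\sigma^-\cdot[\![\boldsymbol\tau]\!]_t+v^-[\![\boldsymbol\tau]\!]_N+\boldsymbol\sigma^-\cdot[\![w]\!]_N\big)dS+\int_{\mathcal F^T}(c^{-2}vw+\boldsymbol\sigma\cdot\boldsymbol\tau)\,d\mathbf x\\ &+\int_{\mathcal F^{\rm time}}\big(\{\!\!\{v\}\!\!\}[\![\boldsymbol\tau]\!]_N+\{\!\!\{\boldsymbol\sigma\}\!\!\}\cdot[\![w]\!]_N+\alpha[\![v]\!]_N\cdot[\![w]\!]_N+\beta[\![\boldsymbol\sigma]\!]_N[\![\boldsymbol\tau]\!]_N\big)dS\\ &+\int_{\mathcal F^D}(\boldsymbol\sigma\cdot\mathbf n_\Omega^x\,w+\alpha vw)\,dS+\int_{\mathcal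 F^N}\big(v\,\boldsymbol\tau\cdot\mathbf n_\Omega^x+\beta(\boldsymbol\sigma\cdot\mathbf n_\Omega^x)(\boldsymbol\tau\cdot\mathbf n_\Omega^x)\big)dS\\ &+\int_{\mathcal F^R}\Big(\tfrac{(1-\delta)\vartheta}{c}vw+(1-\delta)v\,\boldsymbol\tau\cdot\mathbf n_\Omega^x+\delta\,\boldsymbol\sigma\cdot\mathbf n_\Omega^x\,w+\tfrac{\delta c}{\vartheta}(\boldsymbol\sigma\cdot\mathbf n_\Omega^x)(\boldsymbol\tau\cdot\mathbf n_\Omega^x)\Big)dS,\\ \ell(w,\boldsymbol\tau)=&\int_{\mathcal F^0}(c^{-2}v_0w+\boldsymbol\sigma_0\cdot\boldsymbol\tau)\,d\mathbf x+\int_{\mathcal F^D}g_D(\alpha w-\boldsymbol\tau\cdot\mathbf n_\Omega^x)\,dS+\int_{\mathcal F^N}g_N(\beta\,\boldsymbol\tau\cdot\mathbf n_\Omega^x-w)\,dS\\ &+\int_{\mathcal F^R}g_R\big((1-\delta)w-\tfrac{\delta c}{\vartheta}\boldsymbol\tau\cdot\mathbf n_\Omega^x\big)dS. \end{aligned}$$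 **Norms.** All norms on the right are $L^2$ norms on the indicated sets: $$\begin{aligned} |||(w,\boldsymbol\tau)|||_{DG}^2=&\tfrac12\big\|(\tfrac{1-\gamma}{n_F^t})^{1/2}c^{-1}[\![w]\!]_t\big\|^2_{\mathcal F^{\rm space}}+\tfrac12\big\|(\tfrac{1-\gamma}{n_F^t})^{1/2}[\![\boldsymbol\tau]\!]_t\big\|^2_{\mathcal F^{\rm space}}+\tfrac12\|c^{-1}w\|^2_{\mathcal F^0\cup\mathcal F^T}+\tfrac12\|\boldsymbol\tau\|^2_{\mathcal F^0\cup\mathcal F^T}\\ &+\|\alpha^{1/2}[\![w]\!]_N\|^2_{\mathcal F^{\rm time}}+\|\beta^{1/2}[\![\boldsymbol\tau]\!]_N\|^2_{\mathcal F^{\rm time}}+\|\alpha^{1/2}w\|^2_{\mathcal F^D}+\|\beta^{1/2}\boldsymbol\tau\cdot\mathbf n_\Omega^x\|^2_{\mathcal F^N}\\ &+\big\|(\tfrac{(1-\delta)\vartheta}{c})^{1/2}w\big\|^2_{\mathcal F^R}+\big\|(\tfrac{\delta c}{\vartheta})^{1/2}\boldsymbol\tau\cdot\mathbf n_\Omega^x\big\|^2_{\mathcal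 F^R},\\ |||(w,\boldsymbol\tau)|||_{DG^+}^2=&|||(w,\boldsymbol\tau)|||_{DG}^2+2\big\|(\tfrac{n_F^t}{1-\gamma})^{1/2}c^{-1}w^-\big\|^2_{\mathcal F^{\rm space}}+2\big\|(\tfrac{n_F^t}{1-\gamma})^{1/2}\boldsymbol\tau^-\big\|^2_{\mathcal F^{\rm space}}\\ &+\|\beta^{-1/2}\{\!\!\{w\}\!\!\}\|^2_{\mathcal F^{\rm time}}+\|\alpha^{-1/2}\{\!\!\{\boldsymbol\tau\}\!\!\}\|^2_{\mathcal F^{\rm time}}+\|\alpha^{-1/2}\boldsymbol\tau\cdot\mathbf n_\Omega^x\|^2_{\mathcal F^D}+\|\beta^{-1/2}w\|^2_{\mathcal F^N}. \end{aligned}$$ Let $C_c=2$ if $\mathcal F^R$ is empty (or of surface measure zero), and otherwise $$C_c=2\max\Big\{\big\|\tfrac{1-\delta}{\delta}\big\|^{1/2}_{L^\infty(\mathcal F^R)},\big\|\tfrac{\delta}{1-\delta}\big\|^{1/2}_{L^\infty(\mathcal F^R)}\Big\}.$$ **Theorem.** Let $\mathbf V_p(\mathcal T_h)\subset\mathbf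 T(\mathcal T_h)$ be any finite-dimensional linear subspace. There is exactly one $(v_{hp},\boldsymbol\sigma_{hp})\in\mathbf V_p(\mathcal T_h)$ with $$\mathcal A(v_{hp},\boldsymbol\sigma_{hp};w,\boldsymbol\tau)=\ell(w,\boldsymbol\tau)\qquad\forall(w,\boldsymbol\tau)\in\mathbf V_p(\mathcal T_h).$$ If $(v,\boldsymbol\sigma)\in\mathbf T(\mathcal T_h)$ solves (1), then $$|||(v-v_{hp},\boldsymbol\sigma-\boldsymbol\sigma_{hp})|||_{DG}\le(1+C_c)\inf_{(w,\boldsymbol\tau)\in\mathbf V_p(\mathcal T_h)}|||(v-w,\boldsymbol\sigma-\boldsymbol\tau)|||_{DG^+}.$$ Moreover, if $g_D=0$ and $g_N=0$ (in particular if the corresponding parts of the boundary are empty), then $$|||(v_{hp},\boldsymbol\sigma_{hp})|||_{DG}\le\Big(2\|c^{-1}v_0\|^2_{L^2(\mathcal F^0)}+2\|\boldsymbol\sigma_0\|^2_{L^2(\mathcal F^0)}+\|(c/\vartheta)^{1/2}g_R\|^2_{L^2(\mathcal F^R)}\Big)^{1/2}.$$ -/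

import Mathlib

open MeasureTheory Filter Topology
open scoped ContDiff RealInnerProductSpace

noncomputable section

namespace TrefftzDG

/-! ### Space, time, surface measure -/

/-- The space `ℝⁿ`. -/
abbrev Space (n : ℕ) := EuclideanSpace ℝ (Fin n)

/-- Space-time `ℝⁿ × ℝ = ℝⁿ⁺¹` with the Euclidean norm; a point is `z = (x, t)` with
`x = z.fst` and `t = z.snd`. -/
abbrev SpaceTime (n : ℕ) := WithLp 2 (Space n × ℝ)

/-- The `n`-dimensional surface measure `dS` in `ℝⁿ⁺¹`: the `n`-dimensional Hausdorff measure,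
normalised so that it agrees with Lebesgue measure on hyperplanes. -/
def surf (n : ℕ) : Measure (SpaceTime n) := Measure.euclideanHausdorffMeasure n

/-! ### Lipschitz polytopes and their outward normals -/

section Geometry

variable {E : Type*} [NormedAddCommGroup E] [InnerProductSpace ℝ E]

/-- A (nonempty, open, bounded, not necessarily convex) Lipschitz polytope: the boundary is covered
by finitely many hyperplanes, and near each boundary point the set is, in a suitable direction `e`,
the strict subgraph of a Lipschitz function of the coordinates orthogonal to `e`. -/
structure IsLipschitzPolytope (K : Set E) : Prop where
  nonempty : K.Nonempty
  isOpen : IsOpen K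
  isBounded : Bornology.IsBounded K
  flat : ∃ H : Finset (E × ℝ), (∀ h ∈ H, h.1 ≠ 0) ∧
    frontier K ⊆ ⋃ h ∈ H, {y | ⟪h.1, y⟫ = h.2}
  lipschitz : ∀ x ∈ frontier K, ∃ e : E, ‖e‖ = 1 ∧ ∃ (r : ℝ) (L : NNReal) (f : E → ℝ),
    0 < r ∧ LipschitzWith L f ∧ ∀ y ∈ Metric.ball x r, y ∈ K ↔ ⟪e, y⟫ < f (y - ⟪e, y⟫ • e)

/-- `ν` is the outward unit normal of `K` at the point `z` of a flat piece of its boundary: near `z`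
the set `K` is the open half space `{y | ⟪y - z, ν⟫ < 0}`. (For a Lipschitz polytope such a `ν`
exists at almost every boundary point; it is unique where it exists.) -/
def IsOuterNormal (K : Set E) (z ν : E) : Prop :=
  ‖ν‖ = 1 ∧ ∃ r : ℝ, 0 < r ∧ ∀ y ∈ Metric.ball z r, y ∈ K ↔ ⟪y - z, ν⟫ < 0

open Classical in
/-- The outward unit normal `n_K` (with value `0` where there is none). -/
def outerNormal (K : Set E) (z : E) : E :=
  if h : ∃ ν, IsOuterNormal K z ν then h.choose else 0

end Geometry

/-! ### One-sided boundary values -/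

section Traces

variable {n : ℕ} {F : Type*} [NormedAddCommGroup F] [NormedSpace ℝ F]

/-- Mean value of `u` over the half ball of centre `z`, radius `r`, on the side opposite to `ν`. -/
def halfBallMean (u : SpaceTime n → F) (z ν : SpaceTime n) (r : ℝ) : F :=
  ⨍ y in Metric.ball z r ∩ {y | ⟪y - z, ν⟫ < 0}, u y

/-- `a` is the boundary value of `u` at `z`, taken from the side opposite to `ν`. -/
def HasBoundaryValue (u : SpaceTime n → F) (z ν : SpaceTime n) (a : F) : Prop :=
  Tendsto (halfBallMean u z ν) (𝓝[>] 0) (𝓝 a)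

/-- The boundary value of `u` at `z`, taken from the side opposite to `ν`. With `ν = n_K(z)`,
`z ∈ ∂K`, it is the value at `z` of the trace on `∂K` of the restriction of `u` to `K`. -/
def tr (u : SpaceTime n → F) (z ν : SpaceTime n) : F :=
  limUnder (𝓝[>] (0 : ℝ)) (halfBallMean u z ν)

/-- `w ∈ H¹(K)` with (weak) space-time gradient `G` and trace `g ∈ L²(∂K)` on `∂K`: `w` is a limit
in `H¹(K)` of functions that are smooth up to the boundary and whose boundary values converge to
`g` in `L²(∂K)`. -/
def IsSobolevWithTrace (K : Set (SpaceTime n)) (w : SpaceTime n → ℝ)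
    (G : SpaceTime n → SpaceTime n) (g : SpaceTime n → ℝ) : Prop :=
  MemLp w 2 (volume.restrict K) ∧ MemLp G 2 (volume.restrict K) ∧
  MemLp g 2 ((surf n).restrict (frontier K)) ∧
  ∃ φ : ℕ → SpaceTime n → ℝ, (∀ k, ContDiff ℝ ∞ (φ k)) ∧
    Tendsto (fun k => eLpNorm (φ k - w) 2 (volume.restrict K)) atTop (𝓝 0) ∧
    Tendsto (fun k => eLpNorm (gradient (φ k) - G) 2 (volume.restrict K)) atTop (𝓝 0) ∧
    Tendsto (fun k => eLpNorm (φ k - g) 2 ((surf n).restrict (frontier K))) atTop (𝓝 0)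

/-- `τ ∈ L²(K)ⁿ` has weak space divergence `d ∈ L²(K)`, and `g ∈ L²(∂K)ⁿ` represents the normal
trace `τ·nˣ` on `∂K`: Green's formula holds for all smooth test functions. (Test functions
supported in `K` say that `d` is the weak divergence.) -/
def HasSpaceDivWithTrace (K : Set (SpaceTime n)) (τ : SpaceTime n → Space n)
    (d : SpaceTime n → ℝ) (g : SpaceTime n → Space n) : Prop :=
  MemLp τ 2 (volume.restrict K) ∧ MemLp d 2 (volume.restrict K) ∧
  MemLp g 2 ((surf n).restrict (frontier K)) ∧
  ∀ φ : SpaceTime n → ℝ, ContDiff ℝ ∞ φ →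
    ∫ z in K, (⟪τ z, (gradient φ z).fst⟫ + d z * φ z) =
      ∫ z in frontier K, ⟪g z, (outerNormal K z).fst⟫ * φ z ∂(surf n)

/-- `τ ∈ L²(K)ⁿ` has weak time derivative `τ' ∈ L²(K)ⁿ`, and `g ∈ L²(∂K)ⁿ` represents the trace
`τ nᵗ` on `∂K`: integration by parts in time holds for all smooth test functions. (Test functions
supported in `K` say that `τ'` is the weak time derivative.) -/
def HasTimeDerivWithTrace (K : Set (SpaceTime n)) (τ τ' : SpaceTime n → Space n)
    (g : SpaceTime n → Space n) : Prop :=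
  MemLp τ 2 (volume.restrict K) ∧ MemLp τ' 2 (volume.restrict K) ∧
  MemLp g 2 ((surf n).restrict (frontier K)) ∧
  ∀ φ : SpaceTime n → ℝ, ContDiff ℝ ∞ φ →
    ∫ z in K, ((gradient φ z).snd • τ z + φ z • τ' z) =
      ∫ z in frontier K, (φ z * (outerNormal K z).snd) • g z ∂(surf n)

end Traces

/-! ### The initial boundary value problem -/

/-- The space-time cylinder over `A`, with times in `I`. -/
def cylinder {n : ℕ} (A : Set (Space n)) (I : Set ℝ) : Set (SpaceTime n) :=
  {z | z.fst ∈ A ∧ z.snd ∈ I}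

/-- Geometry, coefficients and data of the acoustic wave problem on `Q = Ω × (0,T)`. -/
structure AcousticProblem (n : ℕ) where
  Ω : Set (Space n)
  polytope : IsLipschitzPolytope Ω
  T : ℝ
  T_pos : 0 < T
  /-- wave speed, independent of time -/
  c : Space n → ℝ
  c_lower : ∃ c₀ : ℝ, 0 < c₀ ∧ ∀ x ∈ Ω, c₀ ≤ c x
  /-- Dirichlet, Neumann and Robin parts of the boundary; some may be empty -/
  ΓD : Set (Space n)
  ΓN : Set (Space n)
  ΓR : Set (Space n)
  measurable_D : MeasurableSet ΓD
  measurable_N : MeasurableSet ΓN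
  measurable_R : MeasurableSet ΓR
  cover : ΓD ∪ ΓN ∪ ΓR = frontier Ω
  overlap_DN : surf n (cylinder (ΓD ∩ ΓN) (Set.Icc 0 T)) = 0
  overlap_DR : surf n (cylinder (ΓD ∩ ΓR) (Set.Icc 0 T)) = 0
  overlap_NR : surf n (cylinder (ΓN ∩ ΓR) (Set.Icc 0 T)) = 0
  /-- impedance parameter -/
  θ : SpaceTime n → ℝ
  θ_bounded : MemLp θ ⊤ ((surf n).restrict (cylinder ΓR (Set.Icc 0 T)))
  θ_pos : ∃ a : ℝ, 0 < a ∧ ∀ᵐ z ∂(surf n).restrict (cylinder ΓR (Set.Icc 0 T)), a ≤ θ z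
  /-- initial data -/
  v₀ : Space n → ℝ
  σ₀ : Space n → Space n
  memLp_v₀ : MemLp v₀ 2 (volume.restrict Ω)
  memLp_σ₀ : MemLp σ₀ 2 (volume.restrict Ω)
  /-- boundary data -/
  gD : SpaceTime n → ℝ
  gN : SpaceTime n → ℝ
  gR : SpaceTime n → ℝ
  memLp_gD : MemLp gD 2 ((surf n).restrict (cylinder ΓD (Set.Icc 0 T)))
  memLp_gN : MemLp gN 2 ((surf n).restrict (cylinder ΓN (Set.Icc 0 T)))
  memLp_gR : MemLp gR 2 ((surf n).restrict (cylinder ΓR (Set.Icc 0 T)))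

namespace AcousticProblem

variable {n : ℕ} (P : AcousticProblem n)

/-- `Q = Ω × (0,T)` -/
def Q : Set (SpaceTime n) := cylinder P.Ω (Set.Ioo 0 P.T)

/-- `F⁰ = Ω × {0}` -/
def F0 : Set (SpaceTime n) := cylinder P.Ω {0}

/-- `Fᵀ = Ω × {T}` -/
def FT : Set (SpaceTime n) := cylinder P.Ω {P.T}

/-- `Fᴰ = Γ_D × [0,T]` -/
def FD : Set (SpaceTime n) := cylinder P.ΓD (Set.Icc 0 P.T)

/-- `Fᴺ = Γ_N × [0,T]` -/
def FN : Set (SpaceTime n) := cylinder P.ΓN (Set.Icc 0 P.T)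

/-- `Fᴿ = Γ_R × [0,T]` -/
def FR : Set (SpaceTime n) := cylinder P.ΓR (Set.Icc 0 P.T)

/-- The unit vector in the direction of future time. -/
def eT (n : ℕ) : SpaceTime n := WithLp.toLp 2 (0, 1)

/-- The outward unit normal `n_Ω^x` on `∂Ω × [0,T]`. -/
def nΩ (z : SpaceTime n) : Space n := outerNormal P.Ω z.fst

/-- The same normal as a space-time vector, `(n_Ω^x, 0)`. -/
def nΩT (z : SpaceTime n) : SpaceTime n := WithLp.toLp 2 (P.nΩ z, 0)

/-- Trace on `Fᴰ ∪ Fᴺ ∪ Fᴿ` of a function on `Q`. -/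
def lat {F : Type*} [NormedAddCommGroup F] [NormedSpace ℝ F] (u : SpaceTime n → F)
    (z : SpaceTime n) : F := tr u z (P.nΩT z)

/-- Normal trace `τ·n_Ω^x` on `Fᴰ ∪ Fᴺ ∪ Fᴿ`. -/
def latN (τ : SpaceTime n → Space n) (z : SpaceTime n) : ℝ := ⟪P.lat τ z, P.nΩ z⟫

/-- The boundary value of the wave speed on `∂Ω × [0,T]`. -/
def cB (z : SpaceTime n) : ℝ := P.lat (fun y : SpaceTime n => P.c y.fst) z

/-- The space `L²(Q)^{1+n}` of fields `(w, τ)`. -/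
abbrev Field : Type :=
  Lp ℝ 2 (volume.restrict P.Q) × Lp (Space n) 2 (volume.restrict P.Q)

/-- `(v, σ) ∈ L²(Q)^{1+n}` solves the initial boundary value problem: the two equations hold in the
sense of distributions in `Q`, the initial and boundary conditions hold for the boundary values,
almost everywhere. -/
structure IsSolution (u : P.Field) : Prop where
  momentum : ∀ φ : SpaceTime n → ℝ, ContDiff ℝ ∞ φ → HasCompactSupport φ → tsupport φ ⊆ P.Q →
    ∫ z in P.Q, (u.1 z • (gradient φ z).fst + (gradient φ z).snd • u.2 z) = 0
  mass : ∀ φ : SpaceTime n → ℝ, ContDiff ℝ ∞ φ → HasCompactSupport φ → tsupport φ ⊆ P.Q →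
    ∫ z in P.Q, (⟪u.2 z, (gradient φ z).fst⟫
      + (P.c z.fst ^ 2)⁻¹ * u.1 z * (gradient φ z).snd) = 0
  initial : ∀ᵐ z ∂(surf n).restrict P.F0,
    tr u.1 z (-eT n) = P.v₀ z.fst ∧ tr u.2 z (-eT n) = P.σ₀ z.fst
  dirichlet : ∀ᵐ z ∂(surf n).restrict P.FD, P.lat u.1 z = P.gD z
  neumann : ∀ᵐ z ∂(surf n).restrict P.FN, P.latN u.2 z = P.gN z
  robin : ∀ᵐ z ∂(surf n).restrict P.FR,
    P.θ z / P.cB z * P.lat u.1 z - P.latN u.2 z = P.gR z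

end AcousticProblem

/-! ### Meshes -/

section Interfaces

variable {n : ℕ}

/-- `z` lies on a flat piece of the internal face `∂K₁ ∩ ∂K₂` of two different elements, and `ν`
is there the unit normal that points from `K₁` to `K₂`. -/
def IsInterface (elems : Finset (Set (SpaceTime n))) (z ν : SpaceTime n) : Prop :=
  ∃ K₁ ∈ elems, ∃ K₂ ∈ elems, K₁ ≠ K₂ ∧ IsOuterNormal K₁ z ν ∧ IsOuterNormal K₂ z (-ν)

end Interfaces

/-- A finite mesh of `Q` by Lipschitz polytopes, on each of which the wave speed is constant, all of
whose internal faces are space-like, `c |nˣ| < |nᵗ|`, or time-like, `nᵗ = 0`. -/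
structure Mesh {n : ℕ} (P : AcousticProblem n) where
  elems : Finset (Set (SpaceTime n))
  polytope : ∀ K ∈ elems, IsLipschitzPolytope K
  subset : ∀ K ∈ elems, K ⊆ P.Q
  disjoint : ∀ K₁ ∈ elems, ∀ K₂ ∈ elems, K₁ ≠ K₂ → Disjoint K₁ K₂
  cover : P.Q ⊆ ⋃ K ∈ elems, closure K
  speed_const : ∀ K ∈ elems, ∃ k : ℝ, ∀ z ∈ K, P.c z.fst = k
  faces : ∀ z ν, IsInterface elems z ν → P.c z.fst * ‖ν.fst‖ < |ν.snd| ∨ ν.snd = 0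

namespace Mesh

variable {n : ℕ} {P : AcousticProblem n} (M : Mesh P)

/-- The union of the internal space-like faces. -/
def Fspace : Set (SpaceTime n) :=
  {z | ∃ ν, IsInterface M.elems z ν ∧ P.c z.fst * ‖ν.fst‖ < |ν.snd|}

/-- The union of the internal time-like faces. -/
def Ftime : Set (SpaceTime n) :=
  {z | ∃ ν, IsInterface M.elems z ν ∧ ν.snd = 0}

open Classical in
/-- The unit normal `n_F` of the internal faces, future-pointing on space-like faces; on time-like
faces one of the two orientations (nothing below depends on which). -/
def nF (z : SpaceTime n) : SpaceTime n :=
  if h : ∃ ν, IsInterface M.elems z ν ∧ 0 ≤ ν.snd then h.choose else 0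

/-- `γ = c |n_F^x| / n_F^t` on space-like faces. -/
def γ (z : SpaceTime n) : ℝ := P.c z.fst * ‖(M.nF z).fst‖ / (M.nF z).snd

section Jumps

variable {F : Type*} [NormedAddCommGroup F] [NormedSpace ℝ F]

/-- `u⁻`, the trace from the element from which `n_F` points away; on space-like faces the trace from
the element at lower times. -/
def lower (u : SpaceTime n → F) (z : SpaceTime n) : F := tr u z (M.nF z)

/-- `u⁺`, the trace from the other element. -/
def upper (u : SpaceTime n → F) (z : SpaceTime n) : F := tr u z (-M.nF z)

/-- average `{{u}}` -/
def avg (u : SpaceTime n → F) (z : SpaceTime n) : F := (2 : ℝ)⁻¹ • (M.lower u z + M.upper u z)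

/-- time jump `[[u]]_t` -/
def jumpT (u : SpaceTime n → F) (z : SpaceTime n) : F :=
  (M.nF z).snd • M.lower u z + (-M.nF z).snd • M.upper u z

end Jumps

/-- space normal jump `[[w]]_N` of a scalar field, a vector -/
def jumpN (w : SpaceTime n → ℝ) (z : SpaceTime n) : Space n :=
  M.lower w z • (M.nF z).fst + M.upper w z • (-M.nF z).fst

/-- space normal jump `[[τ]]_N` of a vector field, a scalar -/
def jumpNv (τ : SpaceTime n → Space n) (z : SpaceTime n) : ℝ :=
  ⟪M.lower τ z, (M.nF z).fst⟫ + ⟪M.upper τ z, (-M.nF z).fst⟫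

/-- The Trefftz space `T(T_h)`: for every element `K`, the field has a trace on `∂K` in
`L²(∂K)^{1+n}`, first derivatives `∇w`, `∂w/∂t`, `∇·τ`, `∂τ/∂t` in `L²(K)`, and satisfies
`∇w + ∂τ/∂t = 0`, `∇·τ + c⁻² ∂w/∂t = 0` in `K`. -/
def IsTrefftz (u : P.Field) : Prop :=
  ∀ K ∈ M.elems, ∃ (gw : SpaceTime n → ℝ) (gτ : SpaceTime n → Space n)
      (G : SpaceTime n → SpaceTime n) (d : SpaceTime n → ℝ) (τ' : SpaceTime n → Space n),
    (∀ᵐ z ∂(surf n).restrict (frontier K),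
      HasBoundaryValue u.1 z (outerNormal K z) (gw z) ∧
      HasBoundaryValue u.2 z (outerNormal K z) (gτ z)) ∧
    IsSobolevWithTrace K u.1 G gw ∧
    HasSpaceDivWithTrace K u.2 d gτ ∧
    HasTimeDerivWithTrace K u.2 τ' gτ ∧
    (∀ᵐ z ∂volume.restrict K,
      (G z).fst + τ' z = 0 ∧ d z + (P.c z.fst ^ 2)⁻¹ * (G z).snd = 0)

end Mesh

/-- Numerical flux parameters: essentially bounded and uniformly positive, with `‖δ‖_∞ < 1`. -/
structure FluxParams {n : ℕ} {P : AcousticProblem n} (M : Mesh P) where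
  α : SpaceTime n → ℝ
  β : SpaceTime n → ℝ
  δ : SpaceTime n → ℝ
  α_bounded : MemLp α ⊤ ((surf n).restrict (M.Ftime ∪ P.FD))
  β_bounded : MemLp β ⊤ ((surf n).restrict (M.Ftime ∪ P.FN))
  δ_bounded : MemLp δ ⊤ ((surf n).restrict P.FR)
  α_pos : ∃ a : ℝ, 0 < a ∧ ∀ᵐ z ∂(surf n).restrict (M.Ftime ∪ P.FD), a ≤ α z
  β_pos : ∃ a : ℝ, 0 < a ∧ ∀ᵐ z ∂(surf n).restrict (M.Ftime ∪ P.FN), a ≤ β z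
  δ_pos : ∃ a : ℝ, 0 < a ∧ ∀ᵐ z ∂(surf n).restrict P.FR, a ≤ δ z
  δ_lt_one : eLpNorm δ ⊤ ((surf n).restrict P.FR) < 1

namespace FluxParams

open AcousticProblem

variable {n : ℕ} {P : AcousticProblem n} {M : Mesh P} (p : FluxParams M)

/-- The bilinear form `A(v, σ; w, τ)` of the Trefftz-DG method. -/
def A (s t : P.Field) : ℝ :=
  let v : SpaceTime n → ℝ := s.1
  let σ : SpaceTime n → Space n := s.2
  let w : SpaceTime n → ℝ := t.1
  let τ : SpaceTime n → Space n := t.2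
  (∫ z in M.Fspace, ((P.c z.fst ^ 2)⁻¹ * M.lower v z * M.jumpT w z
      + ⟪M.lower σ z, M.jumpT τ z⟫ + M.lower v z * M.jumpNv τ z
      + ⟪M.lower σ z, M.jumpN w z⟫) ∂(surf n))
  + (∫ z in P.FT, ((P.c z.fst ^ 2)⁻¹ * tr v z (eT n) * tr w z (eT n)
      + ⟪tr σ z (eT n), tr τ z (eT n)⟫) ∂(surf n))
  + (∫ z in M.Ftime, (M.avg v z * M.jumpNv τ z + ⟪M.avg σ z, M.jumpN w z⟫
      + p.α z * ⟪M.jumpN v z, M.jumpN w z⟫ + p.β z * M.jumpNv σ z * M.jumpNv τ z) ∂(surf n))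
  + (∫ z in P.FD, (P.latN σ z * P.lat w z + p.α z * P.lat v z * P.lat w z) ∂(surf n))
  + (∫ z in P.FN, (P.lat v z * P.latN τ z + p.β z * P.latN σ z * P.latN τ z) ∂(surf n))
  + (∫ z in P.FR, ((1 - p.δ z) * P.θ z / P.cB z * P.lat v z * P.lat w z
      + (1 - p.δ z) * P.lat v z * P.latN τ z
      + p.δ z * P.latN σ z * P.lat w z
      + p.δ z * P.cB z / P.θ z * P.latN σ z * P.latN τ z) ∂(surf n))

/-- The linear functional `ℓ(w, τ)` of the Trefftz-DG method. -/
def ell (t : P.Field) : ℝ :=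
  let w : SpaceTime n → ℝ := t.1
  let τ : SpaceTime n → Space n := t.2
  (∫ z in P.F0, ((P.c z.fst ^ 2)⁻¹ * P.v₀ z.fst * tr w z (-eT n)
      + ⟪P.σ₀ z.fst, tr τ z (-eT n)⟫) ∂(surf n))
  + (∫ z in P.FD, P.gD z * (p.α z * P.lat w z - P.latN τ z) ∂(surf n))
  + (∫ z in P.FN, P.gN z * (p.β z * P.latN τ z - P.lat w z) ∂(surf n))
  + (∫ z in P.FR, P.gR z * ((1 - p.δ z) * P.lat w z
      - p.δ z * P.cB z / P.θ z * P.latN τ z) ∂(surf n))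

/-- The square of the DG norm. -/
def normDGsq (t : P.Field) : ℝ :=
  let w : SpaceTime n → ℝ := t.1
  let τ : SpaceTime n → Space n := t.2
  (1 / 2) * (∫ z in M.Fspace,
      (1 - M.γ z) / (M.nF z).snd * ((P.c z.fst)⁻¹ * M.jumpT w z) ^ 2 ∂(surf n))
  + (1 / 2) * (∫ z in M.Fspace, (1 - M.γ z) / (M.nF z).snd * ‖M.jumpT τ z‖ ^ 2 ∂(surf n))
  + (1 / 2) * ((∫ z in P.F0, ((P.c z.fst)⁻¹ * tr w z (-eT n)) ^ 2 ∂(surf n))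
      + ∫ z in P.FT, ((P.c z.fst)⁻¹ * tr w z (eT n)) ^ 2 ∂(surf n))
  + (1 / 2) * ((∫ z in P.F0, ‖tr τ z (-eT n)‖ ^ 2 ∂(surf n))
      + ∫ z in P.FT, ‖tr τ z (eT n)‖ ^ 2 ∂(surf n))
  + (∫ z in M.Ftime, p.α z * ‖M.jumpN w z‖ ^ 2 ∂(surf n))
  + (∫ z in M.Ftime, p.β z * M.jumpNv τ z ^ 2 ∂(surf n))
  + (∫ z in P.FD, p.α z * P.lat w z ^ 2 ∂(surf n))
  + (∫ z in P.FN, p.β z * P.latN τ z ^ 2 ∂(surf n))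
  + (∫ z in P.FR, (1 - p.δ z) * P.θ z / P.cB z * P.lat w z ^ 2 ∂(surf n))
  + (∫ z in P.FR, p.δ z * P.cB z / P.θ z * P.latN τ z ^ 2 ∂(surf n))

/-- The DG norm. -/
def normDG (t : P.Field) : ℝ := √(p.normDGsq t)

/-- The DG⁺ norm. -/
def normDGplus (t : P.Field) : ℝ :=
  let w : SpaceTime n → ℝ := t.1
  let τ : SpaceTime n → Space n := t.2
  √(p.normDGsq t
    + 2 * (∫ z in M.Fspace,
        (M.nF z).snd / (1 - M.γ z) * ((P.c z.fst)⁻¹ * M.lower w z) ^ 2 ∂(surf n))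
    + 2 * (∫ z in M.Fspace, (M.nF z).snd / (1 - M.γ z) * ‖M.lower τ z‖ ^ 2 ∂(surf n))
    + (∫ z in M.Ftime, (p.β z)⁻¹ * M.avg w z ^ 2 ∂(surf n))
    + (∫ z in M.Ftime, (p.α z)⁻¹ * ‖M.avg τ z‖ ^ 2 ∂(surf n))
    + (∫ z in P.FD, (p.α z)⁻¹ * P.latN τ z ^ 2 ∂(surf n))
    + (∫ z in P.FN, (p.β z)⁻¹ * P.lat w z ^ 2 ∂(surf n)))

open Classical in
/-- The continuity constant `C_c`; a Robin part of surface measure zero counts as empty. -/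
def Cc : ℝ :=
  if surf n P.FR = 0 then 2
  else 2 * max
    (√(eLpNorm (fun z => (1 - p.δ z) / p.δ z) ⊤ ((surf n).restrict P.FR)).toReal)
    (√(eLpNorm (fun z => p.δ z / (1 - p.δ z)) ⊤ ((surf n).restrict P.FR)).toReal)

/-- `u` solves the Trefftz-DG variational problem in the discrete space `V`. -/
def IsDiscreteSolution (V : Submodule ℝ P.Field) (u : P.Field) : Prop :=
  u ∈ V ∧ ∀ t ∈ V, p.A u t = p.ell t

end FluxParams

end TrefftzDG

end

/-! The argument is the energy method, and one identity carries it. If `(v, σ)` and `(w, τ)` are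
Trefftz fields on an element `K` and `b` is a smooth weight, the flux `b (v τ·nˣ + w σ·nˣ + nᵗ (c⁻²
v w + σ·τ))` integrated over `∂K` equals an integral over `K` in which only derivatives of `b`
occur, all other terms cancelling by the two equations (`IsTrefftzOn.energy`). Summed over the
elements, the left side becomes an integral over the faces.

This identity is used three times. With `b = 1` and both fields equal to `u`, half of the flux can
be subtracted from `A(u; u)` at no cost; what remains dominates the density of the squared DG norm
pointwise, with equality except on space-like faces, where the inequality is Cauchy–Schwarz together
with `c|nˣ| < nᵗ`. Hence `A` is coercive (`normDGsq_le_A`). With `b = 1` and an exact solution in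
the first argument, the integrands of `A` and `ℓ` differ exactly by the flux, so the method is
consistent (`A_eq_ell_of_solution`). With `b = T - t`, a field of zero DG norm has no flux through
any face, while the volume term is minus its energy; so the field is zero
(`eq_zero_of_normDGsq_eq_zero`). Coercivity and definiteness make `A` injective from `V` to its
dual, and dimension counting gives existence and uniqueness.

Continuity is kept in the additive form `A(s; t) ≤ ½ (C_c² |||s|||²_{DG⁺} + |||t|||²_{DG})`, which
follows from pointwise Young inequalities. Inserting `t = u_hp - w` and `s = u - w`, the last term
is absorbed by coercivity, and the triangle inequality yields quasi-optimality. The stability bound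
is the same absorption applied to `ℓ`.

The analytic difficulty is the energy identity at low regularity: `τ` has only a space divergence, a
time derivative and a square integrable trace, and is not assumed to be a limit of smooth fields.
The mixed term is harmless, because `w` is such a limit and can be used as test function in Green's
formula for `τ`. The term `τ·∂τ/∂t` is treated on time lines. Over almost every `x`, a polytope is
cut into an open set with finitely many end points, and integration by parts against `a(x) tᵏ`
localises to that line; it shows that `τ` is there an absolutely continuous primitive with known
jumps, and the one-dimensional energy identity is elementary (`IsEndpointSystem.integral_two_mul`).
The same slicing, with a reflection, gives the divergence theorem on polytopes.

The geometric input is that all boundaries lie in finitely many hyperplanes, and that non-parallel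
hyperplanes meet in sets of surface measure zero. At almost every point of the skeleton the skeleton
is therefore flat, and an element boundary point is either on the boundary of `Q` with one adjacent
element or inside `Q` with exactly two (`Mesh.sum_integral_frontier`). -/

noncomputable section

namespace TrefftzDG

/-! ### Outward normals of polytopes -/

section Normals

variable {E : Type*} [NormedAddCommGroup E] [InnerProductSpace ℝ E]

/-- The open half ball of centre `z` and radius `r` on the side opposite to `ν`. -/
def halfBall (z ν : E) (r : ℝ) : Set E := Metric.ball z r ∩ {y | ⟪y - z, ν⟫ < 0}

theorem isOpen_halfBall (z ν : E) (r : ℝ) : IsOpen (halfBall z ν r) := by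
  refine Metric.isOpen_ball.inter (isOpen_lt ?_ continuous_const)
  fun_prop

theorem convex_halfBall (z ν : E) (r : ℝ) : Convex ℝ (halfBall z ν r) := by
  refine (convex_ball z r).inter ?_
  intro a ha b hb s t hs ht hst
  simp only [Set.mem_ofPred_eq, inner_sub_left, inner_add_left, real_inner_smul_left] at *
  rcases hs.eq_or_lt with rfl | hs
  · obtain rfl : t = 1 := by linarith
    linarith
  · have h1 : s * ⟪z, ν⟫ + t * ⟪z, ν⟫ = ⟪z, ν⟫ := by rw [← add_mul, hst, one_mul]
    nlinarith [mul_pos hs (sub_pos.2 ha), mul_nonneg ht (sub_nonneg.2 hb.le)]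

/-- A point of the flat side lies in the closure of the half ball. -/
theorem exists_mem_halfBall_of_isOpen {z ν y : E} {r : ℝ} (hν : ν ≠ 0) {U : Set E} (hU : IsOpen U)
    (hyU : y ∈ U) (hy : y ∈ Metric.ball z r) (hyν : ⟪y - z, ν⟫ ≤ 0) :
    (U ∩ halfBall z ν r).Nonempty := by
  have hc : Tendsto (fun s : ℝ => y - s • ν) (𝓝[>] 0) (𝓝 y) := by
    have : Continuous (fun s : ℝ => y - s • ν) := by fun_prop
    have h := (this.tendsto 0).mono_left (nhdsWithin_le_nhds (s := Set.Ioi 0))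
    simpa using h
  have h1 := hc.eventually ((hU.inter Metric.isOpen_ball).mem_nhds ⟨hyU, hy⟩)
  obtain ⟨s, ⟨hs1, hs2⟩, hs⟩ := (h1.and self_mem_nhdsWithin).exists
  refine ⟨y - s • ν, hs1, hs2, ?_⟩
  have : ⟪y - s • ν - z, ν⟫ = ⟪y - z, ν⟫ - s * ‖ν‖ ^ 2 := by
    simp only [inner_sub_left, real_inner_smul_left, real_inner_self_eq_norm_sq]
    ring
  have h3 : 0 < s * ‖ν‖ ^ 2 := mul_pos hs (by positivity)
  simp only [Set.mem_ofPred_eq, this]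
  linarith

theorem nonempty_halfBall {z ν : E} {r : ℝ} (hν : ν ≠ 0) (hr : 0 < r) :
    (halfBall z ν r).Nonempty := by
  obtain ⟨y, -, hy⟩ := exists_mem_halfBall_of_isOpen hν isOpen_univ (Set.mem_univ z)
    (Metric.mem_ball_self hr) (by simp)
  exact ⟨y, hy⟩

/-- A half ball that does not meet the frontier of a set is inside or outside of it. -/
theorem halfBall_subset_or_disjoint {K : Set E} {z ν : E} {r : ℝ}
    (h : Disjoint (halfBall z ν r) (frontier K)) :
    halfBall z ν r ⊆ K ∨ Disjoint (halfBall z ν r) K := by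
  by_contra hcon
  rw [not_or, Set.not_disjoint_iff_nonempty_inter, Set.not_subset] at hcon
  obtain ⟨⟨y, hy1, hy2⟩, h2⟩ := hcon
  -- Off the frontier these two disjoint open sets cover the half ball, which is connected because
  -- it is convex; it cannot meet both.
  have hsub : halfBall z ν r ⊆ interior K ∪ (closure K)ᶜ := fun x hx => by
    by_contra hcon
    rw [Set.mem_union, not_or, Set.mem_compl_iff, not_not] at hcon
    exact Set.disjoint_left.1 h hx ⟨hcon.2, hcon.1⟩
  obtain ⟨x, hx⟩ := h2
  obtain ⟨w, -, hw1, hw2⟩ := (convex_halfBall z ν r).isPreconnected _ _ isOpen_interior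
    isClosed_closure.isOpen_compl hsub
    ⟨x, hx.1, (hsub hx.1).resolve_right fun hc => hc (subset_closure hx.2)⟩
    ⟨y, hy1, (hsub hy1).resolve_left fun hc => hy2 (interior_subset hc)⟩
  exact hw2 (interior_subset_closure hw1)

/-- For distinct unit vectors `⟪ν, ν'⟫ < 1`, so a displacement along `ν' - ν` is negative against
`ν` and positive against `ν'`. The factor `s` places the test point at distance `r / 2`. -/
theorem eq_of_halfBall_subset {ν ν' z : E} (hν : ‖ν‖ = 1) (hν' : ‖ν'‖ = 1) {r : ℝ} (hr : 0 < r)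
    (h : ∀ y ∈ Metric.ball z r, ⟪y - z, ν⟫ < 0 → ⟪y - z, ν'⟫ < 0) : ν = ν' := by
  by_contra hne
  have hlt : ⟪ν, ν'⟫ < 1 := inner_lt_one_iff_real_of_norm_eq_one hν hν' |>.2 hne
  have hv : 0 < ‖ν' - ν‖ := norm_pos_iff.2 (sub_ne_zero.2 (Ne.symm hne))
  set s : ℝ := r / (2 * ‖ν' - ν‖) with hs
  have hs0 : 0 < s := by positivity
  have h1 := h (z + s • (ν' - ν)) (by
    rw [Metric.mem_ball, dist_eq_norm, add_sub_cancel_left, norm_smul, Real.norm_of_nonneg hs0.le,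
      hs]
    field_simp
    linarith)
  rw [add_sub_cancel_left, real_inner_smul_left, real_inner_smul_left, inner_sub_left,
    inner_sub_left, real_inner_self_eq_norm_sq, real_inner_self_eq_norm_sq, hν, hν',
    real_inner_comm ν ν'] at h1
  nlinarith [h1 (by nlinarith)]

namespace IsOuterNormal

variable {K : Set E} {z ν ν' : E}

theorem ne_zero (h : IsOuterNormal K z ν) : ν ≠ 0 := by
  rintro rfl
  simpa using h.1

theorem unique (h : IsOuterNormal K z ν) (h' : IsOuterNormal K z ν') : ν = ν' := by
  obtain ⟨hν, r, hr, hK⟩ := h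
  obtain ⟨hν', r', hr', hK'⟩ := h'
  refine eq_of_halfBall_subset (z := z) hν hν' (lt_min hr hr') fun y hy hlt => ?_
  have hy1 := Metric.ball_subset_ball (min_le_left r r') hy
  have hy2 := Metric.ball_subset_ball (min_le_right r r') hy
  exact (hK' y hy2).1 ((hK y hy1).2 hlt)

theorem outerNormal_eq (h : IsOuterNormal K z ν) : outerNormal K z = ν := by
  have hex : ∃ ν, IsOuterNormal K z ν := ⟨ν, h⟩
  rw [outerNormal, dif_pos hex]
  exact hex.choose_spec.unique h

theorem exists_halfBall_subset (h : IsOuterNormal K z ν) :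
    ∃ r, 0 < r ∧ halfBall z ν r ⊆ K := by
  obtain ⟨-, r, hr, hK⟩ := h
  exact ⟨r, hr, fun y hy => (hK y hy.1).2 hy.2⟩

theorem notMem (h : IsOuterNormal K z ν) : z ∉ K := by
  obtain ⟨-, r, hr, hK⟩ := h
  intro hz
  simpa using (hK z (Metric.mem_ball_self hr)).1 hz

theorem mem_closure (h : IsOuterNormal K z ν) : z ∈ closure K := by
  have h0 := h.ne_zero
  obtain ⟨-, r, hr, hK⟩ := h
  refine mem_closure_iff.2 fun U hU hz => ?_
  obtain ⟨y, hy1, hy2⟩ := exists_mem_halfBall_of_isOpen h0 hU hz (Metric.mem_ball_self hr) (by simp)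
  exact ⟨y, hy1, (hK y hy2.1).2 hy2.2⟩

theorem mem_frontier (h : IsOuterNormal K z ν) : z ∈ frontier K :=
  ⟨h.mem_closure, fun hz => h.notMem (interior_subset hz)⟩

end IsOuterNormal

theorem isOuterNormal_outerNormal {K : Set E} {z : E} (h : outerNormal K z ≠ 0) :
    IsOuterNormal K z (outerNormal K z) := by
  unfold outerNormal at h ⊢
  split_ifs with hex
  · exact hex.choose_spec
  · simp [hex] at h

theorem outerNormal_eq_zero_of_notMem_frontier {K : Set E} {z : E} (h : z ∉ frontier K) :
    outerNormal K z = 0 := by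
  by_contra hne
  exact h (isOuterNormal_outerNormal hne).mem_frontier

/-- Near a boundary point where the boundary is contained in a hyperplane, a Lipschitz polytope is
one of the two half balls. -/
theorem IsLipschitzPolytope.isOuterNormal_or {K : Set E} (hK : IsLipschitzPolytope K) {z ν : E}
    (hz : z ∈ frontier K) (hν : ‖ν‖ = 1) {r : ℝ} (hr : 0 < r)
    (h : ∀ y ∈ Metric.ball z r, y ∈ frontier K → ⟪y - z, ν⟫ = 0) :
    IsOuterNormal K z ν ∨ IsOuterNormal K z (-ν) := by
  have hν0 : ν ≠ 0 := by rintro rfl; simp at hν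
  have hd1 : Disjoint (halfBall z ν r) (frontier K) :=
    Set.disjoint_left.2 fun y hy hf => hy.2.ne (h y hy.1 hf)
  have hd2 : Disjoint (halfBall z (-ν) r) (frontier K) :=
    Set.disjoint_left.2 fun y hy hf => by
      have h1 := hy.2
      simp only [Set.mem_ofPred_eq, inner_neg_right, h y hy.1 hf] at h1
      simp at h1
  have hKo := hK.isOpen
  have hzK : z ∉ K := by
    have := hz.2
    rwa [hKo.interior_eq] at this
  obtain ⟨e, he, ρ, L, f, hρ, hf, hloc⟩ := hK.lipschitz z hz
  have hcont : Continuous fun y : E => ⟪e, y⟫ - f (y - ⟪e, y⟫ • e) := by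
    have := hf.continuous
    fun_prop
  -- This is the signed height above the Lipschitz graph. A translation along `e` leaves the
  -- orthogonal part alone, so the height grows at unit rate; the boundary point itself has height
  -- zero.
  have hshift : ∀ s : ℝ, ⟪e, z + s • e⟫ - f (z + s • e - ⟪e, z + s • e⟫ • e)
      = s + (⟪e, z⟫ - f (z - ⟪e, z⟫ • e)) := by
    intro s
    have h1 : ⟪e, z + s • e⟫ = ⟪e, z⟫ + s := by
      rw [inner_add_right, real_inner_smul_right, real_inner_self_eq_norm_sq, he]; ring
    have h2 : z + s • e - ⟪e, z + s • e⟫ • e = z - ⟪e, z⟫ • e := by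
      rw [h1, add_smul]; abel
    rw [h2, h1]; ring
  have hzero : ⟪e, z⟫ - f (z - ⟪e, z⟫ • e) = 0 := by
    apply le_antisymm
    · by_contra hgt
      push Not at hgt
      have hev : ∀ᶠ y in 𝓝 z, y ∉ K := by
        filter_upwards [hcont.continuousAt.eventually (lt_mem_nhds hgt),
          Metric.ball_mem_nhds z hρ] with y hy hyb hyK
        have := (hloc y hyb).1 hyK
        linarith
      obtain ⟨y, hy1, hy2⟩ := mem_closure_iff_nhds.1 hz.1 _ hev
      exact hy1 hy2
    · have := mt (hloc z (Metric.mem_ball_self hρ)).2 hzK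
      linarith
  have htend : Tendsto (fun s : ℝ => z + s • e) (𝓝 0) (𝓝 z) := by
    have : Continuous (fun s : ℝ => z + s • e) := by fun_prop
    simpa using this.tendsto 0
  have hnear : ∀ᶠ s in 𝓝 (0 : ℝ), z + s • e ∈ Metric.ball z r ∩ Metric.ball z ρ :=
    htend.eventually ((Metric.isOpen_ball.inter Metric.isOpen_ball).mem_nhds
      ⟨Metric.mem_ball_self hr, Metric.mem_ball_self hρ⟩)
  -- an open set that meets the ball meets one of the half balls
  have hmeet : ∀ U : Set E, IsOpen U → ∀ y ∈ U, y ∈ Metric.ball z r →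
      (U ∩ halfBall z ν r).Nonempty ∨ (U ∩ halfBall z (-ν) r).Nonempty := by
    intro U hU y hyU hyb
    rcases le_total ⟪y - z, ν⟫ 0 with hle | hle
    · exact Or.inl (exists_mem_halfBall_of_isOpen hν0 hU hyU hyb hle)
    · exact Or.inr (exists_mem_halfBall_of_isOpen (neg_ne_zero.2 hν0) hU hyU hyb
        (by rw [inner_neg_right]; linarith))
  have hin : ∃ y ∈ K, y ∈ Metric.ball z r := by
    have := hnear.filter_mono (nhdsWithin_le_nhds (s := Set.Iio 0))
    obtain ⟨s, ⟨hs1, hs2⟩, hs⟩ := (this.and self_mem_nhdsWithin).exists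
    refine ⟨_, (hloc _ hs2).2 ?_, hs1⟩
    have h1 := hshift s
    have h2 : s < 0 := hs
    linarith
  have hout : ∃ U : Set E, IsOpen U ∧ Disjoint U K ∧ ∃ y ∈ U, y ∈ Metric.ball z r := by
    have := hnear.filter_mono (nhdsWithin_le_nhds (s := Set.Ioi 0))
    obtain ⟨s, ⟨hs1, hs2⟩, hs⟩ := (this.and self_mem_nhdsWithin).exists
    refine ⟨Metric.ball z ρ ∩ {y | 0 < ⟪e, y⟫ - f (y - ⟪e, y⟫ • e)},
      Metric.isOpen_ball.inter (isOpen_lt continuous_const hcont), ?_, z + s • e, ⟨hs2, ?_⟩, hs1⟩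
    · refine Set.disjoint_left.2 fun y hy hyK => ?_
      have h1 := (hloc y hy.1).1 hyK
      have h2 : 0 < ⟪e, y⟫ - f (y - ⟪e, y⟫ • e) := hy.2
      linarith
    · have h2 : 0 < s := hs
      simp only [Set.mem_ofPred_eq]
      rw [hshift s]
      linarith
  have hflat : ∀ y ∈ Metric.ball z r, ⟪y - z, ν⟫ = 0 → y ∈ K →
      halfBall z ν r ⊆ K ∧ halfBall z (-ν) r ⊆ K := by
    intro y hy hy0 hyK
    obtain ⟨a, ha1, ha2⟩ := exists_mem_halfBall_of_isOpen hν0 hKo hyK hy hy0.le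
    obtain ⟨b, hb1, hb2⟩ := exists_mem_halfBall_of_isOpen (neg_ne_zero.2 hν0) hKo hyK hy
      (by rw [inner_neg_right, hy0, neg_zero])
    refine ⟨(halfBall_subset_or_disjoint hd1).resolve_right fun hd => ?_,
      (halfBall_subset_or_disjoint hd2).resolve_right fun hd => ?_⟩
    · exact Set.disjoint_left.1 hd ha2 ha1
    · exact Set.disjoint_left.1 hd hb2 hb1
  have hnotboth : ¬ (halfBall z ν r ⊆ K ∧ halfBall z (-ν) r ⊆ K) := by
    rintro ⟨h1, h2⟩
    obtain ⟨U, hU, hUK, y, hyU, hyb⟩ := hout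
    rcases hmeet U hU y hyU hyb with ⟨a, ha1, ha2⟩ | ⟨a, ha1, ha2⟩
    · exact Set.disjoint_left.1 hUK ha1 (h1 ha2)
    · exact Set.disjoint_left.1 hUK ha1 (h2 ha2)
  have hneg : ∀ y, ⟪y - z, -ν⟫ < 0 ↔ 0 < ⟪y - z, ν⟫ := fun y => by
    rw [inner_neg_right, neg_lt_zero]
  have key : ∀ y ∈ Metric.ball z r, y ∈ K → y ∈ halfBall z ν r ∨ y ∈ halfBall z (-ν) r := by
    intro y hy hyK
    rcases lt_trichotomy ⟪y - z, ν⟫ 0 with hlt | heq | hgt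
    · exact Or.inl ⟨hy, hlt⟩
    · exact absurd (hflat y hy heq hyK) hnotboth
    · exact Or.inr ⟨hy, (hneg y).2 hgt⟩
  rcases halfBall_subset_or_disjoint hd1 with h1 | h1 <;>
    rcases halfBall_subset_or_disjoint hd2 with h2 | h2
  · exact absurd ⟨h1, h2⟩ hnotboth
  · refine Or.inl ⟨hν, r, hr, fun y hy => ⟨fun hyK => ?_, fun hlt => h1 ⟨hy, hlt⟩⟩⟩
    rcases key y hy hyK with h3 | h3
    · exact h3.2
    · exact absurd hyK (Set.disjoint_left.1 h2 h3)
  · refine Or.inr ⟨by rwa [norm_neg], r, hr, fun y hy => ⟨fun hyK => ?_, fun hlt => h2 ⟨hy, hlt⟩⟩⟩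
    rcases key y hy hyK with h3 | h3
    · exact absurd hyK (Set.disjoint_left.1 h1 h3)
    · exact h3.2
  · obtain ⟨y, hyK, hyb⟩ := hin
    rcases key y hyb hyK with h3 | h3
    · exact absurd hyK (Set.disjoint_left.1 h1 h3)
    · exact absurd hyK (Set.disjoint_left.1 h2 h3)

/-- A failure of the half-space condition at some `y` persists under small changes of point and
normal, once the inequality violated there is strict. If `y ∈ K` lies only on the dividing
hyperplane, openness of `K` allows it to be pushed strictly to the wrong side. -/
theorem isClosed_isOuterNormal_ball {K : Set E} (hK : IsOpen K) (r : ℝ) :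
    IsClosed {p : E × E | ‖p.2‖ = 1 ∧
      ∀ y ∈ Metric.ball p.1 r, y ∈ K ↔ ⟪y - p.1, p.2⟫ < 0} := by
  rw [← isOpen_compl_iff, isOpen_iff_mem_nhds]
  rintro ⟨z, ν⟩ h
  have hball : ∀ y ∈ Metric.ball z r, ∀ᶠ p : E × E in 𝓝 (z, ν), y ∈ Metric.ball p.1 r := by
    intro y hy
    have : Continuous fun p : E × E => dist y p.1 := by fun_prop
    exact this.continuousAt.eventually (gt_mem_nhds hy)
  have hinner : ∀ y : E, Continuous fun p : E × E => ⟪y - p.1, p.2⟫ := fun y => by fun_prop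
  by_cases hν : ‖ν‖ = 1
  swap
  · have hc : Continuous fun p : E × E => ‖p.2‖ := by fun_prop
    filter_upwards [hc.continuousAt.eventually (isOpen_ne.mem_nhds hν)] with p hp h'
    exact hp h'.1
  have hν0 : ν ≠ 0 := by rintro rfl; simp at hν
  simp only [Set.mem_compl_iff, Set.mem_ofPred_eq, not_and, not_forall] at h
  obtain ⟨y, hy, h⟩ := h hν
  by_cases hyK : y ∈ K
  · have hge : 0 ≤ ⟪y - z, ν⟫ := by
      by_contra hlt
      exact h ⟨fun _ => by linarith, fun _ => hyK⟩
    obtain ⟨y', hy'K, hy'⟩ := exists_mem_halfBall_of_isOpen (neg_ne_zero.2 hν0) hK hyK hy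
      (by rw [inner_neg_right]; linarith)
    have hpos : 0 < ⟪y' - z, ν⟫ := by
      have : ⟪y' - z, -ν⟫ < 0 := hy'.2
      rw [inner_neg_right] at this
      linarith
    filter_upwards [hball y' hy'.1, (hinner y').continuousAt.eventually (lt_mem_nhds hpos)]
      with p hp1 hp2 h'
    exact lt_asymm hp2 ((h'.2 y' hp1).1 hy'K)
  · have hlt : ⟪y - z, ν⟫ < 0 := by
      by_contra hge
      exact h ⟨fun hy => absurd hy hyK, fun hlt => absurd hlt hge⟩
    filter_upwards [hball y hy, (hinner y).continuousAt.eventually (gt_mem_nhds hlt)]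
      with p hp1 hp2 h'
    exact hyK ((h'.2 y hp1).2 hp2)

/-- The points whose normal lies in a closed set form a countable union, over radii `1 / (k + 1)`,
of projections of closed sets of pairs. The pairs are cut by balls into compact pieces, because only
these have closed projections in general. -/
theorem measurable_outerNormal [FiniteDimensional ℝ E] [MeasurableSpace E] [BorelSpace E]
    {K : Set E} (hK : IsOpen K) : Measurable (outerNormal K) := by
  have hset : ∀ C : Set E, IsClosed C → MeasurableSet {z | ∃ ν ∈ C, IsOuterNormal K z ν} := by
    intro C hC
    have hUnion : {z | ∃ ν ∈ C, IsOuterNormal K z ν} = ⋃ k : ℕ, Prod.fst ''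
        ({p : E × E | ‖p.2‖ = 1 ∧
          ∀ y ∈ Metric.ball p.1 (1 / ((k : ℝ) + 1)), y ∈ K ↔ ⟪y - p.1, p.2⟫ < 0} ∩
            (Set.univ ×ˢ (C ∩ Metric.closedBall 0 1))) := by
      ext z
      simp only [Set.mem_ofPred_eq, Set.mem_iUnion, Set.mem_image, Set.mem_inter_iff, Set.mem_prod,
        Set.mem_univ, true_and, Prod.exists, exists_and_right, exists_eq_right,
        mem_closedBall_zero_iff]
      constructor
      · rintro ⟨ν, hν, h1, r, hr, h⟩
        obtain ⟨k, hk⟩ := exists_nat_one_div_lt hr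
        exact ⟨k, ν, ⟨h1, fun y hy => h y (Metric.ball_subset_ball hk.le hy)⟩, hν, h1.le⟩
      · rintro ⟨k, ν, ⟨h1, h⟩, hν, -⟩
        exact ⟨ν, hν, h1, _, Nat.one_div_pos_of_nat, h⟩
    rw [hUnion]
    refine MeasurableSet.iUnion fun k => ?_
    have hcl := isClosed_isOuterNormal_ball hK (1 / ((k : ℝ) + 1))
    have hcomp : IsCompact (C ∩ Metric.closedBall (0 : E) 1) :=
      (isCompact_closedBall 0 1).inter_left hC
    have hcov : (Set.univ ×ˢ (C ∩ Metric.closedBall (0 : E) 1) : Set (E × E)) =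
        ⋃ m : ℕ, Metric.closedBall (0 : E) m ×ˢ (C ∩ Metric.closedBall (0 : E) 1) := by
      rw [← Set.iUnion_prod_const, Metric.iUnion_closedBall_nat]
    rw [hcov, Set.inter_iUnion, Set.image_iUnion]
    refine MeasurableSet.iUnion fun m => IsCompact.measurableSet ?_
    exact ((((isCompact_closedBall 0 (m : ℝ)).prod hcomp).inter_left hcl)).image continuous_fst
  refine measurable_of_isClosed fun C hC => ?_
  have hpre : outerNormal K ⁻¹' C = {z | ∃ ν ∈ C, IsOuterNormal K z ν} ∪
      ({z | ∃ ν ∈ Set.univ, IsOuterNormal K z ν}ᶜ ∩ {_z | (0 : E) ∈ C}) := by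
    ext z
    simp only [Set.mem_preimage, Set.mem_union, Set.mem_inter_iff, Set.mem_compl_iff,
      Set.mem_ofPred_eq, Set.mem_univ, true_and]
    by_cases hex : ∃ ν, IsOuterNormal K z ν
    · obtain ⟨ν, hν⟩ := hex
      rw [hν.outerNormal_eq]
      constructor
      · exact fun h => Or.inl ⟨ν, h, hν⟩
      · rintro (⟨ν', h', h''⟩ | ⟨h, -⟩)
        · rwa [hν.unique h'']
        · exact absurd ⟨ν, hν⟩ h
    · have h0 : outerNormal K z = 0 := dif_neg hex
      rw [h0]
      constructor
      · exact fun h => Or.inr ⟨hex, h⟩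
      · rintro (⟨ν', -, h''⟩ | ⟨-, h⟩)
        · exact absurd ⟨ν', h''⟩ hex
        · exact h
  rw [hpre]
  exact (hset C hC).union ((hset _ isClosed_univ).compl.inter (MeasurableSet.const _))

end Normals

/-! ### Regular points of a finite family of hyperplanes -/

section Regular

variable {E : Type*} [NormedAddCommGroup E] [InnerProductSpace ℝ E]

/-- Any two hyperplanes of the family that contain `z` are parallel. -/
def NoCrossing (H : Finset (E × ℝ)) (z : E) : Prop :=
  ∀ h ∈ H, ∀ h' ∈ H, ⟪h.1, z⟫ = h.2 → ⟪h'.1, z⟫ = h'.2 → ∃ a : ℝ, h'.1 = a • h.1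

/-- Near `z` all hyperplanes of the family lie in the hyperplane through `z` orthogonal to `ν`. -/
def FlatAt (H : Finset (E × ℝ)) (z ν : E) : Prop :=
  ∃ r : ℝ, 0 < r ∧ ∀ h ∈ H, ∀ y ∈ Metric.ball z r, ⟪h.1, y⟫ = h.2 → ⟪y - z, ν⟫ = 0

theorem eventually_inner_ne (H : Finset (E × ℝ)) (z : E) :
    ∃ r : ℝ, 0 < r ∧ ∀ h ∈ H, ∀ y ∈ Metric.ball z r, ⟪h.1, y⟫ = h.2 → ⟪h.1, z⟫ = h.2 := by
  have : ∀ᶠ y in 𝓝 z, ∀ h ∈ H, ⟪h.1, y⟫ = h.2 → ⟪h.1, z⟫ = h.2 := by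
    refine (Finset.eventually_all H).2 fun h _ => ?_
    by_cases hz : ⟪h.1, z⟫ = h.2
    · exact Eventually.of_forall fun _ _ => hz
    · have hc : Continuous fun y : E => ⟪h.1, y⟫ := by fun_prop
      filter_upwards [hc.continuousAt.eventually (isOpen_ne.mem_nhds hz)] with y hy hy'
      exact absurd hy' hy
  obtain ⟨r, hr, hb⟩ := Metric.eventually_nhds_iff_ball.1 this
  exact ⟨r, hr, fun h hh y hy => hb y hy h hh⟩

/-- Close to `z` only the hyperplanes through `z` matter, by finiteness, and these are all parallel
to `h`. -/
theorem NoCrossing.flatAt {H : Finset (E × ℝ)} {z : E} (hz : NoCrossing H z) {h : E × ℝ}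
    (hh : h ∈ H) (hzh : ⟪h.1, z⟫ = h.2) : FlatAt H z (‖h.1‖⁻¹ • h.1) := by
  obtain ⟨r, hr, hb⟩ := eventually_inner_ne H z
  refine ⟨r, hr, fun h' hh' y hy hy' => ?_⟩
  have hz' := hb h' hh' y hy hy'
  obtain ⟨a, ha⟩ := hz h' hh' h hh hz' hzh
  rw [ha, smul_smul, real_inner_smul_right, inner_sub_left, real_inner_comm, hy',
    real_inner_comm h'.1 z, hz', sub_self, mul_zero]

theorem flatAt_of_forall_ne {H : Finset (E × ℝ)} {z : E} (hz : ∀ h ∈ H, ⟪h.1, z⟫ ≠ h.2) (ν : E) :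
    FlatAt H z ν := by
  obtain ⟨r, hr, hb⟩ := eventually_inner_ne H z
  exact ⟨r, hr, fun h hh y hy hy' => absurd (hb h hh y hy hy') (hz h hh)⟩

end Regular

/-! ### Surface measure on hyperplanes -/

section Surface

variable {n : ℕ}

theorem finrank_spaceTime : Module.finrank ℝ (SpaceTime n) = n + 1 := by
  rw [(WithLp.linearEquiv 2 ℝ (Space n × ℝ)).finrank_eq]
  simp

theorem inner_spaceTime (y z : SpaceTime n) : ⟪y, z⟫ = ⟪y.fst, z.fst⟫ + y.snd * z.snd := by
  rw [WithLp.prod_inner_apply]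
  simp [mul_comm]

theorem norm_sq_spaceTime (z : SpaceTime n) : ‖z‖ ^ 2 = ‖z.fst‖ ^ 2 + z.snd ^ 2 := by
  rw [← real_inner_self_eq_norm_sq, inner_spaceTime, real_inner_self_eq_norm_sq]
  ring

/-- The graph of an affine function over space. -/
def graphMap (p : Space n × ℝ) (x : Space n) : SpaceTime n := WithLp.toLp 2 (x, ⟪p.1, x⟫ + p.2)

@[simp] theorem graphMap_fst (p : Space n × ℝ) (x : Space n) : (graphMap p x).fst = x := rfl

@[simp] theorem graphMap_snd (p : Space n × ℝ) (x : Space n) :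
    (graphMap p x).snd = ⟪p.1, x⟫ + p.2 := rfl

theorem continuous_graphMap (p : Space n × ℝ) : Continuous (graphMap p) := by
  unfold graphMap
  fun_prop

theorem continuous_fst_spaceTime : Continuous fun z : SpaceTime n => z.fst := by fun_prop

theorem continuous_snd_spaceTime : Continuous fun z : SpaceTime n => z.snd := by fun_prop

theorem measurableEmbedding_graphMap (p : Space n × ℝ) : MeasurableEmbedding (graphMap p) := by
  have h : Function.LeftInverse (fun z : SpaceTime n => z.fst) (graphMap p) := fun x => rfl
  exact (h.isClosedEmbedding continuous_fst_spaceTime (continuous_graphMap p)).measurableEmbedding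

theorem mem_range_graphMap {p : Space n × ℝ} {z : SpaceTime n} :
    z ∈ Set.range (graphMap p) ↔ z.snd = ⟪p.1, z.fst⟫ + p.2 := by
  constructor
  · rintro ⟨x, rfl⟩
    rfl
  · intro h
    refine ⟨z.fst, ?_⟩
    unfold graphMap
    rw [← h]
    rfl

/-- The linear part of `graphMap`. -/
def graphLin (p : Space n) : Space n →ₗ[ℝ] SpaceTime n :=
  (WithLp.linearEquiv 2 ℝ (Space n × ℝ)).symm.toLinearMap ∘ₗ
    LinearMap.prod LinearMap.id (innerₗ (Space n) p)

theorem graphLin_apply (p x : Space n) : graphLin p x = WithLp.toLp 2 (x, ⟪p, x⟫) := rfl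

/-- The Gram matrix of the images of the standard basis is the rank-one update `1 + p pᵀ`. -/
theorem normDet_graphLin (p : Space n) : (graphLin p).normDet = √(1 + ‖p‖ ^ 2) := by
  have h := (graphLin p).normDet_sq_eq_det_gram (EuclideanSpace.basisFun (Fin n) ℝ)
  have hg : Matrix.gram ℝ (fun i => graphLin p (EuclideanSpace.basisFun (Fin n) ℝ i)) =
      1 + Matrix.replicateCol Unit p.ofLp * Matrix.replicateRow Unit p.ofLp := by
    ext i j
    rw [Matrix.gram_apply, graphLin_apply, graphLin_apply, inner_spaceTime]
    simp [Matrix.mul_apply, Matrix.one_apply, EuclideanSpace.inner_single_right]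
    simp [eq_comm]
  rw [hg, Matrix.det_one_add_replicateCol_mul_replicateRow] at h
  have h2 : (graphLin p).normDet ^ 2 = 1 + ‖p‖ ^ 2 := by
    rw [EuclideanSpace.real_norm_sq_eq]
    simpa [dotProduct, sq] using h
  rw [← h2, Real.sqrt_sq (LinearMap.normDet_nonneg _)]

/-- The slope factor `√(1 + |p|²)` of a graph. -/
def slope (p : Space n × ℝ) : ℝ := √(1 + ‖p.1‖ ^ 2)

theorem slope_pos (p : Space n × ℝ) : 0 < slope p := Real.sqrt_pos.2 (by positivity)

theorem surf_image_graphMap (p : Space n × ℝ) (s : Set (Space n)) :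
    surf n (graphMap p '' s) = ENNReal.ofReal (slope p) * volume s := by
  have h1 : graphMap p '' s = (fun y => WithLp.toLp 2 (0, p.2) + y) '' (graphLin p.1 '' s) := by
    rw [Set.image_image]
    refine Set.image_congr fun x _ => ?_
    rw [graphLin_apply, graphMap, ← WithLp.toLp_add]
    simp [add_comm]
  have h2 := (graphLin p.1).euclideanHausdorffMeasure_image_eq_normDet_mul_volume s
  rw [finrank_euclideanSpace_fin, normDet_graphLin] at h2
  rw [h1, surf, (isometry_add_left _).euclideanHausdorffMeasure_image, h2]
  rfl

theorem surf_restrict_range_graphMap (p : Space n × ℝ) :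
    (surf n).restrict (Set.range (graphMap p)) =
      ENNReal.ofReal (slope p) • (volume : Measure (Space n)).map (graphMap p) := by
  ext s hs
  rw [Measure.restrict_apply hs, Measure.smul_apply, (measurableEmbedding_graphMap p).map_apply,
    ← Set.image_preimage_eq_inter_range, surf_image_graphMap, smul_eq_mul]

theorem setIntegral_range_graphMap {F : Type*} [NormedAddCommGroup F] [NormedSpace ℝ F]
    (p : Space n × ℝ) (f : SpaceTime n → F) :
    ∫ z in Set.range (graphMap p), f z ∂surf n = slope p • ∫ x, f (graphMap p x) := by
  rw [surf_restrict_range_graphMap, integral_smul_measure,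
    (measurableEmbedding_graphMap p).integral_map, ENNReal.toReal_ofReal (slope_pos p).le]

theorem integrableOn_range_graphMap {F : Type*} [NormedAddCommGroup F]
    (p : Space n × ℝ) (f : SpaceTime n → F) :
    IntegrableOn f (Set.range (graphMap p)) (surf n) ↔ Integrable fun x => f (graphMap p x) := by
  rw [IntegrableOn, surf_restrict_range_graphMap, integrable_smul_measure
    (by simpa using slope_pos p) ENNReal.ofReal_ne_top,
    (measurableEmbedding_graphMap p).integrable_map_iff]
  rfl

theorem ae_graphMap {P : SpaceTime n → Prop} (h : ∀ᵐ z ∂surf n, P z) (p : Space n × ℝ) :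
    ∀ᵐ x, P (graphMap p x) := by
  have h1 := ae_restrict_of_ae (s := Set.range (graphMap p)) h
  rw [surf_restrict_range_graphMap, Measure.ae_ennreal_smul_measure_eq (by simpa using slope_pos p),
    (measurableEmbedding_graphMap p).ae_map_iff] at h1
  exact h1

/-- A nonempty intersection lies in a translate of the orthogonal complement of a plane, of
dimension `n - 1`, and the `n`-dimensional Hausdorff measure vanishes there. -/
theorem surf_inter_hyperplanes {h h' : SpaceTime n} (h0 : h ≠ 0) (hne : ¬ ∃ a : ℝ, h' = a • h)
    (b b' : ℝ) : surf n {y | ⟪h, y⟫ = b ∧ ⟪h', y⟫ = b'} = 0 := by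
  rcases Set.eq_empty_or_nonempty {y : SpaceTime n | ⟪h, y⟫ = b ∧ ⟪h', y⟫ = b'} with he | ⟨y₀, hy₀⟩
  · rw [he, measure_empty]
  have hli : LinearIndependent ℝ ![h, h'] := by
    rw [LinearIndependent.pair_iff' h0]
    exact fun a ha => hne ⟨a, ha.symm⟩
  set S := Submodule.span ℝ (Set.range ![h, h']) with hS
  have hrank : Module.finrank ℝ S = 2 := by
    rw [hS, finrank_span_eq_card hli, Fintype.card_fin]
  have hperp : Module.finrank ℝ Sᗮ + 2 = n + 1 := by
    rw [← hrank, add_comm, Submodule.finrank_add_finrank_orthogonal, finrank_spaceTime]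
  have hsub : {y : SpaceTime n | ⟪h, y⟫ = b ∧ ⟪h', y⟫ = b'} ⊆
      (fun w : Sᗮ => y₀ + (w : SpaceTime n)) '' Set.univ := by
    rintro y ⟨hy1, hy2⟩
    have hmem : y - y₀ ∈ Sᗮ := by
      rw [Submodule.mem_orthogonal]
      intro u hu
      refine Submodule.span_induction (p := fun u _ => ⟪u, y - y₀⟫ = 0) ?_ ?_ ?_ ?_ hu
      · rintro _ ⟨i, rfl⟩
        fin_cases i
        · simp [inner_sub_right, hy1, hy₀.1]
        · simp [inner_sub_right, hy2, hy₀.2]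
      · simp
      · intro a b _ _ ha hb
        rw [inner_add_left, ha, hb, add_zero]
      · intro a b _ hb
        rw [real_inner_smul_left, hb, mul_zero]
    exact ⟨⟨y - y₀, hmem⟩, trivial, by simp⟩
  have hiso : Isometry fun w : Sᗮ => y₀ + (w : SpaceTime n) :=
    (isometry_add_left y₀).comp isometry_subtype_coe
  refine measure_mono_null hsub ?_
  rw [surf, hiso.euclideanHausdorffMeasure_image, Measure.euclideanHausdorffMeasure_def,
    Measure.smul_apply]
  have hz : (Measure.hausdorffMeasure (n : ℝ) : Measure Sᗮ) = 0 :=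
    Real.hausdorffMeasure_of_finrank_lt (by norm_cast; omega)
  simp [hz]

/-- The hyperplane is an isometric copy of `hᗮ`, of dimension `n`, on which the surface measure is
Lebesgue measure. -/
theorem surf_lt_top_of_isBounded {h : SpaceTime n} (h0 : h ≠ 0) {b : ℝ} {s : Set (SpaceTime n)}
    (hs : Bornology.IsBounded s) (hsub : s ⊆ {y | ⟪h, y⟫ = b}) : surf n s < ⊤ := by
  rcases Set.eq_empty_or_nonempty s with he | ⟨y₀, hy₀⟩
  · simp [he]
  set S := Submodule.span ℝ {h} with hS
  have hrank : Module.finrank ℝ S = 1 := finrank_span_singleton h0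
  have hperp : Module.finrank ℝ Sᗮ = n := by
    have := Submodule.finrank_add_finrank_orthogonal S
    rw [finrank_spaceTime] at this
    omega
  set f : Sᗮ → SpaceTime n := fun w => y₀ + (w : SpaceTime n) with hf
  have hiso : Isometry f := (isometry_add_left y₀).comp isometry_subtype_coe
  have himg : s = f '' (f ⁻¹' s) := by
    refine (Set.image_preimage_eq_of_subset fun y hy => ?_).symm
    refine ⟨⟨y - y₀, ?_⟩, by simp [hf]⟩
    rw [hS, Submodule.mem_orthogonal_singleton_iff_inner_right, inner_sub_right, hsub hy,
      hsub hy₀, sub_self]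
  have hb : Bornology.IsBounded (f ⁻¹' s) := hiso.antilipschitz.isBounded_preimage hs
  rw [surf, himg, hiso.euclideanHausdorffMeasure_image]
  have hv : (Measure.euclideanHausdorffMeasure n : Measure Sᗮ) = volume := by
    rw [← InnerProductSpace.euclideanHausdorffMeasure_eq_volume, hperp]
  rw [hv]
  exact hb.measure_lt_top

theorem ae_noCrossing {H : Finset (SpaceTime n × ℝ)} (hH : ∀ h ∈ H, h.1 ≠ 0) :
    ∀ᵐ z ∂surf n, NoCrossing H z := by
  unfold NoCrossing
  refine (ae_ball_iff H.countable_toSet).2 fun h hh => (ae_ball_iff H.countable_toSet).2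
    fun h' hh' => ?_
  by_cases hp : ∃ a : ℝ, h'.1 = a • h.1
  · exact Eventually.of_forall fun _ _ _ => hp
  · have := surf_inter_hyperplanes (hH h hh) hp h.2 h'.2
    filter_upwards [compl_mem_ae_iff.2 this] with z hz h1 h2
    exact absurd ⟨h1, h2⟩ hz

theorem surf_frontier_lt_top {K : Set (SpaceTime n)} (hK : IsLipschitzPolytope K) :
    surf n (frontier K) < ⊤ := by
  obtain ⟨H, hH, hcov⟩ := hK.flat
  have h1 : frontier K ⊆ ⋃ h ∈ H, (frontier K ∩ {y | ⟪h.1, y⟫ = h.2}) := by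
    intro y hy
    obtain ⟨h, hh, hy'⟩ := Set.mem_iUnion₂.1 (hcov hy)
    exact Set.mem_iUnion₂.2 ⟨h, hh, hy, hy'⟩
  refine (measure_mono h1).trans_lt ((measure_biUnion_finset_le _ _).trans_lt ?_)
  refine ENNReal.sum_lt_top.2 fun h hh => ?_
  refine surf_lt_top_of_isBounded (hH h hh) ?_ Set.inter_subset_right
  refine hK.isBounded.closure.subset ?_
  exact Set.inter_subset_left.trans frontier_subset_closure

end Surface

/-! ### Open sets of the real line with finitely many boundary points -/

section Line

variable {ι : Type*}

/-- The bounded open set `O` of the line has its boundary points among the `a i`, `i ∈ s`; the sign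
`ε i` is `1` at right end points, `-1` at left end points, and `0` off the boundary. -/
structure IsEndpointSystem (O : Set ℝ) (s : Finset ι) (a ε : ι → ℝ) : Prop where
  isBounded : Bornology.IsBounded O
  isOpen : IsOpen O
  injOn : Set.InjOn a s
  frontier_subset : frontier O ⊆ a '' s
  sign : ∀ i ∈ s, (ε i = 1 ∧ ∀ᶠ y in 𝓝 (a i), y ∈ O ↔ y < a i) ∨
    (ε i = -1 ∧ ∀ᶠ y in 𝓝 (a i), y ∈ O ↔ a i < y) ∨ (ε i = 0 ∧ a i ∉ frontier O)

theorem eventually_mem_iff_of_notMem_frontier {X : Type*} [TopologicalSpace X] {O : Set X} {x : X}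
    (h : x ∉ frontier O) : ∀ᶠ y in 𝓝 x, y ∈ O ↔ x ∈ O := by
  by_cases hx : x ∈ closure O
  · have hi : x ∈ interior O := by
      by_contra hn
      exact h ⟨hx, hn⟩
    filter_upwards [mem_interior_iff_mem_nhds.1 hi] with y hy
    exact ⟨fun _ => interior_subset hi, fun _ => hy⟩
  · filter_upwards [isClosed_closure.isOpen_compl.mem_nhds hx] with y hy
    exact ⟨fun h => absurd (subset_closure h) hy, fun h => absurd (subset_closure h) hx⟩

theorem eventually_step_eq {a y₀ : ℝ} (h : a ≠ y₀) :
    ∀ᶠ y in 𝓝 y₀, (a < y ↔ a < y₀) ∧ (a ≤ y ↔ a ≤ y₀) := by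
  rcases h.lt_or_gt with h | h
  · filter_upwards [lt_mem_nhds h] with y hy
    exact ⟨iff_of_true hy h, iff_of_true hy.le h.le⟩
  · filter_upwards [gt_mem_nhds h] with y hy
    exact ⟨iff_of_false hy.not_gt h.not_gt, iff_of_false hy.not_ge h.not_ge⟩

namespace IsEndpointSystem

variable {O : Set ℝ} {s : Finset ι} {a ε : ι → ℝ}

theorem exists_bound (h : IsEndpointSystem O s a ε) :
    ∃ R : ℝ, 0 < R ∧ O ⊆ Set.Ioo (-R) R ∧ ∀ i ∈ s, a i ∈ Set.Ioo (-R) R := by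
  have hb : Bornology.IsBounded (O ∪ a '' s) :=
    h.isBounded.union ((s.finite_toSet.image a).isBounded)
  obtain ⟨R, hR⟩ := hb.subset_closedBall 0
  refine ⟨max R 0 + 1, by positivity, fun y hy => ?_, fun i hi => ?_⟩
  · have := hR (Or.inl hy)
    rw [mem_closedBall_zero_iff, Real.norm_eq_abs, abs_le] at this
    constructor <;> linarith [le_max_left R 0]
  · have := hR (Or.inr ⟨i, hi, rfl⟩)
    rw [mem_closedBall_zero_iff, Real.norm_eq_abs, abs_le] at this
    constructor <;> linarith [le_max_left R 0]

open Classical in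
-- Each step cancels one jump of the indicator, so the sum is locally constant on a connected line,
-- and it is zero far to the left. Since `O` is open, neither kind of end point belongs to it; for
-- exact cancellation at the end points the step must therefore be closed (`a i ≤ y`) at right ends
-- and open (`a i < y`) at left ends.
theorem indicator_add_sum_eq_zero (h : IsEndpointSystem O s a ε) (y : ℝ) :
    O.indicator (fun _ => (1 : ℝ)) y + ∑ i ∈ s, (if 0 < ε i then (if a i ≤ y then ε i else 0)
      else (if a i < y then ε i else 0)) = 0 := by
  set c : ι → ℝ → ℝ := fun i y => if 0 < ε i then (if a i ≤ y then ε i else 0)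
      else (if a i < y then ε i else 0) with hc
  set f : ℝ → ℝ := fun y => O.indicator (fun _ => (1 : ℝ)) y + ∑ i ∈ s, c i y with hf
  have hcc : ∀ i y₀, a i ≠ y₀ → ∀ᶠ y in 𝓝 y₀, c i y = c i y₀ := by
    intro i y₀ hi
    filter_upwards [eventually_step_eq hi] with y hy
    simp only [hc, hy.1, hy.2]
  have hloc : IsLocallyConstant f := by
    rw [IsLocallyConstant.iff_eventually_eq]
    intro y₀
    by_cases hy₀ : ∃ i ∈ s, a i = y₀
    · obtain ⟨i, hi, rfl⟩ := hy₀
      have hne : ∀ᶠ y in 𝓝 (a i), ∀ j ∈ s.erase i, c j y = c j (a i) := by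
        refine (Finset.eventually_all _).2 fun j hj => hcc j _ fun hji => ?_
        exact Finset.ne_of_mem_erase hj (h.injOn (Finset.mem_of_mem_erase hj) hi hji)
      have hsplit : ∀ y, f y = O.indicator (fun _ => (1 : ℝ)) y + c i y +
          ∑ j ∈ s.erase i, c j y := fun y => by
        rw [hf]
        simp only
        rw [← Finset.add_sum_erase s _ hi, add_assoc]
      rcases h.sign i hi with ⟨he, hO⟩ | ⟨he, hO⟩ | ⟨he, hO⟩
      · filter_upwards [hne, hO] with y hy hyO
        rw [hsplit, hsplit, Finset.sum_congr rfl hy]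
        have h1 := hO.self_of_nhds
        congr 1
        simp only [hc, Set.indicator_apply, hyO, h1, he]
        rcases lt_or_ge y (a i) with hlt | hge
        · simp [hlt, hlt.not_ge]
        · simp [hge, hge.not_gt]
      · filter_upwards [hne, hO] with y hy hyO
        rw [hsplit, hsplit, Finset.sum_congr rfl hy]
        have h1 := hO.self_of_nhds
        congr 1
        simp only [hc, Set.indicator_apply, hyO, h1, he]
        rcases lt_or_ge (a i) y with hlt | hge
        · norm_num [hlt]
        · norm_num [hge.not_gt]
      · filter_upwards [hne, eventually_mem_iff_of_notMem_frontier hO] with y hy hyO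
        rw [hsplit, hsplit, Finset.sum_congr rfl hy]
        congr 1
        simp only [hc, Set.indicator_apply, hyO, he]
        simp
    · push Not at hy₀
      have hne : ∀ᶠ y in 𝓝 y₀, ∀ j ∈ s, c j y = c j y₀ :=
        (Finset.eventually_all _).2 fun j hj => hcc j _ (hy₀ j hj)
      have hO : y₀ ∉ frontier O := fun hfr => by
        obtain ⟨i, hi, hiy⟩ := h.frontier_subset hfr
        exact hy₀ i hi hiy
      filter_upwards [hne, eventually_mem_iff_of_notMem_frontier hO] with y hy hyO
      simp only [hf, Set.indicator_apply, hyO, Finset.sum_congr rfl hy]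
  obtain ⟨R, hR, hOR, haR⟩ := h.exists_bound
  have h1 : f y = f (-R) := hloc.apply_eq_of_preconnectedSpace y (-R)
  have h2 : f (-R) = 0 := by
    simp only [hf]
    rw [Set.indicator_of_notMem fun hm => lt_irrefl _ (hOR hm).1, zero_add]
    refine Finset.sum_eq_zero fun i hi => ?_
    have := (haR i hi).1
    simp only [hc]
    rw [if_neg this.not_ge, if_neg this.not_gt, ite_self]
  exact h1.trans h2

open Classical in
theorem indicator_eq (h : IsEndpointSystem O s a ε) {y : ℝ} (hy : ∀ i ∈ s, a i ≠ y) :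
    O.indicator (fun _ => (1 : ℝ)) y = -∑ i ∈ s, (if a i < y then ε i else 0) := by
  have := h.indicator_add_sum_eq_zero y
  rw [Finset.sum_congr rfl (g := fun i => if a i < y then ε i else 0)] at this
  · linarith
  · intro i hi
    have : a i ≤ y ↔ a i < y := ⟨fun hle => lt_of_le_of_ne hle (hy i hi), le_of_lt⟩
    simp only [this, ite_self]

theorem sum_sign (h : IsEndpointSystem O s a ε) : ∑ i ∈ s, ε i = 0 := by
  classical
  obtain ⟨R, hR, hOR, haR⟩ := h.exists_bound
  have := h.indicator_eq (y := R) fun i hi => (haR i hi).2.ne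
  rw [Set.indicator_of_notMem fun hm => lt_irrefl _ (hOR hm).2,
    Finset.sum_congr rfl (g := ε) fun i hi => if_pos (haR i hi).2] at this
  linarith

theorem ae_ne (s : Finset ι) (a : ι → ℝ) : ∀ᵐ y : ℝ, ∀ i ∈ s, a i ≠ y := by
  refine (ae_ball_iff s.countable_toSet).2 fun i _ => ?_
  have : ∀ᵐ y : ℝ, y ≠ a i := by simp [ae_iff, measure_singleton]
  filter_upwards [this] with y hy using hy.symm

theorem integral_step {a R : ℝ} (ha : a ∈ Set.Ioo (-R) R) (f : ℝ → ℝ) :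
    ∫ y in (-R)..R, (if a < y then f y else 0) = ∫ y in a..R, f y := by
  rw [intervalIntegral.integral_of_le (by linarith [ha.1, ha.2]),
    intervalIntegral.integral_of_le ha.2.le]
  have : (fun y => if a < y then f y else 0) = (Set.Ioi a).indicator f := by
    ext y; simp [Set.indicator_apply]
  rw [this, integral_indicator measurableSet_Ioi, Measure.restrict_restrict measurableSet_Ioi]
  congr 2
  ext y
  simp only [Set.mem_inter_iff, Set.mem_Ioi, Set.mem_Ioc]
  constructor
  · rintro ⟨h1, h2⟩; exact ⟨h1, h2.2⟩
  · rintro ⟨h1, h2⟩; exact ⟨h1, by linarith [ha.1], h2⟩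

theorem intervalIntegrable_finset_sum {s : Finset ι} {f : ι → ℝ → ℝ} {b c : ℝ}
    (h : ∀ i ∈ s, IntervalIntegrable (f i) volume b c) :
    IntervalIntegrable (fun y => ∑ i ∈ s, f i y) volume b c := by
  have := IntervalIntegrable.sum s h
  rwa [Finset.sum_fn] at this

theorem intervalIntegrable_step {a b c : ℝ} {f : ℝ → ℝ} (hf : IntervalIntegrable f volume b c) :
    IntervalIntegrable (fun y => if a < y then f y else 0) volume b c := by
  have : (fun y => if a < y then f y else 0) = (Set.Ioi a).indicator f := by
    ext y; simp [Set.indicator_apply]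
  rw [this]
  exact ⟨hf.1.indicator measurableSet_Ioi, hf.2.indicator measurableSet_Ioi⟩

/-- The fundamental theorem of calculus on a bounded open set with finite boundary. -/
theorem integral_deriv (h : IsEndpointSystem O s a ε) {φ φ' : ℝ → ℝ}
    (hφ : ∀ y, HasDerivAt φ (φ' y) y) (hφ' : Continuous φ') :
    ∫ y in O, φ' y = ∑ i ∈ s, ε i * φ (a i) := by
  classical
  obtain ⟨R, hR, hOR, haR⟩ := h.exists_bound
  have h1 : ∫ y in O, φ' y = ∫ y in (-R)..R, -∑ i ∈ s, ε i * (if a i < y then φ' y else 0) := by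
    rw [← integral_indicator h.isOpen.measurableSet,
      ← intervalIntegral.integral_eq_integral_of_support_subset (a := -R) (b := R)]
    · refine intervalIntegral.integral_congr_ae ?_
      filter_upwards [ae_ne s a] with y hy _
      have := h.indicator_eq hy
      calc O.indicator φ' y = O.indicator (fun _ => (1 : ℝ)) y * φ' y := by
            simp [Set.indicator_apply]
        _ = _ := by
            rw [this, neg_mul, Finset.sum_mul]
            congr 1
            refine Finset.sum_congr rfl fun i _ => ?_
            split_ifs <;> simp
    · refine Set.support_indicator_subset.trans (hOR.trans Set.Ioo_subset_Ioc_self)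
  have hint : ∀ b c, IntervalIntegrable φ' volume b c := fun b c => hφ'.intervalIntegrable b c
  rw [h1, intervalIntegral.integral_neg, intervalIntegral.integral_finsetSum
    fun i _ => (intervalIntegrable_step (hint _ _)).const_mul _]
  have h2 : ∀ i ∈ s, ∫ y in (-R)..R, ε i * (if a i < y then φ' y else 0) =
      ε i * φ R - ε i * φ (a i) := by
    intro i hi
    rw [intervalIntegral.integral_const_mul, integral_step (haR i hi),
      intervalIntegral.integral_eq_sub_of_hasDerivAt (fun y _ => hφ y) (hint _ _), mul_sub]
  -- The contributions `φ R` of the auxiliary bound cancel because the signs add up to zero.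
  rw [Finset.sum_congr rfl h2, Finset.sum_sub_distrib, ← Finset.sum_mul, h.sum_sign]
  ring

end IsEndpointSystem

/-! ### Weak primitives on the line and their energy. -/

theorem exists_derivative_eq (q : Polynomial ℝ) : ∃ p : Polynomial ℝ, p.derivative = q := by
  induction q using Polynomial.induction_on' with
  | add p q hp hq =>
    obtain ⟨p', rfl⟩ := hp
    obtain ⟨q', rfl⟩ := hq
    exact ⟨p' + q', by simp⟩
  | monomial k c =>
    refine ⟨Polynomial.monomial (k + 1) (c / ((k : ℝ) + 1)), ?_⟩
    rw [Polynomial.derivative_monomial]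
    have : ((k : ℝ) + 1) ≠ 0 := by positivity
    simp only [Nat.add_sub_cancel, Nat.cast_add, Nat.cast_one]
    congr 1
    field_simp

/-- A function on an interval that is orthogonal to all polynomials vanishes. -/
theorem ae_eq_zero_of_integral_polynomial {R : ℝ} (hR : 0 < R) {h : ℝ → ℝ}
    (hh : IntervalIntegrable h volume (-R) R)
    (hp : ∀ q : Polynomial ℝ, ∫ y in (-R)..R, q.eval y * h y = 0) :
    ∀ᵐ y : ℝ, y ∈ Set.Ioo (-R) R → h y = 0 := by
  have hle : -R ≤ R := by linarith
  have hI : IntegrableOn h (Set.Ioc (-R) R) := (intervalIntegrable_iff_integrableOn_Ioc_of_le hle).1 hh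
  refine isOpen_Ioo.ae_eq_zero_of_integral_contDiff_smul_eq_zero
    (hI.mono_set Set.Ioo_subset_Ioc_self).locallyIntegrableOn fun g hg _ hsupp => ?_
  have hsub : Function.support (fun y => g y • h y) ⊆ Set.Ioc (-R) R := by
    refine (Function.support_smul_subset_left g h).trans ?_
    exact (subset_tsupport g).trans (hsupp.trans Set.Ioo_subset_Ioc_self)
  rw [← intervalIntegral.integral_eq_integral_of_support_subset hsub]
  have hgi : ∀ φ : ℝ → ℝ, Continuous φ → IntervalIntegrable (fun y => φ y * h y) volume (-R) R :=
    fun φ hφ => hh.continuousOn_mul hφ.continuousOn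
  set N := ∫ y in (-R)..R, |h y| with hN
  have hN0 : 0 ≤ N := intervalIntegral.integral_nonneg hle fun y _ => abs_nonneg _
  -- By Weierstrass approximation a test function differs from a polynomial by at most `δ` on the
  -- interval, and the polynomial contributes nothing.
  have key : ∀ δ > 0, |∫ y in (-R)..R, g y • h y| ≤ δ * N := by
    intro δ hδ
    obtain ⟨q, hq⟩ := exists_polynomial_near_of_continuousOn (-R) R g hg.continuous.continuousOn δ hδ
    have h1 : ∫ y in (-R)..R, g y • h y = ∫ y in (-R)..R, (g y - q.eval y) * h y := by
      simp only [sub_mul, smul_eq_mul]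
      rw [intervalIntegral.integral_sub (hgi _ hg.continuous) (hgi _ q.continuous), hp q, sub_zero]
    rw [h1]
    refine (intervalIntegral.abs_integral_le_integral_abs hle).trans ?_
    rw [hN, ← intervalIntegral.integral_const_mul]
    refine intervalIntegral.integral_mono_on hle ?_ (hh.abs.const_mul _) fun y hy => ?_
    · exact (hgi (fun y => g y - q.eval y) (hg.continuous.sub q.continuous)).abs
    · rw [abs_mul]
      refine mul_le_mul_of_nonneg_right ?_ (abs_nonneg _)
      rw [abs_sub_comm]
      exact (hq y hy).le
  have : |∫ y in (-R)..R, g y • h y| ≤ 0 := by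
    refine le_of_forall_pos_le_add fun η hη => ?_
    -- Dividing by `N + 1` rather than `N` covers the case `N = 0`.
    have := key (η / (N + 1)) (by positivity)
    refine this.trans ?_
    rw [zero_add, div_mul_eq_mul_div, div_le_iff₀ (by positivity)]
    nlinarith
  exact abs_nonpos_iff.1 this

namespace IsEndpointSystem

variable {O : Set ℝ} {s : Finset ι} {a ε : ι → ℝ}

/-- A function `U` on `O` whose weak derivative on `O` is `f` and whose boundary values are `g`, in
the sense that integration by parts holds for all monomials, is a primitive of `f` with jumps `g`;
the energy identity follows. -/
theorem integral_two_mul (h : IsEndpointSystem O s a ε) {U f : ℝ → ℝ} {g : ι → ℝ}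
    (hU : Integrable U) (hf : Integrable f) (hU0 : ∀ y ∉ O, U y = 0) (hf0 : ∀ y ∉ O, f y = 0)
    (hk : ∀ k : ℕ, ∫ y, ((k : ℝ) * y ^ (k - 1) * U y + y ^ k * f y) =
      ∑ i ∈ s, ε i * a i ^ k * g i) :
    ∫ y, 2 * U y * f y = ∑ i ∈ s, ε i * g i ^ 2 := by
  classical
  obtain ⟨R, hR, hOR, haR⟩ := h.exists_bound
  have hle : -R ≤ R := by linarith
  have hUi : ∀ b c, IntervalIntegrable U volume b c := fun b c => hU.intervalIntegrable
  have hfi : ∀ b c, IntervalIntegrable f volume b c := fun b c => hf.intervalIntegrable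
  have hsupp : ∀ v : ℝ → ℝ, (∀ y ∉ O, v y = 0) → ∫ y, v y = ∫ y in (-R)..R, v y := by
    intro v hv
    refine (intervalIntegral.integral_eq_integral_of_support_subset fun y hy => ?_).symm
    by_contra hcon
    exact hy (hv y fun hyO => hcon (Set.Ioo_subset_Ioc_self (hOR hyO)))
  -- integration by parts against polynomials
  have hpoly : ∀ p : Polynomial ℝ,
      ∫ y in (-R)..R, p.derivative.eval y * U y + p.eval y * f y =
        ∑ i ∈ s, ε i * p.eval (a i) * g i := by
    intro p
    induction p using Polynomial.induction_on' with
    | add p q hp hq =>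
      have hpI : ∀ p : Polynomial ℝ, IntervalIntegrable
          (fun y => p.derivative.eval y * U y + p.eval y * f y) volume (-R) R := fun p =>
        ((hUi _ _).continuousOn_mul p.derivative.continuous.continuousOn).add
          ((hfi _ _).continuousOn_mul p.continuous.continuousOn)
      simp only [Polynomial.derivative_add, Polynomial.eval_add, mul_add, add_mul,
        Finset.sum_add_distrib]
      rw [← hp, ← hq, ← intervalIntegral.integral_add (hpI p) (hpI q)]
      refine intervalIntegral.integral_congr fun y _ => ?_
      ring
    | monomial k c =>
      have h1 := hk k
      rw [hsupp _ fun y hy => by rw [hU0 y hy, hf0 y hy]; ring] at h1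
      have h2 : ∑ i ∈ s, ε i * (Polynomial.monomial k c).eval (a i) * g i =
          c * ∑ i ∈ s, ε i * a i ^ k * g i := by
        rw [Finset.mul_sum]
        refine Finset.sum_congr rfl fun i _ => ?_
        rw [Polynomial.eval_monomial]
        ring
      rw [h2, ← h1, ← intervalIntegral.integral_const_mul]
      refine intervalIntegral.integral_congr fun y _ => ?_
      simp only [Polynomial.derivative_monomial, Polynomial.eval_monomial]
      ring
  set F : ℝ → ℝ := fun y => ∫ t in (-R)..y, f t with hF
  have hFac : AbsolutelyContinuousOnInterval F (-R) R :=
    (hfi (-R) R).absolutelyContinuousOnInterval_intervalIntegral (by simp)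
  have hFd : ∀ᵐ y : ℝ, y ∈ Set.uIoc (-R) R → deriv F y = f y := by
    filter_upwards [(hfi (-R) R).ae_hasDerivAt_integral] with y hy hy'
    exact (hy (Set.uIoc_subset_uIcc hy') (-R) (by simp)).deriv
  have hFc : Continuous F := by
    have := intervalIntegral.continuous_primitive (fun b c => hfi b c) (-R)
    exact this
  have hFm : F (-R) = 0 := intervalIntegral.integral_same
  have hFR : F R = ∑ i ∈ s, ε i * g i := by
    have h1 := hk 0
    rw [hsupp _ fun y hy => by rw [hU0 y hy, hf0 y hy]; ring] at h1
    simpa using h1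
  have hFsub : ∀ b, ∫ t in b..R, f t = F R - F b := fun b => by
    rw [hF]
    exact (intervalIntegral.integral_interval_sub_left (hfi _ _) (hfi _ _)).symm
  -- Extended by zero, `U` has distributional derivative `f` minus point masses `ε i * g i` at the
  -- end points. The candidate for `U` is therefore `m`: the continuous primitive `F` of `f` minus
  -- the corresponding steps.
  set J : ι → ℝ := fun i => ε i * g i with hJ
  set m : ℝ → ℝ := fun y => F y - ∑ i ∈ s, J i * (if a i < y then 1 else 0) with hm
  have hstepI : ∀ v : ℝ → ℝ, Continuous v → ∀ i,
      IntervalIntegrable (fun y => J i * (if a i < y then v y else 0)) volume (-R) R :=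
    fun v hv i => (intervalIntegrable_step (hv.intervalIntegrable _ _)).const_mul _
  have hmI : IntervalIntegrable m volume (-R) R := by
    refine (hFc.intervalIntegrable _ _).sub ?_
    exact intervalIntegrable_finset_sum fun i _ => hstepI (fun _ => 1) continuous_const i
  have hUm : ∀ᵐ y : ℝ, y ∈ Set.Ioo (-R) R → U y - m y = 0 := by
    refine ae_eq_zero_of_integral_polynomial hR ((hUi _ _).sub hmI) fun q => ?_
    -- The test polynomial is written as a derivative, because the assumed integration by parts
    -- controls `U` only through integrals against `p'`.
    obtain ⟨p, rfl⟩ := exists_derivative_eq q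
    have hp1 := hpoly p
    have hpac : AbsolutelyContinuousOnInterval (fun y => p.eval y) (-R) R := by
      have : ContDiffOn ℝ 1 (fun y => p.eval y) (Set.uIcc (-R) R) :=
        (by simpa using p.contDiff_aeval (𝕜 := ℝ) 1 : ContDiff ℝ 1 fun y => p.eval y).contDiffOn
      exact this.absolutelyContinuousOnInterval
    have hqF : ∫ y in (-R)..R, p.derivative.eval y * F y =
        p.eval R * F R - ∫ y in (-R)..R, p.eval y * f y := by
      have h1 := hFac.integral_mul_deriv_eq_deriv_mul hpac
      simp only [Polynomial.deriv, hFm, zero_mul, sub_zero] at h1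
      have h2 : ∫ y in (-R)..R, deriv F y * p.eval y = ∫ y in (-R)..R, p.eval y * f y := by
        refine intervalIntegral.integral_congr_ae ?_
        filter_upwards [hFd] with y hy hy'
        rw [hy hy', mul_comm]
      rw [h2] at h1
      rw [mul_comm (p.eval R), ← h1]
      refine intervalIntegral.integral_congr fun y _ => mul_comm _ _
    have hqs : ∀ i ∈ s, ∫ y in (-R)..R, J i * (if a i < y then p.derivative.eval y else 0) =
        J i * p.eval R - J i * p.eval (a i) := by
      intro i hi
      rw [intervalIntegral.integral_const_mul, integral_step (haR i hi),
        intervalIntegral.integral_eq_sub_of_hasDerivAt (fun y _ => p.hasDerivAt y)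
          (p.derivative.continuous.intervalIntegrable _ _), mul_sub]
    have hqU := (hUi (-R) R).continuousOn_mul p.derivative.continuous.continuousOn
    have hpf := (hfi (-R) R).continuousOn_mul p.continuous.continuousOn
    have hqF' : IntervalIntegrable (fun y => p.derivative.eval y * F y) volume (-R) R :=
      (p.derivative.continuous.mul hFc).intervalIntegrable _ _
    have hsum : IntervalIntegrable
        (fun y => ∑ i ∈ s, J i * (if a i < y then p.derivative.eval y else 0)) volume (-R) R :=
      intervalIntegrable_finset_sum fun i _ => hstepI _ p.derivative.continuous i
    have hexp : ∀ y, p.derivative.eval y * (U y - m y) = p.derivative.eval y * U y -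
        (p.derivative.eval y * F y -
          ∑ i ∈ s, J i * (if a i < y then p.derivative.eval y else 0)) := by
      intro y
      have : ∑ i ∈ s, J i * (if a i < y then p.derivative.eval y else 0) =
          p.derivative.eval y * ∑ i ∈ s, J i * (if a i < y then 1 else 0) := by
        rw [Finset.mul_sum]
        refine Finset.sum_congr rfl fun i _ => ?_
        split_ifs <;> ring
      rw [this, hm]
      ring
    simp only [hexp]
    rw [intervalIntegral.integral_sub hqU (hqF'.sub hsum),
      intervalIntegral.integral_sub hqF' hsum, hqF,
      intervalIntegral.integral_finsetSum fun i _ => hstepI _ p.derivative.continuous i,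
      Finset.sum_congr rfl hqs, Finset.sum_sub_distrib, ← Finset.sum_mul, hFR]
    rw [intervalIntegral.integral_add hqU hpf] at hp1
    have h3 : ∑ i ∈ s, J i * p.eval (a i) = ∑ i ∈ s, ε i * p.eval (a i) * g i :=
      Finset.sum_congr rfl fun i _ => by rw [hJ]; ring
    rw [h3, ← hp1]
    ring
  -- the primitive at the end points
  have hend : ∀ i ∈ s, J i * F (a i) =
      J i * ∑ j ∈ s, J j * (if a j < a i then 1 else 0) + (J i ^ 2 + ε i * g i ^ 2) / 2 := by
    intro i hi
    have hnear : Set.Ioo (-R) R ∈ 𝓝 (a i) := isOpen_Ioo.mem_nhds (haR i hi)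
    -- The value of `F` at an end point is read off from the side `l` outside `O`: there `U = 0`, so
    -- `m = 0` almost everywhere and `F` equals the sum of steps; continuity of `F` carries the
    -- value to `a i`.
    have hdiff : ∀ (C : ℝ) (l : Set ℝ), IsOpen l → l.Nonempty → a i ∈ closure l →
        (∀ᶠ y in 𝓝 (a i), y ∈ l → (y ∉ O ∧
          ∑ j ∈ s, J j * (if a j < y then 1 else 0) = C)) → F (a i) = C := by
      intro C l hl _ hcl hev
      by_contra hne
      have hev2 : ∀ᶠ y in 𝓝 (a i), F y ≠ C :=
        hFc.continuousAt.eventually (isOpen_ne.mem_nhds hne)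
      obtain ⟨W, hW, hWo, hWi⟩ := eventually_nhds_iff.1 ((hev.and hev2).and hnear)
      obtain ⟨y₀, hy₀⟩ := mem_closure_iff.1 hcl W hWo hWi
      have hpos : volume (W ∩ l) ≠ 0 := ((hWo.inter hl).measure_pos volume ⟨y₀, hy₀⟩).ne'
      obtain ⟨y, hyW, hy⟩ := Measure.exists_mem_of_measure_ne_zero_of_ae hpos (ae_restrict_of_ae hUm)
      obtain ⟨⟨h1, h2⟩, h3⟩ := hW y hyW.1
      obtain ⟨h4, h5⟩ := h1 hyW.2
      have h6 := hy h3
      rw [hU0 y h4, hm] at h6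
      simp only [h5] at h6
      exact h2 (by linarith)
    have hothers : ∀ᶠ y in 𝓝 (a i), ∀ j ∈ s.erase i, (a j < y ↔ a j < a i) := by
      refine (Finset.eventually_all _).2 fun j hj => ?_
      refine (eventually_step_eq fun hji => ?_).mono fun y hy => hy.1
      exact Finset.ne_of_mem_erase hj (h.injOn (Finset.mem_of_mem_erase hj) hi hji)
    have hsplit : ∀ y, (∀ j ∈ s.erase i, (a j < y ↔ a j < a i)) →
        ∑ j ∈ s, J j * (if a j < y then 1 else 0) = J i * (if a i < y then 1 else 0) +
          ∑ j ∈ s, J j * (if a j < a i then 1 else 0) := by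
      intro y hy
      rw [← Finset.add_sum_erase s _ hi, ← Finset.add_sum_erase s (fun j =>
        J j * (if a j < a i then (1 : ℝ) else 0)) hi]
      simp only [lt_irrefl, if_false, mul_zero, zero_add]
      congr 1
      refine Finset.sum_congr rfl fun j hj => ?_
      simp only [hy j hj]
    -- At a right end the exterior is to the right and the jump `J i` itself is counted; at a left
    -- end it is not. The term `(J i ^ 2 + ε i * g i ^ 2) / 2` expresses both cases, being `g i ^ 2`
    -- and `0` respectively, and it vanishes when `ε i = 0`.
    rcases h.sign i hi with ⟨he, hO⟩ | ⟨he, hO⟩ | ⟨he, hO⟩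
    · have := hdiff (J i + ∑ j ∈ s, J j * (if a j < a i then 1 else 0)) (Set.Ioi (a i)) isOpen_Ioi
        ⟨a i + 1, by simp⟩ (by simp [closure_Ioi]) (by
          filter_upwards [hO, hothers] with y hy1 hy2 hy3
          refine ⟨fun hyO => lt_asymm (hy1.1 hyO) hy3, ?_⟩
          rw [hsplit y hy2, if_pos (Set.mem_Ioi.1 hy3), mul_one])
      rw [this, hJ]
      simp only [he]
      ring
    · have := hdiff (∑ j ∈ s, J j * (if a j < a i then 1 else 0)) (Set.Iio (a i)) isOpen_Iio
        ⟨a i - 1, by simp⟩ (by simp [closure_Iio]) (by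
          filter_upwards [hO, hothers] with y hy1 hy2 hy3
          refine ⟨fun hyO => lt_asymm (hy1.1 hyO) hy3, ?_⟩
          rw [hsplit y hy2, if_neg (lt_asymm (Set.mem_Iio.1 hy3)), mul_zero, zero_add])
      rw [this, hJ]
      simp only [he]
      ring
    · simp [hJ, he]
  -- the energy
  have hFF : ∫ y in (-R)..R, 2 * F y * f y = F R ^ 2 := by
    have h1 := hFac.integral_deriv_mul_eq_sub hFac
    rw [hFm] at h1
    have h2 : ∫ y in (-R)..R, 2 * F y * f y =
        ∫ y in (-R)..R, deriv F y * F y + F y * deriv F y := by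
      refine intervalIntegral.integral_congr_ae ?_
      filter_upwards [hFd] with y hy hy'
      rw [hy hy']
      ring
    rw [h2, h1]
    ring
  have hfs : ∀ i, IntervalIntegrable (fun y => 2 * J i * (if a i < y then f y else 0)) volume
      (-R) R := fun i => (intervalIntegrable_step (hfi _ _)).const_mul _
  have hmain : ∫ y, 2 * U y * f y = F R ^ 2 - ∑ i ∈ s, 2 * J i * (F R - F (a i)) := by
    rw [hsupp _ fun y hy => by rw [hU0 y hy]; ring]
    have h1 : ∫ y in (-R)..R, 2 * U y * f y = ∫ y in (-R)..R, 2 * F y * f y -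
        ∑ i ∈ s, 2 * J i * (if a i < y then f y else 0) := by
      refine intervalIntegral.integral_congr_ae ?_
      have hR' : ∀ᵐ y : ℝ, y ≠ R := by simp [ae_iff, measure_singleton]
      filter_upwards [hUm, hR'] with y hy hyR hy'
      rw [Set.uIoc_of_le hle] at hy'
      have hyU : U y = m y := sub_eq_zero.1 (hy ⟨hy'.1, lt_of_le_of_ne hy'.2 hyR⟩)
      rw [hyU, hm]
      have : ∑ i ∈ s, 2 * J i * (if a i < y then f y else 0) =
          2 * f y * ∑ i ∈ s, J i * (if a i < y then 1 else 0) := by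
        rw [Finset.mul_sum]
        refine Finset.sum_congr rfl fun i _ => ?_
        split_ifs <;> ring
      rw [this]
      ring
    rw [h1, intervalIntegral.integral_sub _ (intervalIntegrable_finset_sum fun i _ => hfs i), hFF,
      intervalIntegral.integral_finsetSum fun i _ => hfs i]
    · congr 1
      refine Finset.sum_congr rfl fun i hi => ?_
      rw [intervalIntegral.integral_const_mul, integral_step (haR i hi), hFsub]
    · exact (hfi _ _).continuousOn_mul (continuous_const.mul hFc).continuousOn
  -- The square is expanded over pairs of jumps ordered by position. The end points are distinct, so
  -- the pairs are diagonal or strictly ordered; this removes the double sum left by the values `F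
  -- (a i)`.
  have hdouble : (∑ i ∈ s, J i) ^ 2 =
      2 * (∑ i ∈ s, J i * ∑ j ∈ s, J j * (if a j < a i then 1 else 0)) + ∑ i ∈ s, J i ^ 2 := by
    have h1 : ∀ i ∈ s, ∀ j ∈ s, J i * J j = J i * (J j * (if a j < a i then 1 else 0)) +
        J j * (J i * (if a i < a j then 1 else 0)) + (if i = j then J i ^ 2 else 0) := by
      intro i hi j hj
      rcases lt_trichotomy (a i) (a j) with hlt | heq | hgt
      · have : i ≠ j := fun hij => hlt.ne (by rw [hij])
        rw [if_neg hlt.not_gt, if_pos hlt, if_neg this]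
        ring
      · have : i = j := h.injOn hi hj heq
        subst this
        simp
        ring
      · have : i ≠ j := fun hij => hgt.ne (by rw [hij])
        rw [if_pos hgt, if_neg hgt.not_gt, if_neg this]
        ring
    rw [sq, Finset.sum_mul_sum, Finset.sum_congr rfl fun i hi => Finset.sum_congr rfl (h1 i hi)]
    simp only [Finset.sum_add_distrib, Finset.mul_sum]
    have h2 : ∑ i ∈ s, ∑ j ∈ s, J j * (J i * (if a i < a j then 1 else 0)) =
        ∑ i ∈ s, ∑ j ∈ s, J i * (J j * (if a j < a i then 1 else 0)) := Finset.sum_comm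
    rw [h2]
    have h3 : ∑ i ∈ s, ∑ j ∈ s, (if i = j then J i ^ 2 else 0) = ∑ i ∈ s, J i ^ 2 := by
      refine Finset.sum_congr rfl fun i hi => ?_
      rw [Finset.sum_ite_eq, if_pos hi]
    rw [h3]
    have h4 : ∑ i ∈ s, ∑ j ∈ s, 2 * (J i * (J j * (if a j < a i then 1 else 0))) =
        2 * ∑ i ∈ s, ∑ j ∈ s, J i * (J j * (if a j < a i then 1 else 0)) := by
      rw [Finset.mul_sum]
      exact Finset.sum_congr rfl fun i _ => (Finset.mul_sum _ _ _).symm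
    linarith [h4]
  have hfin : ∑ i ∈ s, 2 * J i * (F R - F (a i)) = 2 * F R ^ 2 -
      (2 * (∑ i ∈ s, J i * ∑ j ∈ s, J j * (if a j < a i then 1 else 0)) + ∑ i ∈ s, J i ^ 2) -
        ∑ i ∈ s, ε i * g i ^ 2 := by
    have h1 : ∀ i ∈ s, 2 * J i * (F R - F (a i)) = 2 * F R * J i -
        2 * (J i * ∑ j ∈ s, J j * (if a j < a i then 1 else 0)) - J i ^ 2 - ε i * g i ^ 2 := by
      intro i hi
      have := hend i hi
      linear_combination (-2) * this
    rw [Finset.sum_congr rfl h1]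
    simp only [Finset.sum_sub_distrib]
    rw [← Finset.mul_sum, ← Finset.mul_sum, hFR]
    ring
  rw [hmain, hfin, ← hdouble, hFR]
  ring

end IsEndpointSystem

end Line

/-! ### Slicing a polytope into time lines -/

section Slicing

variable {n : ℕ}

theorem ae_inner_ne {E : Type*} [NormedAddCommGroup E] [InnerProductSpace ℝ E]
    [FiniteDimensional ℝ E] [MeasurableSpace E] [BorelSpace E] {v : E} (hv : v ≠ 0) (c : ℝ) :
    ∀ᵐ x : E, ⟪v, x⟫ ≠ c := by
  rw [ae_iff]
  simp only [ne_eq, not_not]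
  rcases Set.eq_empty_or_nonempty {x : E | ⟪v, x⟫ = c} with he | ⟨x₀, hx₀⟩
  · rw [he, measure_empty]
  have hset : {x : E | ⟪v, x⟫ = c} =
      (AffineSubspace.mk' x₀ (LinearMap.ker (innerₗ (E) v)) : Set (E)) := by
    ext x
    have : ⟪v, x₀⟫ = c := hx₀
    simp [inner_sub_right, this, sub_eq_zero]
  rw [hset]
  refine Measure.addHaar_affineSubspace _ _ fun htop => hv ?_
  have h1 := congrArg AffineSubspace.direction htop
  rw [AffineSubspace.direction_mk', AffineSubspace.direction_top] at h1
  have h2 : v ∈ LinearMap.ker (innerₗ (E) v) := by rw [h1]; trivial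
  simpa using h2

/-- A hyperplane may be listed several times with different scalings of its normal. Passing to slope
and intercept removes the scaling, so parallel hyperplanes through a common point receive the same
index. -/
theorem graphMap_injective_index {p p' : Space n × ℝ} {z : SpaceTime n} {h h' : SpaceTime n × ℝ}
    (hs : h.1.snd ≠ 0) (hs' : h'.1.snd ≠ 0) (hp : p.1 = -(h.1.snd)⁻¹ • h.1.fst)
    (hp' : p'.1 = -(h'.1.snd)⁻¹ • h'.1.fst) (hz : z ∈ Set.range (graphMap p))
    (hz' : z ∈ Set.range (graphMap p')) (hpar : ∃ a : ℝ, h'.1 = a • h.1) : p = p' := by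
  obtain ⟨a, ha⟩ := hpar
  have h1 : h'.1.snd = a * h.1.snd := by rw [ha]; rfl
  have h2 : h'.1.fst = a • h.1.fst := by rw [ha]; rfl
  have ha0 : a ≠ 0 := by
    rintro rfl
    exact hs' (by rw [h1, zero_mul])
  have h3 : p.1 = p'.1 := by
    rw [hp, hp', h1, h2, smul_smul]
    congr 1
    field_simp
  rw [mem_range_graphMap] at hz hz'
  refine Prod.ext h3 ?_
  rw [← h3] at hz'
  linarith

theorem inner_eq_iff_mem_range_graphMap {h z : SpaceTime n} {b : ℝ} (hs : h.snd ≠ 0) :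
    ⟪h, z⟫ = b ↔ z ∈ Set.range (graphMap (-(h.snd)⁻¹ • h.fst, b / h.snd)) := by
  rw [mem_range_graphMap, inner_spaceTime, real_inner_smul_left]
  constructor
  · intro hb
    rw [← hb]
    field_simp
    ring
  · intro hb
    rw [hb]
    field_simp
    ring

/-- The time slice of a set over the point `x`. -/
def timeSlice (K : Set (SpaceTime n)) (x : Space n) : Set ℝ := {t | WithLp.toLp 2 (x, t) ∈ K}

/-- The sign of the time component of the outward normal. -/
def normalSign (K : Set (SpaceTime n)) (z : SpaceTime n) : ℝ :=
  Real.sign (outerNormal K z).snd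

/-- The boundary of a Lipschitz polytope lies, up to parts with horizontal normal, in finitely many
graphs over space, and almost every time slice is an open set with end points on these graphs. -/
theorem IsLipschitzPolytope.exists_graphs {K : Set (SpaceTime n)} (hK : IsLipschitzPolytope K) :
    ∃ A : Finset (Space n × ℝ),
      (∀ᵐ x : Space n, IsEndpointSystem (timeSlice K x) A (fun p => ⟪p.1, x⟫ + p.2)
        (fun p => normalSign K (graphMap p x))) ∧
      (∀ᵐ z ∂surf n, (outerNormal K z).snd ≠ 0 → ∃ p ∈ A, z ∈ Set.range (graphMap p) ∧
        slope p * |(outerNormal K z).snd| = 1 ∧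
        ∀ p' ∈ A, z ∈ Set.range (graphMap p') → p' = p) := by
  classical
  obtain ⟨H, hH, hcov⟩ := hK.flat
  -- Slope and intercept come from solving `⟪h, z⟫ = b` for the time coordinate.
  set G : SpaceTime n × ℝ → Space n × ℝ := fun h => (-(h.1.snd)⁻¹ • h.1.fst, h.2 / h.1.snd) with hG
  set A := (H.filter fun h => h.1.snd ≠ 0).image G with hA
  have hAmem : ∀ p ∈ A, ∃ h ∈ H, h.1.snd ≠ 0 ∧ p = G h := by
    intro p hp
    obtain ⟨h, hh, rfl⟩ := Finset.mem_image.1 hp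
    rw [Finset.mem_filter] at hh
    exact ⟨h, hh.1, hh.2, rfl⟩
  have hnormal : ∀ z ∈ frontier K, NoCrossing H z → ∀ h ∈ H, ⟪h.1, z⟫ = h.2 →
      ∃ ν, IsOuterNormal K z ν ∧ (ν = ‖h.1‖⁻¹ • h.1 ∨ ν = -(‖h.1‖⁻¹ • h.1)) := by
    intro z hz hzH h hh hzh
    obtain ⟨r, hr, hflat⟩ := hzH.flatAt hh hzh
    have h1 : ‖‖h.1‖⁻¹ • h.1‖ = 1 := norm_smul_inv_norm (𝕜 := ℝ) (hH h hh)
    rcases hK.isOuterNormal_or hz h1 hr fun y hy hyf => by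
      obtain ⟨h', hh', hy'⟩ := Set.mem_iUnion₂.1 (hcov hyf)
      exact hflat h' hh' y hy hy' with h2 | h2
    · exact ⟨_, h2, Or.inl rfl⟩
    · exact ⟨_, h2, Or.inr rfl⟩
  refine ⟨A, ?_, ?_⟩
  -- Three null sets of `x` are discarded: those whose line meets a graph at a crossing of
  -- hyperplanes, those over which two graphs coincide, and those whose line lies in a hyperplane
  -- parallel to the time axis.
  · have h1 : ∀ᵐ x : Space n, ∀ p ∈ A, NoCrossing H (graphMap p x) :=
      (ae_ball_iff A.countable_toSet).2 fun p _ => ae_graphMap (ae_noCrossing hH) p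
    have h2 : ∀ᵐ x : Space n, ∀ p ∈ A, ∀ p' ∈ A, p ≠ p' → ⟪p.1, x⟫ + p.2 ≠ ⟪p'.1, x⟫ + p'.2 := by
      refine (ae_ball_iff A.countable_toSet).2 fun p _ => (ae_ball_iff A.countable_toSet).2
        fun p' _ => ?_
      by_cases hpp : p.1 = p'.1
      · refine Eventually.of_forall fun x hne heq => hne (Prod.ext hpp ?_)
        rw [hpp] at heq
        linarith
      · filter_upwards [ae_inner_ne (sub_ne_zero.2 hpp) (p'.2 - p.2)] with x hx _ heq
        rw [inner_sub_left] at hx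
        exact hx (by linarith)
    have h3 : ∀ᵐ x : Space n, ∀ h ∈ H, h.1.snd = 0 → ⟪h.1.fst, x⟫ ≠ h.2 := by
      refine (ae_ball_iff H.countable_toSet).2 fun h hh => ?_
      by_cases hs : h.1.snd = 0
      · have hf : h.1.fst ≠ 0 := by
          intro hf
          have := norm_sq_spaceTime h.1
          rw [hf, hs] at this
          simp at this
          exact hH h hh this
        filter_upwards [ae_inner_ne hf h.2] with x hx _ using hx
      · exact Eventually.of_forall fun _ h => absurd h hs
    filter_upwards [h1, h2, h3] with x hx1 hx2 hx3
    have hline : Continuous fun t : ℝ => (WithLp.toLp 2 (x, t) : SpaceTime n) := by fun_prop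
    have hgm : ∀ p : Space n × ℝ, graphMap p x = WithLp.toLp 2 (x, ⟪p.1, x⟫ + p.2) := fun _ => rfl
    refine ⟨?_, hK.isOpen.preimage hline, ?_, ?_, ?_⟩
    · obtain ⟨R, hR⟩ := hK.isBounded.subset_closedBall 0
      refine (Metric.isBounded_closedBall (x := (0 : ℝ)) (r := R)).subset fun t ht => ?_
      have h4 := hR ht
      rw [mem_closedBall_zero_iff] at h4 ⊢
      refine le_trans ?_ h4
      rw [Real.norm_eq_abs]
      refine abs_le_of_sq_le_sq ?_ (norm_nonneg _)
      rw [norm_sq_spaceTime]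
      exact le_add_of_nonneg_left (sq_nonneg _)
    · intro p hp p' hp' heq
      by_contra hne
      exact hx2 p hp p' hp' hne heq
    · intro t ht
      have h4 := hline.frontier_preimage_subset K ht
      obtain ⟨h, hh, hy⟩ := Set.mem_iUnion₂.1 (hcov h4)
      have hy' : ⟪h.1, (WithLp.toLp 2 (x, t) : SpaceTime n)⟫ = h.2 := hy
      have hs : h.1.snd ≠ 0 := by
        intro hs
        rw [inner_spaceTime, hs, zero_mul, add_zero] at hy'
        exact hx3 h hh hs hy'
      refine ⟨G h, Finset.mem_coe.2 (Finset.mem_image_of_mem _ (Finset.mem_filter.2 ⟨hh, hs⟩)), ?_⟩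
      rw [inner_eq_iff_mem_range_graphMap hs, mem_range_graphMap] at hy'
      exact hy'.symm
    · intro p hp
      obtain ⟨h, hh, hs, rfl⟩ := hAmem p hp
      by_cases hz : graphMap (G h) x ∈ frontier K
      · have hzh : ⟪h.1, graphMap (G h) x⟫ = h.2 :=
          (inner_eq_iff_mem_range_graphMap hs).2 ⟨x, rfl⟩
        obtain ⟨ν, hν, hνh⟩ := hnormal _ hz (hx1 _ hp) h hh hzh
        have hνs : ν.snd ≠ 0 := by
          have h5 : ‖h.1‖⁻¹ * h.1.snd ≠ 0 :=
            mul_ne_zero (inv_ne_zero (norm_ne_zero_iff.2 (hH h hh))) hs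
          rcases hνh with rfl | rfl
          · exact h5
          · exact neg_ne_zero.2 h5
        have hsign : normalSign K (graphMap (G h) x) = Real.sign ν.snd := by
          rw [normalSign, hν.outerNormal_eq]
        obtain ⟨-, r, hr, hball⟩ := hν
        have hev : ∀ᶠ t in 𝓝 (⟪(G h).1, x⟫ + (G h).2),
            t ∈ timeSlice K x ↔ (t - (⟪(G h).1, x⟫ + (G h).2)) * ν.snd < 0 := by
          have h6 := hline.continuousAt.eventually (Metric.ball_mem_nhds
            (WithLp.toLp 2 (x, ⟪(G h).1, x⟫ + (G h).2) : SpaceTime n) hr)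
          filter_upwards [h6] with t ht
          have h7 := hball _ ht
          rw [inner_spaceTime] at h7
          have h8 : ((WithLp.toLp 2 (x, t) : SpaceTime n) - graphMap (G h) x).fst = 0 := by
            rw [hgm]
            simp
          have h9 : ((WithLp.toLp 2 (x, t) : SpaceTime n) - graphMap (G h) x).snd =
              t - (⟪(G h).1, x⟫ + (G h).2) := by
            rw [hgm]
            simp
          rw [h8, h9, inner_zero_left, zero_add] at h7
          exact h7
        rcases lt_or_gt_of_ne hνs with hlt | hgt
        · refine Or.inr (Or.inl ⟨by rw [hsign, Real.sign_of_neg hlt], ?_⟩)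
          filter_upwards [hev] with t ht
          rw [ht, mul_neg_iff]
          constructor
          · rintro (⟨h6, -⟩ | ⟨-, h6⟩)
            · linarith
            · linarith
          · exact fun h6 => Or.inl ⟨by linarith, hlt⟩
        · refine Or.inl ⟨by rw [hsign, Real.sign_of_pos hgt], ?_⟩
          filter_upwards [hev] with t ht
          rw [ht, mul_neg_iff]
          constructor
          · rintro (⟨-, h6⟩ | ⟨h6, -⟩)
            · linarith
            · linarith
          · exact fun h6 => Or.inr ⟨by linarith, hgt⟩
      -- The graphs extend beyond the faces of `K`. At such spurious points the default normal `0`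
      -- gives sign `0`, the third alternative in the end point system.
      · refine Or.inr (Or.inr ⟨?_, fun hf => hz (hline.frontier_preimage_subset K hf)⟩)
        rw [normalSign, outerNormal_eq_zero_of_notMem_frontier hz]
        exact Real.sign_zero
  · filter_upwards [ae_noCrossing hH] with z hzH hne
    have hz : z ∈ frontier K := by
      by_contra hz
      rw [outerNormal_eq_zero_of_notMem_frontier hz] at hne
      exact hne rfl
    obtain ⟨h, hh, hzh⟩ := Set.mem_iUnion₂.1 (hcov hz)
    obtain ⟨ν, hν, hνh⟩ := hnormal z hz hzH h hh hzh
    rw [hν.outerNormal_eq] at hne ⊢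
    have habs : |ν.snd| = ‖h.1‖⁻¹ * |h.1.snd| := by
      have h5 : |‖h.1‖⁻¹ * h.1.snd| = ‖h.1‖⁻¹ * |h.1.snd| := by
        rw [abs_mul, abs_of_nonneg (inv_nonneg.2 (norm_nonneg _))]
      rcases hνh with rfl | rfl
      · exact h5
      · rw [← h5, ← abs_neg]
        congr 1
        exact neg_neg _
    have hs : h.1.snd ≠ 0 := by
      intro hs
      rw [hs, abs_zero, mul_zero, abs_eq_zero] at habs
      exact hne habs
    have hn0 : 0 < ‖h.1‖ := norm_pos_iff.2 (hH h hh)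
    refine ⟨G h, Finset.mem_image_of_mem _ (Finset.mem_filter.2 ⟨hh, hs⟩),
      (inner_eq_iff_mem_range_graphMap hs).1 hzh, ?_, ?_⟩
    -- The area factor of the graph is the reciprocal of the time component of its unit normal.
    · have hslope : slope (G h) = ‖h.1‖ / |h.1.snd| := by
        rw [slope, Real.sqrt_eq_iff_eq_sq (by positivity) (by positivity), div_pow, sq_abs,
          norm_sq_spaceTime, hG]
        simp only [norm_smul, norm_neg, norm_inv, Real.norm_eq_abs, mul_pow, inv_pow, sq_abs]
        field_simp
        ring
      have := abs_pos.2 hs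
      rw [hslope, habs]
      field_simp
    · intro p' hp' hzp'
      obtain ⟨h', hh', hs', rfl⟩ := hAmem p' hp'
      have hzh' : ⟪h'.1, z⟫ = h'.2 := (inner_eq_iff_mem_range_graphMap hs').2 hzp'
      exact (graphMap_injective_index hs hs' rfl rfl
        ((inner_eq_iff_mem_range_graphMap hs).1 hzh) hzp' (hzH h hh h' hh' hzh hzh')).symm

/-- Surface integrals against the time component of the normal, as integrals over space. -/
theorem integral_normal_snd_mul {K : Set (SpaceTime n)} {A : Finset (Space n × ℝ)}
    (hA : ∀ᵐ z ∂surf n, (outerNormal K z).snd ≠ 0 → ∃ p ∈ A, z ∈ Set.range (graphMap p) ∧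
        slope p * |(outerNormal K z).snd| = 1 ∧
        ∀ p' ∈ A, z ∈ Set.range (graphMap p') → p' = p) {ψ : SpaceTime n → ℝ}
    (hψ : IntegrableOn (fun z => (outerNormal K z).snd * ψ z) (frontier K) (surf n)) :
    (∀ p ∈ A, Integrable fun x => normalSign K (graphMap p x) * ψ (graphMap p x)) ∧
    ∫ z in frontier K, (outerNormal K z).snd * ψ z ∂surf n =
      ∫ x, ∑ p ∈ A, normalSign K (graphMap p x) * ψ (graphMap p x) := by
  classical
  set f : SpaceTime n → ℝ := fun z => (outerNormal K z).snd * ψ z with hf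
  have hf0 : ∀ z, z ∉ frontier K → f z = 0 := fun z hz => by
    rw [hf]
    simp only [outerNormal_eq_zero_of_notMem_frontier hz]
    exact zero_mul _
  have hfi : Integrable f (surf n) := (integrableOn_iff_integrable_of_support_subset
    (Function.support_subset_iff'.2 hf0)).1 hψ
  -- Almost every point where the integrand is nonzero lies on exactly one graph.
  have hsum : f =ᵐ[surf n] fun z => ∑ p ∈ A, (Set.range (graphMap p)).indicator f z := by
    filter_upwards [hA] with z hz
    by_cases hne : (outerNormal K z).snd = 0
    · have : f z = 0 := by rw [hf]; simp only [hne, zero_mul]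
      rw [this]
      refine (Finset.sum_eq_zero fun p _ => ?_).symm
      rw [Set.indicator_apply, this, ite_self]
    · obtain ⟨p, hp, hzp, -, huniq⟩ := hz hne
      rw [Finset.sum_eq_single_of_mem p hp fun p' hp' hpp' =>
        Set.indicator_of_notMem (fun hz' => hpp' (huniq p' hp' hz')) _, Set.indicator_of_mem hzp]
  -- In the coordinates of the graph, the area factor cancels the size of the time component of the
  -- normal and only its sign survives.
  have hslope : ∀ p ∈ A, ∀ᵐ x : Space n, slope p * f (graphMap p x) =
      normalSign K (graphMap p x) * ψ (graphMap p x) := by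
    intro p hp
    filter_upwards [ae_graphMap hA p] with x hx
    by_cases hne : (outerNormal K (graphMap p x)).snd = 0
    · simp only [hf, normalSign, hne, zero_mul, mul_zero, Real.sign_zero]
    · obtain ⟨p₁, hp₁, -, hsl, huniq⟩ := hx hne
      obtain rfl := huniq p hp ⟨x, rfl⟩
      simp only [hf, normalSign]
      rw [← mul_assoc]
      congr 1
      rcases lt_or_gt_of_ne hne with hlt | hgt
      · rw [Real.sign_of_neg hlt]
        rw [abs_of_neg hlt] at hsl
        linarith
      · rw [Real.sign_of_pos hgt]
        rw [abs_of_pos hgt] at hsl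
        linarith
  have hint : ∀ p, Integrable fun x => f (graphMap p x) := fun p =>
    (integrableOn_range_graphMap p f).1 hfi.integrableOn
  have hint2 : ∀ p ∈ A, Integrable fun x => normalSign K (graphMap p x) * ψ (graphMap p x) :=
    fun p hp => ((hint p).const_mul (slope p)).congr (hslope p hp)
  refine ⟨hint2, ?_⟩
  have hmeas : ∀ p : Space n × ℝ, MeasurableSet (Set.range (graphMap p)) :=
    fun p => (measurableEmbedding_graphMap p).measurableSet_range
  rw [setIntegral_eq_integral_of_forall_compl_eq_zero hf0, integral_congr_ae hsum,
    integral_finsetSum A fun p _ => hfi.indicator (hmeas p), integral_finsetSum A hint2]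
  refine Finset.sum_congr rfl fun p hp => ?_
  rw [integral_indicator (hmeas p), setIntegral_range_graphMap, smul_eq_mul,
    ← integral_const_mul, integral_congr_ae (hslope p hp)]

theorem integral_spaceTime {f : SpaceTime n → ℝ} (hf : Integrable f) :
    ∫ z, f z = ∫ x : Space n, ∫ t : ℝ, f (WithLp.toLp 2 (x, t)) := by
  have h1 := WithLp.volume_preserving_toLp (U := Space n) (V := ℝ)
  have hemb : MeasurableEmbedding (WithLp.toLp 2 : Space n × ℝ → SpaceTime n) :=
    (MeasurableEquiv.toLp 2 (Space n × ℝ)).measurableEmbedding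
  rw [← h1.integral_comp hemb]
  exact integral_prod _ ((h1.integrable_comp_emb hemb).2 hf)

theorem integrable_spaceTime {f : SpaceTime n → ℝ} (hf : Integrable f) :
    (∀ᵐ x : Space n, Integrable fun t : ℝ => f (WithLp.toLp 2 (x, t))) ∧
    Integrable fun x : Space n => ∫ t : ℝ, f (WithLp.toLp 2 (x, t)) := by
  have h1 := WithLp.volume_preserving_toLp (U := Space n) (V := ℝ)
  have hemb : MeasurableEmbedding (WithLp.toLp 2 : Space n × ℝ → SpaceTime n) :=
    (MeasurableEquiv.toLp 2 (Space n × ℝ)).measurableEmbedding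
  have h2 : Integrable (f ∘ WithLp.toLp 2) ((volume : Measure (Space n)).prod (volume : Measure ℝ)) :=
    (h1.integrable_comp_emb hemb).2 hf
  exact ⟨h2.prod_right_ae, h2.integral_prod_left⟩

end Slicing

/-! ### The divergence theorem -/

section Divergence

theorem integrableOn_continuous_mul {X : Type*} [PseudoMetricSpace X] [ProperSpace X]
    [MeasurableSpace X] [OpensMeasurableSpace X] {μ : Measure X} {s : Set X}
    (hs : Bornology.IsBounded s) (hsm : MeasurableSet s) {φ u : X → ℝ} (hφ : Continuous φ)
    (hu : IntegrableOn u s μ) : IntegrableOn (fun z => φ z * u z) s μ := by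
  obtain ⟨C, hC⟩ := (hs.isCompact_closure.image hφ).isBounded.exists_norm_le
  refine Integrable.bdd_mul (c := C) hu hφ.aestronglyMeasurable ?_
  filter_upwards [ae_restrict_mem hsm] with z hz
  exact hC _ ⟨z, subset_closure hz, rfl⟩

theorem memLp_continuous_mul {X : Type*} [PseudoMetricSpace X] [ProperSpace X]
    [MeasurableSpace X] [OpensMeasurableSpace X] {F : Type*} [NormedAddCommGroup F]
    [NormedSpace ℝ F] {μ : Measure X} {s : Set X}
    (hs : Bornology.IsBounded s) (hsm : MeasurableSet s) {φ : X → ℝ} {u : X → F}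
    (hφ : Continuous φ) (hu : MemLp u 2 (μ.restrict s)) :
    MemLp (fun z => φ z • u z) 2 (μ.restrict s) := by
  obtain ⟨C, hC⟩ := (hs.isCompact_closure.image hφ).isBounded.exists_norm_le
  refine MemLp.of_le_mul (c := C) hu (hφ.aestronglyMeasurable.smul hu.1) ?_
  filter_upwards [ae_restrict_mem hsm] with z hz
  rw [norm_smul]
  exact mul_le_mul_of_nonneg_right (hC _ ⟨z, subset_closure hz, rfl⟩) (norm_nonneg _)

/-! ### Gradients of products, along lines and under isometries. -/

section Gradient

variable {E : Type*} [NormedAddCommGroup E] [InnerProductSpace ℝ E] [CompleteSpace E]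

theorem inner_gradient (φ : E → ℝ) (z v : E) : ⟪gradient φ z, v⟫ = fderiv ℝ φ z v :=
  InnerProductSpace.toDual_symm_apply

theorem continuous_gradient {φ : E → ℝ} (hφ : ContDiff ℝ ∞ φ) : Continuous (gradient φ) :=
  (InnerProductSpace.toDual ℝ E).symm.continuous.comp (hφ.continuous_fderiv (by simp))

theorem gradient_mul {φ ψ : E → ℝ} (hφ : ContDiff ℝ ∞ φ) (hψ : ContDiff ℝ ∞ ψ) (z : E) :
    gradient (fun y => φ y * ψ y) z = φ z • gradient ψ z + ψ z • gradient φ z := by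
  refine ext_inner_right ℝ fun v => ?_
  have h1 := (hφ.differentiable (by simp)).differentiableAt (x := z)
  have h2 := (hψ.differentiable (by simp)).differentiableAt (x := z)
  rw [inner_gradient, fderiv_fun_mul h1 h2, inner_add_left, real_inner_smul_left,
    real_inner_smul_left, inner_gradient, inner_gradient]
  simp

theorem hasDerivAt_along {φ : E → ℝ} (hφ : ContDiff ℝ ∞ φ) (x v : E) (t : ℝ) :
    HasDerivAt (fun t : ℝ => φ (x + t • v)) ⟪gradient φ (x + t • v), v⟫ t := by
  rw [inner_gradient]
  have h1 : HasDerivAt (fun t : ℝ => x + t • v) v t := by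
    simpa using ((hasDerivAt_id t).smul_const v).const_add x
  exact ((hφ.differentiable (by simp)) _).hasFDerivAt.comp_hasDerivAt t h1

theorem gradient_comp_isometry {φ : E → ℝ} (hφ : ContDiff ℝ ∞ φ) (R : E ≃ₗᵢ[ℝ] E) (z : E) :
    gradient (fun y => φ (R y)) z = R.symm (gradient φ (R z)) := by
  refine ext_inner_right ℝ fun v => ?_
  have h1 : HasFDerivAt (fun y => φ (R y))
      ((fderiv ℝ φ (R z)).comp (R.toContinuousLinearEquiv : E →L[ℝ] E)) z :=
    ((hφ.differentiable (by simp)) _).hasFDerivAt.comp z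
      (R.toContinuousLinearEquiv : E →L[ℝ] E).hasFDerivAt
  rw [inner_gradient, h1.fderiv, ← R.inner_map_map, R.apply_symm_apply, inner_gradient]
  rfl

end Gradient

variable {n : ℕ}

theorem inner_eT (z : SpaceTime n) : ⟪z, AcousticProblem.eT n⟫ = z.snd := by
  rw [inner_spaceTime]
  simp [AcousticProblem.eT]

theorem norm_eT : ‖AcousticProblem.eT n‖ = 1 := by
  have := norm_sq_spaceTime (AcousticProblem.eT n)
  simp only [AcousticProblem.eT] at this ⊢
  simp

theorem hasDerivAt_timeLine {φ : SpaceTime n → ℝ} (hφ : ContDiff ℝ ∞ φ) (x : Space n) (t : ℝ) :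
    HasDerivAt (fun t : ℝ => φ (WithLp.toLp 2 (x, t)))
      (gradient φ (WithLp.toLp 2 (x, t))).snd t := by
  have h2 : ∀ t : ℝ, (WithLp.toLp 2 (x, t) : SpaceTime n) =
      WithLp.toLp 2 (x, 0) + t • AcousticProblem.eT n := by
    intro t
    rw [AcousticProblem.eT, ← WithLp.toLp_smul, ← WithLp.toLp_add]
    simp
  have h3 : (fun t : ℝ => φ (WithLp.toLp 2 (x, t))) =
      fun t => φ (WithLp.toLp 2 (x, 0) + t • AcousticProblem.eT n) := funext fun t => by rw [← h2 t]
  rw [h3, h2 t, ← inner_eT]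
  exact hasDerivAt_along hφ _ _ t

theorem norm_outerNormal_le {E : Type*} [NormedAddCommGroup E] [InnerProductSpace ℝ E]
    (K : Set E) (z : E) : ‖outerNormal K z‖ ≤ 1 := by
  by_cases h : outerNormal K z = 0
  · simp [h]
  · exact (isOuterNormal_outerNormal h).1.le

theorem norm_fst_le (z : SpaceTime n) : ‖z.fst‖ ≤ ‖z‖ := by
  refine abs_le_of_sq_le_sq' ?_ (norm_nonneg _) |>.2
  rw [norm_sq_spaceTime]
  exact le_add_of_nonneg_right (sq_nonneg _)

theorem abs_snd_le (z : SpaceTime n) : |z.snd| ≤ ‖z‖ := by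
  refine abs_le_of_sq_le_sq ?_ (norm_nonneg _)
  rw [norm_sq_spaceTime]
  exact le_add_of_nonneg_left (sq_nonneg _)

namespace IsLipschitzPolytope

variable {K : Set (SpaceTime n)}

theorem measurableSet (hK : IsLipschitzPolytope K) : MeasurableSet K := hK.isOpen.measurableSet

theorem isFiniteMeasure (hK : IsLipschitzPolytope K) : IsFiniteMeasure (volume.restrict K) :=
  ⟨by rw [Measure.restrict_apply_univ]; exact hK.isBounded.measure_lt_top⟩

theorem isFiniteMeasure_frontier (hK : IsLipschitzPolytope K) :
    IsFiniteMeasure ((surf n).restrict (frontier K)) :=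
  ⟨by rw [Measure.restrict_apply_univ]; exact surf_frontier_lt_top hK⟩

theorem isBounded_frontier (hK : IsLipschitzPolytope K) : Bornology.IsBounded (frontier K) :=
  hK.isBounded.closure.subset frontier_subset_closure

theorem integrable_of_memLp (hK : IsLipschitzPolytope K) {F : Type*} [NormedAddCommGroup F]
    {u : SpaceTime n → F} (hu : MemLp u 2 (volume.restrict K)) : IntegrableOn u K :=
  have := hK.isFiniteMeasure
  hu.integrable (by norm_num)

theorem integrable_of_memLp_frontier (hK : IsLipschitzPolytope K) {F : Type*}
    [NormedAddCommGroup F] {u : SpaceTime n → F} (hu : MemLp u 2 ((surf n).restrict (frontier K))) :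
    IntegrableOn u (frontier K) (surf n) :=
  have := hK.isFiniteMeasure_frontier
  hu.integrable (by norm_num)

theorem measurable_normal_snd (hK : IsLipschitzPolytope K) :
    Measurable fun z => (outerNormal K z).snd :=
  continuous_snd_spaceTime.measurable.comp (measurable_outerNormal hK.isOpen)

theorem measurable_normal_fst (hK : IsLipschitzPolytope K) :
    Measurable fun z => (outerNormal K z).fst :=
  continuous_fst_spaceTime.measurable.comp (measurable_outerNormal hK.isOpen)

theorem integrable_normal_snd_mul (hK : IsLipschitzPolytope K) {μ : Measure (SpaceTime n)}
    {u : SpaceTime n → ℝ} (hu : Integrable u μ) :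
    Integrable (fun z => (outerNormal K z).snd * u z) μ :=
  hu.bdd_mul (c := 1) hK.measurable_normal_snd.aestronglyMeasurable
    (Eventually.of_forall fun z => (abs_snd_le _).trans (norm_outerNormal_le K z))

theorem integrable_continuous (hK : IsLipschitzPolytope K) {φ : SpaceTime n → ℝ}
    (hφ : Continuous φ) : IntegrableOn φ K := by
  have := hK.isFiniteMeasure
  have := integrableOn_continuous_mul (μ := volume) hK.isBounded hK.measurableSet hφ
    (u := fun _ => 1) (integrable_const _)
  simpa using this

theorem integrable_continuous_frontier (hK : IsLipschitzPolytope K) {φ : SpaceTime n → ℝ}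
    (hφ : Continuous φ) : IntegrableOn φ (frontier K) (surf n) := by
  have := hK.isFiniteMeasure_frontier
  have := integrableOn_continuous_mul (μ := surf n) hK.isBounded_frontier
    isClosed_frontier.measurableSet hφ (u := fun _ => 1) (integrable_const _)
  simpa using this

theorem indicator_timeLine (x : Space n) (t : ℝ) (f : SpaceTime n → ℝ) :
    K.indicator f (WithLp.toLp 2 (x, t)) =
      (timeSlice K x).indicator (fun t => f (WithLp.toLp 2 (x, t))) t := rfl

/-- By Fubini, the fundamental theorem of calculus applies on almost every time slice; the end point
values, with their signs, are the surface integral written over the graphs. -/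
theorem integral_gradient_snd (hK : IsLipschitzPolytope K) {φ : SpaceTime n → ℝ}
    (hφ : ContDiff ℝ ∞ φ) :
    ∫ z in K, (gradient φ z).snd = ∫ z in frontier K, (outerNormal K z).snd * φ z ∂surf n := by
  obtain ⟨A, hA1, hA2⟩ := hK.exists_graphs
  have hg : Continuous fun z => (gradient φ z).snd :=
    continuous_snd_spaceTime.comp (continuous_gradient hφ)
  rw [(integral_normal_snd_mul hA2 (hK.integrable_normal_snd_mul
    (hK.integrable_continuous_frontier hφ.continuous))).2, ← integral_indicator hK.measurableSet,
    integral_spaceTime ((integrable_indicator_iff hK.measurableSet).2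
      (hK.integrable_continuous hg))]
  refine integral_congr_ae ?_
  filter_upwards [hA1] with x hx
  simp only [indicator_timeLine]
  rw [integral_indicator hx.isOpen.measurableSet]
  have hline : Continuous fun t : ℝ => (WithLp.toLp 2 (x, t) : SpaceTime n) := by fun_prop
  exact hx.integral_deriv (fun t => hasDerivAt_timeLine hφ x t) (hg.comp hline)

/-! #### Isometries -/

theorem preimage (hK : IsLipschitzPolytope K) (R : SpaceTime n ≃ₗᵢ[ℝ] SpaceTime n) :
    IsLipschitzPolytope (R ⁻¹' K) where
  nonempty := hK.nonempty.preimage R.surjective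
  isOpen := hK.isOpen.preimage R.continuous
  isBounded := R.antilipschitz.isBounded_preimage hK.isBounded
  flat := by
    classical
    obtain ⟨H, hH, hcov⟩ := hK.flat
    refine ⟨H.image fun h => (R.symm h.1, h.2), fun h hh => ?_, fun y hy => ?_⟩
    · obtain ⟨h', hh', rfl⟩ := Finset.mem_image.1 hh
      simpa using hH h' hh'
    · have h1 : R y ∈ frontier K := R.continuous.frontier_preimage_subset K hy
      obtain ⟨h, hh, hy'⟩ := Set.mem_iUnion₂.1 (hcov h1)
      refine Set.mem_iUnion₂.2 ⟨_, Finset.mem_image_of_mem _ hh, ?_⟩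
      have h2 : ⟪h.1, R y⟫ = h.2 := hy'
      change ⟪R.symm h.1, y⟫ = h.2
      rw [← h2, ← R.inner_map_map, R.apply_symm_apply]
  lipschitz := by
    intro x hx
    obtain ⟨e, he, r, L, f, hr, hf, hloc⟩ :=
      hK.lipschitz (R x) (R.continuous.frontier_preimage_subset K hx)
    refine ⟨R.symm e, by simpa using he, r, L, fun y => f (R y), hr, ?_, fun y hy => ?_⟩
    · have := hf.comp R.lipschitz
      rwa [mul_one] at this
    · have h1 : R y ∈ Metric.ball (R x) r := by
        rw [Metric.mem_ball, R.dist_map]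
        exact hy
      have h2 : ⟪R.symm e, y⟫ = ⟪e, R y⟫ := by
        rw [← R.inner_map_map, R.apply_symm_apply]
      simp only [Set.mem_preimage, hloc _ h1, h2, map_sub, map_smul, R.apply_symm_apply]

end IsLipschitzPolytope

theorem IsOuterNormal.preimage {K : Set (SpaceTime n)} {z ν : SpaceTime n}
    (R : SpaceTime n ≃ₗᵢ[ℝ] SpaceTime n) (h : IsOuterNormal K (R z) ν) :
    IsOuterNormal (R ⁻¹' K) z (R.symm ν) := by
  obtain ⟨h1, r, hr, hball⟩ := h
  refine ⟨by simpa using h1, r, hr, fun y hy => ?_⟩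
  have h2 : R y ∈ Metric.ball (R z) r := by
    rw [Metric.mem_ball, R.dist_map]
    exact hy
  rw [Set.mem_preimage, hball _ h2, ← R.inner_map_map (y - z), R.apply_symm_apply, map_sub]

theorem outerNormal_preimage (K : Set (SpaceTime n)) (R : SpaceTime n ≃ₗᵢ[ℝ] SpaceTime n)
    (z : SpaceTime n) : outerNormal (R ⁻¹' K) z = R.symm (outerNormal K (R z)) := by
  by_cases h : outerNormal K (R z) = 0
  · rw [h, map_zero]
    by_contra hne
    have h1 := isOuterNormal_outerNormal hne
    have h2 : R ⁻¹' K = R ⁻¹' K := rfl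
    have h3 : IsOuterNormal (R.symm ⁻¹' (R ⁻¹' K)) (R z) (R (outerNormal (R ⁻¹' K) z)) := by
      refine IsOuterNormal.preimage R.symm ?_
      rwa [R.symm_apply_apply]
    have h4 : R.symm ⁻¹' (R ⁻¹' K) = K := by
      ext y
      simp
    rw [h4] at h3
    rw [h3.outerNormal_eq] at h
    exact hne (by simpa using h)
  · exact ((isOuterNormal_outerNormal h).preimage R).outerNormal_eq

/-- The divergence theorem for smooth functions on a Lipschitz polytope. -/
theorem IsLipschitzPolytope.integral_inner_gradient {K : Set (SpaceTime n)}
    (hK : IsLipschitzPolytope K) {φ : SpaceTime n → ℝ} (hφ : ContDiff ℝ ∞ φ) (e : SpaceTime n) :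
    ∫ z in K, ⟪gradient φ z, e⟫ = ∫ z in frontier K, ⟪outerNormal K z, e⟫ * φ z ∂surf n := by
  have hunit : ∀ e : SpaceTime n, ‖e‖ = 1 →
      ∫ z in K, ⟪gradient φ z, e⟫ = ∫ z in frontier K, ⟪outerNormal K z, e⟫ * φ z ∂surf n := by
    intro e he
    -- A reflection carries the time axis to the direction `e`; polytopes, normals and both measures
    -- are transported with it, so the slicing result for the time derivative suffices.
    obtain ⟨R, hR⟩ : ∃ R : SpaceTime n ≃ₗᵢ[ℝ] SpaceTime n, R (AcousticProblem.eT n) = e :=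
      ⟨_, Submodule.reflection_sub (by rw [norm_eT, he])⟩
    have h1 := (hK.preimage R).integral_gradient_snd (φ := fun y => φ (R y))
      (hφ.comp R.contDiff)
    have h2 : ∀ v : SpaceTime n, (R.symm v).snd = ⟪v, e⟫ := fun v => by
      rw [← inner_eT, ← R.inner_map_map, R.apply_symm_apply, hR]
    have h3 : frontier (R ⁻¹' K) = R ⁻¹' frontier K :=
      (R.toHomeomorph.preimage_frontier K).symm
    simp only [gradient_comp_isometry hφ, outerNormal_preimage, h2, h3] at h1
    have hv : MeasurePreserving R volume volume := R.measurePreserving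
    have hs : MeasurePreserving R (surf n) (surf n) :=
      R.toIsometryEquiv.measurePreserving_euclideanHausdorffMeasure n
    have hemb : MeasurableEmbedding R := R.toHomeomorph.measurableEmbedding
    rw [hv.setIntegral_preimage_emb hemb (fun z => ⟪gradient φ z, e⟫) K,
      hs.setIntegral_preimage_emb hemb (fun z => ⟪outerNormal K z, e⟫ * φ z) (frontier K)] at h1
    exact h1
  by_cases he : e = 0
  · simp [he]
  · have hn : ‖e‖ ≠ 0 := norm_ne_zero_iff.2 he
    have h1 := hunit (‖e‖⁻¹ • e) (norm_smul_inv_norm (𝕜 := ℝ) he)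
    simp only [real_inner_smul_right, mul_assoc, integral_const_mul] at h1
    exact mul_left_cancel₀ (inv_ne_zero hn) h1

end Divergence

/-! ### Integration by parts in time and the energy identity -/

section Pairings

variable {X : Type*} [MeasurableSpace X] {μ : Measure X} {F : Type*} [NormedAddCommGroup F]
  [InnerProductSpace ℝ F]

theorem MemLp.integrable_inner_two {f g : X → F} (hf : MemLp f 2 μ) (hg : MemLp g 2 μ) :
    Integrable (fun x => ⟪f x, g x⟫) μ :=
  memLp_one_iff_integrable.1 (hf.of_bilin (r := 1) (fun x y => ⟪x, y⟫) 1 hg (hf.1.inner hg.1)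
    (Eventually.of_forall fun x => by simpa using nnnorm_inner_le_nnnorm (𝕜 := ℝ) (f x) (g x)))

theorem MemLp.integrable_mul_two {f g : X → ℝ} (hf : MemLp f 2 μ) (hg : MemLp g 2 μ) :
    Integrable (fun x => f x * g x) μ := hf.integrable_mul hg

theorem tendsto_integral_inner {f : X → F} {fk : ℕ → X → F} {h : X → F} (hf : MemLp f 2 μ)
    (hfk : ∀ k, MemLp (fk k) 2 μ) (hh : MemLp h 2 μ)
    (hlim : Tendsto (fun k => eLpNorm (fk k - f) 2 μ) atTop (𝓝 0)) :
    Tendsto (fun k => ∫ x, ⟪fk k x, h x⟫ ∂μ) atTop (𝓝 (∫ x, ⟪f x, h x⟫ ∂μ)) := by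
  refine tendsto_integral_of_L1' _ (MemLp.integrable_inner_two hf hh).aestronglyMeasurable
    (Eventually.of_forall fun k => MemLp.integrable_inner_two (hfk k) hh) ?_
  have hle : ∀ k, eLpNorm ((fun x => ⟪fk k x, h x⟫) - fun x => ⟪f x, h x⟫) 1 μ ≤
      eLpNorm (fk k - f) 2 μ * eLpNorm h 2 μ := by
    intro k
    have h1 := eLpNorm_le_eLpNorm_mul_eLpNorm'_of_norm (p := 2) (q := 2) (r := 1)
      ((hfk k).sub hf).1 hh.1 (fun x y : F => ⟪x, y⟫) 1
      (Eventually.of_forall fun x => by simpa using norm_inner_le_norm (𝕜 := ℝ) _ (h x))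
    have h2 : ((fun x => ⟪fk k x, h x⟫) - fun x => ⟪f x, h x⟫) =
        fun x => ⟪(fk k - f) x, h x⟫ := by
      ext x
      simp [inner_sub_left]
    rw [h2]
    simpa using h1
  refine tendsto_of_tendsto_of_tendsto_of_le_of_le tendsto_const_nhds ?_ (fun _ => zero_le) hle
  have := ENNReal.Tendsto.mul_const hlim (b := eLpNorm h 2 μ) (Or.inr hh.2.ne)
  simpa using this

theorem tendsto_integral_mul {f : X → ℝ} {fk : ℕ → X → ℝ} {h : X → ℝ} (hf : MemLp f 2 μ)
    (hfk : ∀ k, MemLp (fk k) 2 μ) (hh : MemLp h 2 μ)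
    (hlim : Tendsto (fun k => eLpNorm (fk k - f) 2 μ) atTop (𝓝 0)) :
    Tendsto (fun k => ∫ x, h x * fk k x ∂μ) atTop (𝓝 (∫ x, h x * f x ∂μ)) := by
  simpa using tendsto_integral_inner hf hfk hh hlim

end Pairings

section TimeDerivative

variable {n : ℕ}

/-- `u ∈ L²(K)` has the weak time derivative `u' ∈ L²(K)` and the trace `g ∈ L²(∂K)`: integration
by parts in time holds. -/
structure HasTimeDeriv (K : Set (SpaceTime n)) (u u' g : SpaceTime n → ℝ) : Prop where
  memLp : MemLp u 2 (volume.restrict K)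
  memLp_deriv : MemLp u' 2 (volume.restrict K)
  memLp_trace : MemLp g 2 ((surf n).restrict (frontier K))
  parts : ∀ φ : SpaceTime n → ℝ, ContDiff ℝ ∞ φ →
    ∫ z in K, ((gradient φ z).snd * u z + φ z * u' z) =
      ∫ z in frontier K, φ z * (outerNormal K z).snd * g z ∂surf n

variable {K : Set (SpaceTime n)}

theorem continuous_gradient_snd {φ : SpaceTime n → ℝ} (hφ : ContDiff ℝ ∞ φ) :
    Continuous fun z => (gradient φ z).snd :=
  continuous_snd_spaceTime.comp (continuous_gradient hφ)

theorem continuous_gradient_fst {φ : SpaceTime n → ℝ} (hφ : ContDiff ℝ ∞ φ) :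
    Continuous fun z => (gradient φ z).fst :=
  continuous_fst_spaceTime.comp (continuous_gradient hφ)

theorem IsLipschitzPolytope.memLp_of_continuous (hK : IsLipschitzPolytope K) {F : Type*}
    [NormedAddCommGroup F] {f : SpaceTime n → F} (hf : Continuous f) :
    MemLp f 2 (volume.restrict K) := by
  have := hK.isFiniteMeasure
  obtain ⟨C, hC⟩ := (hK.isBounded.isCompact_closure.image hf).isBounded.exists_norm_le
  refine MemLp.of_bound hf.aestronglyMeasurable C ?_
  filter_upwards [ae_restrict_mem hK.measurableSet] with z hz
  exact hC _ ⟨z, subset_closure hz, rfl⟩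

theorem IsLipschitzPolytope.memLp_frontier_of_continuous (hK : IsLipschitzPolytope K) {F : Type*}
    [NormedAddCommGroup F] {f : SpaceTime n → F} (hf : Continuous f) :
    MemLp f 2 ((surf n).restrict (frontier K)) := by
  have := hK.isFiniteMeasure_frontier
  obtain ⟨C, hC⟩ := (hK.isBounded_frontier.isCompact_closure.image hf).isBounded.exists_norm_le
  refine MemLp.of_bound hf.aestronglyMeasurable C ?_
  filter_upwards [ae_restrict_mem isClosed_frontier.measurableSet] with z hz
  exact hC _ ⟨z, subset_closure hz, rfl⟩

namespace HasTimeDeriv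

variable {u u' g v v' k : SpaceTime n → ℝ}

theorem integrable_parts (hK : IsLipschitzPolytope K) (h : HasTimeDeriv K u u' g)
    {φ : SpaceTime n → ℝ} (hφ : ContDiff ℝ ∞ φ) :
    IntegrableOn (fun z => (gradient φ z).snd * u z + φ z * u' z) K :=
  (integrableOn_continuous_mul hK.isBounded hK.measurableSet (continuous_gradient_snd hφ)
    (hK.integrable_of_memLp h.memLp)).add
  (integrableOn_continuous_mul hK.isBounded hK.measurableSet hφ.continuous
    (hK.integrable_of_memLp h.memLp_deriv))

theorem integrable_trace (hK : IsLipschitzPolytope K) (h : HasTimeDeriv K u u' g)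
    {φ : SpaceTime n → ℝ} (hφ : Continuous φ) :
    IntegrableOn (fun z => φ z * (outerNormal K z).snd * g z) (frontier K) (surf n) := by
  have := hK.integrable_normal_snd_mul (integrableOn_continuous_mul hK.isBounded_frontier
    isClosed_frontier.measurableSet hφ (hK.integrable_of_memLp_frontier h.memLp_trace))
  refine this.congr (Eventually.of_forall fun z => ?_)
  ring

theorem add (hK : IsLipschitzPolytope K) (h : HasTimeDeriv K u u' g) (h' : HasTimeDeriv K v v' k) :
    HasTimeDeriv K (fun z => u z + v z) (fun z => u' z + v' z) (fun z => g z + k z) where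
  memLp := h.memLp.add h'.memLp
  memLp_deriv := h.memLp_deriv.add h'.memLp_deriv
  memLp_trace := h.memLp_trace.add h'.memLp_trace
  parts φ hφ := by
    simp only [mul_add]
    rw [integral_add (h.integrable_trace hK hφ.continuous) (h'.integrable_trace hK hφ.continuous),
      ← h.parts φ hφ, ← h'.parts φ hφ,
      ← integral_add (h.integrable_parts hK hφ) (h'.integrable_parts hK hφ)]
    refine integral_congr_ae (Eventually.of_forall fun z => ?_)
    ring

/-- The weight is moved to the other side: the formula for `b u` tested with `φ` is the formula for
`u` tested with `φ b`. -/
theorem mul_smooth (hK : IsLipschitzPolytope K) (h : HasTimeDeriv K u u' g) {b : SpaceTime n → ℝ}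
    (hb : ContDiff ℝ ∞ b) :
    HasTimeDeriv K (fun z => b z * u z) (fun z => (gradient b z).snd * u z + b z * u' z)
      (fun z => b z * g z) where
  memLp := memLp_continuous_mul hK.isBounded hK.measurableSet hb.continuous h.memLp
  memLp_deriv := (memLp_continuous_mul hK.isBounded hK.measurableSet (continuous_gradient_snd hb)
    h.memLp).add (memLp_continuous_mul hK.isBounded hK.measurableSet hb.continuous h.memLp_deriv)
  memLp_trace := memLp_continuous_mul hK.isBounded_frontier isClosed_frontier.measurableSet
    hb.continuous h.memLp_trace
  parts φ hφ := by
    have h1 := h.parts (fun z => φ z * b z) (hφ.mul hb)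
    simp only [gradient_mul hφ hb] at h1
    refine Eq.trans ?_ (h1.trans ?_)
    · refine integral_congr_ae (Eventually.of_forall fun z => ?_)
      simp only [WithLp.add_snd, WithLp.smul_snd, smul_eq_mul]
      ring
    · refine integral_congr_ae (Eventually.of_forall fun z => ?_)
      ring

/-- The energy identity in time. -/
theorem integral_two_mul (hK : IsLipschitzPolytope K) (h : HasTimeDeriv K u u' g) :
    ∫ z in K, 2 * u z * u' z = ∫ z in frontier K, (outerNormal K z).snd * g z ^ 2 ∂surf n := by
  obtain ⟨A, hA1, hA2⟩ := hK.exists_graphs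
  have hui := hK.integrable_of_memLp h.memLp
  have hu'i := hK.integrable_of_memLp h.memLp_deriv
  have huu' : IntegrableOn (fun z => 2 * u z * u' z) K := by
    have := (MemLp.integrable_mul_two h.memLp h.memLp_deriv).const_mul 2
    exact this.congr (Eventually.of_forall fun z => by ring)
  have hgg : IntegrableOn (fun z => (outerNormal K z).snd * g z ^ 2) (frontier K) (surf n) := by
    refine hK.integrable_normal_snd_mul ?_
    exact (MemLp.integrable_mul_two h.memLp_trace h.memLp_trace).congr
      (Eventually.of_forall fun z => by ring)
  have hind : ∀ {f : SpaceTime n → ℝ}, IntegrableOn f K → Integrable (K.indicator f) := fun hf =>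
    (integrable_indicator_iff hK.measurableSet).2 hf
  -- the identity on almost every time line, for one monomial
  have hmono : ∀ k : ℕ, ∀ᵐ x : Space n,
      ∫ t : ℝ, ((k : ℝ) * t ^ (k - 1) * K.indicator u (WithLp.toLp 2 (x, t)) +
        t ^ k * K.indicator u' (WithLp.toLp 2 (x, t))) =
      ∑ p ∈ A, normalSign K (graphMap p x) * (⟪p.1, x⟫ + p.2) ^ k * g (graphMap p x) := by
    intro k
    have hc1 : Continuous fun z : SpaceTime n => (k : ℝ) * z.snd ^ (k - 1) := by fun_prop
    have hc2 : Continuous fun z : SpaceTime n => z.snd ^ k := by fun_prop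
    set f : SpaceTime n → ℝ := fun z => (k : ℝ) * z.snd ^ (k - 1) * u z + z.snd ^ k * u' z with hf
    have hfi : IntegrableOn f K :=
      (integrableOn_continuous_mul hK.isBounded hK.measurableSet hc1 hui).add
        (integrableOn_continuous_mul hK.isBounded hK.measurableSet hc2 hu'i)
    have hline : ∀ x : Space n, ∫ t : ℝ, ((k : ℝ) * t ^ (k - 1) *
        K.indicator u (WithLp.toLp 2 (x, t)) + t ^ k * K.indicator u' (WithLp.toLp 2 (x, t))) =
        ∫ t : ℝ, K.indicator f (WithLp.toLp 2 (x, t)) := by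
      intro x
      refine integral_congr_ae (Eventually.of_forall fun t => ?_)
      by_cases ht : (WithLp.toLp 2 (x, t) : SpaceTime n) ∈ K
      · simp [Set.indicator_of_mem ht, hf]
      · simp [Set.indicator_of_notMem ht]
    simp only [hline]
    have htr : IntegrableOn (fun z => (outerNormal K z).snd * (z.snd ^ k * g z)) (frontier K)
        (surf n) := hK.integrable_normal_snd_mul (integrableOn_continuous_mul
      hK.isBounded_frontier isClosed_frontier.measurableSet hc2
      (hK.integrable_of_memLp_frontier h.memLp_trace))
    have hsl := (integral_normal_snd_mul hA2 htr).1
    -- Testing with products `a(x) tᵏ` for arbitrary smooth `a` localises integration by parts to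
    -- almost every time line.
    refine ae_eq_of_integral_contDiff_smul_eq
      (integrable_spaceTime (hind hfi)).2.locallyIntegrable
      (f' := fun x => ∑ p ∈ A, normalSign K (graphMap p x) * (⟪p.1, x⟫ + p.2) ^ k *
        g (graphMap p x)) ?_ fun a ha _ => ?_
    · refine Integrable.locallyIntegrable ?_
      refine (integrable_finsetSum A hsl).congr (Eventually.of_forall fun x => ?_)
      exact Finset.sum_congr rfl fun p _ => by rw [graphMap_snd]; ring
    have hfst : ContDiff ℝ ∞ fun z : SpaceTime n => a z.fst := by
      have : ContDiff ℝ ∞ fun z : SpaceTime n => z.fst :=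
        (WithLp.fstL 2 ℝ (Space n) ℝ).contDiff
      exact ha.comp this
    have hpow : ContDiff ℝ ∞ fun z : SpaceTime n => z.snd ^ k := by
      have : ContDiff ℝ ∞ fun z : SpaceTime n => z.snd :=
        (WithLp.sndL 2 ℝ (Space n) ℝ).contDiff
      exact this.pow k
    have hφ := hfst.mul hpow
    have hgrad : ∀ z : SpaceTime n, (gradient (fun z : SpaceTime n => a z.fst * z.snd ^ k) z).snd =
        a z.fst * ((k : ℝ) * z.snd ^ (k - 1)) := by
      intro z
      have h1 := hasDerivAt_timeLine hφ z.fst z.snd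
      have h2 : HasDerivAt (fun t : ℝ => a z.fst * t ^ k) (a z.fst * ((k : ℝ) * z.snd ^ (k - 1)))
          z.snd := (hasDerivAt_pow k z.snd).const_mul _
      exact h1.unique h2
    have hparts := h.parts _ hφ
    simp only [hgrad] at hparts
    have hL : ∫ z in K, (a z.fst * ((k : ℝ) * z.snd ^ (k - 1)) * u z + a z.fst * z.snd ^ k * u' z) =
        ∫ x, a x • ∫ t : ℝ, K.indicator f (WithLp.toLp 2 (x, t)) := by
      have hai : IntegrableOn (fun z => a z.fst * f z) K :=
        integrableOn_continuous_mul hK.isBounded hK.measurableSet hfst.continuous hfi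
      rw [← integral_indicator hK.measurableSet]
      have h1 : ∀ z, K.indicator (fun z => a z.fst * ((k : ℝ) * z.snd ^ (k - 1)) * u z +
          a z.fst * z.snd ^ k * u' z) z = K.indicator (fun z => a z.fst * f z) z := by
        intro z
        congr 1
        funext z
        rw [hf]
        ring
      simp only [h1]
      rw [integral_spaceTime (hind hai)]
      refine integral_congr_ae (Eventually.of_forall fun x => ?_)
      simp only [smul_eq_mul]
      rw [← integral_const_mul]
      refine integral_congr_ae (Eventually.of_forall fun t => ?_)
      by_cases ht : (WithLp.toLp 2 (x, t) : SpaceTime n) ∈ K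
      · simp [Set.indicator_of_mem ht]
      · simp [Set.indicator_of_notMem ht]
    have hR : ∫ z in frontier K, a z.fst * z.snd ^ k * (outerNormal K z).snd * g z ∂surf n =
        ∫ x, a x • ∑ p ∈ A, normalSign K (graphMap p x) * (⟪p.1, x⟫ + p.2) ^ k *
          g (graphMap p x) := by
      have hai : IntegrableOn (fun z => (outerNormal K z).snd * (a z.fst * z.snd ^ k * g z))
          (frontier K) (surf n) := hK.integrable_normal_snd_mul (integrableOn_continuous_mul
        hK.isBounded_frontier isClosed_frontier.measurableSet hφ.continuous
        (hK.integrable_of_memLp_frontier h.memLp_trace))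
      have h1 := (integral_normal_snd_mul hA2 hai).2
      refine Eq.trans ?_ (h1.trans ?_)
      · refine integral_congr_ae (Eventually.of_forall fun z => ?_)
        ring
      · refine integral_congr_ae (Eventually.of_forall fun x => ?_)
        simp only [smul_eq_mul, graphMap_fst, graphMap_snd]
        rw [Finset.mul_sum]
        exact Finset.sum_congr rfl fun p _ => by ring
    rw [← hL, ← hR]
    exact hparts
  -- Monomials are used because there are countably many of them: one null set of `x` serves for all
  -- powers at once.
  have hmono' := ae_all_iff.2 hmono
  rw [(integral_normal_snd_mul hA2 hgg).2, ← integral_indicator hK.measurableSet,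
    integral_spaceTime (hind huu')]
  refine integral_congr_ae ?_
  filter_upwards [hA1, hmono', (integrable_spaceTime (hind hui)).1,
    (integrable_spaceTime (hind hu'i)).1] with x hx hk hxu hxu'
  have h1 := hx.integral_two_mul hxu hxu' (fun t ht => Set.indicator_of_notMem (s := K) (a := WithLp.toLp 2 (x, t)) ht _)
    (fun t ht => Set.indicator_of_notMem (s := K) (a := WithLp.toLp 2 (x, t)) ht _) hk
  rw [← h1]
  refine integral_congr_ae (Eventually.of_forall fun t => ?_)
  by_cases ht : (WithLp.toLp 2 (x, t) : SpaceTime n) ∈ K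
  · simp [Set.indicator_of_mem ht]
  · simp [Set.indicator_of_notMem ht]

/-- This is the polarisation of the quadratic energy identity, which is applied to `u`, `v` and `u +
v`. -/
theorem integral_mul_add_mul (hK : IsLipschitzPolytope K) (h : HasTimeDeriv K u u' g)
    (h' : HasTimeDeriv K v v' k) :
    ∫ z in K, (u z * v' z + u' z * v z) =
      ∫ z in frontier K, (outerNormal K z).snd * (g z * k z) ∂surf n := by
  have h1 := (h.add hK h').integral_two_mul hK
  have h2 := h.integral_two_mul hK
  have h3 := h'.integral_two_mul hK
  have i1 := MemLp.integrable_mul_two h.memLp h.memLp_deriv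
  have i2 := MemLp.integrable_mul_two h'.memLp h'.memLp_deriv
  have i3 : IntegrableOn (fun z => u z * v' z + u' z * v z) K :=
    (MemLp.integrable_mul_two h.memLp h'.memLp_deriv).add
      (MemLp.integrable_mul_two h.memLp_deriv h'.memLp)
  have i12 : IntegrableOn (fun z => 2 * (u z * u' z) + 2 * (v z * v' z)) K :=
    (i1.const_mul 2).add (i2.const_mul 2)
  have j1 := hK.integrable_normal_snd_mul (MemLp.integrable_mul_two h.memLp_trace h.memLp_trace)
  have j2 := hK.integrable_normal_snd_mul (MemLp.integrable_mul_two h'.memLp_trace h'.memLp_trace)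
  have j3 := hK.integrable_normal_snd_mul (MemLp.integrable_mul_two h.memLp_trace h'.memLp_trace)
  have j12 : IntegrableOn (fun z => (outerNormal K z).snd * (g z * g z) +
    (outerNormal K z).snd * (k z * k z)) (frontier K) (surf n) := j1.add j2
  have e1 : ∫ z in K, 2 * (u z + v z) * (u' z + v' z) =
      2 * (∫ z in K, u z * u' z) + 2 * (∫ z in K, v z * v' z) +
        2 * ∫ z in K, (u z * v' z + u' z * v z) := by
    rw [← integral_const_mul, ← integral_const_mul, ← integral_const_mul,
      ← integral_add (i1.const_mul 2) (i2.const_mul 2),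
      ← integral_add i12 (i3.const_mul 2)]
    refine integral_congr_ae (Eventually.of_forall fun z => ?_)
    ring
  have e2 : ∫ z in frontier K, (outerNormal K z).snd * (g z + k z) ^ 2 ∂surf n =
      (∫ z in frontier K, (outerNormal K z).snd * (g z * g z) ∂surf n) +
      (∫ z in frontier K, (outerNormal K z).snd * (k z * k z) ∂surf n) +
        2 * ∫ z in frontier K, (outerNormal K z).snd * (g z * k z) ∂surf n := by
    rw [← integral_const_mul, ← integral_add j1 j2, ← integral_add j12 (j3.const_mul 2)]
    refine integral_congr_ae (Eventually.of_forall fun z => ?_)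
    ring
  simp only [mul_assoc, integral_const_mul, sq] at h2 h3
  rw [e1, e2] at h1
  linarith

end HasTimeDeriv

end TimeDerivative

/-! ### Bulk-boundary identities on one element -/

section Element

variable {n : ℕ} {K : Set (SpaceTime n)}

/-- The bulk density `f` and the boundary density `g` are integrable and have equal integrals. -/
structure FluxIdentity (K : Set (SpaceTime n)) (f g : SpaceTime n → ℝ) : Prop where
  integrable : IntegrableOn f K
  integrable_trace : IntegrableOn g (frontier K) (surf n)
  eq : ∫ z in K, f z = ∫ z in frontier K, g z ∂surf n

namespace FluxIdentity

variable {f f' g g' : SpaceTime n → ℝ}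

theorem add (h : FluxIdentity K f g) (h' : FluxIdentity K f' g') :
    FluxIdentity K (fun z => f z + f' z) (fun z => g z + g' z) where
  integrable := h.integrable.add h'.integrable
  integrable_trace := h.integrable_trace.add h'.integrable_trace
  eq := by
    rw [integral_add h.integrable h'.integrable, integral_add h.integrable_trace
      h'.integrable_trace, h.eq, h'.eq]

theorem const_mul (h : FluxIdentity K f g) (a : ℝ) :
    FluxIdentity K (fun z => a * f z) (fun z => a * g z) where
  integrable := h.integrable.const_mul a
  integrable_trace := h.integrable_trace.const_mul a
  eq := by rw [integral_const_mul, integral_const_mul, h.eq]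

theorem sum {ι : Type*} (s : Finset ι) {f g : ι → SpaceTime n → ℝ}
    (h : ∀ i ∈ s, FluxIdentity K (f i) (g i)) :
    FluxIdentity K (fun z => ∑ i ∈ s, f i z) (fun z => ∑ i ∈ s, g i z) where
  integrable := integrable_finsetSum _ fun i hi => (h i hi).integrable
  integrable_trace := integrable_finsetSum _ fun i hi => (h i hi).integrable_trace
  eq := by
    rw [integral_finsetSum _ fun i hi => (h i hi).integrable,
      integral_finsetSum _ fun i hi => (h i hi).integrable_trace]
    exact Finset.sum_congr rfl fun i hi => (h i hi).eq

theorem congr (h : FluxIdentity K f g) (hf : f =ᵐ[volume.restrict K] f')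
    (hg : g =ᵐ[(surf n).restrict (frontier K)] g') : FluxIdentity K f' g' where
  integrable := h.integrable.congr hf
  integrable_trace := h.integrable_trace.congr hg
  eq := by rw [← integral_congr_ae hf, ← integral_congr_ae hg, h.eq]

end FluxIdentity

theorem HasTimeDeriv.fluxIdentity {u u' g v v' k : SpaceTime n → ℝ} (hK : IsLipschitzPolytope K)
    (h : HasTimeDeriv K u u' g) (h' : HasTimeDeriv K v v' k) :
    FluxIdentity K (fun z => u z * v' z + u' z * v z)
      (fun z => (outerNormal K z).snd * (g z * k z)) where
  integrable := (MemLp.integrable_mul_two h.memLp h'.memLp_deriv).add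
    (MemLp.integrable_mul_two h.memLp_deriv h'.memLp)
  integrable_trace :=
    hK.integrable_normal_snd_mul (MemLp.integrable_mul_two h.memLp_trace h'.memLp_trace)
  eq := h.integral_mul_add_mul hK h'

theorem HasTimeDeriv.fluxIdentity_parts {u u' g : SpaceTime n → ℝ} (hK : IsLipschitzPolytope K)
    (h : HasTimeDeriv K u u' g) {φ : SpaceTime n → ℝ} (hφ : ContDiff ℝ ∞ φ) :
    FluxIdentity K (fun z => (gradient φ z).snd * u z + φ z * u' z)
      (fun z => φ z * (outerNormal K z).snd * g z) :=
  ⟨h.integrable_parts hK hφ, h.integrable_trace hK hφ.continuous, h.parts φ hφ⟩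

theorem HasTimeDerivWithTrace.inner_const {τ τ' g : SpaceTime n → Space n}
    (hK : IsLipschitzPolytope K) (h : HasTimeDerivWithTrace K τ τ' g) (ξ : Space n) :
    HasTimeDeriv K (fun z => ⟪ξ, τ z⟫) (fun z => ⟪ξ, τ' z⟫) (fun z => ⟪ξ, g z⟫) where
  memLp := h.1.const_inner ξ
  memLp_deriv := h.2.1.const_inner ξ
  memLp_trace := h.2.2.1.const_inner ξ
  parts φ hφ := by
    have hi : IntegrableOn (fun z => (gradient φ z).snd • τ z + φ z • τ' z) K :=
      (hK.integrable_of_memLp (memLp_continuous_mul hK.isBounded hK.measurableSet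
        (continuous_gradient_snd hφ) h.1)).add
      (hK.integrable_of_memLp (memLp_continuous_mul hK.isBounded hK.measurableSet
        hφ.continuous h.2.1))
    have hj : IntegrableOn (fun z => (φ z * (outerNormal K z).snd) • g z) (frontier K)
        (surf n) := by
      have h1 := hK.integrable_of_memLp_frontier (memLp_continuous_mul hK.isBounded_frontier
        isClosed_frontier.measurableSet hφ.continuous h.2.2.1)
      refine (Integrable.bdd_smul h1 1 hK.measurable_normal_snd.aestronglyMeasurable
        (Eventually.of_forall fun z => (abs_snd_le _).trans (norm_outerNormal_le K z))).congr
        (Eventually.of_forall fun z => ?_)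
      simp only [Pi.smul_apply', smul_smul]
      rw [mul_comm]
    have h2 := congrArg (fun y => ⟪ξ, y⟫) (h.2.2.2 φ hφ)
    simp only [← integral_inner hi, ← integral_inner hj, inner_add_right,
      real_inner_smul_right] at h2
    exact h2

namespace IsSobolevWithTrace

variable {w g : SpaceTime n → ℝ} {G : SpaceTime n → SpaceTime n}

/-- The divergence theorem holds for `φ` times the smooth approximants of `w`, and every term is
continuous under the convergence that defines the trace. -/
theorem fluxIdentity (hK : IsLipschitzPolytope K) (h : IsSobolevWithTrace K w G g)
    {φ : SpaceTime n → ℝ} (hφ : ContDiff ℝ ∞ φ) (e : SpaceTime n) :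
    FluxIdentity K (fun z => ⟪gradient φ z, e⟫ * w z + φ z * ⟪G z, e⟫)
      (fun z => φ z * ⟪outerNormal K z, e⟫ * g z) := by
  obtain ⟨hw, hG, hg, ψ, hψ, l1, l2, l3⟩ := h
  have c1 : Continuous fun z => ⟪gradient φ z, e⟫ := (continuous_gradient hφ).inner continuous_const
  have m1 : MemLp (fun z => ⟪gradient φ z, e⟫) 2 (volume.restrict K) := hK.memLp_of_continuous c1
  have m2 : MemLp (fun z => φ z • e) 2 (volume.restrict K) :=
    hK.memLp_of_continuous (hφ.continuous.smul continuous_const)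
  have m3 : MemLp (fun z => ⟪outerNormal K z, e⟫ * φ z) 2 ((surf n).restrict (frontier K)) := by
    refine MemLp.of_le_mul (c := ‖e‖) (hK.memLp_frontier_of_continuous hφ.continuous)
      ((((measurable_outerNormal hK.isOpen).inner measurable_const).mul
        hφ.continuous.measurable).aestronglyMeasurable) (Eventually.of_forall fun z => ?_)
    rw [norm_mul]
    refine mul_le_mul_of_nonneg_right ((norm_inner_le_norm _ _).trans ?_) (norm_nonneg _)
    simpa using mul_le_mul_of_nonneg_right (norm_outerNormal_le K z) (norm_nonneg e)
  have t1 := tendsto_integral_mul hw (fun k => hK.memLp_of_continuous (hψ k).continuous) m1 l1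
  have t2 := tendsto_integral_inner hG
    (fun k => hK.memLp_of_continuous (continuous_gradient (hψ k))) m2 l2
  have t3 := tendsto_integral_mul hg
    (fun k => hK.memLp_frontier_of_continuous (hψ k).continuous) m3 l3
  have i1 := MemLp.integrable_mul_two m1 hw
  have i2 := MemLp.integrable_inner_two hG m2
  have i3 := MemLp.integrable_mul_two m3 hg
  have heq : (∫ z in K, ⟪gradient φ z, e⟫ * w z) + (∫ z in K, ⟪G z, φ z • e⟫) =
      ∫ z in frontier K, ⟪outerNormal K z, e⟫ * φ z * g z ∂surf n := by
    refine tendsto_nhds_unique (t1.add t2) (t3.congr fun k => ?_)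
    have j1 := MemLp.integrable_mul_two m1 (hK.memLp_of_continuous (hψ k).continuous)
    have j2 := MemLp.integrable_inner_two
      (hK.memLp_of_continuous (continuous_gradient (hψ k))) m2
    rw [← integral_add j1 j2]
    have h1 := hK.integral_inner_gradient (hφ.mul (hψ k)) e
    refine Eq.trans ?_ (h1.symm.trans ?_)
    · exact integral_congr_ae (Eventually.of_forall fun z => by ring)
    · refine integral_congr_ae (Eventually.of_forall fun z => ?_)
      simp only [gradient_mul hφ (hψ k), inner_add_left, real_inner_smul_left,
        real_inner_smul_right]
      ring
  have i12 : IntegrableOn (fun z => ⟪gradient φ z, e⟫ * w z + ⟪G z, φ z • e⟫) K := i1.add i2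
  have := FluxIdentity.mk i12 i3 (by rw [integral_add i1 i2, heq])
  refine this.congr (Eventually.of_forall fun z => ?_) (Eventually.of_forall fun z => ?_)
  · simp only [real_inner_smul_right]
  · ring

theorem hasTimeDeriv (hK : IsLipschitzPolytope K) (h : IsSobolevWithTrace K w G g) :
    HasTimeDeriv K w (fun z => (G z).snd) g where
  memLp := h.1
  memLp_deriv := by
    refine MemLp.of_le h.2.1 (continuous_snd_spaceTime.comp_aestronglyMeasurable h.2.1.1)
      (Eventually.of_forall fun z => abs_snd_le _)
  memLp_trace := h.2.2.1
  parts φ hφ := by simpa only [inner_eT] using (h.fluxIdentity hK hφ (AcousticProblem.eT n)).eq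

end IsSobolevWithTrace

/-- Green's formula for `τ` is given only for smooth test functions. It is used with `b` times the
approximants of `w`, which converge in `H¹(K)` and on the boundary, so no smooth approximation of
`τ` is required. -/
theorem HasSpaceDivWithTrace.fluxIdentity {τ gτ : SpaceTime n → Space n} {d w g : SpaceTime n → ℝ}
    {G : SpaceTime n → SpaceTime n} (hK : IsLipschitzPolytope K)
    (h : HasSpaceDivWithTrace K τ d gτ) (hw : IsSobolevWithTrace K w G g)
    {b : SpaceTime n → ℝ} (hb : ContDiff ℝ ∞ b) :
    FluxIdentity K
      (fun z => b z * ⟪τ z, (G z).fst⟫ + w z * ⟪τ z, (gradient b z).fst⟫ + b z * d z * w z)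
      (fun z => b z * g z * ⟪gτ z, (outerNormal K z).fst⟫) := by
  obtain ⟨hw, hG, hg, ψ, hψ, l1, l2, l3⟩ := hw
  obtain ⟨hτ, hd, hgτ, hparts⟩ := h
  have hG1 : MemLp (fun z => (G z).fst) 2 (volume.restrict K) :=
    MemLp.of_le hG (continuous_fst_spaceTime.comp_aestronglyMeasurable hG.1)
      (Eventually.of_forall fun z => norm_fst_le _)
  have l2' : Tendsto (fun k => eLpNorm ((fun z => (gradient (ψ k) z).fst) - fun z => (G z).fst) 2
      (volume.restrict K)) atTop (𝓝 0) := by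
    refine tendsto_of_tendsto_of_tendsto_of_le_of_le tendsto_const_nhds l2 (fun _ => zero_le)
      fun k => eLpNorm_mono fun z => ?_
    simpa using norm_fst_le (gradient (ψ k) z - G z)
  have m1 : MemLp (fun z => b z • τ z) 2 (volume.restrict K) :=
    memLp_continuous_mul hK.isBounded hK.measurableSet hb.continuous hτ
  have m2 : MemLp (fun z => ⟪τ z, (gradient b z).fst⟫ + b z * d z) 2 (volume.restrict K) := by
    refine MemLp.add ?_ (memLp_continuous_mul hK.isBounded hK.measurableSet hb.continuous hd)
    obtain ⟨C, hC⟩ := (hK.isBounded.isCompact_closure.image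
      (continuous_gradient_fst hb)).isBounded.exists_norm_le
    refine MemLp.of_le_mul (c := C) hτ
      (hτ.1.inner (continuous_gradient_fst hb).aestronglyMeasurable) ?_
    filter_upwards [ae_restrict_mem hK.measurableSet] with z hz
    refine (norm_inner_le_norm _ _).trans ?_
    rw [mul_comm]
    exact mul_le_mul_of_nonneg_right (hC _ ⟨z, subset_closure hz, rfl⟩) (norm_nonneg _)
  have m3 : MemLp (fun z => b z • ⟪gτ z, (outerNormal K z).fst⟫) 2
      ((surf n).restrict (frontier K)) := by
    refine memLp_continuous_mul hK.isBounded_frontier isClosed_frontier.measurableSet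
      hb.continuous ?_
    refine MemLp.of_le hgτ (hgτ.1.inner hK.measurable_normal_fst.aestronglyMeasurable)
      (Eventually.of_forall fun z => (norm_inner_le_norm _ _).trans ?_)
    exact mul_le_of_le_one_right (norm_nonneg _)
      ((norm_fst_le _).trans (norm_outerNormal_le K z))
  have mψ := fun k => hK.memLp_of_continuous (continuous_gradient_fst (hψ k))
  have t1 := tendsto_integral_inner hG1 mψ m1 l2'
  have t2 := tendsto_integral_mul hw (fun k => hK.memLp_of_continuous (hψ k).continuous) m2 l1
  have t3 := tendsto_integral_mul hg
    (fun k => hK.memLp_frontier_of_continuous (hψ k).continuous) m3 l3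
  have i1 := MemLp.integrable_inner_two hG1 m1
  have i2 := MemLp.integrable_mul_two m2 hw
  have i3 := MemLp.integrable_mul_two m3 hg
  have heq : (∫ z in K, ⟪(G z).fst, b z • τ z⟫) +
      (∫ z in K, (⟪τ z, (gradient b z).fst⟫ + b z * d z) * w z) =
      ∫ z in frontier K, b z • ⟪gτ z, (outerNormal K z).fst⟫ * g z ∂surf n := by
    refine tendsto_nhds_unique (t1.add t2) (t3.congr fun k => ?_)
    have j1 := MemLp.integrable_inner_two (mψ k) m1
    have j2 := MemLp.integrable_mul_two m2 (hK.memLp_of_continuous (hψ k).continuous)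
    rw [← integral_add j1 j2]
    refine Eq.trans ?_ ((hparts _ (hb.mul (hψ k))).symm.trans ?_)
    · refine integral_congr_ae (Eventually.of_forall fun z => ?_)
      simp only [smul_eq_mul]
      ring
    · refine integral_congr_ae (Eventually.of_forall fun z => ?_)
      simp only [gradient_mul hb (hψ k), WithLp.add_fst, WithLp.smul_fst, inner_add_right,
        real_inner_smul_right]
      rw [real_inner_comm]
      ring
  have i12 : IntegrableOn (fun z => ⟪(G z).fst, b z • τ z⟫ +
    (⟪τ z, (gradient b z).fst⟫ + b z * d z) * w z) K := i1.add i2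
  have := FluxIdentity.mk i12 i3 (by rw [integral_add i1 i2, heq])
  refine this.congr (Eventually.of_forall fun z => ?_) (Eventually.of_forall fun z => ?_)
  · simp only [real_inner_smul_right]
    rw [real_inner_comm]
    ring
  · simp only [smul_eq_mul]
    ring

/-- A field on `K` satisfying `∇w + ∂τ/∂t = 0`, `∇·τ + κ ∂w/∂t = 0`, with traces `gw`, `gτ`. -/
def IsTrefftzOn (K : Set (SpaceTime n)) (κ : ℝ) (w : SpaceTime n → ℝ) (τ : SpaceTime n → Space n)
    (gw : SpaceTime n → ℝ) (gτ : SpaceTime n → Space n) : Prop :=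
  ∃ (G : SpaceTime n → SpaceTime n) (d : SpaceTime n → ℝ) (τ' : SpaceTime n → Space n),
    IsSobolevWithTrace K w G gw ∧ HasSpaceDivWithTrace K τ d gτ ∧
    HasTimeDerivWithTrace K τ τ' gτ ∧
    ∀ᵐ z ∂volume.restrict K, (G z).fst + τ' z = 0 ∧ d z + κ * (G z).snd = 0

theorem inner_toLp_zero (z : SpaceTime n) (ξ : Space n) :
    ⟪z, (WithLp.toLp 2 (ξ, 0) : SpaceTime n)⟫ = ⟪ξ, z.fst⟫ := by
  rw [inner_spaceTime, real_inner_comm]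
  simp

namespace IsTrefftzOn

variable {κ : ℝ} {v w gv gw : SpaceTime n → ℝ} {σ τ gσ gτ : SpaceTime n → Space n}

/-- Weighted energy identity, in bilinear form. -/
theorem energy (hK : IsLipschitzPolytope K) (hs : IsTrefftzOn K κ v σ gv gσ)
    (ht : IsTrefftzOn K κ w τ gw gτ) {b : SpaceTime n → ℝ} (hb : ContDiff ℝ ∞ b) :
    FluxIdentity K
      (fun z => v z * ⟪τ z, (gradient b z).fst⟫ + w z * ⟪σ z, (gradient b z).fst⟫ +
        (gradient b z).snd * (κ * v z * w z + ⟪σ z, τ z⟫))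
      (fun z => b z * (gv z * ⟪gτ z, (outerNormal K z).fst⟫ +
        gw z * ⟪gσ z, (outerNormal K z).fst⟫ +
        (outerNormal K z).snd * (κ * gv z * gw z + ⟪gσ z, gτ z⟫))) := by
  obtain ⟨G, d, σ', s1, s2, s3, s4⟩ := hs
  obtain ⟨H, e, τ', t1, t2, t3, t4⟩ := ht
  -- The four identities are the time products `κ v w` and, componentwise, `σ·τ`, then the space
  -- products of `τ` with `v` and of `σ` with `w`. In their sum the equations cancel every volume
  -- term that does not contain a derivative of `b`.
  have a1 := ((s1.hasTimeDeriv hK).fluxIdentity hK ((t1.hasTimeDeriv hK).mul_smooth hK hb)).const_mul κ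
  have a2 := FluxIdentity.sum Finset.univ fun (i : Fin n) _ =>
    (s3.inner_const hK (EuclideanSpace.basisFun (Fin n) ℝ i)).fluxIdentity hK
      ((t3.inner_const hK (EuclideanSpace.basisFun (Fin n) ℝ i)).mul_smooth hK hb)
  have a3 := t2.fluxIdentity hK s1 hb
  have a4 := s2.fluxIdentity hK t1 hb
  have key : ∀ x y : Space n, ∑ i, ⟪EuclideanSpace.basisFun (Fin n) ℝ i, x⟫ *
      ⟪EuclideanSpace.basisFun (Fin n) ℝ i, y⟫ = ⟪x, y⟫ := by
    intro x y
    rw [← OrthonormalBasis.sum_inner_mul_inner (EuclideanSpace.basisFun (Fin n) ℝ) x y]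
    exact Finset.sum_congr rfl fun i _ => by rw [real_inner_comm]
  refine (((a1.add a2).add a3).add a4).congr ?_ (Eventually.of_forall fun z => ?_)
  · filter_upwards [s4, t4] with z hz hz'
    have e1 : σ' z = -(G z).fst := eq_neg_of_add_eq_zero_right hz.1
    have e2 : d z = -(κ * (G z).snd) := eq_neg_of_add_eq_zero_left hz.2
    have e3 : τ' z = -(H z).fst := eq_neg_of_add_eq_zero_right hz'.1
    have e4 : e z = -(κ * (H z).snd) := eq_neg_of_add_eq_zero_left hz'.2
    have hsum : ∑ i, (⟪EuclideanSpace.basisFun (Fin n) ℝ i, σ z⟫ *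
        ((gradient b z).snd * ⟪EuclideanSpace.basisFun (Fin n) ℝ i, τ z⟫ +
          b z * ⟪EuclideanSpace.basisFun (Fin n) ℝ i, τ' z⟫) +
        ⟪EuclideanSpace.basisFun (Fin n) ℝ i, σ' z⟫ *
          (b z * ⟪EuclideanSpace.basisFun (Fin n) ℝ i, τ z⟫)) =
        (gradient b z).snd * ⟪σ z, τ z⟫ + b z * ⟪σ z, τ' z⟫ + b z * ⟪σ' z, τ z⟫ := by
      rw [← key, ← key, ← key, Finset.mul_sum, Finset.mul_sum, Finset.mul_sum,
        ← Finset.sum_add_distrib, ← Finset.sum_add_distrib]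
      exact Finset.sum_congr rfl fun i _ => by ring
    rw [hsum, e1, e2, e3, e4]
    simp only [inner_neg_left, inner_neg_right]
    rw [real_inner_comm (τ z) (G z).fst]
    ring
  · have hsum : ∑ i, (outerNormal K z).snd * (⟪EuclideanSpace.basisFun (Fin n) ℝ i, gσ z⟫ *
        (b z * ⟪EuclideanSpace.basisFun (Fin n) ℝ i, gτ z⟫)) =
        (outerNormal K z).snd * (b z * ⟪gσ z, gτ z⟫) := by
      rw [← key, Finset.mul_sum, Finset.mul_sum]
      exact Finset.sum_congr rfl fun i _ => by ring
    beta_reduce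
    rw [hsum]
    ring

/-- Together with `mass`, this identifies the boundary flux of each equation separately; comparison
with the weak equations in `Q` then shows which jumps an exact solution cannot have. -/
theorem momentum (hK : IsLipschitzPolytope K) (ht : IsTrefftzOn K κ w τ gw gτ)
    {φ : SpaceTime n → ℝ} (hφ : ContDiff ℝ ∞ φ) (ξ : Space n) :
    FluxIdentity K (fun z => ⟪ξ, w z • (gradient φ z).fst + (gradient φ z).snd • τ z⟫)
      (fun z => φ z * ⟪ξ, gw z • (outerNormal K z).fst + (outerNormal K z).snd • gτ z⟫) := by
  obtain ⟨H, e, τ', t1, t2, t3, t4⟩ := ht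
  have a1 := t1.fluxIdentity hK hφ (WithLp.toLp 2 (ξ, 0))
  have a2 := (t3.inner_const hK ξ).fluxIdentity_parts hK hφ
  refine (a1.add a2).congr ?_ (Eventually.of_forall fun z => ?_)
  · filter_upwards [t4] with z hz
    have e3 : τ' z = -(H z).fst := eq_neg_of_add_eq_zero_right hz.1
    simp only [inner_toLp_zero, inner_add_right, real_inner_smul_right, e3, inner_neg_right]
    ring
  · simp only [inner_toLp_zero, inner_add_right, real_inner_smul_right]
    ring

theorem mass (hK : IsLipschitzPolytope K) (ht : IsTrefftzOn K κ w τ gw gτ)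
    {φ : SpaceTime n → ℝ} (hφ : ContDiff ℝ ∞ φ) :
    FluxIdentity K (fun z => ⟪τ z, (gradient φ z).fst⟫ + κ * w z * (gradient φ z).snd)
      (fun z => φ z * (⟪gτ z, (outerNormal K z).fst⟫ + κ * gw z * (outerNormal K z).snd)) := by
  obtain ⟨H, e, τ', t1, t2, t3, t4⟩ := ht
  have a2 := ((t1.hasTimeDeriv hK).fluxIdentity_parts hK hφ).const_mul κ
  have hi : IntegrableOn (fun z => ⟪τ z, (gradient φ z).fst⟫ + e z * φ z) K :=
    (MemLp.integrable_inner_two t2.1 (hK.memLp_of_continuous (continuous_gradient_fst hφ))).add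
      (MemLp.integrable_mul_two t2.2.1 (hK.memLp_of_continuous hφ.continuous))
  have hj : IntegrableOn (fun z => ⟪gτ z, (outerNormal K z).fst⟫ * φ z) (frontier K) (surf n) := by
    refine MemLp.integrable_mul_two (MemLp.of_le t2.2.2.1
      (t2.2.2.1.1.inner hK.measurable_normal_fst.aestronglyMeasurable)
      (Eventually.of_forall fun z => (norm_inner_le_norm _ _).trans ?_))
      (hK.memLp_frontier_of_continuous hφ.continuous)
    exact mul_le_of_le_one_right (norm_nonneg _)
      ((norm_fst_le _).trans (norm_outerNormal_le K z))
  have a1 := FluxIdentity.mk hi hj (t2.2.2.2 φ hφ)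
  refine (a1.add a2).congr ?_ (Eventually.of_forall fun z => ?_)
  · filter_upwards [t4] with z hz
    have e4 : e z = -(κ * (H z).snd) := eq_neg_of_add_eq_zero_left hz.2
    simp only [e4]
    ring
  · ring

theorem congr (ht : IsTrefftzOn K κ w τ gw gτ)
    (hv : gw =ᵐ[(surf n).restrict (frontier K)] gv)
    (hσ : gτ =ᵐ[(surf n).restrict (frontier K)] gσ) : IsTrefftzOn K κ w τ gv gσ := by
  obtain ⟨H, e, τ', ⟨s1, s2, s3, φ, hφ, l1, l2, l3⟩, ⟨t1, t2, t3, t4⟩, ⟨r1, r2, r3, r4⟩, h⟩ := ht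
  refine ⟨H, e, τ', ⟨s1, s2, s3.ae_eq hv, φ, hφ, l1, l2, l3.congr fun k => ?_⟩,
    ⟨t1, t2, t3.ae_eq hσ, fun φ hφ => ?_⟩, ⟨r1, r2, r3.ae_eq hσ, fun φ hφ => ?_⟩, h⟩
  · exact eLpNorm_congr_ae (by filter_upwards [hv] with z hz; simp [hz])
  · rw [t4 φ hφ]
    exact integral_congr_ae (by filter_upwards [hσ] with z hz; simp [hz])
  · rw [r4 φ hφ]
    exact integral_congr_ae (by filter_upwards [hσ] with z hz; simp [hz])

end IsTrefftzOn

end Element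

/-! ### Regular points of the skeleton of a mesh -/

section Regular

theorem mem_closure_of_halfBall_subset {E : Type*} [NormedAddCommGroup E] [InnerProductSpace ℝ E]
    {K : Set E} {z m : E} {r : ℝ} (hm : m ≠ 0) (hr : 0 < r) (h : halfBall z m r ⊆ K) :
    z ∈ closure K := by
  refine mem_closure_iff.2 fun U hU hz => ?_
  obtain ⟨y, hy1, hy2⟩ := exists_mem_halfBall_of_isOpen hm hU hz (Metric.mem_ball_self hr) (by simp)
  exact ⟨y, hy1, h hy2⟩

theorem halfBall_mono {E : Type*} [NormedAddCommGroup E] [InnerProductSpace ℝ E]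
    (z m : E) {r s : ℝ} (h : r ≤ s) : halfBall z m r ⊆ halfBall z m s :=
  Set.inter_subset_inter_left _ (Metric.ball_subset_ball h)

theorem IsLipschitzPolytope.isOuterNormal_of_halfBall_subset {E : Type*} [NormedAddCommGroup E]
    [InnerProductSpace ℝ E] {K : Set E} (hK : IsLipschitzPolytope K) {z m : E} {r : ℝ}
    (hm : ‖m‖ = 1) (hr : 0 < r) (hflat : ∀ y ∈ Metric.ball z r, y ∈ frontier K → ⟪y - z, m⟫ = 0)
    (h : halfBall z m r ⊆ K) (hz : z ∉ K) : IsOuterNormal K z m := by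
  have hm0 : m ≠ 0 := by rintro rfl; simp at hm
  have hfr : z ∈ frontier K := ⟨mem_closure_of_halfBall_subset hm0 hr h,
    fun hi => hz (interior_subset hi)⟩
  rcases hK.isOuterNormal_or hfr hm hr hflat with h1 | ⟨-, s, hs, h2⟩
  · exact h1
  · obtain ⟨y, hy1, hy2⟩ := nonempty_halfBall (z := z) hm0 (lt_min hr hs)
    have h3 := (h2 y (Metric.ball_subset_ball (min_le_right r s) hy1)).1
      (h (halfBall_mono z m (min_le_left r s) ⟨hy1, hy2⟩))
    rw [inner_neg_right] at h3
    have : ⟪y - z, m⟫ < 0 := hy2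
    linarith

namespace Mesh

variable {n : ℕ} {P : AcousticProblem n} (M : Mesh P)

/-- The union of all element boundaries, of `∂Ω × ℝ` and of the initial and final hyperplanes. -/
def skeleton : Set (SpaceTime n) :=
  {y | (∃ K ∈ M.elems, y ∈ frontier K) ∨ y.fst ∈ frontier P.Ω ∨ y.snd = 0 ∨ y.snd = P.T}

/-- Near `z` the skeleton is contained in a hyperplane. -/
def IsRegular (z : SpaceTime n) : Prop :=
  ∃ ν : SpaceTime n, ‖ν‖ = 1 ∧ ∃ r : ℝ, 0 < r ∧
    ∀ y ∈ Metric.ball z r, y ∈ M.skeleton → ⟪y - z, ν⟫ = 0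

/-- Element boundaries, `∂Ω × ℝ` and the two extreme time levels lie in a single finite family of
hyperplanes, whose crossings are null for the surface measure. -/
theorem ae_isRegular : ∀ᵐ z ∂surf n, M.IsRegular z := by
  classical
  have h1 : ∀ K ∈ M.elems, ∃ H : Finset (SpaceTime n × ℝ), (∀ h ∈ H, h.1 ≠ 0) ∧
      frontier K ⊆ ⋃ h ∈ H, {y | ⟪h.1, y⟫ = h.2} := fun K hK => (M.polytope K hK).flat
  choose! H hH using h1
  obtain ⟨HΩ, hΩ0, hΩ⟩ := P.polytope.flat
  set L : Finset (SpaceTime n × ℝ) :=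
    M.elems.biUnion H ∪ HΩ.image (fun h => ((WithLp.toLp 2 (h.1, 0) : SpaceTime n), h.2)) ∪
      {(AcousticProblem.eT n, 0), (AcousticProblem.eT n, P.T)} with hL
  have hL0 : ∀ h ∈ L, h.1 ≠ 0 := by
    intro h hh
    simp only [hL, Finset.mem_union, Finset.mem_biUnion, Finset.mem_image, Finset.mem_insert,
      Finset.mem_singleton] at hh
    have heT : AcousticProblem.eT n ≠ 0 := by
      intro h0
      have := norm_eT (n := n)
      rw [h0, norm_zero] at this
      exact zero_ne_one this
    rcases hh with (⟨K, hK, hKh⟩ | ⟨h', hh', rfl⟩) | rfl | rfl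
    · exact (hH K hK).1 h hKh
    · intro h0
      exact hΩ0 h' hh' (congrArg WithLp.fst h0)
    · exact heT
    · exact heT
  have hskel : ∀ y ∈ M.skeleton, ∃ h ∈ L, ⟪h.1, y⟫ = h.2 := by
    intro y hy
    simp only [hL, Finset.mem_union, Finset.mem_biUnion, Finset.mem_image, Finset.mem_insert,
      Finset.mem_singleton]
    rcases hy with ⟨K, hK, hy⟩ | hy | hy | hy
    · obtain ⟨h, hh, hhy⟩ := Set.mem_iUnion₂.1 ((hH K hK).2 hy)
      exact ⟨h, Or.inl (Or.inl ⟨K, hK, hh⟩), hhy⟩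
    · obtain ⟨h, hh, hhy⟩ := Set.mem_iUnion₂.1 (hΩ hy)
      refine ⟨(WithLp.toLp 2 (h.1, 0), h.2), Or.inl (Or.inr ⟨h, hh, rfl⟩), ?_⟩
      rw [real_inner_comm, inner_toLp_zero]
      exact hhy
    · exact ⟨(AcousticProblem.eT n, 0), Or.inr (Or.inl rfl), by rw [real_inner_comm, inner_eT, hy]⟩
    · exact ⟨(AcousticProblem.eT n, P.T), Or.inr (Or.inr rfl),
        by rw [real_inner_comm, inner_eT, hy]⟩
  filter_upwards [ae_noCrossing hL0] with z hz
  have hflat : ∃ ν : SpaceTime n, ‖ν‖ = 1 ∧ FlatAt L z ν := by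
    by_cases hex : ∃ h ∈ L, ⟪h.1, z⟫ = h.2
    · obtain ⟨h, hh, hzh⟩ := hex
      exact ⟨_, norm_smul_inv_norm (𝕜 := ℝ) (hL0 h hh), hz.flatAt hh hzh⟩
    · push Not at hex
      exact ⟨_, norm_eT, flatAt_of_forall_ne hex _⟩
  obtain ⟨ν, hν, r, hr, hb⟩ := hflat
  refine ⟨ν, hν, r, hr, fun y hy hys => ?_⟩
  obtain ⟨h, hh, hhy⟩ := hskel y hys
  exact hb h hh y hy hhy

variable {M} {z : SpaceTime n}

theorem isOpen_Q : IsOpen P.Q :=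
  (P.polytope.isOpen.preimage continuous_fst_spaceTime).inter
    (isOpen_Ioo.preimage continuous_snd_spaceTime)

theorem frontier_subset_skeleton {K : Set (SpaceTime n)} (hK : K ∈ M.elems) :
    frontier K ⊆ M.skeleton := fun _ hy => Or.inl ⟨K, hK, hy⟩

/-- The whole time level through `z` is part of the skeleton, so `z` may be moved in the direction
`ν.fst` without leaving it. Flatness forces `ν.fst = 0`, and `ν` is the time direction up to sign.
-/
theorem IsRegular.flat_time (hz : M.IsRegular z) (h : z.snd = 0 ∨ z.snd = P.T) :
    ∃ r : ℝ, 0 < r ∧ ∀ y ∈ Metric.ball z r, y ∈ M.skeleton →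
      ⟪y - z, AcousticProblem.eT n⟫ = 0 := by
  obtain ⟨ν, hν, r, hr, hb⟩ := hz
  have hfst : ν.fst = 0 := by
    set y : SpaceTime n := z + WithLp.toLp 2 ((r / 2) • ν.fst, 0) with hy
    have hyz : y - z = WithLp.toLp 2 ((r / 2) • ν.fst, 0) := by rw [hy]; abel
    have hys : y.snd = z.snd := by simp [hy]
    have hyb : y ∈ Metric.ball z r := by
      rw [mem_ball_iff_norm, hyz]
      have h1 : ‖(WithLp.toLp 2 ((r / 2) • ν.fst, (0 : ℝ)) : SpaceTime n)‖ = r / 2 * ‖ν.fst‖ := by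
        rw [← sq_eq_sq₀ (norm_nonneg _) (by positivity), norm_sq_spaceTime]
        simp [norm_smul, abs_of_pos hr, mul_pow]
      rw [h1]
      have := (norm_fst_le ν).trans hν.le
      nlinarith
    have h2 := hb y hyb (by
      rcases h with h | h
      · exact Or.inr (Or.inr (Or.inl (hys.trans h)))
      · exact Or.inr (Or.inr (Or.inr (hys.trans h))))
    rw [hyz, real_inner_comm, inner_toLp_zero, real_inner_smul_left] at h2
    have h3 : r / 2 ≠ 0 := by positivity
    exact inner_self_eq_zero.1 ((mul_eq_zero.1 h2).resolve_left h3)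
  have hsnd : ν.snd ≠ 0 := by
    intro h0
    have := norm_sq_spaceTime ν
    rw [hν, hfst, h0] at this
    simp at this
  refine ⟨r, hr, fun y hy hys => ?_⟩
  have h2 := hb y hy hys
  rw [inner_spaceTime, hfst, inner_zero_right, zero_add] at h2
  rw [inner_eT]
  exact (mul_eq_zero.1 h2).resolve_right hsnd

/-- Moving in time along `∂Ω × ℝ` stays in the skeleton, so the normal of the flat piece has no time
component; the restriction to the time level of `z` then makes `∂Ω` flat near `z.fst`. -/
theorem IsRegular.flat_lateral (hz : M.IsRegular z) (h : z.fst ∈ frontier P.Ω) :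
    IsOuterNormal P.Ω z.fst (P.nΩ z) ∧ ∃ r : ℝ, 0 < r ∧
      ∀ y ∈ Metric.ball z r, y ∈ M.skeleton → ⟪y - z, P.nΩT z⟫ = 0 := by
  obtain ⟨ν, hν, r, hr, hb⟩ := hz
  have hsnd : ν.snd = 0 := by
    set y : SpaceTime n := z + (r / 2) • AcousticProblem.eT n with hy
    have hyz : y - z = (r / 2) • AcousticProblem.eT n := by rw [hy]; abel
    have hyf : y.fst = z.fst := by simp [hy, AcousticProblem.eT]
    have hyb : y ∈ Metric.ball z r := by
      rw [mem_ball_iff_norm, hyz, norm_smul, norm_eT, Real.norm_eq_abs, abs_of_pos (by positivity)]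
      linarith
    have h2 := hb y hyb (Or.inr (Or.inl (by rw [hyf]; exact h)))
    rw [hyz, real_inner_smul_left, real_inner_comm, inner_eT] at h2
    exact (mul_eq_zero.1 h2).resolve_left (by positivity)
  have hfst : ‖ν.fst‖ = 1 := by
    have := norm_sq_spaceTime ν
    rw [hν, hsnd] at this
    have h2 : ‖ν.fst‖ ^ 2 = 1 := by linarith
    nlinarith [norm_nonneg ν.fst]
  have hflat : ∀ x ∈ Metric.ball z.fst r, x ∈ frontier P.Ω → ⟪x - z.fst, ν.fst⟫ = 0 := by
    intro x hx hxf
    have h1 := hb (WithLp.toLp 2 (x, z.snd)) (by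
      rw [mem_ball_iff_norm] at hx ⊢
      refine lt_of_le_of_lt (le_of_eq ?_) hx
      rw [← sq_eq_sq₀ (norm_nonneg _) (norm_nonneg _), norm_sq_spaceTime]
      simp) (Or.inr (Or.inl hxf))
    rw [inner_spaceTime, hsnd, mul_zero, add_zero] at h1
    exact h1
  have hor := P.polytope.isOuterNormal_or h hfst hr hflat
  have hN : IsOuterNormal P.Ω z.fst (P.nΩ z) ∧ (P.nΩ z = ν.fst ∨ P.nΩ z = -ν.fst) := by
    rcases hor with h1 | h1
    · have : P.nΩ z = ν.fst := h1.outerNormal_eq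
      exact ⟨this ▸ h1, Or.inl this⟩
    · have : P.nΩ z = -ν.fst := h1.outerNormal_eq
      exact ⟨this ▸ h1, Or.inr this⟩
  refine ⟨hN.1, r, hr, fun y hy hys => ?_⟩
  have h2 := hb y hy hys
  rw [inner_spaceTime, hsnd, mul_zero, add_zero] at h2
  rw [AcousticProblem.nΩT, inner_toLp_zero, real_inner_comm]
  rcases hN.2 with h3 | h3
  · rw [h3]; exact h2
  · rw [h3, inner_neg_right, h2, neg_zero]

theorem eq_of_isOuterNormal {K K' : Set (SpaceTime n)} (hK : K ∈ M.elems) (hK' : K' ∈ M.elems)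
    {m : SpaceTime n} (h : IsOuterNormal K z m) (h' : IsOuterNormal K' z m) : K = K' := by
  by_contra hne
  have h0 := h.ne_zero
  obtain ⟨r, hr, h1⟩ := h.exists_halfBall_subset
  obtain ⟨s, hs, h2⟩ := h'.exists_halfBall_subset
  obtain ⟨y, hy⟩ := nonempty_halfBall (z := z) h0 (lt_min hr hs)
  exact Set.disjoint_left.1 (M.disjoint K hK K' hK' hne)
    (h1 (halfBall_mono z m (min_le_left r s) hy)) (h2 (halfBall_mono z m (min_le_right r s) hy))

/-- Flatness keeps the half ball off all element boundaries, so it lies entirely inside any element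
whose closure it meets. -/
theorem exists_halfBall_subset {m : SpaceTime n} {r : ℝ} (hm : m ≠ 0) (hr : 0 < r)
    (hflat : ∀ y ∈ Metric.ball z r, y ∈ M.skeleton → ⟪y - z, m⟫ = 0)
    (hsub : halfBall z m r ⊆ P.Q) : ∃ K ∈ M.elems, halfBall z m r ⊆ K := by
  obtain ⟨y, hy⟩ := nonempty_halfBall (z := z) hm hr
  obtain ⟨K, hK, hyK⟩ := Set.mem_iUnion₂.1 (M.cover (hsub hy))
  refine ⟨K, hK, ?_⟩
  have hd : Disjoint (halfBall z m r) (frontier K) := Set.disjoint_left.2 fun y hy1 hy2 =>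
    (hflat y hy1.1 (frontier_subset_skeleton hK hy2)).not_lt hy1.2
  refine (halfBall_subset_or_disjoint hd).resolve_right fun h => ?_
  obtain ⟨w, hw1, hw2⟩ := mem_closure_iff.1 hyK _ (isOpen_halfBall z m r) hy
  exact Set.disjoint_left.1 h hw1 hw2

/-- A boundary point of `Q` at which the skeleton is flat belongs to exactly one element. -/
theorem exists_unique_elem {m : SpaceTime n} (hm : ‖m‖ = 1) (hzQ : z ∉ P.Q)
    (hflat : ∃ r : ℝ, 0 < r ∧ ∀ y ∈ Metric.ball z r, y ∈ M.skeleton → ⟪y - z, m⟫ = 0)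
    (hin : ∃ r : ℝ, 0 < r ∧ ∀ y ∈ Metric.ball z r, y ∈ P.Q ↔ ⟪y - z, m⟫ < 0) :
    ∃ K ∈ M.elems, IsOuterNormal K z m ∧ ∀ K' ∈ M.elems, z ∈ frontier K' → K' = K := by
  obtain ⟨r, hr, hflat⟩ := hflat
  obtain ⟨s, hs, hin⟩ := hin
  have hm0 : m ≠ 0 := by rintro rfl; simp at hm
  have hsub : halfBall z m (min r s) ⊆ P.Q := fun y hy =>
    (hin y (Metric.ball_subset_ball (min_le_right r s) hy.1)).2 hy.2
  have hflat' : ∀ y ∈ Metric.ball z (min r s), y ∈ M.skeleton → ⟪y - z, m⟫ = 0 := fun y hy =>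
    hflat y (Metric.ball_subset_ball (min_le_left r s) hy)
  obtain ⟨K, hK, hKs⟩ := exists_halfBall_subset hm0 (lt_min hr hs) hflat' hsub
  have hKn := (M.polytope K hK).isOuterNormal_of_halfBall_subset hm (lt_min hr hs)
    (fun y hy hyf => hflat' y hy (frontier_subset_skeleton hK hyf)) hKs
    (fun h => hzQ (M.subset K hK h))
  refine ⟨K, hK, hKn, fun K' hK' hz' => ?_⟩
  rcases (M.polytope K' hK').isOuterNormal_or hz' hm (lt_min hr hs)
    (fun y hy hyf => hflat' y hy (frontier_subset_skeleton hK' hyf)) with h | h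
  · exact eq_of_isOuterNormal hK' hK h hKn
  · obtain ⟨t, ht, hts⟩ := h.exists_halfBall_subset
    obtain ⟨y, hy⟩ := nonempty_halfBall (z := z) h.ne_zero (lt_min ht hs)
    have h1 := (hin y (Metric.ball_subset_ball (min_le_right t s) hy.1)).1
      (M.subset K' hK' (hts (halfBall_mono z _ (min_le_left t s) hy)))
    have h2 : ⟪y - z, -m⟫ < 0 := hy.2
    rw [inner_neg_right] at h2
    linarith

/-- An element boundary point in `Q` at which the skeleton is flat lies on an interface of exactly
two elements. -/
theorem IsRegular.exists_interface (hz : M.IsRegular z) (hzQ : z ∈ P.Q) {K : Set (SpaceTime n)}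
    (hK : K ∈ M.elems) (hzK : z ∈ frontier K) :
    ∃ ν, IsOuterNormal K z ν ∧ ∃ K' ∈ M.elems, K ≠ K' ∧ IsOuterNormal K' z (-ν) ∧
      ∀ L ∈ M.elems, z ∈ frontier L → L = K ∨ L = K' := by
  obtain ⟨μ, hμ, r, hr, hflat⟩ := hz
  obtain ⟨s, hs, hsub⟩ := Metric.isOpen_iff.1 isOpen_Q z hzQ
  obtain ⟨ν, hν, hνK, hfl⟩ : ∃ ν, ‖ν‖ = 1 ∧ IsOuterNormal K z ν ∧
      ∀ y ∈ Metric.ball z (min r s), y ∈ M.skeleton → ⟪y - z, ν⟫ = 0 := by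
    have hflat' : ∀ y ∈ Metric.ball z (min r s), y ∈ M.skeleton → ⟪y - z, μ⟫ = 0 := fun y hy =>
      hflat y (Metric.ball_subset_ball (min_le_left r s) hy)
    rcases (M.polytope K hK).isOuterNormal_or hzK hμ (lt_min hr hs)
      (fun y hy hyf => hflat' y hy (frontier_subset_skeleton hK hyf)) with h | h
    · exact ⟨μ, hμ, h, hflat'⟩
    · exact ⟨-μ, h.1, h, fun y hy hys => by rw [inner_neg_right, hflat' y hy hys, neg_zero]⟩
  have hfl' : ∀ y ∈ Metric.ball z (min r s), y ∈ M.skeleton → ⟪y - z, -ν⟫ = 0 := fun y hy hys => by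
    rw [inner_neg_right, hfl y hy hys, neg_zero]
  have hν' : ‖-ν‖ = 1 := by rwa [norm_neg]
  have hν0 : -ν ≠ 0 := neg_ne_zero.2 hνK.ne_zero
  obtain ⟨K', hK', hKs⟩ := exists_halfBall_subset hν0 (lt_min hr hs) hfl'
    fun y hy => hsub (Metric.ball_subset_ball (min_le_right r s) hy.1)
  -- If the open set `K'` contained the boundary point `z` of `K`, it would meet `K`; the two
  -- elements would coincide, although `z` is not in `K`.
  have hzK' : z ∉ K' := by
    intro h
    obtain ⟨y, hy1, hy2⟩ := mem_closure_iff.1 hνK.mem_closure K' (M.polytope K' hK').isOpen h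
    have : K = K' := by
      by_contra hne
      exact Set.disjoint_left.1 (M.disjoint K hK K' hK' hne) hy2 hy1
    exact hνK.notMem (this ▸ h)
  have hK'n := (M.polytope K' hK').isOuterNormal_of_halfBall_subset hν' (lt_min hr hs)
    (fun y hy hyf => hfl' y hy (frontier_subset_skeleton hK' hyf)) hKs hzK'
  refine ⟨ν, hνK, K', hK', ?_, hK'n, fun L hL hzL => ?_⟩
  · rintro rfl
    have h1 := hνK.unique hK'n
    have h2 : ⟪ν, ν⟫ = ⟪ν, -ν⟫ := congrArg (fun x => ⟪ν, x⟫) h1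
    rw [inner_neg_right, real_inner_self_eq_norm_sq, hν] at h2
    norm_num at h2
  · rcases (M.polytope L hL).isOuterNormal_or hzL hν (lt_min hr hs)
      (fun y hy hyf => hfl y hy (frontier_subset_skeleton hL hyf)) with h | h
    · exact Or.inl (eq_of_isOuterNormal hL hK h hνK)
    · exact Or.inr (eq_of_isOuterNormal hL hK' h hK'n)

end Mesh

end Regular

/-! ### Sums over element boundaries as integrals over the faces -/

section Faces

namespace AcousticProblem

variable {n : ℕ} (P : AcousticProblem n)

theorem gamma_subset : P.ΓD ⊆ frontier P.Ω ∧ P.ΓN ⊆ frontier P.Ω ∧ P.ΓR ⊆ frontier P.Ω := by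
  rw [← P.cover]
  exact ⟨fun _ h => Or.inl (Or.inl h), fun _ h => Or.inl (Or.inr h), fun _ h => Or.inr h⟩

/-- `m` is the outward normal of `Q` at the point `z` of its boundary. -/
def IsBoundaryNormal (z m : SpaceTime n) : Prop :=
  (z ∈ P.F0 ∧ m = -eT n) ∨ (z ∈ P.FT ∧ m = eT n) ∨
    (z.fst ∈ frontier P.Ω ∧ z.snd ∈ Set.Icc 0 P.T ∧ m = P.nΩT z)

variable {P}

theorem notMem_of_mem_frontier {x : Space n} (h : x ∈ frontier P.Ω) : x ∉ P.Ω := fun h' =>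
  (P.polytope.isOpen.frontier_eq ▸ h).2 h'

theorem measurableSet_cylinder {A : Set (Space n)} {I : Set ℝ} (hA : MeasurableSet A)
    (hI : MeasurableSet I) : MeasurableSet (cylinder A I : Set (SpaceTime n)) :=
  (continuous_fst_spaceTime.measurable hA).inter (continuous_snd_spaceTime.measurable hI)

theorem measurableSet_F0 : MeasurableSet P.F0 :=
  measurableSet_cylinder P.polytope.isOpen.measurableSet (measurableSet_singleton _)

theorem measurableSet_FT : MeasurableSet P.FT :=
  measurableSet_cylinder P.polytope.isOpen.measurableSet (measurableSet_singleton _)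

theorem measurableSet_FD : MeasurableSet P.FD :=
  measurableSet_cylinder P.measurable_D measurableSet_Icc

theorem measurableSet_FN : MeasurableSet P.FN :=
  measurableSet_cylinder P.measurable_N measurableSet_Icc

theorem measurableSet_FR : MeasurableSet P.FR :=
  measurableSet_cylinder P.measurable_R measurableSet_Icc

end AcousticProblem

open AcousticProblem

theorem IsInterface.neg {n : ℕ} {elems : Finset (Set (SpaceTime n))} {z ν : SpaceTime n}
    (h : IsInterface elems z ν) : IsInterface elems z (-ν) := by
  obtain ⟨K₁, h1, K₂, h2, hne, h3, h4⟩ := h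
  exact ⟨K₂, h2, K₁, h1, hne.symm, h4, by rwa [neg_neg]⟩

namespace Mesh

variable {n : ℕ} {P : AcousticProblem n} {M : Mesh P} {z m ν : SpaceTime n}

theorem exists_ball_subset_time (h : z.fst ∈ P.Ω) {I : Set ℝ} (hI : IsOpen I) (hz : z.snd ∈ I) :
    ∃ r : ℝ, 0 < r ∧ ∀ y ∈ Metric.ball z r, y.fst ∈ P.Ω ∧ y.snd ∈ I := by
  have hopen : IsOpen {y : SpaceTime n | y.fst ∈ P.Ω ∧ y.snd ∈ I} :=
    (P.polytope.isOpen.preimage continuous_fst_spaceTime).inter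
      (hI.preimage continuous_snd_spaceTime)
  exact Metric.isOpen_iff.1 hopen z ⟨h, hz⟩

/-- The edges `∂Ω × {0}` and `∂Ω × {T}` contain no regular point: flatness along the time level is
incompatible with the skeleton direction along the time axis. -/
theorem IsRegular.snd_mem_Ioo (hz : M.IsRegular z) (h1 : z.fst ∈ frontier P.Ω)
    (h2 : z.snd ∈ Set.Icc 0 P.T) : z.snd ∈ Set.Ioo 0 P.T := by
  have key : ¬ (z.snd = 0 ∨ z.snd = P.T) := by
    intro h
    obtain ⟨r, hr, hb⟩ := hz.flat_time h
    have h3 : ‖(r / 2) • eT n‖ = r / 2 := by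
      rw [norm_smul, norm_eT, Real.norm_eq_abs, abs_of_pos (by positivity), mul_one]
    have h4 := hb (z + (r / 2) • eT n)
      (by rw [mem_ball_iff_norm, add_sub_cancel_left, h3]; linarith)
      (Or.inr (Or.inl (by simpa [eT] using h1)))
    rw [add_sub_cancel_left, real_inner_smul_left, real_inner_self_eq_norm_sq, norm_eT] at h4
    linarith
  push Not at key
  exact ⟨lt_of_le_of_ne h2.1 (Ne.symm key.1), lt_of_le_of_ne h2.2 key.2⟩

theorem IsRegular.exists_unique_boundary (hz : M.IsRegular z) (h : P.IsBoundaryNormal z m) :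
    z ∉ P.Q ∧
      ∃ K ∈ M.elems, IsOuterNormal K z m ∧ ∀ K' ∈ M.elems, z ∈ frontier K' → K' = K := by
  rcases h with ⟨⟨h1, h2⟩, rfl⟩ | ⟨⟨h1, h2⟩, rfl⟩ | ⟨h1, h2, rfl⟩
  · have h2 : z.snd = 0 := h2
    have hQ : z ∉ P.Q := fun h => h.2.1.ne' h2
    refine ⟨hQ, exists_unique_elem (by rw [norm_neg, norm_eT]) hQ ?_ ?_⟩
    · obtain ⟨r, hr, hb⟩ := hz.flat_time (Or.inl h2)
      exact ⟨r, hr, fun y hy hys => by rw [inner_neg_right, hb y hy hys, neg_zero]⟩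
    · obtain ⟨r, hr, hb⟩ := exists_ball_subset_time (I := Set.Iio P.T) h1 isOpen_Iio
        (by rw [h2]; exact P.T_pos)
      refine ⟨r, hr, fun y hy => ?_⟩
      rw [inner_neg_right, inner_eT, WithLp.sub_snd, h2, sub_zero, neg_lt_zero]
      exact ⟨fun h => h.2.1, fun h => ⟨(hb y hy).1, h, (hb y hy).2⟩⟩
  · have h2 : z.snd = P.T := h2
    have hQ : z ∉ P.Q := fun h => h.2.2.ne h2
    refine ⟨hQ, exists_unique_elem norm_eT hQ (hz.flat_time (Or.inr h2)) ?_⟩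
    obtain ⟨r, hr, hb⟩ := exists_ball_subset_time (I := Set.Ioi 0) h1 isOpen_Ioi
      (by rw [h2]; exact P.T_pos)
    refine ⟨r, hr, fun y hy => ?_⟩
    rw [inner_eT, WithLp.sub_snd, h2, sub_neg]
    exact ⟨fun h => h.2.2, fun h => ⟨(hb y hy).1, (hb y hy).2, h⟩⟩
  · have hQ : z ∉ P.Q := fun h => notMem_of_mem_frontier h1 h.1
    obtain ⟨⟨hν, r, hr, hb⟩, hflat⟩ := hz.flat_lateral h1
    have hnorm : ‖P.nΩT z‖ = 1 := by
      have h3 : ‖P.nΩT z‖ ^ 2 = ‖P.nΩ z‖ ^ 2 + 0 ^ 2 := norm_sq_spaceTime (P.nΩT z)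
      rw [hν] at h3
      nlinarith [norm_nonneg (P.nΩT z)]
    refine ⟨hQ, exists_unique_elem hnorm hQ hflat ?_⟩
    obtain ⟨s, hs, hsb⟩ := Metric.isOpen_iff.1
      ((isOpen_Ioo (a := (0 : ℝ)) (b := P.T)).preimage (continuous_snd_spaceTime (n := n))) z
      (hz.snd_mem_Ioo h1 h2)
    refine ⟨min r s, lt_min hr hs, fun y hy => ?_⟩
    have hyr : y.fst ∈ Metric.ball z.fst r := by
      have := Metric.ball_subset_ball (min_le_left r s) hy
      rw [mem_ball_iff_norm] at this ⊢
      exact (norm_fst_le (y - z)).trans_lt this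
    have hys : y.snd ∈ Set.Ioo 0 P.T := hsb (Metric.ball_subset_ball (min_le_right r s) hy)
    rw [nΩT, inner_toLp_zero, real_inner_comm, WithLp.sub_fst, ← hb _ hyr]
    exact ⟨fun h => h.1, fun h => ⟨h, hys⟩⟩

theorem mem_Q_or_boundary {K : Set (SpaceTime n)} (hK : K ∈ M.elems) (hz : z ∈ frontier K) :
    z ∈ P.Q ∨ ∃ m, P.IsBoundaryNormal z m := by
  have hcl : z ∈ {y : SpaceTime n | y.fst ∈ closure P.Ω ∧ y.snd ∈ Set.Icc 0 P.T} := by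
    have hclosed : IsClosed {y : SpaceTime n | y.fst ∈ closure P.Ω ∧ y.snd ∈ Set.Icc 0 P.T} :=
      (isClosed_closure.preimage continuous_fst_spaceTime).inter
        (isClosed_Icc.preimage continuous_snd_spaceTime)
    refine closure_minimal (fun y hy => ?_) hclosed hz.1
    exact ⟨subset_closure (M.subset K hK hy).1, Set.Ioo_subset_Icc_self (M.subset K hK hy).2⟩
  by_cases h1 : z.fst ∈ P.Ω
  · rcases hcl.2.1.eq_or_lt with h2 | h2
    · exact Or.inr ⟨_, Or.inl ⟨⟨h1, h2.symm⟩, rfl⟩⟩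
    · rcases hcl.2.2.eq_or_lt with h3 | h3
      · exact Or.inr ⟨_, Or.inr (Or.inl ⟨⟨h1, h3⟩, rfl⟩)⟩
      · exact Or.inl ⟨h1, h2, h3⟩
  · refine Or.inr ⟨_, Or.inr (Or.inr ⟨?_, hcl.2, rfl⟩)⟩
    rw [P.polytope.isOpen.frontier_eq]
    exact ⟨hcl.1, h1⟩

theorem IsRegular.mem_Q_of_isInterface (hz : M.IsRegular z) (h : IsInterface M.elems z ν) :
    z ∈ P.Q := by
  obtain ⟨K₁, h1, K₂, h2, hne, h3, h4⟩ := h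
  refine (mem_Q_or_boundary h1 h3.mem_frontier).resolve_right ?_
  rintro ⟨m, hm⟩
  obtain ⟨-, K, -, -, huniq⟩ := hz.exists_unique_boundary hm
  exact hne ((huniq K₁ h1 h3.mem_frontier).trans (huniq K₂ h2 h4.mem_frontier).symm)

theorem IsRegular.isOuterNormal_outerNormal (hz : M.IsRegular z) {K : Set (SpaceTime n)}
    (hK : K ∈ M.elems) (hzK : z ∈ frontier K) : IsOuterNormal K z (outerNormal K z) := by
  obtain ⟨μ, hμ, r, hr, hb⟩ := hz
  rcases (M.polytope K hK).isOuterNormal_or hzK hμ hr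
    (fun y hy hyf => hb y hy (frontier_subset_skeleton hK hyf)) with h | h
  · exact h.outerNormal_eq ▸ h
  · exact h.outerNormal_eq ▸ h

/-! ### Sums over the elements that meet at a point. -/

section FaceSum

variable {F : Type*} [NormedAddCommGroup F]

variable (M) in
/-- Sum over the elements at `z` of a function of the outward normal. -/
def faceSum (h : SpaceTime n → SpaceTime n → F) (z : SpaceTime n) : F :=
  ∑ K ∈ M.elems, (frontier K).indicator (fun z => h z (outerNormal K z)) z

theorem IsRegular.faceSum_boundary (hz : M.IsRegular z) (hm : P.IsBoundaryNormal z m)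
    (h : SpaceTime n → SpaceTime n → F) : M.faceSum h z = h z m := by
  obtain ⟨-, K, hK, hKm, huniq⟩ := hz.exists_unique_boundary hm
  rw [faceSum, Finset.sum_eq_single_of_mem K hK, Set.indicator_of_mem hKm.mem_frontier,
    hKm.outerNormal_eq]
  intro K' hK' hne
  exact Set.indicator_of_notMem (fun h => hne (huniq K' hK' h)) _

theorem IsRegular.faceSum_interface (hz : M.IsRegular z) (hν : IsInterface M.elems z ν)
    (h : SpaceTime n → SpaceTime n → F) : M.faceSum h z = h z ν + h z (-ν) := by
  classical
  have hQ := hz.mem_Q_of_isInterface hν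
  obtain ⟨K₁, h1, K₂, h2, hne, h3, h4⟩ := hν
  obtain ⟨μ, hμ, K', hK', hne', hμ', huniq⟩ := hz.exists_interface hQ h1 h3.mem_frontier
  have hKK : K' = K₂ := ((huniq K₂ h2 h4.mem_frontier).resolve_left hne.symm).symm
  subst hKK
  have hsub : ({K₁, K'} : Finset (Set (SpaceTime n))) ⊆ M.elems := by
    intro K hK
    rcases Finset.mem_insert.1 hK with rfl | hK
    · exact h1
    · rw [Finset.mem_singleton.1 hK]; exact h2
  rw [faceSum, ← Finset.sum_subset hsub, Finset.sum_pair hne,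
    Set.indicator_of_mem h3.mem_frontier, Set.indicator_of_mem h4.mem_frontier, h3.outerNormal_eq,
    h4.outerNormal_eq]
  intro K hK hK'
  refine Set.indicator_of_notMem (fun hzK => hK' ?_) _
  rcases huniq K hK hzK with rfl | rfl <;> simp

theorem IsRegular.eq_or_eq_neg (hz : M.IsRegular z) {ν' : SpaceTime n}
    (hν : IsInterface M.elems z ν) (hν' : IsInterface M.elems z ν') : ν' = ν ∨ ν' = -ν := by
  have hQ := hz.mem_Q_of_isInterface hν
  obtain ⟨K₁, h1, K₂, h2, hne, h3, h4⟩ := hν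
  obtain ⟨L₁, g1, L₂, g2, hne', g3, g4⟩ := hν'
  obtain ⟨μ, hμ, K', hK', -, hμ', huniq⟩ := hz.exists_interface hQ h1 h3.mem_frontier
  have hμν := hμ.unique h3
  subst hμν
  rcases huniq L₁ g1 g3.mem_frontier with rfl | rfl
  · exact Or.inl (g3.unique h3)
  · exact Or.inr (g3.unique hμ')

theorem isInterface_nF (hν : IsInterface M.elems z ν) :
    IsInterface M.elems z (M.nF z) ∧ 0 ≤ (M.nF z).snd := by
  have hex : ∃ ν, IsInterface M.elems z ν ∧ 0 ≤ ν.snd := by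
    rcases le_total 0 ν.snd with h | h
    · exact ⟨ν, hν, h⟩
    · exact ⟨-ν, hν.neg, by simpa using h⟩
  rw [nF, dif_pos hex]
  exact hex.choose_spec

theorem norm_eq_one_of_isInterface (hν : IsInterface M.elems z ν) : ‖ν‖ = 1 := by
  obtain ⟨K₁, h1, K₂, h2, hne, h3, h4⟩ := hν
  exact h3.1

theorem IsRegular.of_mem_Fspace (hz : M.IsRegular z) (h : z ∈ M.Fspace) :
    z ∈ P.Q ∧ IsInterface M.elems z (M.nF z) ∧ 0 < (M.nF z).snd ∧
      P.c z.fst * ‖(M.nF z).fst‖ < (M.nF z).snd := by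
  obtain ⟨ν, hν, hlt⟩ := h
  have hQ := hz.mem_Q_of_isInterface hν
  obtain ⟨c₀, hc0, hc⟩ := P.c_lower
  have hcz : 0 < P.c z.fst := hc0.trans_le (hc _ hQ.1)
  obtain ⟨h1, h2⟩ := isInterface_nF hν
  have h3 : P.c z.fst * ‖(M.nF z).fst‖ < |(M.nF z).snd| := by
    rcases hz.eq_or_eq_neg hν h1 with h | h <;> rw [h]
    · exact hlt
    · simpa using hlt
  rw [abs_of_nonneg h2] at h3
  exact ⟨hQ, h1, (mul_nonneg hcz.le (norm_nonneg _)).trans_lt h3, h3⟩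

theorem IsRegular.of_mem_Ftime (hz : M.IsRegular z) (h : z ∈ M.Ftime) :
    z ∈ P.Q ∧ IsInterface M.elems z (M.nF z) ∧ (M.nF z).snd = 0 := by
  obtain ⟨ν, hν, h0⟩ := h
  obtain ⟨h1, h2⟩ := isInterface_nF hν
  refine ⟨hz.mem_Q_of_isInterface hν, h1, ?_⟩
  rcases hz.eq_or_eq_neg hν h1 with h | h <;> rw [h]
  · exact h0
  · simp [h0]

theorem IsRegular.mem_Fspace_or_Ftime (hz : M.IsRegular z) (hQ : z ∈ P.Q)
    {K : Set (SpaceTime n)} (hK : K ∈ M.elems) (hzK : z ∈ frontier K) :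
    (z ∈ M.Fspace ∧ (outerNormal K z).snd ≠ 0) ∨ (z ∈ M.Ftime ∧ (outerNormal K z).snd = 0) := by
  obtain ⟨ν, hν, K', hK', hne, hν', -⟩ := hz.exists_interface hQ hK hzK
  have hI : IsInterface M.elems z ν := ⟨K, hK, K', hK', hne, hν, hν'⟩
  obtain ⟨c₀, hc0, hc⟩ := P.c_lower
  have hcz : 0 < P.c z.fst := hc0.trans_le (hc _ hQ.1)
  rw [hν.outerNormal_eq]
  rcases M.faces z ν hI with h | h
  · refine Or.inl ⟨⟨ν, hI, h⟩, ?_⟩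
    have := (mul_nonneg hcz.le (norm_nonneg _)).trans_lt h
    exact abs_pos.1 this
  · exact Or.inr ⟨⟨ν, hI, h⟩, h⟩

variable (M) in
-- The faces are defined by an existential over normals. At regular points the condition says that
-- `z ∈ Q` and that some element normal there has nonzero time component, which is a Borel
-- condition.
theorem nullMeasurableSet_Fspace : NullMeasurableSet M.Fspace (surf n) := by
  have hm : MeasurableSet (P.Q ∩ ⋃ K ∈ M.elems, {z | (outerNormal K z).snd ≠ 0}) := by
    refine isOpen_Q.measurableSet.inter (Finset.measurableSet_biUnion _ fun K hK => ?_)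
    exact (M.polytope K hK).measurable_normal_snd (measurableSet_singleton 0).compl
  refine hm.nullMeasurableSet.congr ?_
  filter_upwards [M.ae_isRegular] with z hz
  refine propext ⟨fun h => ?_, fun h => ?_⟩
  · obtain ⟨hQ, h⟩ := h
    obtain ⟨K, hK, hzK⟩ := Set.mem_iUnion₂.1 h
    have hfr : z ∈ frontier K := by
      by_contra hn
      exact hzK (by rw [outerNormal_eq_zero_of_notMem_frontier hn]; rfl)
    exact ((hz.mem_Fspace_or_Ftime hQ hK hfr).resolve_right fun h => hzK h.2).1
  · obtain ⟨hQ, ⟨K₁, h1, K₂, h2, hne, h3, h4⟩, hpos, -⟩ := hz.of_mem_Fspace h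
    refine ⟨hQ, Set.mem_iUnion₂.2 ⟨K₁, h1, ?_⟩⟩
    rw [Set.mem_ofPred_eq, h3.outerNormal_eq]
    exact hpos.ne'

variable (M) in
theorem nullMeasurableSet_Ftime : NullMeasurableSet M.Ftime (surf n) := by
  have hm : MeasurableSet (P.Q ∩ ⋃ K ∈ M.elems,
      ({z | (outerNormal K z).snd = 0} ∩ {z | outerNormal K z ≠ 0})) := by
    refine isOpen_Q.measurableSet.inter (Finset.measurableSet_biUnion _ fun K hK => ?_)
    exact ((M.polytope K hK).measurable_normal_snd (measurableSet_singleton 0)).inter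
      (measurable_outerNormal (M.polytope K hK).isOpen (measurableSet_singleton 0).compl)
  refine hm.nullMeasurableSet.congr ?_
  filter_upwards [M.ae_isRegular] with z hz
  refine propext ⟨fun h => ?_, fun h => ?_⟩
  · obtain ⟨hQ, h⟩ := h
    obtain ⟨K, hK, hzK, hz0⟩ := Set.mem_iUnion₂.1 h
    have hfr := (TrefftzDG.isOuterNormal_outerNormal hz0).mem_frontier
    exact ((hz.mem_Fspace_or_Ftime hQ hK hfr).resolve_left fun h => h.2 hzK).1
  · obtain ⟨hQ, ⟨K₁, h1, K₂, h2, hne, h3, h4⟩, h0⟩ := hz.of_mem_Ftime h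
    refine ⟨hQ, Set.mem_iUnion₂.2 ⟨K₁, h1, ?_, ?_⟩⟩
    · rw [Set.mem_ofPred_eq, h3.outerNormal_eq]
      exact h0
    · rw [Set.mem_ofPred_eq, h3.outerNormal_eq]
      exact h3.ne_zero

theorem memLp_faceSum {p : ENNReal} {h : SpaceTime n → SpaceTime n → F}
    (hh : ∀ K ∈ M.elems, MemLp (fun z => h z (outerNormal K z)) p
      ((surf n).restrict (frontier K))) : MemLp (M.faceSum h) p (surf n) :=
  memLp_finsetSum _ fun K hK =>
    (memLp_indicator_iff_restrict isClosed_frontier.measurableSet).2 (hh K hK)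

theorem ae_Fspace_iff {p : SpaceTime n → Prop} :
    (∀ᵐ z ∂(surf n).restrict M.Fspace, p z) ↔ ∀ᵐ z ∂surf n, z ∈ M.Fspace → p z :=
  ae_restrict_iff'₀ M.nullMeasurableSet_Fspace

theorem ae_Ftime_iff {p : SpaceTime n → Prop} :
    (∀ᵐ z ∂(surf n).restrict M.Ftime, p z) ↔ ∀ᵐ z ∂surf n, z ∈ M.Ftime → p z :=
  ae_restrict_iff'₀ M.nullMeasurableSet_Ftime

theorem faceSum_Fspace (h : SpaceTime n → SpaceTime n → F) :
    ∀ᵐ z ∂(surf n).restrict M.Fspace, M.faceSum h z = h z (M.nF z) + h z (-M.nF z) := by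
  rw [ae_Fspace_iff]
  filter_upwards [M.ae_isRegular] with z hz hzF
  exact hz.faceSum_interface (hz.of_mem_Fspace hzF).2.1 h

theorem faceSum_Ftime (h : SpaceTime n → SpaceTime n → F) :
    ∀ᵐ z ∂(surf n).restrict M.Ftime, M.faceSum h z = h z (M.nF z) + h z (-M.nF z) := by
  rw [ae_Ftime_iff]
  filter_upwards [M.ae_isRegular] with z hz hzF
  exact hz.faceSum_interface (hz.of_mem_Ftime hzF).2.1 h

theorem faceSum_F0 (h : SpaceTime n → SpaceTime n → F) :
    ∀ᵐ z ∂(surf n).restrict P.F0, M.faceSum h z = h z (-eT n) := by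
  rw [ae_restrict_iff' measurableSet_F0]
  filter_upwards [M.ae_isRegular] with z hz hzF
  exact hz.faceSum_boundary (Or.inl ⟨hzF, rfl⟩) h

theorem faceSum_FT (h : SpaceTime n → SpaceTime n → F) :
    ∀ᵐ z ∂(surf n).restrict P.FT, M.faceSum h z = h z (eT n) := by
  rw [ae_restrict_iff' measurableSet_FT]
  filter_upwards [M.ae_isRegular] with z hz hzF
  exact hz.faceSum_boundary (Or.inr (Or.inl ⟨hzF, rfl⟩)) h

theorem faceSum_lateral {Γ : Set (Space n)} (hΓ : MeasurableSet Γ) (hsub : Γ ⊆ frontier P.Ω)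
    (h : SpaceTime n → SpaceTime n → F) :
    ∀ᵐ z ∂(surf n).restrict (cylinder Γ (Set.Icc 0 P.T)), M.faceSum h z = h z (P.nΩT z) := by
  rw [ae_restrict_iff' (measurableSet_cylinder hΓ measurableSet_Icc)]
  filter_upwards [M.ae_isRegular] with z hz hzF
  exact hz.faceSum_boundary (Or.inr (Or.inr ⟨hsub hzF.1, hzF.2, rfl⟩)) h

end FaceSum

/-- At regular points off the overlaps of the lateral parts the seven kinds of faces exclude each
other, and a point on none of them lies on no element boundary, so that its sum is empty. -/
theorem IsRegular.faceSum_eq_sum_indicator (hz : M.IsRegular z) (h1 : z ∉ P.FD ∩ P.FN)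
    (h2 : z ∉ P.FD ∩ P.FR) (h3 : z ∉ P.FN ∩ P.FR) (h : SpaceTime n → SpaceTime n → ℝ) :
    M.faceSum h z = M.Fspace.indicator (M.faceSum h) z + P.FT.indicator (M.faceSum h) z +
      M.Ftime.indicator (M.faceSum h) z + P.FD.indicator (M.faceSum h) z +
      P.FN.indicator (M.faceSum h) z + P.FR.indicator (M.faceSum h) z +
      P.F0.indicator (M.faceSum h) z := by
  obtain ⟨gD, gN, gR⟩ := P.gamma_subset
  have lat : ∀ {Γ : Set (Space n)}, Γ ⊆ frontier P.Ω → z ∈ cylinder Γ (Set.Icc 0 P.T) →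
      P.IsBoundaryNormal z (P.nΩT z) := fun hΓ h => Or.inr (Or.inr ⟨hΓ h.1, h.2, rfl⟩)
  have hS : z ∈ M.Fspace → z ∈ P.Q := fun h => (hz.of_mem_Fspace h).1
  have hT : z ∈ M.Ftime → z ∈ P.Q := fun h => (hz.of_mem_Ftime h).1
  have hST : z ∈ M.Fspace → z ∉ M.Ftime := fun h h' =>
    (hz.of_mem_Fspace h).2.2.1.ne' (hz.of_mem_Ftime h').2.2
  by_cases hQ : z ∈ P.Q
  · have nb : ∀ m, ¬ P.IsBoundaryNormal z m := fun m hm => (hz.exists_unique_boundary hm).1 hQ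
    have n0 : z ∉ P.F0 := fun h => nb _ (Or.inl ⟨h, rfl⟩)
    have nT : z ∉ P.FT := fun h => nb _ (Or.inr (Or.inl ⟨h, rfl⟩))
    have nD : z ∉ P.FD := fun h => nb _ (lat gD h)
    have nN : z ∉ P.FN := fun h => nb _ (lat gN h)
    have nR : z ∉ P.FR := fun h => nb _ (lat gR h)
    by_cases hs : z ∈ M.Fspace
    · simp [n0, nT, nD, nN, nR, hs, hST hs]
    · by_cases ht : z ∈ M.Ftime
      · simp [n0, nT, nD, nN, nR, hs, ht]
      · have : M.faceSum h z = 0 := by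
          refine Finset.sum_eq_zero fun K hK => Set.indicator_of_notMem (fun hzK => ?_) _
          rcases hz.mem_Fspace_or_Ftime hQ hK hzK with h | h
          · exact hs h.1
          · exact ht h.1
        simp [n0, nT, nD, nN, nR, hs, ht, this]
  · have ns : z ∉ M.Fspace := fun h => hQ (hS h)
    have nt : z ∉ M.Ftime := fun h => hQ (hT h)
    have d0T : z ∈ P.F0 → z ∉ P.FT := fun h h' => by
      have e1 : z.snd = 0 := h.2
      have e2 : z.snd = P.T := h'.2
      exact P.T_pos.ne (e1.symm.trans e2)
    have dl : z.fst ∈ P.Ω → z ∉ P.FD ∧ z ∉ P.FN ∧ z ∉ P.FR := fun h =>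
      ⟨fun h' => notMem_of_mem_frontier (gD h'.1) h, fun h' => notMem_of_mem_frontier (gN h'.1) h,
        fun h' => notMem_of_mem_frontier (gR h'.1) h⟩
    by_cases h0 : z ∈ P.F0
    · obtain ⟨nD, nN, nR⟩ := dl h0.1
      simp [ns, nt, h0, d0T h0, nD, nN, nR]
    by_cases hFT : z ∈ P.FT
    · obtain ⟨nD, nN, nR⟩ := dl hFT.1
      simp [ns, nt, h0, hFT, nD, nN, nR]
    by_cases hD : z ∈ P.FD
    · have nN : z ∉ P.FN := fun h => h1 ⟨hD, h⟩
      have nR : z ∉ P.FR := fun h => h2 ⟨hD, h⟩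
      simp [ns, nt, h0, hFT, hD, nN, nR]
    by_cases hN : z ∈ P.FN
    · have nR : z ∉ P.FR := fun h => h3 ⟨hN, h⟩
      simp [ns, nt, h0, hFT, hD, hN, nR]
    by_cases hR : z ∈ P.FR
    · simp [ns, nt, h0, hFT, hD, hN, hR]
    have : M.faceSum h z = 0 := by
      refine Finset.sum_eq_zero fun K hK => Set.indicator_of_notMem (fun hzK => ?_) _
      rcases (mem_Q_or_boundary hK hzK).resolve_left hQ with ⟨m, h | h | ⟨h4, h5, -⟩⟩
      · exact h0 h.1
      · exact hFT h.1
      · rw [← P.cover] at h4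
        rcases h4 with (h4 | h4) | h4
        · exact hD ⟨h4, h5⟩
        · exact hN ⟨h4, h5⟩
        · exact hR ⟨h4, h5⟩
    simp [ns, nt, h0, hFT, hD, hN, hR, this]

variable (M) in
/-- The sum of the integrals over all element boundaries is the sum of the integrals over all
faces. -/
theorem sum_integral_frontier {h : SpaceTime n → SpaceTime n → ℝ}
    (hh : ∀ K ∈ M.elems, IntegrableOn (fun z => h z (outerNormal K z)) (frontier K) (surf n)) :
    ∑ K ∈ M.elems, ∫ z in frontier K, h z (outerNormal K z) ∂surf n =
      (∫ z in M.Fspace, (h z (M.nF z) + h z (-M.nF z)) ∂surf n) +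
      (∫ z in P.FT, h z (eT n) ∂surf n) +
      (∫ z in M.Ftime, (h z (M.nF z) + h z (-M.nF z)) ∂surf n) +
      (∫ z in P.FD, h z (P.nΩT z) ∂surf n) + (∫ z in P.FN, h z (P.nΩT z) ∂surf n) +
      (∫ z in P.FR, h z (P.nΩT z) ∂surf n) + ∫ z in P.F0, h z (-eT n) ∂surf n := by
  have hi : Integrable (M.faceSum h) (surf n) :=
    memLp_one_iff_integrable.1 (memLp_faceSum fun K hK => memLp_one_iff_integrable.2 (hh K hK))
  have hsum : ∑ K ∈ M.elems, ∫ z in frontier K, h z (outerNormal K z) ∂surf n =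
      ∫ z, M.faceSum h z ∂surf n := by
    unfold faceSum
    rw [integral_finsetSum _ fun K hK =>
      (integrable_indicator_iff isClosed_frontier.measurableSet).2 (hh K hK)]
    exact Finset.sum_congr rfl fun K _ => (integral_indicator isClosed_frontier.measurableSet).symm
  have ha : M.faceSum h =ᵐ[surf n] M.Fspace.indicator (M.faceSum h) +
      P.FT.indicator (M.faceSum h) +
      M.Ftime.indicator (M.faceSum h) + P.FD.indicator (M.faceSum h) +
      P.FN.indicator (M.faceSum h) + P.FR.indicator (M.faceSum h) +
      P.F0.indicator (M.faceSum h) := by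
    have e1 : P.FD ∩ P.FN ⊆ cylinder (P.ΓD ∩ P.ΓN) (Set.Icc 0 P.T) :=
      fun z h => ⟨⟨h.1.1, h.2.1⟩, h.1.2⟩
    have e2 : P.FD ∩ P.FR ⊆ cylinder (P.ΓD ∩ P.ΓR) (Set.Icc 0 P.T) :=
      fun z h => ⟨⟨h.1.1, h.2.1⟩, h.1.2⟩
    have e3 : P.FN ∩ P.FR ⊆ cylinder (P.ΓN ∩ P.ΓR) (Set.Icc 0 P.T) :=
      fun z h => ⟨⟨h.1.1, h.2.1⟩, h.1.2⟩
    filter_upwards [M.ae_isRegular, compl_mem_ae_iff.2 (measure_mono_null e1 P.overlap_DN),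
      compl_mem_ae_iff.2 (measure_mono_null e2 P.overlap_DR),
      compl_mem_ae_iff.2 (measure_mono_null e3 P.overlap_NR)] with z hz h1 h2 h3
    exact hz.faceSum_eq_sum_indicator h1 h2 h3 h
  have hS := M.nullMeasurableSet_Fspace
  have hT := M.nullMeasurableSet_Ftime
  have i1 := hi.indicator₀ hS
  have i2 := hi.indicator (measurableSet_FT (P := P))
  have i3 := hi.indicator₀ hT
  have i4 := hi.indicator (measurableSet_FD (P := P))
  have i5 := hi.indicator (measurableSet_FN (P := P))
  have i6 := hi.indicator (measurableSet_FR (P := P))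
  have i7 := hi.indicator (measurableSet_F0 (P := P))
  obtain ⟨gD, gN, gR⟩ := P.gamma_subset
  rw [hsum, integral_congr_ae ha,
    integral_add' (((((i1.add i2).add i3).add i4).add i5).add i6) i7,
    integral_add' ((((i1.add i2).add i3).add i4).add i5) i6,
    integral_add' (((i1.add i2).add i3).add i4) i5, integral_add' ((i1.add i2).add i3) i4,
    integral_add' (i1.add i2) i3, integral_add' i1 i2, integral_indicator₀ hS,
    integral_indicator₀ hT, integral_indicator measurableSet_FT,
    integral_indicator measurableSet_FD, integral_indicator measurableSet_FN,
    integral_indicator measurableSet_FR, integral_indicator measurableSet_F0,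
    integral_congr_ae (faceSum_Fspace h), integral_congr_ae (faceSum_Ftime h),
    integral_congr_ae (faceSum_FT h), integral_congr_ae (faceSum_F0 h)]
  have l1 := integral_congr_ae (faceSum_lateral (M := M) P.measurable_D gD h)
  have l2 := integral_congr_ae (faceSum_lateral (M := M) P.measurable_N gN h)
  have l3 := integral_congr_ae (faceSum_lateral (M := M) P.measurable_R gR h)
  simp only [FD, FN, FR]
  rw [l1, l2, l3]

end Mesh

end Faces

/-! ### Transfer of almost everywhere statements from element boundaries to faces -/

section Transfer

open AcousticProblem

/-- The normals are, up to sign, those of the finitely many covering hyperplanes. This finiteness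
later turns the strict inequality `γ < 1` into a uniform one. -/
theorem IsLipschitzPolytope.exists_finset_normals {n : ℕ} {K : Set (SpaceTime n)}
    (hK : IsLipschitzPolytope K) :
    ∃ N : Finset (SpaceTime n), ∀ᵐ z ∂(surf n).restrict (frontier K), outerNormal K z ∈ N := by
  classical
  obtain ⟨H, hH0, hH⟩ := hK.flat
  refine ⟨H.image (fun h => ‖h.1‖⁻¹ • h.1) ∪ H.image (fun h => -(‖h.1‖⁻¹ • h.1)), ?_⟩
  rw [ae_restrict_iff' isClosed_frontier.measurableSet]
  filter_upwards [ae_noCrossing hH0] with z hz hzK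
  obtain ⟨h, hh, hhz⟩ := Set.mem_iUnion₂.1 (hH hzK)
  obtain ⟨r, hr, hb⟩ := hz.flatAt hh hhz
  have hor := hK.isOuterNormal_or hzK (norm_smul_inv_norm (𝕜 := ℝ) (hH0 h hh)) hr
    fun y hy hyf => by
      obtain ⟨h', hh', hhy⟩ := Set.mem_iUnion₂.1 (hH hyf)
      exact hb h' hh' y hy hhy
  rcases hor with h1 | h1
  · rw [h1.outerNormal_eq]
    exact Finset.mem_union_left _ (Finset.mem_image.2 ⟨h, hh, rfl⟩)
  · rw [h1.outerNormal_eq]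
    exact Finset.mem_union_right _ (Finset.mem_image.2 ⟨h, hh, rfl⟩)

namespace Mesh

variable {n : ℕ} {P : AcousticProblem n} {M : Mesh P}

variable (M) in
/-- `p z n_K(z)` holds at almost every boundary point `z` of every element `K`. -/
def AeNormals (p : SpaceTime n → SpaceTime n → Prop) : Prop :=
  ∀ K ∈ M.elems, ∀ᵐ z ∂(surf n).restrict (frontier K), p z (outerNormal K z)

namespace AeNormals

variable {p q : SpaceTime n → SpaceTime n → Prop}

theorem ae (h : M.AeNormals p) :
    ∀ᵐ z ∂surf n, ∀ K ∈ M.elems, z ∈ frontier K → p z (outerNormal K z) :=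
  (ae_ball_iff M.elems.countable_toSet).2 fun K hK =>
    (ae_restrict_iff' isClosed_frontier.measurableSet).1 (h K hK)

theorem of_isInterface {z ν : SpaceTime n}
    (h : ∀ K ∈ M.elems, z ∈ frontier K → p z (outerNormal K z))
    (hν : IsInterface M.elems z ν) : p z ν ∧ p z (-ν) := by
  obtain ⟨K₁, h1, K₂, h2, hne, h3, h4⟩ := hν
  exact ⟨h3.outerNormal_eq ▸ h K₁ h1 h3.mem_frontier, h4.outerNormal_eq ▸ h K₂ h2 h4.mem_frontier⟩

theorem of_isBoundaryNormal {z m : SpaceTime n} (hz : M.IsRegular z)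
    (h : ∀ K ∈ M.elems, z ∈ frontier K → p z (outerNormal K z))
    (hm : P.IsBoundaryNormal z m) : p z m := by
  obtain ⟨-, K, hK, hKm, -⟩ := hz.exists_unique_boundary hm
  exact hKm.outerNormal_eq ▸ h K hK hKm.mem_frontier

theorem Fspace (h : M.AeNormals p) :
    ∀ᵐ z ∂(surf n).restrict M.Fspace, p z (M.nF z) ∧ p z (-M.nF z) := by
  rw [ae_Fspace_iff]
  filter_upwards [M.ae_isRegular, h.ae] with z hz hp hzF
  exact of_isInterface hp (hz.of_mem_Fspace hzF).2.1

theorem Ftime (h : M.AeNormals p) :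
    ∀ᵐ z ∂(surf n).restrict M.Ftime, p z (M.nF z) ∧ p z (-M.nF z) := by
  rw [ae_Ftime_iff]
  filter_upwards [M.ae_isRegular, h.ae] with z hz hp hzF
  exact of_isInterface hp (hz.of_mem_Ftime hzF).2.1

theorem F0 (h : M.AeNormals p) : ∀ᵐ z ∂(surf n).restrict P.F0, p z (-eT n) := by
  rw [ae_restrict_iff' measurableSet_F0]
  filter_upwards [M.ae_isRegular, h.ae] with z hz hp hzF
  exact of_isBoundaryNormal hz hp (Or.inl ⟨hzF, rfl⟩)

theorem FT (h : M.AeNormals p) : ∀ᵐ z ∂(surf n).restrict P.FT, p z (eT n) := by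
  rw [ae_restrict_iff' measurableSet_FT]
  filter_upwards [M.ae_isRegular, h.ae] with z hz hp hzF
  exact of_isBoundaryNormal hz hp (Or.inr (Or.inl ⟨hzF, rfl⟩))

theorem lateral (h : M.AeNormals p) {Γ : Set (Space n)} (hΓ : MeasurableSet Γ)
    (hsub : Γ ⊆ frontier P.Ω) :
    ∀ᵐ z ∂(surf n).restrict (cylinder Γ (Set.Icc 0 P.T)), p z (P.nΩT z) := by
  rw [ae_restrict_iff' (measurableSet_cylinder hΓ measurableSet_Icc)]
  filter_upwards [M.ae_isRegular, h.ae] with z hz hp hzF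
  exact of_isBoundaryNormal hz hp (Or.inr (Or.inr ⟨hsub hzF.1, hzF.2, rfl⟩))

theorem FD (h : M.AeNormals p) : ∀ᵐ z ∂(surf n).restrict P.FD, p z (P.nΩT z) :=
  h.lateral P.measurable_D P.gamma_subset.1

theorem FN (h : M.AeNormals p) : ∀ᵐ z ∂(surf n).restrict P.FN, p z (P.nΩT z) :=
  h.lateral P.measurable_N P.gamma_subset.2.1

theorem FR (h : M.AeNormals p) : ∀ᵐ z ∂(surf n).restrict P.FR, p z (P.nΩT z) :=
  h.lateral P.measurable_R P.gamma_subset.2.2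

theorem and (h : M.AeNormals p) (h' : M.AeNormals q) : M.AeNormals fun z ν => p z ν ∧ q z ν :=
  fun K hK => (h K hK).and (h' K hK)

theorem mono (h : M.AeNormals p) (hpq : ∀ z ν, p z ν → q z ν) : M.AeNormals q :=
  fun K hK => (h K hK).mono fun z => hpq z _

theorem of_forall (h : ∀ z, ∀ K ∈ M.elems, IsOuterNormal K z (outerNormal K z) →
    p z (outerNormal K z)) : M.AeNormals p := fun K hK => by
  rw [ae_restrict_iff' isClosed_frontier.measurableSet]
  filter_upwards [M.ae_isRegular] with z hz hzK
  exact h z K hK (hz.isOuterNormal_outerNormal hK hzK)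

end AeNormals

theorem ae_nF_Fspace : ∀ᵐ z ∂(surf n).restrict M.Fspace,
    z ∈ P.Q ∧ ‖M.nF z‖ = 1 ∧ 0 < (M.nF z).snd ∧ P.c z.fst * ‖(M.nF z).fst‖ < (M.nF z).snd := by
  rw [ae_Fspace_iff]
  filter_upwards [M.ae_isRegular] with z hz hzF
  obtain ⟨h1, h2, h3, h4⟩ := hz.of_mem_Fspace hzF
  exact ⟨h1, norm_eq_one_of_isInterface h2, h3, h4⟩

theorem ae_nF_Ftime : ∀ᵐ z ∂(surf n).restrict M.Ftime,
    z ∈ P.Q ∧ ‖M.nF z‖ = 1 ∧ (M.nF z).snd = 0 := by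
  rw [ae_Ftime_iff]
  filter_upwards [M.ae_isRegular] with z hz hzF
  obtain ⟨h1, h2, h3⟩ := hz.of_mem_Ftime hzF
  exact ⟨h1, norm_eq_one_of_isInterface h2, h3⟩

/-! ### The wave speed on the faces -/

variable (M) in
/-- The wave speed of an element. -/
def speed (K : Set (SpaceTime n)) : ℝ := sSup ((fun z : SpaceTime n => P.c z.fst) '' K)

theorem speed_eq {K : Set (SpaceTime n)} (hK : K ∈ M.elems) {z : SpaceTime n} (hz : z ∈ K) :
    P.c z.fst = speed (P := P) K := by
  obtain ⟨k, hk⟩ := M.speed_const K hK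
  have : (fun z : SpaceTime n => P.c z.fst) '' K = {k} := by
    ext a
    constructor
    · rintro ⟨y, hy, rfl⟩
      exact hk y hy
    · rintro rfl
      exact ⟨z, hz, hk z hz⟩
  rw [speed, this, csSup_singleton, hk z hz]

variable (P) in
/-- A positive lower bound of the wave speed. -/
theorem exists_lower_speed (M : Mesh P) :
    ∃ c₀ : ℝ, 0 < c₀ ∧ ∀ K ∈ M.elems, c₀ ≤ speed (P := P) K := by
  obtain ⟨c₀, h0, hc⟩ := P.c_lower
  refine ⟨c₀, h0, fun K hK => ?_⟩
  obtain ⟨z, hz⟩ := (M.polytope K hK).nonempty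
  rw [← speed_eq hK hz]
  exact hc _ (M.subset K hK hz).1

theorem speed_pos {K : Set (SpaceTime n)} (hK : K ∈ M.elems) : 0 < speed (P := P) K := by
  obtain ⟨c₀, h0, hc⟩ := exists_lower_speed P M
  exact h0.trans_le (hc K hK)

theorem exists_upper_speed (M : Mesh P) :
    ∃ C : ℝ, ∀ K ∈ M.elems, speed (P := P) K ≤ C := by
  classical
  obtain ⟨C, hC⟩ := Finset.exists_le (M.elems.image fun K => speed (P := P) K)
  exact ⟨C, fun K hK => hC _ (Finset.mem_image_of_mem _ hK)⟩

/-- Since `c` does not depend on time, `z` may be shifted in time; where the normal is not purely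
spatial such a shift enters `K` without changing `x`. Thus the pointwise value of `c` is meaningful
on these faces, although surface null sets are invisible to volume measure. -/
theorem speed_eq_of_normal {K : Set (SpaceTime n)} (hK : K ∈ M.elems) {z : SpaceTime n}
    (hz : (outerNormal K z).snd ≠ 0) : P.c z.fst = speed (P := P) K := by
  have hn : IsOuterNormal K z (outerNormal K z) :=
    TrefftzDG.isOuterNormal_outerNormal fun h => hz (by rw [h]; rfl)
  set ν := outerNormal K z with hν
  obtain ⟨-, r, hr, hb⟩ := hn
  -- The sign makes `z - s • eT n` lie on the inner side of the face, and the size keeps it in the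
  -- ball.
  set s : ℝ := r / 2 * SignType.sign ν.snd with hs
  have hsabs : |s| ≤ r / 2 := by
    rw [hs, abs_mul, abs_of_pos (by positivity)]
    rcases lt_or_gt_of_ne hz with h | h
    · simp [sign_neg h]
    · simp [sign_pos h]
  have hy : z - s • eT n ∈ K := by
    refine (hb _ ?_).2 ?_
    · rw [mem_ball_iff_norm, sub_sub_cancel_left, norm_neg, norm_smul, norm_eT, mul_one,
        Real.norm_eq_abs]
      linarith
    · rw [sub_sub_cancel_left, inner_neg_left, real_inner_smul_left, real_inner_comm, inner_eT,
        neg_lt_zero, hs, mul_assoc, sign_mul_self]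
      have := abs_pos.2 hz
      positivity
  rw [← speed_eq hK hy]
  simp [eT]

/-- Functions on the faces that are on every element boundary given by an a.e. strongly measurable
function of the outward normal. -/
theorem aestronglyMeasurable_faceSum {F : Type*} [NormedAddCommGroup F]
    {h : SpaceTime n → SpaceTime n → F} (hh : ∀ K ∈ M.elems,
      AEStronglyMeasurable (fun z => h z (outerNormal K z)) ((surf n).restrict (frontier K))) :
    AEStronglyMeasurable (M.faceSum h) (surf n) := by
  refine (Finset.aestronglyMeasurable_fun_sum M.elems fun K hK => ?_)
  exact (aestronglyMeasurable_indicator_iff isClosed_frontier.measurableSet).2 (hh K hK)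

section Speed

open Classical in
-- This is how `c` becomes measurable on faces that are not lateral or time-like: on each element
-- boundary it is replaced by the constant speed of the element where the normal has a time
-- component, and by zero elsewhere.
theorem aestronglyMeasurable_speedSum :
    AEStronglyMeasurable (M.faceSum fun z ν => if ν.snd = 0 then 0 else P.c z.fst) (surf n) := by
  refine aestronglyMeasurable_faceSum fun K hK => ?_
  have hm := (M.polytope K hK).measurable_normal_snd (measurableSet_singleton (0 : ℝ))
  have : (fun z => if (outerNormal K z).snd = 0 then 0 else P.c z.fst) =
      fun z => if (outerNormal K z).snd = 0 then 0 else speed (P := P) K := by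
    funext z
    split_ifs with h
    · rfl
    · exact speed_eq_of_normal hK h
  simp only [this]
  exact (Measurable.ite hm measurable_const measurable_const).aestronglyMeasurable

theorem eT_snd : (eT n).snd = 1 := rfl

theorem aestronglyMeasurable_c_F0 (M : Mesh P) :
    AEStronglyMeasurable (fun z : SpaceTime n => P.c z.fst) ((surf n).restrict P.F0) := by
  refine (aestronglyMeasurable_speedSum (M := M)).restrict.congr ?_
  filter_upwards [M.faceSum_F0 fun z ν => if ν.snd = 0 then (0 : ℝ) else P.c z.fst] with z hz
  rw [hz]
  simp [eT_snd]

theorem aestronglyMeasurable_c_FT (M : Mesh P) :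
    AEStronglyMeasurable (fun z : SpaceTime n => P.c z.fst) ((surf n).restrict P.FT) := by
  refine (aestronglyMeasurable_speedSum (M := M)).restrict.congr ?_
  filter_upwards [M.faceSum_FT fun z ν => if ν.snd = 0 then (0 : ℝ) else P.c z.fst] with z hz
  rw [hz]
  simp [eT_snd]

theorem aestronglyMeasurable_c_Fspace :
    AEStronglyMeasurable (fun z : SpaceTime n => P.c z.fst) ((surf n).restrict M.Fspace) := by
  -- Two elements meet on an internal face and each contributes `c`, hence the factor one half.
  refine ((aestronglyMeasurable_speedSum (M := M)).restrict.const_mul (2⁻¹ : ℝ)).congr ?_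
  filter_upwards [M.faceSum_Fspace fun z ν => if ν.snd = 0 then (0 : ℝ) else P.c z.fst,
    ae_nF_Fspace (M := M)] with z hz hn
  simp only [hz, WithLp.neg_snd, neg_eq_zero, if_neg hn.2.2.1.ne']
  ring

theorem aeNormals_speed : M.AeNormals fun z ν =>
    ν.snd = 0 ∨ ∃ K ∈ M.elems, P.c z.fst = speed (P := P) K := fun K hK =>
  Eventually.of_forall fun z => by
    by_cases h : (outerNormal K z).snd = 0
    · exact Or.inl h
    · exact Or.inr ⟨K, hK, speed_eq_of_normal hK h⟩

theorem ae_speed_F0 (M : Mesh P) :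
    ∀ᵐ z ∂(surf n).restrict P.F0, ∃ K ∈ M.elems, P.c z.fst = speed (P := P) K := by
  filter_upwards [(aeNormals_speed (M := M)).F0] with z hz
  exact hz.resolve_left (by simp [eT_snd])

theorem ae_speed_FT (M : Mesh P) :
    ∀ᵐ z ∂(surf n).restrict P.FT, ∃ K ∈ M.elems, P.c z.fst = speed (P := P) K := by
  filter_upwards [(aeNormals_speed (M := M)).FT] with z hz
  exact hz.resolve_left (by simp [eT_snd])

theorem ae_speed_Fspace :
    ∀ᵐ z ∂(surf n).restrict M.Fspace, ∃ K ∈ M.elems, P.c z.fst = speed (P := P) K := by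
  filter_upwards [(aeNormals_speed (M := M)).Fspace, ae_nF_Fspace (M := M)] with z hz hn
  exact hz.1.resolve_left hn.2.2.1.ne'

end Speed

open Classical in
-- The normal `nF` is chosen, not constructed; on space-like faces it is the one of the two element
-- normals with positive time component, so summing only such normals recovers it measurably.
theorem aestronglyMeasurable_nF :
    AEStronglyMeasurable M.nF ((surf n).restrict M.Fspace) := by
  have h := aestronglyMeasurable_faceSum (M := M)
    (h := fun _ ν : SpaceTime n => if 0 < ν.snd then ν else 0) fun K hK =>
      (Measurable.ite ((M.polytope K hK).measurable_normal_snd measurableSet_Ioi)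
        (measurable_outerNormal (M.polytope K hK).isOpen) measurable_const).aestronglyMeasurable
  refine h.restrict.congr ?_
  filter_upwards [M.faceSum_Fspace fun _ ν : SpaceTime n => if 0 < ν.snd then ν else 0,
    ae_nF_Fspace (M := M)] with z hz hn
  rw [hz, if_pos hn.2.2.1, if_neg, add_zero]
  rw [WithLp.neg_snd]
  linarith [hn.2.2.1]

variable (M) in
-- Only finitely many pairs of element speed and normal occur, and each weight is a function of such
-- a pair, so a maximum bounds it.
theorem exists_bound_gamma : ∃ B : ℝ, ∀ᵐ z ∂(surf n).restrict M.Fspace,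
    0 ≤ M.γ z ∧ M.γ z < 1 ∧ (M.nF z).snd / (1 - M.γ z) ≤ B ∧ (1 - M.γ z) / (M.nF z).snd ≤ B := by
  classical
  have h1 : ∀ K ∈ M.elems, ∃ N : Finset (SpaceTime n),
      ∀ᵐ z ∂(surf n).restrict (frontier K), outerNormal K z ∈ N := fun K hK =>
    (M.polytope K hK).exists_finset_normals
  choose! N hN using h1
  have h2 : M.AeNormals fun _ ν => ν ∈ M.elems.biUnion N := fun K hK =>
    (hN K hK).mono fun z hz => Finset.mem_biUnion.2 ⟨K, hK, hz⟩
  obtain ⟨B, hB⟩ := Finset.exists_le ((M.elems ×ˢ M.elems.biUnion N).image fun x =>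
    x.2.snd / (1 - speed (P := P) x.1 * ‖x.2.fst‖ / x.2.snd))
  obtain ⟨B', hB'⟩ := Finset.exists_le ((M.elems ×ˢ M.elems.biUnion N).image fun x =>
    (1 - speed (P := P) x.1 * ‖x.2.fst‖ / x.2.snd) / x.2.snd)
  refine ⟨max B B', ?_⟩
  filter_upwards [h2.Fspace, ae_nF_Fspace (M := M), ae_speed_Fspace (M := M)] with z hz hn hc
  obtain ⟨K, hK, hcK⟩ := hc
  have hpos := speed_pos hK
  refine ⟨?_, ?_, le_max_of_le_left ?_, le_max_of_le_right ?_⟩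
  · rw [γ, hcK]
    exact div_nonneg (mul_nonneg hpos.le (norm_nonneg _)) hn.2.2.1.le
  · rw [γ, div_lt_one hn.2.2.1]
    exact hn.2.2.2
  · refine hB _ (Finset.mem_image.2 ⟨(K, M.nF z), Finset.mem_product.2 ⟨hK, hz.1⟩, ?_⟩)
    rw [γ, hcK]
  · refine hB' _ (Finset.mem_image.2 ⟨(K, M.nF z), Finset.mem_product.2 ⟨hK, hz.1⟩, ?_⟩)
    rw [γ, hcK]

theorem aestronglyMeasurable_gamma :
    AEStronglyMeasurable M.γ ((surf n).restrict M.Fspace) := by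
  have h1 := (aestronglyMeasurable_c_Fspace (M := M)).aemeasurable
  have h2 := continuous_fst_spaceTime.comp_aestronglyMeasurable (aestronglyMeasurable_nF (M := M))
  have h3 := continuous_snd_spaceTime.comp_aestronglyMeasurable (aestronglyMeasurable_nF (M := M))
  exact ((h1.mul h2.norm.aemeasurable).div h3.aemeasurable).aestronglyMeasurable

end Mesh

end Transfer

/-! ### Algebra of boundary values -/

section BoundaryValues

open AcousticProblem

variable {n : ℕ} {F : Type*} [NormedAddCommGroup F] [NormedSpace ℝ F]
  {u v : SpaceTime n → F} {z ν : SpaceTime n} {a b : F} {K : Set (SpaceTime n)}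

theorem HasBoundaryValue.tr_eq (h : HasBoundaryValue u z ν a) : tr u z ν = a := h.limUnder_eq

theorem IsOuterNormal.eventually_halfBall (hν : IsOuterNormal K z ν) :
    ∀ᶠ r in 𝓝[>] (0 : ℝ), 0 < r ∧ halfBall z ν r ⊆ K := by
  obtain ⟨r, hr, h⟩ := hν.exists_halfBall_subset
  filter_upwards [Ioo_mem_nhdsGT hr] with s hs
  exact ⟨hs.1, (halfBall_mono z ν hs.2.le).trans h⟩

theorem halfBallMean_eq (u : SpaceTime n → F) (z ν : SpaceTime n) (r : ℝ) :
    halfBallMean u z ν r = ⨍ y in halfBall z ν r, u y := rfl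

namespace HasBoundaryValue

theorem congr (hν : IsOuterNormal K z ν) (huv : u =ᵐ[volume.restrict K] v)
    (h : HasBoundaryValue u z ν a) : HasBoundaryValue v z ν a := by
  refine Tendsto.congr' ?_ h
  filter_upwards [hν.eventually_halfBall] with r hr
  rw [halfBallMean_eq, halfBallMean_eq, setAverage_eq, setAverage_eq,
    integral_congr_ae (ae_mono (Measure.restrict_mono hr.2 le_rfl) huv)]

theorem add (hν : IsOuterNormal K z ν) (hu : IntegrableOn u K) (hv : IntegrableOn v K)
    (h : HasBoundaryValue u z ν a) (h' : HasBoundaryValue v z ν b) :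
    HasBoundaryValue (u + v) z ν (a + b) := by
  refine Tendsto.congr' ?_ (Tendsto.add h h')
  filter_upwards [hν.eventually_halfBall] with r hr
  simp only [halfBallMean_eq, setAverage_eq, Pi.add_apply]
  rw [integral_add (hu.mono_set hr.2) (hv.mono_set hr.2), smul_add]

theorem const_smul (c : ℝ) (h : HasBoundaryValue u z ν a) :
    HasBoundaryValue (c • u) z ν (c • a) := by
  refine Tendsto.congr (fun r => ?_) (Tendsto.const_smul h c)
  simp only [halfBallMean_eq, setAverage_eq, Pi.smul_apply]
  rw [integral_smul, smul_comm]

theorem of_forall_eq [CompleteSpace F] (hν : IsOuterNormal K z ν) (h : ∀ y ∈ K, u y = a) :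
    HasBoundaryValue u z ν a := by
  refine Tendsto.congr' ?_ tendsto_const_nhds
  filter_upwards [hν.eventually_halfBall] with r hr
  have hpos : 0 < volume (halfBall z ν r) :=
    (isOpen_halfBall z ν r).measure_pos _ (nonempty_halfBall hν.ne_zero hr.1)
  have hfin : volume (halfBall z ν r) ≠ ⊤ :=
    ((measure_mono Set.inter_subset_left).trans_lt measure_ball_lt_top).ne
  rw [halfBallMean_eq, setAverage_eq,
    setIntegral_congr_fun (isOpen_halfBall z ν r).measurableSet (fun y hy => h y (hr.2 hy)),
    setIntegral_const, smul_smul, inv_mul_cancel₀, one_smul]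
  exact (ENNReal.toReal_pos hpos.ne' hfin).ne'

end HasBoundaryValue

end BoundaryValues

/-! ### Traces on the faces -/

section FaceTraces

open AcousticProblem

namespace Mesh

variable {n : ℕ} {P : AcousticProblem n} {M : Mesh P}

theorem ae_elem {p : SpaceTime n → Prop} (h : ∀ᵐ z ∂volume.restrict P.Q, p z)
    {K : Set (SpaceTime n)} (hK : K ∈ M.elems) : ∀ᵐ z ∂volume.restrict K, p z :=
  ae_mono (Measure.restrict_mono (M.subset K hK) le_rfl) h

theorem aeNormals_isOuterNormal : M.AeNormals fun z ν => ∃ K ∈ M.elems, IsOuterNormal K z ν :=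
  AeNormals.of_forall fun _ K hK h => ⟨K, hK, h⟩

theorem integrableOn_elem {F : Type*} [NormedAddCommGroup F]
    (u : Lp F 2 (volume.restrict P.Q)) {K : Set (SpaceTime n)} (hK : K ∈ M.elems) :
    IntegrableOn u K :=
  (M.polytope K hK).integrable_of_memLp
    ((Lp.memLp u).mono_measure (Measure.restrict_mono (M.subset K hK) le_rfl))

variable {F : Type*} [NormedAddCommGroup F] [InnerProductSpace ℝ F]

variable (M) in
/-- `u` has boundary values on all element boundaries, and they are square integrable. -/
structure HasTraces (u : Lp F 2 (volume.restrict P.Q)) : Prop where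
  boundaryValue : M.AeNormals fun z ν => HasBoundaryValue u z ν (tr u z ν)
  memLp : ∀ K ∈ M.elems,
    MemLp (fun z => tr u z (outerNormal K z)) 2 ((surf n).restrict (frontier K))

namespace HasTraces

variable {u v : Lp F 2 (volume.restrict P.Q)}

theorem boundaryValue_add (hu : M.HasTraces u) (hv : M.HasTraces v) :
    M.AeNormals fun z ν => HasBoundaryValue (u + v : Lp F 2 (volume.restrict P.Q)) z ν
      (tr u z ν + tr v z ν) := by
  refine ((hu.boundaryValue.and hv.boundaryValue).and aeNormals_isOuterNormal).mono ?_
  rintro z ν ⟨⟨h1, h2⟩, K, hK, hν⟩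
  exact (h1.add hν (integrableOn_elem u hK) (integrableOn_elem v hK) h2).congr hν
    (EventuallyEq.symm (ae_elem (Lp.coeFn_add u v) hK))

theorem boundaryValue_smul (hu : M.HasTraces u) (c : ℝ) :
    M.AeNormals fun z ν => HasBoundaryValue (c • u : Lp F 2 (volume.restrict P.Q)) z ν
      (c • tr u z ν) := by
  refine (hu.boundaryValue.and aeNormals_isOuterNormal).mono ?_
  rintro z ν ⟨h1, K, hK, hν⟩
  exact (h1.const_smul c).congr hν (EventuallyEq.symm (ae_elem (Lp.coeFn_smul c u) hK))

theorem tr_add (hu : M.HasTraces u) (hv : M.HasTraces v) :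
    M.AeNormals fun z ν => tr (u + v : Lp F 2 (volume.restrict P.Q)) z ν = tr u z ν + tr v z ν :=
  (hu.boundaryValue_add hv).mono fun _ _ h => h.tr_eq

theorem tr_smul (hu : M.HasTraces u) (c : ℝ) :
    M.AeNormals fun z ν => tr (c • u : Lp F 2 (volume.restrict P.Q)) z ν = c • tr u z ν :=
  (hu.boundaryValue_smul c).mono fun _ _ h => h.tr_eq

theorem add (hu : M.HasTraces u) (hv : M.HasTraces v) : M.HasTraces (u + v) where
  boundaryValue := (hu.boundaryValue_add hv).mono fun _ _ h => by rwa [h.tr_eq]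
  memLp K hK := ((hu.memLp K hK).add (hv.memLp K hK)).ae_eq
    ((hu.tr_add hv K hK).mono fun _ h => h.symm)

theorem smul (hu : M.HasTraces u) (c : ℝ) : M.HasTraces (c • u) where
  boundaryValue := (hu.boundaryValue_smul c).mono fun _ _ h => by rwa [h.tr_eq]
  memLp K hK := ((hu.memLp K hK).const_smul c).ae_eq
    ((hu.tr_smul c K hK).mono fun _ h => h.symm)

/-- Multiplying the trace by a bounded measurable function of the normal. -/
theorem memLp_of_norm_le {G : Type*} [NormedAddCommGroup G] (hu : M.HasTraces u)
    {h : SpaceTime n → SpaceTime n → G} {C : ℝ}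
    (hm : ∀ K ∈ M.elems, AEStronglyMeasurable (fun z => h z (outerNormal K z))
      ((surf n).restrict (frontier K)))
    (hle : ∀ z ν : SpaceTime n, ‖ν‖ ≤ 1 → ‖h z ν‖ ≤ C * ‖tr u z ν‖) :
    MemLp (M.faceSum h) 2 (surf n) :=
  memLp_faceSum fun K hK => MemLp.of_le_mul (hu.memLp K hK) (hm K hK)
    (Eventually.of_forall fun z => hle z _ (norm_outerNormal_le K z))

theorem memLp_F0 (hu : M.HasTraces u) :
    MemLp (fun z => tr u z (-eT n)) 2 ((surf n).restrict P.F0) :=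
  ((memLp_faceSum hu.memLp).restrict P.F0).ae_eq (M.faceSum_F0 _)

theorem memLp_FT (hu : M.HasTraces u) :
    MemLp (fun z => tr u z (eT n)) 2 ((surf n).restrict P.FT) :=
  ((memLp_faceSum hu.memLp).restrict P.FT).ae_eq (M.faceSum_FT _)

theorem memLp_lateral (hu : M.HasTraces u) {Γ : Set (Space n)} (hΓ : MeasurableSet Γ)
    (hsub : Γ ⊆ frontier P.Ω) :
    MemLp (P.lat u) 2 ((surf n).restrict (cylinder Γ (Set.Icc 0 P.T))) :=
  ((memLp_faceSum hu.memLp).restrict _).ae_eq (M.faceSum_lateral hΓ hsub _)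

theorem memLp_jumpT (hu : M.HasTraces u) : MemLp (M.jumpT u) 2 ((surf n).restrict M.Fspace) := by
  refine ((hu.memLp_of_norm_le (h := fun z ν => ν.snd • tr u z ν) (C := 1) (fun K hK => ?_)
    fun z ν hν => ?_).restrict _).ae_eq
    (M.faceSum_Fspace fun z ν => ν.snd • tr u z ν)
  · exact (M.polytope K hK).measurable_normal_snd.aestronglyMeasurable.smul (hu.memLp K hK).1
  · rw [norm_smul]
    exact mul_le_mul_of_nonneg_right ((abs_snd_le ν).trans hν) (norm_nonneg _)

theorem memLp_avg (hu : M.HasTraces u) : MemLp (M.avg u) 2 ((surf n).restrict M.Ftime) := by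
  refine (((memLp_faceSum hu.memLp).restrict M.Ftime).const_smul (2⁻¹ : ℝ)).ae_eq ?_
  filter_upwards [M.faceSum_Ftime (tr u)] with z hz
  rw [Pi.smul_apply, hz]
  rfl

open Classical in
theorem memLp_lower (hu : M.HasTraces u) : MemLp (M.lower u) 2 ((surf n).restrict M.Fspace) := by
  refine ((hu.memLp_of_norm_le (h := fun z ν => if 0 < ν.snd then tr u z ν else 0) (C := 1)
    (fun K hK => ?_) fun z ν hν => ?_).restrict _).ae_eq ?_
  · have : (fun z => if 0 < (outerNormal K z).snd then tr u z (outerNormal K z) else 0) =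
        {z | 0 < (outerNormal K z).snd}.indicator fun z => tr u z (outerNormal K z) := by
      funext z
      simp [Set.indicator]
    simp only [this]
    exact (hu.memLp K hK).1.indicator
      ((M.polytope K hK).measurable_normal_snd measurableSet_Ioi)
  · split_ifs
    · rw [one_mul]
    · simp
  · filter_upwards [M.faceSum_Fspace fun z ν => if 0 < ν.snd then tr u z ν else 0,
      ae_nF_Fspace (M := M)] with z hz hn
    rw [hz, if_pos hn.2.2.1, if_neg, add_zero]
    · rfl
    · rw [WithLp.neg_snd]
      linarith [hn.2.2.1]

end HasTraces

section Components

variable {w : Lp ℝ 2 (volume.restrict P.Q)} {τ : Lp (Space n) 2 (volume.restrict P.Q)}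

theorem HasTraces.memLp_jumpN_faceSum (hw : M.HasTraces w) :
    MemLp (M.faceSum fun z ν => tr w z ν • ν.fst) 2 (surf n) := by
  refine hw.memLp_of_norm_le (C := 1) (fun K hK => ?_) fun z ν hν => ?_
  · exact (hw.memLp K hK).1.smul (M.polytope K hK).measurable_normal_fst.aestronglyMeasurable
  · rw [norm_smul, mul_comm]
    exact mul_le_mul_of_nonneg_right ((norm_fst_le ν).trans hν) (norm_nonneg _)

theorem HasTraces.memLp_normal_faceSum (hτ : M.HasTraces τ) :
    MemLp (M.faceSum fun z ν => ⟪tr τ z ν, ν.fst⟫) 2 (surf n) := by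
  refine hτ.memLp_of_norm_le (C := 1) (fun K hK => ?_) fun z ν hν => ?_
  · exact (hτ.memLp K hK).1.inner (M.polytope K hK).measurable_normal_fst.aestronglyMeasurable
  · refine (norm_inner_le_norm _ _).trans ?_
    rw [mul_comm]
    exact mul_le_mul_of_nonneg_right ((norm_fst_le ν).trans hν) (norm_nonneg _)

theorem HasTraces.memLp_jumpN (hw : M.HasTraces w) :
    MemLp (M.jumpN w) 2 ((surf n).restrict M.Fspace) ∧
      MemLp (M.jumpN w) 2 ((surf n).restrict M.Ftime) :=
  ⟨(hw.memLp_jumpN_faceSum.restrict _).ae_eq (M.faceSum_Fspace fun z ν => tr w z ν • ν.fst),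
    (hw.memLp_jumpN_faceSum.restrict _).ae_eq (M.faceSum_Ftime fun z ν => tr w z ν • ν.fst)⟩

theorem HasTraces.memLp_jumpNv (hτ : M.HasTraces τ) :
    MemLp (M.jumpNv τ) 2 ((surf n).restrict M.Fspace) ∧
      MemLp (M.jumpNv τ) 2 ((surf n).restrict M.Ftime) :=
  ⟨(hτ.memLp_normal_faceSum.restrict _).ae_eq (M.faceSum_Fspace fun z ν => ⟪tr τ z ν, ν.fst⟫),
    (hτ.memLp_normal_faceSum.restrict _).ae_eq (M.faceSum_Ftime fun z ν => ⟪tr τ z ν, ν.fst⟫)⟩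

theorem HasTraces.memLp_latN (hτ : M.HasTraces τ) {Γ : Set (Space n)} (hΓ : MeasurableSet Γ)
    (hsub : Γ ⊆ frontier P.Ω) :
    MemLp (P.latN τ) 2 ((surf n).restrict (cylinder Γ (Set.Icc 0 P.T))) :=
  (hτ.memLp_normal_faceSum.restrict _).ae_eq (M.faceSum_lateral hΓ hsub fun z ν => ⟪tr τ z ν, ν.fst⟫)

end Components

/-! ### The wave speed on the lateral boundary -/

/-- On `∂Ω` the values of `c` itself are not tied to those inside `Ω`. The half-ball means are, and
they are eventually constant because the half balls lie in one element. -/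
theorem aeNormals_tr_speed : M.AeNormals fun z ν => ∃ K ∈ M.elems,
    tr (fun y : SpaceTime n => P.c y.fst) z ν = speed (P := P) K :=
  AeNormals.of_forall fun _ K hK h => ⟨K, hK,
    (HasBoundaryValue.of_forall_eq h fun _ hy => speed_eq hK hy).tr_eq⟩

theorem aestronglyMeasurable_cB {Γ : Set (Space n)} (M : Mesh P) (hΓ : MeasurableSet Γ)
    (hsub : Γ ⊆ frontier P.Ω) :
    AEStronglyMeasurable P.cB ((surf n).restrict (cylinder Γ (Set.Icc 0 P.T))) := by
  have h := aestronglyMeasurable_faceSum (M := M)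
    (h := fun z ν => tr (fun y : SpaceTime n => P.c y.fst) z ν) fun K hK => by
      refine AEStronglyMeasurable.congr (aestronglyMeasurable_const (b := speed (P := P) K)) ?_
      have hK' : ∀ᵐ z ∂(surf n).restrict (frontier K), IsOuterNormal K z (outerNormal K z) := by
        rw [ae_restrict_iff' isClosed_frontier.measurableSet]
        filter_upwards [M.ae_isRegular] with z hz hzK
        exact hz.isOuterNormal_outerNormal hK hzK
      filter_upwards [hK'] with z hz
      exact (HasBoundaryValue.of_forall_eq hz fun _ hy => speed_eq hK hy).tr_eq.symm
  exact h.restrict.congr (M.faceSum_lateral hΓ hsub _)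

theorem ae_cB {Γ : Set (Space n)} (M : Mesh P) (hΓ : MeasurableSet Γ)
    (hsub : Γ ⊆ frontier P.Ω) :
    ∀ᵐ z ∂(surf n).restrict (cylinder Γ (Set.Icc 0 P.T)), ∃ K ∈ M.elems,
      P.cB z = speed (P := P) K :=
  (aeNormals_tr_speed (M := M)).lateral hΓ hsub

end Mesh

end FaceTraces

/-! ### Integrals over the union of all faces -/

section FaceIntegral

open AcousticProblem

/-- The types of mesh faces. -/
inductive Face
  | space
  | final
  | time
  | dirichlet
  | neumann
  | robin
  | initial

namespace AcousticProblem

variable {n : ℕ}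

/-- Boundary density of the weighted energy identity. -/
def energyDensity (P : AcousticProblem n) (b : SpaceTime n → ℝ) (s t : P.Field) (z ν : SpaceTime n) : ℝ :=
  b z * (tr s.1 z ν * ⟪tr t.2 z ν, ν.fst⟫ + tr t.1 z ν * ⟪tr s.2 z ν, ν.fst⟫ +
    ν.snd * ((P.c z.fst ^ 2)⁻¹ * tr s.1 z ν * tr t.1 z ν + ⟪tr s.2 z ν, tr t.2 z ν⟫))

end AcousticProblem

namespace Mesh

variable {n : ℕ} {P : AcousticProblem n} (M : Mesh P)

/-- The union of the faces of a given type. -/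
def faceSet : Face → Set (SpaceTime n)
  | .space => M.Fspace
  | .final => P.FT
  | .time => M.Ftime
  | .dirichlet => P.FD
  | .neumann => P.FN
  | .robin => P.FR
  | .initial => P.F0

/-- Surface measure on the faces of a given type. -/
def faceMeasure (i : Face) : Measure (SpaceTime n) := (surf n).restrict (M.faceSet i)

/-- Integral over all faces of a density given on each type of faces. -/
def faceIntegral (f : Face → SpaceTime n → ℝ) : ℝ :=
  (∫ z in M.Fspace, f .space z ∂surf n) + (∫ z in P.FT, f .final z ∂surf n) +
  (∫ z in M.Ftime, f .time z ∂surf n) + (∫ z in P.FD, f .dirichlet z ∂surf n) +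
  (∫ z in P.FN, f .neumann z ∂surf n) + (∫ z in P.FR, f .robin z ∂surf n) +
  ∫ z in P.F0, f .initial z ∂surf n

/-- Integrability on all faces. -/
def FaceIntegrable (f : Face → SpaceTime n → ℝ) : Prop := ∀ i, Integrable (f i) (M.faceMeasure i)

variable {M} {f g : Face → SpaceTime n → ℝ}

theorem FaceIntegrable.add (hf : M.FaceIntegrable f) (hg : M.FaceIntegrable g) :
    M.FaceIntegrable fun i z => f i z + g i z := fun i => (hf i).add (hg i)

theorem FaceIntegrable.const_mul (hf : M.FaceIntegrable f) (a : ℝ) :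
    M.FaceIntegrable fun i z => a * f i z := fun i => (hf i).const_mul a

theorem faceIntegral_add (hf : M.FaceIntegrable f) (hg : M.FaceIntegrable g) :
    M.faceIntegral (fun i z => f i z + g i z) = M.faceIntegral f + M.faceIntegral g := by
  have key := fun i => integral_add (hf i) (hg i)
  have h1 := key .space
  have h2 := key .final
  have h3 := key .time
  have h4 := key .dirichlet
  have h5 := key .neumann
  have h6 := key .robin
  have h7 := key .initial
  simp only [faceMeasure, faceSet] at h1 h2 h3 h4 h5 h6 h7
  simp only [faceIntegral, h1, h2, h3, h4, h5, h6, h7]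
  ring

theorem faceIntegral_const_mul (f : Face → SpaceTime n → ℝ) (a : ℝ) :
    M.faceIntegral (fun i z => a * f i z) = a * M.faceIntegral f := by
  simp only [faceIntegral, integral_const_mul]
  ring

theorem faceIntegral_mono (hf : M.FaceIntegrable f) (hg : M.FaceIntegrable g)
    (h : ∀ i, f i ≤ᵐ[M.faceMeasure i] g i) : M.faceIntegral f ≤ M.faceIntegral g := by
  have key := fun i => integral_mono_ae (hf i) (hg i) (h i)
  exact add_le_add (add_le_add (add_le_add (add_le_add (add_le_add (add_le_add (key .space)
    (key .final)) (key .time)) (key .dirichlet)) (key .neumann)) (key .robin)) (key .initial)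

theorem faceIntegral_congr (h : ∀ i, f i =ᵐ[M.faceMeasure i] g i) :
    M.faceIntegral f = M.faceIntegral g := by
  have key := fun i => integral_congr_ae (h i)
  unfold faceIntegral
  exact congrArg₂ _ (congrArg₂ _ (congrArg₂ _ (congrArg₂ _ (congrArg₂ _ (congrArg₂ _ (key .space)
    (key .final)) (key .time)) (key .dirichlet)) (key .neumann)) (key .robin)) (key .initial)

theorem faceIntegral_nonneg (h : ∀ i, 0 ≤ᵐ[M.faceMeasure i] f i) : 0 ≤ M.faceIntegral f := by
  have key := fun i => integral_nonneg_of_ae (h i)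
  exact add_nonneg (add_nonneg (add_nonneg (add_nonneg (add_nonneg (add_nonneg (key .space)
    (key .final)) (key .time)) (key .dirichlet)) (key .neumann)) (key .robin)) (key .initial)

theorem ae_eq_zero_of_faceIntegral_eq_zero (hf : M.FaceIntegrable f)
    (h : ∀ i, 0 ≤ᵐ[M.faceMeasure i] f i) (h0 : M.faceIntegral f = 0) (i : Face) :
    f i =ᵐ[M.faceMeasure i] 0 := by
  have key := fun i => integral_nonneg_of_ae (h i)
  rw [← integral_eq_zero_iff_of_nonneg_ae (h i) (hf i)]
  have h1 := key .space
  have h2 := key .final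
  have h3 := key .time
  have h4 := key .dirichlet
  have h5 := key .neumann
  have h6 := key .robin
  have h7 := key .initial
  simp only [faceMeasure, faceSet] at h1 h2 h3 h4 h5 h6 h7
  unfold faceIntegral at h0
  cases i <;> simp only [faceMeasure, faceSet] <;> linarith

/-- The density on the faces obtained by summing over the elements at a point. -/
def normalDensity (M : Mesh P) (h : SpaceTime n → SpaceTime n → ℝ) : Face → SpaceTime n → ℝ
  | .space => fun z => h z (M.nF z) + h z (-M.nF z)
  | .final => fun z => h z (eT n)
  | .time => fun z => h z (M.nF z) + h z (-M.nF z)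
  | .dirichlet => fun z => h z (P.nΩT z)
  | .neumann => fun z => h z (P.nΩT z)
  | .robin => fun z => h z (P.nΩT z)
  | .initial => fun z => h z (-eT n)

theorem faceSum_ae_eq_normalDensity (h : SpaceTime n → SpaceTime n → ℝ) (i : Face) :
    M.faceSum h =ᵐ[M.faceMeasure i] M.normalDensity h i := by
  cases i
  · exact M.faceSum_Fspace h
  · exact M.faceSum_FT h
  · exact M.faceSum_Ftime h
  · exact M.faceSum_lateral P.measurable_D P.gamma_subset.1 h
  · exact M.faceSum_lateral P.measurable_N P.gamma_subset.2.1 h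
  · exact M.faceSum_lateral P.measurable_R P.gamma_subset.2.2 h
  · exact M.faceSum_F0 h

theorem faceIntegrable_normalDensity {h : SpaceTime n → SpaceTime n → ℝ}
    (hh : ∀ K ∈ M.elems, IntegrableOn (fun z => h z (outerNormal K z)) (frontier K) (surf n)) :
    M.FaceIntegrable (M.normalDensity h) := fun i =>
  ((memLp_one_iff_integrable.1 (memLp_faceSum fun K hK =>
    memLp_one_iff_integrable.2 (hh K hK))).restrict).congr (faceSum_ae_eq_normalDensity h i)

theorem sum_integral_frontier_eq_faceIntegral {h : SpaceTime n → SpaceTime n → ℝ}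
    (hh : ∀ K ∈ M.elems, IntegrableOn (fun z => h z (outerNormal K z)) (frontier K) (surf n)) :
    ∑ K ∈ M.elems, ∫ z in frontier K, h z (outerNormal K z) ∂surf n =
      M.faceIntegral (M.normalDensity h) := M.sum_integral_frontier hh

/-! ### Traces of Trefftz fields -/

variable (M) in
/-- Both components have square integrable boundary values. -/
def FieldTraces (u : P.Field) : Prop := M.HasTraces u.1 ∧ M.HasTraces u.2

theorem FieldTraces.add {u v : P.Field} (hu : M.FieldTraces u) (hv : M.FieldTraces v) :
    M.FieldTraces (u + v) := ⟨hu.1.add hv.1, hu.2.add hv.2⟩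

theorem FieldTraces.smul {u : P.Field} (hu : M.FieldTraces u) (c : ℝ) :
    M.FieldTraces (c • u) := ⟨hu.1.smul c, hu.2.smul c⟩

theorem FieldTraces.sub {u v : P.Field} (hu : M.FieldTraces u) (hv : M.FieldTraces v) :
    M.FieldTraces (u - v) := by
  have := hu.add (hv.smul (-1))
  rwa [neg_one_smul, ← sub_eq_add_neg] at this

theorem IsTrefftz.fieldTraces {u : P.Field} (hu : M.IsTrefftz u) : M.FieldTraces u := by
  refine ⟨⟨fun K hK => ?_, fun K hK => ?_⟩, ⟨fun K hK => ?_, fun K hK => ?_⟩⟩ <;>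
    obtain ⟨gw, gτ, G, d, τ', hb, h1, h2, h3, h4⟩ := hu K hK
  · filter_upwards [hb] with z hz
    rw [hz.1.tr_eq]
    exact hz.1
  · exact h1.2.2.1.ae_eq (hb.mono fun z hz => hz.1.tr_eq.symm)
  · filter_upwards [hb] with z hz
    rw [hz.2.tr_eq]
    exact hz.2
  · exact h2.2.2.1.ae_eq (hb.mono fun z hz => hz.2.tr_eq.symm)

theorem IsTrefftz.isTrefftzOn {u : P.Field} (hu : M.IsTrefftz u) {K : Set (SpaceTime n)}
    (hK : K ∈ M.elems) :
    IsTrefftzOn K (speed (P := P) K ^ 2)⁻¹ u.1 u.2 (fun z => tr u.1 z (outerNormal K z))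
      (fun z => tr u.2 z (outerNormal K z)) := by
  obtain ⟨gw, gτ, G, d, τ', hb, h1, h2, h3, h4⟩ := hu K hK
  have : IsTrefftzOn K (speed (P := P) K ^ 2)⁻¹ u.1 u.2 gw gτ := by
    refine ⟨G, d, τ', h1, h2, h3, ?_⟩
    filter_upwards [h4, ae_restrict_mem (M.polytope K hK).measurableSet] with z hz hzK
    rw [← speed_eq hK hzK]
    exact hz
  exact this.congr (hb.mono fun z hz => hz.1.tr_eq.symm) (hb.mono fun z hz => hz.2.tr_eq.symm)

theorem IsTrefftz.energy {s t : P.Field} (hs : M.IsTrefftz s) (ht : M.IsTrefftz t)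
    {b : SpaceTime n → ℝ} (hb : ContDiff ℝ ∞ b) {K : Set (SpaceTime n)} (hK : K ∈ M.elems) :
    FluxIdentity K
      (fun z => s.1 z * ⟪t.2 z, (gradient b z).fst⟫ + t.1 z * ⟪s.2 z, (gradient b z).fst⟫ +
        (gradient b z).snd * ((speed (P := P) K ^ 2)⁻¹ * s.1 z * t.1 z + ⟪s.2 z, t.2 z⟫))
      (fun z => P.energyDensity b s t z (outerNormal K z)) := by
  refine ((hs.isTrefftzOn hK).energy (M.polytope K hK) (ht.isTrefftzOn hK) hb).congr
    (EventuallyEq.refl _ _) (Eventually.of_forall fun z => ?_)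
  -- The wave speed enters the boundary flux only through a term with factor `nᵗ`; where `nᵗ ≠ 0`
  -- its pointwise value is the speed of the element.
  by_cases h : (outerNormal K z).snd = 0
  · simp only [AcousticProblem.energyDensity, h, zero_mul]
  · simp only [AcousticProblem.energyDensity, speed_eq_of_normal hK h]

theorem IsTrefftz.faceIntegrable_energy {s t : P.Field} (hs : M.IsTrefftz s) (ht : M.IsTrefftz t)
    {b : SpaceTime n → ℝ} (hb : ContDiff ℝ ∞ b) :
    M.FaceIntegrable (M.normalDensity (P.energyDensity b s t)) :=
  faceIntegrable_normalDensity fun _ hK => (hs.energy ht hb hK).integrable_trace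

theorem IsTrefftz.faceIntegral_energy {s t : P.Field} (hs : M.IsTrefftz s) (ht : M.IsTrefftz t)
    {b : SpaceTime n → ℝ} (hb : ContDiff ℝ ∞ b) :
    M.faceIntegral (M.normalDensity (P.energyDensity b s t)) = ∑ K ∈ M.elems, ∫ z in K,
      (s.1 z * ⟪t.2 z, (gradient b z).fst⟫ + t.1 z * ⟪s.2 z, (gradient b z).fst⟫ +
        (gradient b z).snd * ((speed (P := P) K ^ 2)⁻¹ * s.1 z * t.1 z + ⟪s.2 z, t.2 z⟫)) := by
  rw [← sum_integral_frontier_eq_faceIntegral fun K hK => (hs.energy ht hb hK).integrable_trace]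
  exact Finset.sum_congr rfl fun K hK => (hs.energy ht hb hK).eq.symm

/-- Conservation of energy in every element: a constant weight has no gradient, so no volume term is
left. Both coercivity and consistency consist in adding this zero to `A`. -/
theorem IsTrefftz.faceIntegral_energy_one {s t : P.Field} (hs : M.IsTrefftz s)
    (ht : M.IsTrefftz t) :
    M.faceIntegral (M.normalDensity (P.energyDensity (fun _ => 1) s t)) = 0 := by
  rw [hs.faceIntegral_energy ht contDiff_const]
  refine Finset.sum_eq_zero fun K _ => ?_
  have : ∀ z : SpaceTime n, gradient (fun _ : SpaceTime n => (1 : ℝ)) z = 0 := fun z => by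
    simp [gradient]
  simp [this]

end Mesh

end FaceIntegral

/-! ### Bounded weights on the faces -/

section Weights

open AcousticProblem

/-! ### Essentially bounded functions and their inverses. -/

section Bounded

variable {X : Type*} [MeasurableSpace X] {μ : Measure X} {f : X → ℝ}

theorem MemLp.ae_norm_le_toReal (hf : MemLp f ⊤ μ) :
    ∀ᵐ x ∂μ, ‖f x‖ ≤ (eLpNorm f ⊤ μ).toReal := by
  filter_upwards [enorm_ae_le_eLpNormEssSup f μ] with x hx
  rw [← eLpNorm_exponent_top] at hx
  rw [← toReal_enorm]
  exact ENNReal.toReal_mono hf.2.ne hx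

theorem MemLp.inv_of_le (hf : MemLp f ⊤ μ) {a : ℝ} (ha : 0 < a) (h : ∀ᵐ x ∂μ, a ≤ f x) :
    MemLp (fun x => (f x)⁻¹) ⊤ μ := by
  refine memLp_top_of_bound hf.1.aemeasurable.inv.aestronglyMeasurable a⁻¹ ?_
  filter_upwards [h] with x hx
  rw [Real.norm_eq_abs, abs_of_pos (inv_pos.2 (ha.trans_le hx))]
  exact inv_anti₀ ha hx

theorem memLp_top_of_mem_Icc (hf : AEStronglyMeasurable f μ) {a C : ℝ} (ha : 0 < a)
    (h : ∀ᵐ x ∂μ, a ≤ f x ∧ f x ≤ C) :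
    MemLp f ⊤ μ ∧ MemLp (fun x => (f x)⁻¹) ⊤ μ := by
  have h1 : MemLp f ⊤ μ := by
    refine memLp_top_of_bound hf C ?_
    filter_upwards [h] with x hx
    rw [Real.norm_eq_abs, abs_of_pos (ha.trans_le hx.1)]
    exact hx.2
  exact ⟨h1, MemLp.inv_of_le h1 ha (h.mono fun _ hx => hx.1)⟩

end Bounded

namespace Mesh

variable {n : ℕ} {P : AcousticProblem n} {M : Mesh P}

theorem memLp_speed {μ : Measure (SpaceTime n)} {f : SpaceTime n → ℝ} (M : Mesh P)
    (hf : AEStronglyMeasurable f μ) (h : ∀ᵐ z ∂μ, ∃ K ∈ M.elems, f z = speed (P := P) K) :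
    MemLp f ⊤ μ ∧ MemLp (fun z => (f z)⁻¹) ⊤ μ ∧ MemLp (fun z => (f z ^ 2)⁻¹) ⊤ μ := by
  obtain ⟨c₀, h0, hc⟩ := exists_lower_speed P M
  obtain ⟨C, hC⟩ := exists_upper_speed M
  obtain ⟨h1, h2⟩ := memLp_top_of_mem_Icc hf h0 (h.mono fun z ⟨K, hK, hz⟩ =>
    (⟨hz ▸ hc K hK, hz ▸ hC K hK⟩ : c₀ ≤ f z ∧ f z ≤ C))
  refine ⟨h1, h2, (h2.mul h2).ae_eq (Eventually.of_forall fun z => ?_)⟩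
  simp [sq]

theorem memLp_c_Fspace : MemLp (fun z => (P.c z.fst)⁻¹) ⊤ ((surf n).restrict M.Fspace) ∧
    MemLp (fun z => (P.c z.fst ^ 2)⁻¹) ⊤ ((surf n).restrict M.Fspace) :=
  (memLp_speed M aestronglyMeasurable_c_Fspace ae_speed_Fspace).2

theorem memLp_c_F0 (M : Mesh P) : MemLp (fun z => (P.c z.fst)⁻¹) ⊤ ((surf n).restrict P.F0) ∧
    MemLp (fun z => (P.c z.fst ^ 2)⁻¹) ⊤ ((surf n).restrict P.F0) :=
  (memLp_speed M (aestronglyMeasurable_c_F0 M) (ae_speed_F0 M)).2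

theorem memLp_c_FT (M : Mesh P) : MemLp (fun z => (P.c z.fst)⁻¹) ⊤ ((surf n).restrict P.FT) ∧
    MemLp (fun z => (P.c z.fst ^ 2)⁻¹) ⊤ ((surf n).restrict P.FT) :=
  (memLp_speed M (aestronglyMeasurable_c_FT M) (ae_speed_FT M)).2

variable (M) in
theorem memLp_gamma : MemLp (fun z => (1 - M.γ z) / (M.nF z).snd) ⊤ ((surf n).restrict M.Fspace) ∧
    MemLp (fun z => (M.nF z).snd / (1 - M.γ z)) ⊤ ((surf n).restrict M.Fspace) := by
  obtain ⟨B, hB⟩ := M.exists_bound_gamma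
  have m1 := (continuous_snd_spaceTime.comp_aestronglyMeasurable
    (aestronglyMeasurable_nF (M := M))).aemeasurable
  have m2 := (aestronglyMeasurable_gamma (M := M)).aemeasurable.const_sub 1
  refine ⟨memLp_top_of_bound (m2.div m1).aestronglyMeasurable B ?_,
    memLp_top_of_bound (m1.div m2).aestronglyMeasurable B ?_⟩
  · filter_upwards [hB, ae_nF_Fspace (M := M)] with z hz hn
    rw [Real.norm_eq_abs, abs_of_nonneg (div_nonneg (by linarith [hz.2.1]) hn.2.2.1.le)]
    exact hz.2.2.2
  · filter_upwards [hB, ae_nF_Fspace (M := M)] with z hz hn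
    rw [Real.norm_eq_abs, abs_of_nonneg (div_nonneg hn.2.2.1.le (by linarith [hz.2.1]))]
    exact hz.2.2.1

end Mesh

namespace FluxParams

variable {n : ℕ} {P : AcousticProblem n} {M : Mesh P} (p : FluxParams M)

theorem memLp_alpha_time : MemLp p.α ⊤ ((surf n).restrict M.Ftime) ∧
    MemLp (fun z => (p.α z)⁻¹) ⊤ ((surf n).restrict M.Ftime) := by
  obtain ⟨a, ha, h⟩ := p.α_pos
  have h1 := p.α_bounded.mono_measure (Measure.restrict_mono Set.subset_union_left le_rfl)
  exact ⟨h1, MemLp.inv_of_le h1 ha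
    (ae_mono (Measure.restrict_mono Set.subset_union_left le_rfl) h)⟩

theorem memLp_alpha_dirichlet : MemLp p.α ⊤ ((surf n).restrict P.FD) ∧
    MemLp (fun z => (p.α z)⁻¹) ⊤ ((surf n).restrict P.FD) := by
  obtain ⟨a, ha, h⟩ := p.α_pos
  have h1 := p.α_bounded.mono_measure (Measure.restrict_mono Set.subset_union_right le_rfl)
  exact ⟨h1, MemLp.inv_of_le h1 ha
    (ae_mono (Measure.restrict_mono Set.subset_union_right le_rfl) h)⟩

theorem memLp_beta_time : MemLp p.β ⊤ ((surf n).restrict M.Ftime) ∧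
    MemLp (fun z => (p.β z)⁻¹) ⊤ ((surf n).restrict M.Ftime) := by
  obtain ⟨a, ha, h⟩ := p.β_pos
  have h1 := p.β_bounded.mono_measure (Measure.restrict_mono Set.subset_union_left le_rfl)
  exact ⟨h1, MemLp.inv_of_le h1 ha
    (ae_mono (Measure.restrict_mono Set.subset_union_left le_rfl) h)⟩

theorem memLp_beta_neumann : MemLp p.β ⊤ ((surf n).restrict P.FN) ∧
    MemLp (fun z => (p.β z)⁻¹) ⊤ ((surf n).restrict P.FN) := by
  obtain ⟨a, ha, h⟩ := p.β_pos
  have h1 := p.β_bounded.mono_measure (Measure.restrict_mono Set.subset_union_right le_rfl)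
  exact ⟨h1, MemLp.inv_of_le h1 ha
    (ae_mono (Measure.restrict_mono Set.subset_union_right le_rfl) h)⟩

theorem ae_alpha_pos_time : ∀ᵐ z ∂(surf n).restrict M.Ftime, 0 < p.α z := by
  obtain ⟨a, ha, h⟩ := p.α_pos
  filter_upwards [ae_mono (Measure.restrict_mono Set.subset_union_left le_rfl) h] with z hz
  exact ha.trans_le hz

theorem ae_alpha_pos_dirichlet : ∀ᵐ z ∂(surf n).restrict P.FD, 0 < p.α z := by
  obtain ⟨a, ha, h⟩ := p.α_pos
  filter_upwards [ae_mono (Measure.restrict_mono Set.subset_union_right le_rfl) h] with z hz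
  exact ha.trans_le hz

theorem ae_beta_pos_time : ∀ᵐ z ∂(surf n).restrict M.Ftime, 0 < p.β z := by
  obtain ⟨a, ha, h⟩ := p.β_pos
  filter_upwards [ae_mono (Measure.restrict_mono Set.subset_union_left le_rfl) h] with z hz
  exact ha.trans_le hz

theorem ae_beta_pos_neumann : ∀ᵐ z ∂(surf n).restrict P.FN, 0 < p.β z := by
  obtain ⟨a, ha, h⟩ := p.β_pos
  filter_upwards [ae_mono (Measure.restrict_mono Set.subset_union_right le_rfl) h] with z hz
  exact ha.trans_le hz

theorem memLp_theta (P : AcousticProblem n) : MemLp P.θ ⊤ ((surf n).restrict P.FR) ∧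
    MemLp (fun z => (P.θ z)⁻¹) ⊤ ((surf n).restrict P.FR) := by
  obtain ⟨a, ha, h⟩ := P.θ_pos
  exact ⟨P.θ_bounded, MemLp.inv_of_le P.θ_bounded ha h⟩

theorem memLp_cB (M : Mesh P) : MemLp P.cB ⊤ ((surf n).restrict P.FR) ∧
    MemLp (fun z => (P.cB z)⁻¹) ⊤ ((surf n).restrict P.FR) := by
  obtain ⟨h1, h2, -⟩ := Mesh.memLp_speed M
    (Mesh.aestronglyMeasurable_cB M P.measurable_R P.gamma_subset.2.2)
    (Mesh.ae_cB M P.measurable_R P.gamma_subset.2.2)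
  exact ⟨h1, h2⟩

/-- The parameters of the Robin part are uniformly positive, and `δ` is uniformly below one. -/
theorem exists_robin_bounds : ∃ a d : ℝ, 0 < a ∧ d < 1 ∧ ∀ᵐ z ∂(surf n).restrict P.FR,
    a ≤ p.δ z ∧ p.δ z ≤ d ∧ 0 < P.θ z ∧ 0 < P.cB z := by
  obtain ⟨a, ha, h⟩ := p.δ_pos
  obtain ⟨t, ht, hθ⟩ := P.θ_pos
  refine ⟨a, (eLpNorm p.δ ⊤ ((surf n).restrict P.FR)).toReal, ha, ?_, ?_⟩
  · have := (ENNReal.toReal_lt_toReal p.δ_bounded.2.ne ENNReal.one_ne_top).2 p.δ_lt_one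
    simpa using this
  · filter_upwards [h, hθ, Mesh.ae_cB M P.measurable_R P.gamma_subset.2.2,
      MemLp.ae_norm_le_toReal p.δ_bounded] with z h1 h2 h3 h4
    obtain ⟨K, hK, h3⟩ := h3
    exact ⟨h1, (le_abs_self _).trans h4, ht.trans_le h2, h3 ▸ Mesh.speed_pos hK⟩

theorem ae_robin : ∀ᵐ z ∂(surf n).restrict P.FR,
    0 < p.δ z ∧ p.δ z < 1 ∧ 0 < P.θ z ∧ 0 < P.cB z := by
  obtain ⟨a, d, ha, hd, h⟩ := p.exists_robin_bounds
  filter_upwards [h] with z hz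
  exact ⟨ha.trans_le hz.1, hz.2.1.trans_lt hd, hz.2.2⟩

theorem memLp_one_sub_delta : MemLp (fun z => 1 - p.δ z) ⊤ ((surf n).restrict P.FR) :=
  (memLp_top_const 1).sub p.δ_bounded

theorem memLp_robin_first :
    MemLp (fun z => (1 - p.δ z) * P.θ z / P.cB z) ⊤ ((surf n).restrict P.FR) := by
  have h : MemLp (fun z => (1 - p.δ z) * P.θ z) ⊤ ((surf n).restrict P.FR) :=
    (memLp_theta P).1.mul p.memLp_one_sub_delta
  simp only [div_eq_mul_inv]
  exact (memLp_cB M).2.mul h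

theorem memLp_robin_second :
    MemLp (fun z => p.δ z * P.cB z / P.θ z) ⊤ ((surf n).restrict P.FR) := by
  have h : MemLp (fun z => p.δ z * P.cB z) ⊤ ((surf n).restrict P.FR) :=
    (memLp_cB M).1.mul p.δ_bounded
  simp only [div_eq_mul_inv]
  exact (memLp_theta P).2.mul h

end FluxParams

end Weights

/-! ### The bilinear form, the functional and the norms as integrals over the faces -/

section Densities

open AcousticProblem

/-! ### Integrability of products with bounded weights. -/

section Integrability

variable {X : Type*} [MeasurableSpace X] {μ : Measure X} {a : X → ℝ}

theorem MemLp.weight_mul {f : X → ℝ} (hf : MemLp f 2 μ) (ha : MemLp a ⊤ μ) :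
    MemLp (fun x => a x * f x) 2 μ := hf.mul ha

theorem MemLp.integrable_weight_mul {f : X → ℝ} (hf : Integrable f μ) (ha : MemLp a ⊤ μ) :
    Integrable (fun x => a x * f x) μ :=
  memLp_one_iff_integrable.1 ((memLp_one_iff_integrable.2 hf).mul ha)

theorem MemLp.integrable_weight_mul_sq {f : X → ℝ} (hf : MemLp f 2 μ) (ha : MemLp a ⊤ μ) :
    Integrable (fun x => a x * f x ^ 2) μ := MemLp.integrable_weight_mul hf.integrable_sq ha

theorem MemLp.integrable_weight_mul_norm_sq {F : Type*} [NormedAddCommGroup F] {f : X → F}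
    (hf : MemLp f 2 μ) (ha : MemLp a ⊤ μ) : Integrable (fun x => a x * ‖f x‖ ^ 2) μ :=
  MemLp.integrable_weight_mul_sq hf.norm ha

end Integrability

variable {n : ℕ} {P : AcousticProblem n} {M : Mesh P}

/-- Measurable square integrable functions on `Ω` define such functions on `Ω × {0}`. -/
theorem memLp_initial {F : Type*} [NormedAddCommGroup F] {f : Space n → F}
    (hf : MemLp f 2 (volume.restrict P.Ω)) :
    MemLp (fun z : SpaceTime n => f z.fst) 2 ((surf n).restrict P.F0) := by
  have hset : P.F0 = graphMap (0 : Space n × ℝ) '' P.Ω := by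
    ext z
    constructor
    · rintro ⟨h1, h2⟩
      have h2 : z.snd = 0 := h2
      refine ⟨z.fst, h1, ?_⟩
      refine WithLp.ofLp_injective 2 (Prod.ext rfl ?_)
      change (graphMap (0 : Space n × ℝ) z.fst).snd = z.snd
      rw [graphMap_snd, h2]
      simp
    · rintro ⟨x, hx, rfl⟩
      refine ⟨hx, ?_⟩
      change (graphMap (0 : Space n × ℝ) x).snd = 0
      simp
  have hmeas : (surf n).restrict P.F0 = ENNReal.ofReal (slope (0 : Space n × ℝ)) •
      Measure.map (graphMap (0 : Space n × ℝ)) (volume.restrict P.Ω) := by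
    ext s hs
    rw [Measure.restrict_apply hs, Measure.smul_apply, (measurableEmbedding_graphMap 0).map_apply,
      hset, ← Set.image_preimage_inter, surf_image_graphMap, smul_eq_mul,
      Measure.restrict_apply ((measurableEmbedding_graphMap 0).measurable hs)]
  rw [hmeas]
  refine MemLp.smul_measure ?_ ENNReal.ofReal_ne_top
  rw [(measurableEmbedding_graphMap 0).memLp_map_measure_iff]
  exact hf

namespace FluxParams

variable (p : FluxParams M)

/-- Density of the bilinear form. -/
def aDensity (s t : P.Field) : Face → SpaceTime n → ℝ
  | .space => fun z => (P.c z.fst ^ 2)⁻¹ * M.lower s.1 z * M.jumpT t.1 z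
      + ⟪M.lower s.2 z, M.jumpT t.2 z⟫ + M.lower s.1 z * M.jumpNv t.2 z
      + ⟪M.lower s.2 z, M.jumpN t.1 z⟫
  | .final => fun z => (P.c z.fst ^ 2)⁻¹ * tr s.1 z (eT n) * tr t.1 z (eT n)
      + ⟪tr s.2 z (eT n), tr t.2 z (eT n)⟫
  | .time => fun z => M.avg s.1 z * M.jumpNv t.2 z + ⟪M.avg s.2 z, M.jumpN t.1 z⟫
      + p.α z * ⟪M.jumpN s.1 z, M.jumpN t.1 z⟫ + p.β z * M.jumpNv s.2 z * M.jumpNv t.2 z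
  | .dirichlet => fun z => P.latN s.2 z * P.lat t.1 z + p.α z * P.lat s.1 z * P.lat t.1 z
  | .neumann => fun z => P.lat s.1 z * P.latN t.2 z + p.β z * P.latN s.2 z * P.latN t.2 z
  | .robin => fun z => (1 - p.δ z) * P.θ z / P.cB z * P.lat s.1 z * P.lat t.1 z
      + (1 - p.δ z) * P.lat s.1 z * P.latN t.2 z
      + p.δ z * P.latN s.2 z * P.lat t.1 z
      + p.δ z * P.cB z / P.θ z * P.latN s.2 z * P.latN t.2 z
  | .initial => fun _ => 0

/-- Density of the linear functional. -/
def lDensity (t : P.Field) : Face → SpaceTime n → ℝ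
  | .space => fun _ => 0
  | .final => fun _ => 0
  | .time => fun _ => 0
  | .dirichlet => fun z => P.gD z * (p.α z * P.lat t.1 z - P.latN t.2 z)
  | .neumann => fun z => P.gN z * (p.β z * P.latN t.2 z - P.lat t.1 z)
  | .robin => fun z => P.gR z * ((1 - p.δ z) * P.lat t.1 z
      - p.δ z * P.cB z / P.θ z * P.latN t.2 z)
  | .initial => fun z => (P.c z.fst ^ 2)⁻¹ * P.v₀ z.fst * tr t.1 z (-eT n)
      + ⟪P.σ₀ z.fst, tr t.2 z (-eT n)⟫

/-- Density of the squared DG norm. -/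
def qDensity (t : P.Field) : Face → SpaceTime n → ℝ
  | .space => fun z => 1 / 2 * ((1 - M.γ z) / (M.nF z).snd * ((P.c z.fst)⁻¹ * M.jumpT t.1 z) ^ 2)
      + 1 / 2 * ((1 - M.γ z) / (M.nF z).snd * ‖M.jumpT t.2 z‖ ^ 2)
  | .final => fun z => 1 / 2 * ((P.c z.fst)⁻¹ * tr t.1 z (eT n)) ^ 2
      + 1 / 2 * ‖tr t.2 z (eT n)‖ ^ 2
  | .time => fun z => p.α z * ‖M.jumpN t.1 z‖ ^ 2 + p.β z * M.jumpNv t.2 z ^ 2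
  | .dirichlet => fun z => p.α z * P.lat t.1 z ^ 2
  | .neumann => fun z => p.β z * P.latN t.2 z ^ 2
  | .robin => fun z => (1 - p.δ z) * P.θ z / P.cB z * P.lat t.1 z ^ 2
      + p.δ z * P.cB z / P.θ z * P.latN t.2 z ^ 2
  | .initial => fun z => 1 / 2 * ((P.c z.fst)⁻¹ * tr t.1 z (-eT n)) ^ 2
      + 1 / 2 * ‖tr t.2 z (-eT n)‖ ^ 2

/-- Density of the difference of the squared DG⁺ and DG norms. -/
def plusDensity (t : P.Field) : Face → SpaceTime n → ℝ
  | .space => fun z => 2 * ((M.nF z).snd / (1 - M.γ z) * ((P.c z.fst)⁻¹ * M.lower t.1 z) ^ 2)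
      + 2 * ((M.nF z).snd / (1 - M.γ z) * ‖M.lower t.2 z‖ ^ 2)
  | .final => fun _ => 0
  | .time => fun z => (p.β z)⁻¹ * M.avg t.1 z ^ 2 + (p.α z)⁻¹ * ‖M.avg t.2 z‖ ^ 2
  | .dirichlet => fun z => (p.α z)⁻¹ * P.latN t.2 z ^ 2
  | .neumann => fun z => (p.β z)⁻¹ * P.lat t.1 z ^ 2
  | .robin => fun _ => 0
  | .initial => fun _ => 0

/-- Once form, functional and norms are all written as one integral over the faces, each estimate
reduces to a pointwise inequality between densities. -/
theorem A_eq_faceIntegral (s t : P.Field) : p.A s t = M.faceIntegral (p.aDensity s t) := by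
  simp only [A, Mesh.faceIntegral, aDensity, integral_zero, add_zero]

theorem ell_eq_faceIntegral (t : P.Field) : p.ell t = M.faceIntegral (p.lDensity t) := by
  simp only [ell, Mesh.faceIntegral, lDensity, integral_zero]
  ring

section Terms

variable {t : P.Field}

theorem integrable_jumpT (ht : M.FieldTraces t) :
    Integrable (fun z => (1 - M.γ z) / (M.nF z).snd * ((P.c z.fst)⁻¹ * M.jumpT t.1 z) ^ 2)
      ((surf n).restrict M.Fspace) ∧
    Integrable (fun z => (1 - M.γ z) / (M.nF z).snd * ‖M.jumpT t.2 z‖ ^ 2)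
      ((surf n).restrict M.Fspace) :=
  ⟨MemLp.integrable_weight_mul_sq (MemLp.weight_mul ht.1.memLp_jumpT Mesh.memLp_c_Fspace.1)
    M.memLp_gamma.1, MemLp.integrable_weight_mul_norm_sq ht.2.memLp_jumpT M.memLp_gamma.1⟩

theorem integrable_lower (ht : M.FieldTraces t) :
    Integrable (fun z => (M.nF z).snd / (1 - M.γ z) * ((P.c z.fst)⁻¹ * M.lower t.1 z) ^ 2)
      ((surf n).restrict M.Fspace) ∧
    Integrable (fun z => (M.nF z).snd / (1 - M.γ z) * ‖M.lower t.2 z‖ ^ 2)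
      ((surf n).restrict M.Fspace) :=
  ⟨MemLp.integrable_weight_mul_sq (MemLp.weight_mul ht.1.memLp_lower Mesh.memLp_c_Fspace.1)
    M.memLp_gamma.2, MemLp.integrable_weight_mul_norm_sq ht.2.memLp_lower M.memLp_gamma.2⟩

theorem integrable_final (ht : M.FieldTraces t) :
    Integrable (fun z => ((P.c z.fst)⁻¹ * tr t.1 z (eT n)) ^ 2) ((surf n).restrict P.FT) ∧
    Integrable (fun z => ‖tr t.2 z (eT n)‖ ^ 2) ((surf n).restrict P.FT) :=
  ⟨(MemLp.weight_mul ht.1.memLp_FT (Mesh.memLp_c_FT M).1).integrable_sq,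
    ht.2.memLp_FT.norm.integrable_sq⟩

theorem integrable_initial (ht : M.FieldTraces t) :
    Integrable (fun z => ((P.c z.fst)⁻¹ * tr t.1 z (-eT n)) ^ 2) ((surf n).restrict P.F0) ∧
    Integrable (fun z => ‖tr t.2 z (-eT n)‖ ^ 2) ((surf n).restrict P.F0) :=
  ⟨(MemLp.weight_mul ht.1.memLp_F0 (Mesh.memLp_c_F0 M).1).integrable_sq,
    ht.2.memLp_F0.norm.integrable_sq⟩

theorem memLp_lat_D (ht : M.FieldTraces t) : MemLp (P.lat t.1) 2 ((surf n).restrict P.FD) ∧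
    MemLp (P.latN t.2) 2 ((surf n).restrict P.FD) :=
  ⟨ht.1.memLp_lateral P.measurable_D P.gamma_subset.1,
    ht.2.memLp_latN P.measurable_D P.gamma_subset.1⟩

theorem memLp_lat_N (ht : M.FieldTraces t) : MemLp (P.lat t.1) 2 ((surf n).restrict P.FN) ∧
    MemLp (P.latN t.2) 2 ((surf n).restrict P.FN) :=
  ⟨ht.1.memLp_lateral P.measurable_N P.gamma_subset.2.1,
    ht.2.memLp_latN P.measurable_N P.gamma_subset.2.1⟩

theorem memLp_lat_R (ht : M.FieldTraces t) : MemLp (P.lat t.1) 2 ((surf n).restrict P.FR) ∧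
    MemLp (P.latN t.2) 2 ((surf n).restrict P.FR) :=
  ⟨ht.1.memLp_lateral P.measurable_R P.gamma_subset.2.2,
    ht.2.memLp_latN P.measurable_R P.gamma_subset.2.2⟩

end Terms

theorem faceIntegrable_qDensity {t : P.Field} (ht : M.FieldTraces t) :
    M.FaceIntegrable (p.qDensity t) := by
  intro i
  cases i
  · exact ((integrable_jumpT ht).1.const_mul _).add ((integrable_jumpT ht).2.const_mul _)
  · exact ((integrable_final ht).1.const_mul _).add ((integrable_final ht).2.const_mul _)
  · exact (MemLp.integrable_weight_mul_norm_sq ht.1.memLp_jumpN.2 p.memLp_alpha_time.1).add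
      (MemLp.integrable_weight_mul_sq ht.2.memLp_jumpNv.2 p.memLp_beta_time.1)
  · exact MemLp.integrable_weight_mul_sq (memLp_lat_D ht).1 p.memLp_alpha_dirichlet.1
  · exact MemLp.integrable_weight_mul_sq (memLp_lat_N ht).2 p.memLp_beta_neumann.1
  · exact (MemLp.integrable_weight_mul_sq (memLp_lat_R ht).1 p.memLp_robin_first).add
      (MemLp.integrable_weight_mul_sq (memLp_lat_R ht).2 p.memLp_robin_second)
  · exact ((integrable_initial ht).1.const_mul _).add ((integrable_initial ht).2.const_mul _)

theorem faceIntegrable_plusDensity {t : P.Field} (ht : M.FieldTraces t) :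
    M.FaceIntegrable (p.plusDensity t) := by
  intro i
  cases i
  · exact ((integrable_lower ht).1.const_mul _).add ((integrable_lower ht).2.const_mul _)
  · exact integrable_zero _ _ _
  · exact (MemLp.integrable_weight_mul_sq ht.1.memLp_avg p.memLp_beta_time.2).add
      (MemLp.integrable_weight_mul_norm_sq ht.2.memLp_avg p.memLp_alpha_time.2)
  · exact MemLp.integrable_weight_mul_sq (memLp_lat_D ht).2 p.memLp_alpha_dirichlet.2
  · exact MemLp.integrable_weight_mul_sq (memLp_lat_N ht).1 p.memLp_beta_neumann.2
  · exact integrable_zero _ _ _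
  · exact integrable_zero _ _ _

theorem faceIntegrable_aDensity {s t : P.Field} (hs : M.FieldTraces s) (ht : M.FieldTraces t) :
    M.FaceIntegrable (p.aDensity s t) := by
  intro i
  cases i
  · exact (((MemLp.integrable_mul_two (MemLp.weight_mul hs.1.memLp_lower Mesh.memLp_c_Fspace.2)
      ht.1.memLp_jumpT).add (MemLp.integrable_inner_two hs.2.memLp_lower ht.2.memLp_jumpT)).add
      (MemLp.integrable_mul_two hs.1.memLp_lower ht.2.memLp_jumpNv.1)).add
      (MemLp.integrable_inner_two hs.2.memLp_lower ht.1.memLp_jumpN.1)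
  · exact (MemLp.integrable_mul_two (MemLp.weight_mul hs.1.memLp_FT (Mesh.memLp_c_FT M).2)
      ht.1.memLp_FT).add (MemLp.integrable_inner_two hs.2.memLp_FT ht.2.memLp_FT)
  · exact (((MemLp.integrable_mul_two hs.1.memLp_avg ht.2.memLp_jumpNv.2).add
      (MemLp.integrable_inner_two hs.2.memLp_avg ht.1.memLp_jumpN.2)).add
      (MemLp.integrable_weight_mul (MemLp.integrable_inner_two hs.1.memLp_jumpN.2
        ht.1.memLp_jumpN.2) p.memLp_alpha_time.1)).add
      (MemLp.integrable_mul_two (MemLp.weight_mul hs.2.memLp_jumpNv.2 p.memLp_beta_time.1)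
        ht.2.memLp_jumpNv.2)
  · exact (MemLp.integrable_mul_two (memLp_lat_D hs).2 (memLp_lat_D ht).1).add
      (MemLp.integrable_mul_two (MemLp.weight_mul (memLp_lat_D hs).1 p.memLp_alpha_dirichlet.1)
        (memLp_lat_D ht).1)
  · exact (MemLp.integrable_mul_two (memLp_lat_N hs).1 (memLp_lat_N ht).2).add
      (MemLp.integrable_mul_two (MemLp.weight_mul (memLp_lat_N hs).2 p.memLp_beta_neumann.1)
        (memLp_lat_N ht).2)
  · exact (((MemLp.integrable_mul_two (MemLp.weight_mul (memLp_lat_R hs).1 p.memLp_robin_first)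
      (memLp_lat_R ht).1).add
      (MemLp.integrable_mul_two (MemLp.weight_mul (memLp_lat_R hs).1 p.memLp_one_sub_delta)
        (memLp_lat_R ht).2)).add
      (MemLp.integrable_mul_two (MemLp.weight_mul (memLp_lat_R hs).2 p.δ_bounded)
        (memLp_lat_R ht).1)).add
      (MemLp.integrable_mul_two (MemLp.weight_mul (memLp_lat_R hs).2 p.memLp_robin_second)
        (memLp_lat_R ht).2)
  · exact integrable_zero _ _ _

theorem faceIntegrable_lDensity {t : P.Field} (ht : M.FieldTraces t) :
    M.FaceIntegrable (p.lDensity t) := by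
  intro i
  cases i
  · exact integrable_zero _ _ _
  · exact integrable_zero _ _ _
  · exact integrable_zero _ _ _
  · exact MemLp.integrable_mul_two P.memLp_gD
      ((MemLp.weight_mul (memLp_lat_D ht).1 p.memLp_alpha_dirichlet.1).sub (memLp_lat_D ht).2)
  · exact MemLp.integrable_mul_two P.memLp_gN
      ((MemLp.weight_mul (memLp_lat_N ht).2 p.memLp_beta_neumann.1).sub (memLp_lat_N ht).1)
  · exact MemLp.integrable_mul_two P.memLp_gR
      ((MemLp.weight_mul (memLp_lat_R ht).1 p.memLp_one_sub_delta).sub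
        (MemLp.weight_mul (memLp_lat_R ht).2 p.memLp_robin_second))
  · exact (MemLp.integrable_mul_two (MemLp.weight_mul (memLp_initial P.memLp_v₀)
      (Mesh.memLp_c_F0 M).2) ht.1.memLp_F0).add
      (MemLp.integrable_inner_two (memLp_initial P.memLp_σ₀) ht.2.memLp_F0)

theorem normDGsq_eq_faceIntegral {t : P.Field} (ht : M.FieldTraces t) :
    p.normDGsq t = M.faceIntegral (p.qDensity t) := by
  obtain ⟨a1, a2⟩ := integrable_jumpT ht
  obtain ⟨b1, b2⟩ := integrable_final ht
  obtain ⟨c1, c2⟩ := integrable_initial ht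
  have d1 := MemLp.integrable_weight_mul_norm_sq ht.1.memLp_jumpN.2 p.memLp_alpha_time.1
  have d2 := MemLp.integrable_weight_mul_sq ht.2.memLp_jumpNv.2 p.memLp_beta_time.1
  have e1 := MemLp.integrable_weight_mul_sq (memLp_lat_R ht).1 p.memLp_robin_first
  have e2 := MemLp.integrable_weight_mul_sq (memLp_lat_R ht).2 p.memLp_robin_second
  simp only [normDGsq, Mesh.faceIntegral, qDensity]
  rw [integral_add (a1.const_mul _) (a2.const_mul _), integral_add (b1.const_mul _)
    (b2.const_mul _), integral_add (c1.const_mul _) (c2.const_mul _), integral_add d1 d2,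
    integral_add e1 e2]
  simp only [integral_const_mul]
  ring

theorem normDGplus_eq_faceIntegral {t : P.Field} (ht : M.FieldTraces t) :
    p.normDGplus t = √(M.faceIntegral (p.qDensity t) + M.faceIntegral (p.plusDensity t)) := by
  obtain ⟨a1, a2⟩ := integrable_lower ht
  have d1 := MemLp.integrable_weight_mul_sq ht.1.memLp_avg p.memLp_beta_time.2
  have d2 := MemLp.integrable_weight_mul_norm_sq ht.2.memLp_avg p.memLp_alpha_time.2
  simp only [normDGplus]
  rw [p.normDGsq_eq_faceIntegral ht]
  generalize M.faceIntegral (p.qDensity t) = I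
  simp only [Mesh.faceIntegral, plusDensity]
  rw [integral_add (a1.const_mul _) (a2.const_mul _), integral_add d1 d2]
  simp only [integral_const_mul, integral_zero]
  congr 1
  ring

end FluxParams

end Densities

/-! ### Linearity -/

section Linearity

open AcousticProblem

namespace Mesh

variable {n : ℕ} {P : AcousticProblem n} {M : Mesh P}

/-- The value `tr` is a limit with a default, and elements of `Lp` are classes, so linearity is
available only where the boundary values exist. That is why linearity of the densities is stated
almost everywhere. -/
theorem FieldTraces.tr_smul_add {s t : P.Field} (hs : M.FieldTraces s) (ht : M.FieldTraces t)
    (c : ℝ) : M.AeNormals fun z ν =>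
      tr (c • s + t).1 z ν = c * tr s.1 z ν + tr t.1 z ν ∧
      tr (c • s + t).2 z ν = c • tr s.2 z ν + tr t.2 z ν := by
  refine ((((hs.1.smul c).tr_add ht.1).and (hs.1.tr_smul c)).and
    (((hs.2.smul c).tr_add ht.2).and (hs.2.tr_smul c))).mono ?_
  rintro z ν ⟨⟨h1, h2⟩, h3, h4⟩
  rw [h2] at h1
  rw [h4] at h3
  exact ⟨h1, h3⟩

end Mesh

namespace FluxParams

variable {n : ℕ} {P : AcousticProblem n} {M : Mesh P} (p : FluxParams M)

theorem aDensity_left {s s' t : P.Field} (hs : M.FieldTraces s) (hs' : M.FieldTraces s') (c : ℝ)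
    (i : Face) : p.aDensity (c • s + s') t i =ᵐ[M.faceMeasure i]
      fun z => c * p.aDensity s t i z + p.aDensity s' t i z := by
  have H := hs.tr_smul_add hs' c
  cases i
  · filter_upwards [H.Fspace] with z hz
    simp only [aDensity, Mesh.lower, hz, inner_add_left, real_inner_smul_left]
    ring
  · filter_upwards [H.FT] with z hz
    simp only [aDensity, hz, inner_add_left, real_inner_smul_left]
    ring
  · filter_upwards [H.Ftime] with z hz
    simp only [aDensity, Mesh.avg, Mesh.jumpN, Mesh.jumpNv, Mesh.lower, Mesh.upper, hz,
      inner_add_left, real_inner_smul_left, inner_add_right, real_inner_smul_right, add_smul,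
      smul_add, smul_eq_mul, mul_add]
    ring
  · filter_upwards [H.FD] with z hz
    simp only [aDensity, latN, lat, hz, inner_add_left, real_inner_smul_left]
    ring
  · filter_upwards [H.FN] with z hz
    simp only [aDensity, latN, lat, hz, inner_add_left, real_inner_smul_left]
    ring
  · filter_upwards [H.FR] with z hz
    simp only [aDensity, latN, lat, hz, inner_add_left, real_inner_smul_left]
    ring
  · exact Eventually.of_forall fun z => by simp [aDensity]

theorem aDensity_right {s t t' : P.Field} (ht : M.FieldTraces t) (ht' : M.FieldTraces t') (c : ℝ)
    (i : Face) : p.aDensity s (c • t + t') i =ᵐ[M.faceMeasure i]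
      fun z => c * p.aDensity s t i z + p.aDensity s t' i z := by
  have H := ht.tr_smul_add ht' c
  cases i
  · filter_upwards [H.Fspace] with z hz
    simp only [aDensity, Mesh.jumpT, Mesh.jumpN, Mesh.jumpNv, Mesh.lower, Mesh.upper, hz,
      inner_add_left, real_inner_smul_left, inner_add_right, real_inner_smul_right, add_smul,
      smul_add, smul_eq_mul, mul_add, smul_smul]
    ring
  · filter_upwards [H.FT] with z hz
    simp only [aDensity, hz, inner_add_right, real_inner_smul_right]
    ring
  · filter_upwards [H.Ftime] with z hz
    simp only [aDensity, Mesh.avg, Mesh.jumpN, Mesh.jumpNv, Mesh.lower, Mesh.upper, hz,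
      inner_add_left, real_inner_smul_left, inner_add_right, real_inner_smul_right, add_smul,
      smul_add, smul_eq_mul, mul_add]
    ring
  · filter_upwards [H.FD] with z hz
    simp only [aDensity, lat, hz]
    ring
  · filter_upwards [H.FN] with z hz
    simp only [aDensity, latN, lat, hz, inner_add_left, real_inner_smul_left]
    ring
  · filter_upwards [H.FR] with z hz
    simp only [aDensity, latN, lat, hz, inner_add_left, real_inner_smul_left]
    ring
  · exact Eventually.of_forall fun z => by simp [aDensity]

theorem lDensity_smul_add {t t' : P.Field} (ht : M.FieldTraces t) (ht' : M.FieldTraces t') (c : ℝ)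
    (i : Face) : p.lDensity (c • t + t') i =ᵐ[M.faceMeasure i]
      fun z => c * p.lDensity t i z + p.lDensity t' i z := by
  have H := ht.tr_smul_add ht' c
  cases i
  · exact Eventually.of_forall fun z => by simp [lDensity]
  · exact Eventually.of_forall fun z => by simp [lDensity]
  · exact Eventually.of_forall fun z => by simp [lDensity]
  · filter_upwards [H.FD] with z hz
    simp only [lDensity, latN, lat, hz, inner_add_left, real_inner_smul_left]
    ring
  · filter_upwards [H.FN] with z hz
    simp only [lDensity, latN, lat, hz, inner_add_left, real_inner_smul_left]
    ring
  · filter_upwards [H.FR] with z hz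
    simp only [lDensity, latN, lat, hz, inner_add_left, real_inner_smul_left]
    ring
  · filter_upwards [H.F0] with z hz
    simp only [lDensity, hz, inner_add_right, real_inner_smul_right]
    ring

theorem A_smul_add_left {s s' t : P.Field} (hs : M.FieldTraces s) (hs' : M.FieldTraces s')
    (ht : M.FieldTraces t) (c : ℝ) : p.A (c • s + s') t = c * p.A s t + p.A s' t := by
  rw [A_eq_faceIntegral, A_eq_faceIntegral, A_eq_faceIntegral,
    Mesh.faceIntegral_congr (p.aDensity_left hs hs' c),
    Mesh.faceIntegral_add ((p.faceIntegrable_aDensity hs ht).const_mul c)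
      (p.faceIntegrable_aDensity hs' ht), Mesh.faceIntegral_const_mul]

theorem A_smul_add_right {s t t' : P.Field} (hs : M.FieldTraces s) (ht : M.FieldTraces t)
    (ht' : M.FieldTraces t') (c : ℝ) : p.A s (c • t + t') = c * p.A s t + p.A s t' := by
  rw [A_eq_faceIntegral, A_eq_faceIntegral, A_eq_faceIntegral,
    Mesh.faceIntegral_congr (p.aDensity_right ht ht' c),
    Mesh.faceIntegral_add ((p.faceIntegrable_aDensity hs ht).const_mul c)
      (p.faceIntegrable_aDensity hs ht'), Mesh.faceIntegral_const_mul]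

theorem ell_smul_add {t t' : P.Field} (ht : M.FieldTraces t) (ht' : M.FieldTraces t') (c : ℝ) :
    p.ell (c • t + t') = c * p.ell t + p.ell t' := by
  rw [ell_eq_faceIntegral, ell_eq_faceIntegral, ell_eq_faceIntegral,
    Mesh.faceIntegral_congr (p.lDensity_smul_add ht ht' c),
    Mesh.faceIntegral_add ((p.faceIntegrable_lDensity ht).const_mul c)
      (p.faceIntegrable_lDensity ht'), Mesh.faceIntegral_const_mul]

/-! ### Nonnegativity of the norm densities -/

theorem qDensity_nonneg (t : P.Field) (i : Face) : 0 ≤ᵐ[M.faceMeasure i] p.qDensity t i := by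
  obtain ⟨B, hB⟩ := M.exists_bound_gamma
  cases i
  · filter_upwards [hB, Mesh.ae_nF_Fspace (M := M)] with z h1 h2
    have : 0 ≤ (1 - M.γ z) / (M.nF z).snd := div_nonneg (by linarith [h1.2.1]) h2.2.2.1.le
    simp only [qDensity, Pi.zero_apply]
    positivity
  · exact Eventually.of_forall fun z => by simp only [qDensity, Pi.zero_apply]; positivity
  · filter_upwards [p.ae_alpha_pos_time, p.ae_beta_pos_time] with z h1 h2
    simp only [qDensity, Pi.zero_apply]
    positivity
  · filter_upwards [p.ae_alpha_pos_dirichlet] with z h1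
    simp only [qDensity, Pi.zero_apply]
    positivity
  · filter_upwards [p.ae_beta_pos_neumann] with z h1
    simp only [qDensity, Pi.zero_apply]
    positivity
  · filter_upwards [p.ae_robin] with z ⟨h1, h2, h3, h4⟩
    have : 0 < 1 - p.δ z := by linarith
    simp only [qDensity, Pi.zero_apply]
    positivity
  · exact Eventually.of_forall fun z => by simp only [qDensity, Pi.zero_apply]; positivity

theorem plusDensity_nonneg (t : P.Field) (i : Face) :
    0 ≤ᵐ[M.faceMeasure i] p.plusDensity t i := by
  obtain ⟨B, hB⟩ := M.exists_bound_gamma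
  cases i
  · filter_upwards [hB, Mesh.ae_nF_Fspace (M := M)] with z h1 h2
    have : 0 ≤ (M.nF z).snd / (1 - M.γ z) := div_nonneg h2.2.2.1.le (by linarith [h1.2.1])
    simp only [plusDensity, Pi.zero_apply]
    positivity
  · exact Eventually.of_forall fun z => le_rfl
  · filter_upwards [p.ae_alpha_pos_time, p.ae_beta_pos_time] with z h1 h2
    simp only [plusDensity, Pi.zero_apply]
    positivity
  · filter_upwards [p.ae_alpha_pos_dirichlet] with z h1
    simp only [plusDensity, Pi.zero_apply]
    positivity
  · filter_upwards [p.ae_beta_pos_neumann] with z h1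
    simp only [plusDensity, Pi.zero_apply]
    positivity
  · exact Eventually.of_forall fun z => le_rfl
  · exact Eventually.of_forall fun z => le_rfl

end FluxParams

end Linearity

/-! ### Pointwise estimates -/

section Pointwise

open AcousticProblem

/-! ### Young inequalities for real numbers. -/

section Scalar

/-- Completing the square: `A` times the difference of the two sides is `(A x - p y / 2)² + (A B -
p²) y² / 4`. -/
theorem mul_le_of_sq_le {A B p : ℝ} (hA : 0 < A) (h : p ^ 2 ≤ A * B) (x y : ℝ) :
    p * x * y ≤ A * x ^ 2 + 1 / 4 * (B * y ^ 2) := by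
  have h1 : 0 ≤ A * (A * x ^ 2 + 1 / 4 * (B * y ^ 2) - p * x * y) := by
    nlinarith [sq_nonneg (A * x - p * y / 2), mul_nonneg (sub_nonneg.2 h) (sq_nonneg y)]
  linarith [nonneg_of_mul_nonneg_right h1 hA]

theorem mul_le_young {a : ℝ} (ha : 0 < a) (x y : ℝ) :
    x * y ≤ a⁻¹ * x ^ 2 + 1 / 4 * (a * y ^ 2) := by
  have := mul_le_of_sq_le (A := a⁻¹) (B := a) (p := 1) (inv_pos.2 ha)
    (by rw [inv_mul_cancel₀ ha.ne']; norm_num) x y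
  linarith

/-- As `g < 1`, the left side is at most `(x + y)(X + Y)`. Young's inequality with parameter `1 - g`
is applied to `X` and to `Y`, and `(x + y)² ≤ 2 (x² + y²)` produces the factor `4`. -/
theorem coupling_le {x y X Y g : ℝ} (hx : 0 ≤ x) (hy : 0 ≤ y) (hX : 0 ≤ X) (hY : 0 ≤ Y)
    (hg1 : g < 1) :
    x * X + y * Y + g * (x * Y) + g * (X * y) ≤
      4 / (1 - g) * (x ^ 2 + y ^ 2) + 1 / 4 * ((1 - g) * (X ^ 2 + Y ^ 2)) := by
  have hD : 0 < 1 - g := by linarith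
  have h1 := mul_le_young hD (x + y) X
  have h2 := mul_le_young hD (x + y) Y
  have h3 : (1 - g)⁻¹ * (x + y) ^ 2 ≤ (1 - g)⁻¹ * (2 * (x ^ 2 + y ^ 2)) :=
    mul_le_mul_of_nonneg_left (by nlinarith [sq_nonneg (x - y)]) (inv_pos.2 hD).le
  have h4 : g * (x * Y) ≤ x * Y := by nlinarith [mul_nonneg hx hY]
  have h5 : g * (X * y) ≤ X * y := by nlinarith [mul_nonneg hX hy]
  have h6 : 4 / (1 - g) * (x ^ 2 + y ^ 2) = 2 * ((1 - g)⁻¹ * (2 * (x ^ 2 + y ^ 2))) := by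
    rw [div_eq_mul_inv]; ring
  rw [h6]
  nlinarith

end Scalar

/-! ### The bilinear form on one space-like face. -/

section Vector

variable {F : Type*} [NormedAddCommGroup F] [InnerProductSpace ℝ F]

theorem inner_le_young {a : ℝ} (ha : 0 < a) (x y : F) :
    ⟪x, y⟫ ≤ a⁻¹ * ‖x‖ ^ 2 + 1 / 4 * (a * ‖y‖ ^ 2) :=
  (real_inner_le_norm x y).trans (mul_le_young ha _ _)

theorem norm_smul_add_neg_smul_sq (a : ℝ) (x y : F) :
    ‖a • x + (-a) • y‖ ^ 2 = a ^ 2 * ‖x - y‖ ^ 2 := by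
  have : a • x + (-a) • y = a • (x - y) := by rw [neg_smul, smul_sub, sub_eq_add_neg]
  rw [this, norm_smul, mul_pow, Real.norm_eq_abs, sq_abs]

/-- Write `V = v - v'` and `S = s - s'`. After subtraction of half the energy flux, the form is `½ m
(c⁻² V² + |S|²) + V S·N`. Cauchy–Schwarz and `2xy ≤ x² + y²` bound the mixed term below by `-½ c‖N‖
(c⁻² V² + |S|²)`, and `m - c‖N‖ = m (1 - γ)` is the weight in the norm. -/
theorem spaceLike_coercive {c m γ v v' : ℝ} {N s s' : F} (hc : 0 < c) (hm : 0 < m)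
    (hγ : γ = c * ‖N‖ / m) :
    1 / 2 * ((1 - γ) / m * (c⁻¹ * (m * v + -m * v')) ^ 2) +
      1 / 2 * ((1 - γ) / m * ‖m • s + (-m) • s'‖ ^ 2) +
      1 / 2 * ((v * ⟪s, N⟫ + v * ⟪s, N⟫ + m * ((c ^ 2)⁻¹ * v * v + ⟪s, s⟫)) +
        (v' * ⟪s', -N⟫ + v' * ⟪s', -N⟫ + -m * ((c ^ 2)⁻¹ * v' * v' + ⟪s', s'⟫))) ≤
    (c ^ 2)⁻¹ * v * (m * v + -m * v') + ⟪s, m • s + (-m) • s'⟫ +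
      v * (⟪s, N⟫ + ⟪s', -N⟫) + ⟪s, v • N + v' • -N⟫ := by
  have hγ' : (1 - γ) / m * m ^ 2 = m - c * ‖N‖ := by
    rw [hγ]
    field_simp
  have hX : ‖s - s'‖ ^ 2 = ⟪s, s⟫ - 2 * ⟪s, s'⟫ + ⟪s', s'⟫ := by
    rw [norm_sub_sq_real, real_inner_self_eq_norm_sq, real_inner_self_eq_norm_sq]
  have hI : ⟪s, N⟫ - ⟪s', N⟫ = ⟪s - s', N⟫ := by rw [inner_sub_left]
  have hcs := abs_real_inner_le_norm (s - s') N
  have hVI : -(|v - v'| * (‖s - s'‖ * ‖N‖)) ≤ (v - v') * ⟪s - s', N⟫ := by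
    have h1 : |(v - v') * ⟪s - s', N⟫| ≤ |v - v'| * (‖s - s'‖ * ‖N‖) := by
      rw [abs_mul]
      exact mul_le_mul_of_nonneg_left hcs (abs_nonneg _)
    exact (abs_le.1 h1).1
  have hY : |v - v'| * (‖s - s'‖ * ‖N‖) ≤
      1 / 2 * (c * ‖N‖ * ((c⁻¹ * (v - v')) ^ 2 + ‖s - s'‖ ^ 2)) := by
    have h2 : |v - v'| * (‖s - s'‖ * ‖N‖) = c * ‖N‖ * ((c⁻¹ * |v - v'|) * ‖s - s'‖) := by
      field_simp
    have h3 : (c⁻¹ * (v - v')) ^ 2 = (c⁻¹ * |v - v'|) ^ 2 := by rw [mul_pow, mul_pow, sq_abs]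
    rw [h2, h3]
    have h4 : 0 ≤ c * ‖N‖ := by positivity
    nlinarith [two_mul_le_add_sq (c⁻¹ * |v - v'|) ‖s - s'‖]
  have e1 : (1 - γ) / m * (c⁻¹ * (m * v + -m * v')) ^ 2 =
      (m - c * ‖N‖) * (c⁻¹ * (v - v')) ^ 2 := by rw [← hγ']; ring
  have e2 : (1 - γ) / m * ‖m • s + (-m) • s'‖ ^ 2 = (m - c * ‖N‖) * ‖s - s'‖ ^ 2 := by
    rw [← hγ', norm_smul_add_neg_smul_sq]; ring
  rw [e1, e2]
  simp only [inner_add_right, real_inner_smul_right, inner_neg_right, ← inv_pow]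
  have hfin := hVI.trans' (neg_le_neg hY)
  rw [← hI] at hfin
  rw [hX] at hfin ⊢
  nlinarith [hfin]

/-- Since `c‖N‖ = γ m`, a factor `m` can be taken out of all four products; in the rescaled
variables `c⁻¹|v|`, `‖s‖`, `c⁻¹|w - w'|`, `‖t - t'‖` the claim is `coupling_le` with `g = γ`. -/
theorem spaceLike_continuous {c m γ v w w' : ℝ} {N s t t' : F} (hc : 0 < c) (hm : 0 < m)
    (hγ : γ = c * ‖N‖ / m) (hγ1 : γ < 1) :
    (c ^ 2)⁻¹ * v * (m * w + -m * w') + ⟪s, m • t + (-m) • t'⟫ +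
      v * (⟪t, N⟫ + ⟪t', -N⟫) + ⟪s, w • N + w' • -N⟫ ≤
    2 * (2 * (m / (1 - γ) * (c⁻¹ * v) ^ 2) + 2 * (m / (1 - γ) * ‖s‖ ^ 2)) +
      1 / 2 * (1 / 2 * ((1 - γ) / m * (c⁻¹ * (m * w + -m * w')) ^ 2) +
        1 / 2 * ((1 - γ) / m * ‖m • t + (-m) • t'‖ ^ 2)) := by
  have hcN : c * ‖N‖ = γ * m := by rw [hγ]; field_simp
  have key := coupling_le (x := c⁻¹ * |v|) (y := ‖s‖) (X := c⁻¹ * |w - w'|) (Y := ‖t - t'‖) (g := γ)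
    (by positivity) (norm_nonneg _) (by positivity) (norm_nonneg _) hγ1
  have h1 : (c ^ 2)⁻¹ * v * (m * w + -m * w') ≤ m * ((c⁻¹ * |v|) * (c⁻¹ * |w - w'|)) := by
    have : v * (w - w') ≤ |v| * |w - w'| := by rw [← abs_mul]; exact le_abs_self _
    have h : (c ^ 2)⁻¹ * v * (m * w + -m * w') = (m * (c⁻¹) ^ 2) * (v * (w - w')) := by
      rw [inv_pow]; ring
    rw [h]
    have h2 : 0 ≤ m * (c⁻¹) ^ 2 := by positivity
    nlinarith [mul_le_mul_of_nonneg_left this h2]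
  have h2 : ⟪s, m • t + (-m) • t'⟫ ≤ m * (‖s‖ * ‖t - t'‖) := by
    have : m • t + (-m) • t' = m • (t - t') := by rw [neg_smul, smul_sub, sub_eq_add_neg]
    rw [this, real_inner_smul_right]
    exact mul_le_mul_of_nonneg_left (real_inner_le_norm _ _) hm.le
  have h3 : v * (⟪t, N⟫ + ⟪t', -N⟫) ≤ m * (γ * ((c⁻¹ * |v|) * ‖t - t'‖)) := by
    have h : ⟪t, N⟫ + ⟪t', -N⟫ = ⟪t - t', N⟫ := by
      rw [inner_neg_right, inner_sub_left, sub_eq_add_neg]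
    have h' : m * (γ * ((c⁻¹ * |v|) * ‖t - t'‖)) = |v| * (‖t - t'‖ * ‖N‖) := by
      have : m * (γ * ((c⁻¹ * |v|) * ‖t - t'‖)) = (γ * m) * c⁻¹ * |v| * ‖t - t'‖ := by ring
      rw [this, ← hcN]
      field_simp
    rw [h, h']
    refine (le_abs_self _).trans ?_
    rw [abs_mul]
    exact mul_le_mul_of_nonneg_left (abs_real_inner_le_norm _ _) (abs_nonneg _)
  have h4 : ⟪s, w • N + w' • -N⟫ ≤ m * (γ * ((c⁻¹ * |w - w'|) * ‖s‖)) := by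
    have h : ⟪s, w • N + w' • -N⟫ = (w - w') * ⟪s, N⟫ := by
      rw [inner_add_right, real_inner_smul_right, real_inner_smul_right, inner_neg_right]
      ring
    have h' : m * (γ * ((c⁻¹ * |w - w'|) * ‖s‖)) = |w - w'| * (‖s‖ * ‖N‖) := by
      have : m * (γ * ((c⁻¹ * |w - w'|) * ‖s‖)) = (γ * m) * c⁻¹ * |w - w'| * ‖s‖ := by ring
      rw [this, ← hcN]
      field_simp
    rw [h, h']
    refine (le_abs_self _).trans ?_
    rw [abs_mul]
    exact mul_le_mul_of_nonneg_left (abs_real_inner_le_norm _ _) (abs_nonneg _)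
  have e1 : (1 - γ) / m * (c⁻¹ * (m * w + -m * w')) ^ 2 =
      m * ((1 - γ) * (c⁻¹ * |w - w'|) ^ 2) := by
    rw [mul_pow c⁻¹ |w - w'|, sq_abs]
    field_simp
    ring
  have e2 : (1 - γ) / m * ‖m • t + (-m) • t'‖ ^ 2 = m * ((1 - γ) * ‖t - t'‖ ^ 2) := by
    rw [norm_smul_add_neg_smul_sq]
    field_simp
  have e3 : (c⁻¹ * v) ^ 2 = (c⁻¹ * |v|) ^ 2 := by rw [mul_pow, mul_pow, sq_abs]
  have e4 : m / (1 - γ) = m * (1 - γ)⁻¹ := div_eq_mul_inv _ _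
  rw [e1, e2, e3, e4]
  rw [div_eq_mul_inv] at key
  have := mul_le_mul_of_nonneg_left key hm.le
  linarith

end Vector

namespace FluxParams

variable {n : ℕ} {P : AcousticProblem n} {M : Mesh P} (p : FluxParams M)

theorem c_pos_of_mem_Q {z : SpaceTime n} (hz : z ∈ P.Q) : 0 < P.c z.fst := by
  obtain ⟨c₀, h0, hc⟩ := P.c_lower
  exact h0.trans_le (hc _ hz.1)

/-- The added flux has zero total integral but makes the comparison pointwise. It is an equality on
every kind of face except the space-like one. -/
theorem qDensity_le (u : P.Field) (i : Face) :
    (fun z => p.qDensity u i z + 1 / 2 * M.normalDensity (P.energyDensity (fun _ => 1) u u) i z)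
      ≤ᵐ[M.faceMeasure i] p.aDensity u u i := by
  cases i
  · filter_upwards [Mesh.ae_nF_Fspace (M := M)] with z hz
    have := spaceLike_coercive (v := M.lower u.1 z) (v' := M.upper u.1 z) (s := M.lower u.2 z)
      (s' := M.upper u.2 z) (N := (M.nF z).fst) (c_pos_of_mem_Q hz.1) hz.2.2.1
      (show M.γ z = _ from rfl)
    simpa only [qDensity, aDensity, Mesh.normalDensity, energyDensity, Mesh.jumpT, Mesh.jumpN,
      Mesh.jumpNv, Mesh.lower, Mesh.upper, WithLp.neg_fst, WithLp.neg_snd, one_mul,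
      smul_eq_mul] using this
  · refine Eventually.of_forall fun z => le_of_eq ?_
    simp only [qDensity, aDensity, Mesh.normalDensity, energyDensity, Mesh.eT_snd,
      real_inner_self_eq_norm_sq]
    have : (eT n).fst = 0 := rfl
    rw [this, inner_zero_right, mul_pow, inv_pow]
    ring
  · filter_upwards [Mesh.ae_nF_Ftime (M := M)] with z hz
    refine le_of_eq ?_
    simp only [qDensity, aDensity, Mesh.normalDensity, energyDensity, Mesh.avg, WithLp.neg_snd,
      hz.2.2, neg_zero, zero_mul, add_zero, real_inner_self_eq_norm_sq, smul_eq_mul, one_mul]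
    simp only [Mesh.jumpN, Mesh.jumpNv, Mesh.lower, Mesh.upper, WithLp.neg_fst, inner_add_left,
      inner_add_right, real_inner_smul_left, real_inner_smul_right, inner_neg_right]
    ring
  · refine Eventually.of_forall fun z => le_of_eq ?_
    have h1 : (P.nΩT z).fst = P.nΩ z := rfl
    have h2 : (P.nΩT z).snd = 0 := rfl
    simp only [qDensity, aDensity, Mesh.normalDensity, energyDensity, latN, lat, h1, h2]
    ring
  · refine Eventually.of_forall fun z => le_of_eq ?_
    have h1 : (P.nΩT z).fst = P.nΩ z := rfl
    have h2 : (P.nΩT z).snd = 0 := rfl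
    simp only [qDensity, aDensity, Mesh.normalDensity, energyDensity, latN, lat, h1, h2]
    ring
  · refine Eventually.of_forall fun z => le_of_eq ?_
    have h1 : (P.nΩT z).fst = P.nΩ z := rfl
    have h2 : (P.nΩT z).snd = 0 := rfl
    simp only [qDensity, aDensity, Mesh.normalDensity, energyDensity, latN, lat, h1, h2]
    ring
  · refine Eventually.of_forall fun z => le_of_eq ?_
    have h1 : (-eT n).fst = 0 := by simp [eT]
    have h2 : (-eT n).snd = -1 := rfl
    simp only [qDensity, aDensity, Mesh.normalDensity, energyDensity, h1, h2, inner_zero_right,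
      real_inner_self_eq_norm_sq]
    rw [mul_pow, inv_pow]
    ring

/-- Coercivity of the bilinear form on Trefftz fields. -/
theorem normDGsq_le_A {u : P.Field} (hu : M.IsTrefftz u) : p.normDGsq u ≤ p.A u u := by
  have ht := hu.fieldTraces
  have hq := p.faceIntegrable_qDensity ht
  have he := (hu.faceIntegrable_energy hu (contDiff_const (c := (1 : ℝ)))).const_mul (1 / 2)
  have h := Mesh.faceIntegral_mono (hq.add he) (p.faceIntegrable_aDensity ht ht) (p.qDensity_le u)
  rw [Mesh.faceIntegral_add hq he, Mesh.faceIntegral_const_mul, hu.faceIntegral_energy_one hu] at h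
  rw [p.normDGsq_eq_faceIntegral ht, A_eq_faceIntegral]
  linarith

/-! ### The continuity constant -/

theorem memLp_ratio :
    MemLp (fun z => (1 - p.δ z) / p.δ z) ⊤ ((surf n).restrict P.FR) ∧
    MemLp (fun z => p.δ z / (1 - p.δ z)) ⊤ ((surf n).restrict P.FR) := by
  obtain ⟨a, d, ha, hd, h⟩ := p.exists_robin_bounds
  have h1 := MemLp.inv_of_le p.δ_bounded ha (h.mono fun z hz => hz.1)
  have h2 := MemLp.inv_of_le p.memLp_one_sub_delta (sub_pos.2 hd)
    (h.mono fun z hz => by linarith [hz.2.1])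
  simp only [div_eq_mul_inv]
  exact ⟨h1.mul p.memLp_one_sub_delta, h2.mul p.δ_bounded⟩

theorem ae_ratio_le : ∀ᵐ z ∂(surf n).restrict P.FR,
    (1 - p.δ z) / p.δ z ≤ (p.Cc / 2) ^ 2 ∧ p.δ z / (1 - p.δ z) ≤ (p.Cc / 2) ^ 2 := by
  by_cases h0 : surf n P.FR = 0
  · rw [Measure.restrict_eq_zero.2 h0]
    simp
  · filter_upwards [MemLp.ae_norm_le_toReal p.memLp_ratio.1,
      MemLp.ae_norm_le_toReal p.memLp_ratio.2] with z h1 h2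
    rw [Cc, if_neg h0, mul_div_cancel_left₀ _ two_ne_zero]
    refine ⟨(le_abs_self _).trans (h1.trans ?_), (le_abs_self _).trans (h2.trans ?_)⟩
    · refine (Real.sq_sqrt ENNReal.toReal_nonneg).symm.le.trans ?_
      exact pow_le_pow_left₀ (Real.sqrt_nonneg _) (le_max_left _ _) 2
    · refine (Real.sq_sqrt ENNReal.toReal_nonneg).symm.le.trans ?_
      exact pow_le_pow_left₀ (Real.sqrt_nonneg _) (le_max_right _ _) 2

theorem one_le_of_ratio_le {d m : ℝ} (h0 : 0 < d) (h1 : d < 1) (h2 : (1 - d) / d ≤ m)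
    (h3 : d / (1 - d) ≤ m) : 1 ≤ m := by
  rcases le_total d (1 - d) with h | h
  · exact ((one_le_div h0).2 h).trans h2
  · exact ((one_le_div (by linarith)).2 h).trans h3

/-- The two ratios are reciprocal, so at every point one of them is at least one; a Robin part of
positive measure contains a point where both are below `(C_c / 2)²`. -/
theorem two_le_Cc : 2 ≤ p.Cc := by
  by_cases h0 : surf n P.FR = 0
  · rw [Cc, if_pos h0]
  · have hne : (ae ((surf n).restrict P.FR)).NeBot := by
      rw [ae_neBot, Ne, Measure.restrict_eq_zero]
      exact h0
    obtain ⟨z, ⟨h1, h2⟩, h3, h4, -⟩ := (p.ae_ratio_le.and p.ae_robin).exists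
    have h := one_le_of_ratio_le h3 h4 h1 h2
    have hpos : 0 ≤ p.Cc := by
      rw [Cc, if_neg h0]
      positivity
    nlinarith

/-- The two weights satisfy `A B = (1 - d) d`, so the ratio bounds say that the squared mixed
coefficients `(1 - d)²` and `d²` are at most `m A B`. Each of `v`, `s`, `w`, `t` enters two of the
four Young inequalities, which gives the factors `2 m` and `1 / 2`. -/
theorem robin_continuous {d a b m v s w t : ℝ} (h0 : 0 < d) (h1 : d < 1) (ha : 0 < a) (hb : 0 < b)
    (h2 : (1 - d) / d ≤ m) (h3 : d / (1 - d) ≤ m) :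
    (1 - d) * a / b * v * w + (1 - d) * v * t + d * s * w + d * b / a * s * t ≤
      2 * m * ((1 - d) * a / b * v ^ 2 + d * b / a * s ^ 2) +
        1 / 2 * ((1 - d) * a / b * w ^ 2 + d * b / a * t ^ 2) := by
  have hd : 0 < 1 - d := by linarith
  have hm := one_le_of_ratio_le h0 h1 h2 h3
  set A := (1 - d) * a / b with hA
  set B := d * b / a with hB
  have hA0 : 0 < A := by positivity
  have hB0 : 0 < B := by positivity
  have hAB : A * B = (1 - d) * d := by rw [hA, hB]; field_simp
  have hmA : 0 < m * A := by positivity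
  have hmB : 0 < m * B := by positivity
  have k1 : A * v * w ≤ m * A * v ^ 2 + 1 / 4 * (A * w ^ 2) :=
    mul_le_of_sq_le hmA (by nlinarith [mul_pos hA0 hA0]) v w
  have k4 : B * s * t ≤ m * B * s ^ 2 + 1 / 4 * (B * t ^ 2) :=
    mul_le_of_sq_le hmB (by nlinarith [mul_pos hB0 hB0]) s t
  have k2 : (1 - d) * v * t ≤ m * A * v ^ 2 + 1 / 4 * (B * t ^ 2) := by
    refine mul_le_of_sq_le hmA ?_ v t
    rw [mul_assoc, hAB]
    rw [div_le_iff₀ h0] at h2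
    nlinarith
  have k3 : d * s * w ≤ m * B * s ^ 2 + 1 / 4 * (A * w ^ 2) := by
    refine mul_le_of_sq_le hmB ?_ s w
    rw [mul_assoc, mul_comm B, hAB]
    rw [div_le_iff₀ hd] at h3
    nlinarith
  linarith

theorem aDensity_le (s t : P.Field) (i : Face) :
    p.aDensity s t i ≤ᵐ[M.faceMeasure i]
      fun z => 1 / 2 * (p.Cc ^ 2 * (p.qDensity s i z + p.plusDensity s i z) +
        p.qDensity t i z) := by
  have hC : 4 ≤ p.Cc ^ 2 := by nlinarith [p.two_le_Cc]
  have hq := p.qDensity_nonneg s i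
  have hp := p.plusDensity_nonneg s i
  -- Outside the Robin faces the constant `2` suffices, and `C_c ≥ 2` makes it admissible; the
  -- ratios of `δ` matter only on the Robin faces.
  have red : (∀ᵐ z ∂M.faceMeasure i, p.aDensity s t i z ≤
      2 * (p.qDensity s i z + p.plusDensity s i z) + 1 / 2 * p.qDensity t i z) →
      p.aDensity s t i ≤ᵐ[M.faceMeasure i] fun z => 1 / 2 * (p.Cc ^ 2 * (p.qDensity s i z +
        p.plusDensity s i z) + p.qDensity t i z) := by
    intro h
    filter_upwards [h, hq, hp] with z h1 h2 h3
    have h2 : 0 ≤ p.qDensity s i z := h2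
    have h3 : 0 ≤ p.plusDensity s i z := h3
    nlinarith
  obtain ⟨B, hB⟩ := M.exists_bound_gamma
  cases i
  · refine red ?_
    filter_upwards [Mesh.ae_nF_Fspace (M := M), hB, hq] with z hz hγ hqz
    have h2 : 0 ≤ p.qDensity s .space z := hqz
    have := spaceLike_continuous (v := M.lower s.1 z) (w := M.lower t.1 z) (w' := M.upper t.1 z)
      (s := M.lower s.2 z) (t := M.lower t.2 z) (t' := M.upper t.2 z)
      (N := (M.nF z).fst) (c_pos_of_mem_Q hz.1) hz.2.2.1 (show M.γ z = _ from rfl) hγ.2.1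
    have h3 : p.aDensity s t .space z ≤
        2 * p.plusDensity s .space z + 1 / 2 * p.qDensity t .space z := by
      simpa only [qDensity, plusDensity, aDensity, Mesh.jumpT, Mesh.jumpN,
        Mesh.jumpNv, WithLp.neg_fst, WithLp.neg_snd, smul_eq_mul] using this
    linarith
  · refine red (Eventually.of_forall fun z => ?_)
    simp only [qDensity, plusDensity, aDensity]
    have h1 := mul_le_young one_pos ((P.c z.fst)⁻¹ * tr s.1 z (eT n))
      ((P.c z.fst)⁻¹ * tr t.1 z (eT n))
    have h2 := inner_le_young one_pos (tr s.2 z (eT n)) (tr t.2 z (eT n))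
    have h3 : (P.c z.fst ^ 2)⁻¹ * tr s.1 z (eT n) * tr t.1 z (eT n) =
      ((P.c z.fst)⁻¹ * tr s.1 z (eT n)) * ((P.c z.fst)⁻¹ * tr t.1 z (eT n)) := by
      rw [← inv_pow]; ring
    rw [h3]
    simp only [inv_one, one_mul] at h1 h2
    linarith
  · refine red ?_
    filter_upwards [p.ae_alpha_pos_time, p.ae_beta_pos_time] with z hα hβ
    simp only [qDensity, plusDensity, aDensity]
    have h1 := mul_le_young hβ (M.avg s.1 z) (M.jumpNv t.2 z)
    have h2 := inner_le_young hα (M.avg s.2 z) (M.jumpN t.1 z)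
    have h3 := mul_le_mul_of_nonneg_left (inner_le_young one_pos (M.jumpN s.1 z) (M.jumpN t.1 z))
      hα.le
    have h4 := mul_le_mul_of_nonneg_left (mul_le_young one_pos (M.jumpNv s.2 z) (M.jumpNv t.2 z))
      hβ.le
    have p1 : 0 ≤ p.α z * ‖M.jumpN s.1 z‖ ^ 2 := by positivity
    have p2 : 0 ≤ p.β z * M.jumpNv s.2 z ^ 2 := by positivity
    have p3 : 0 ≤ (p.β z)⁻¹ * M.avg s.1 z ^ 2 := by positivity
    have p4 : 0 ≤ (p.α z)⁻¹ * ‖M.avg s.2 z‖ ^ 2 := by positivity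
    simp only [inv_one, one_mul] at h3 h4
    nlinarith
  · refine red ?_
    filter_upwards [p.ae_alpha_pos_dirichlet] with z hα
    simp only [qDensity, plusDensity, aDensity]
    have h1 := mul_le_young hα (P.latN s.2 z) (P.lat t.1 z)
    have h4 := mul_le_mul_of_nonneg_left (mul_le_young one_pos (P.lat s.1 z) (P.lat t.1 z)) hα.le
    have p1 : 0 ≤ p.α z * P.lat s.1 z ^ 2 := by positivity
    have p3 : 0 ≤ (p.α z)⁻¹ * P.latN s.2 z ^ 2 := by positivity
    simp only [inv_one, one_mul] at h4
    nlinarith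
  · refine red ?_
    filter_upwards [p.ae_beta_pos_neumann] with z hβ
    simp only [qDensity, plusDensity, aDensity]
    have h1 := mul_le_young hβ (P.lat s.1 z) (P.latN t.2 z)
    have h4 := mul_le_mul_of_nonneg_left (mul_le_young one_pos (P.latN s.2 z) (P.latN t.2 z)) hβ.le
    have p1 : 0 ≤ p.β z * P.latN s.2 z ^ 2 := by positivity
    have p3 : 0 ≤ (p.β z)⁻¹ * P.lat s.1 z ^ 2 := by positivity
    simp only [inv_one, one_mul] at h4
    nlinarith
  · filter_upwards [p.ae_robin, p.ae_ratio_le] with z ⟨h0, h1, ha, hb⟩ ⟨h2, h3⟩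
    have := robin_continuous (v := P.lat s.1 z) (s := P.latN s.2 z) (w := P.lat t.1 z)
      (t := P.latN t.2 z) h0 h1 ha hb h2 h3
    simp only [qDensity, plusDensity, aDensity]
    linarith
  · refine red ?_
    filter_upwards [hq, p.qDensity_nonneg t .initial] with z h1 h2
    have h1 : 0 ≤ p.qDensity s .initial z := h1
    have h2 : 0 ≤ p.qDensity t .initial z := h2
    simp only [plusDensity, aDensity]
    linarith

/-- Continuity of the bilinear form. -/
theorem A_le {s t : P.Field} (hs : M.FieldTraces s) (ht : M.FieldTraces t) :
    p.A s t ≤ 1 / 2 * (p.Cc ^ 2 * p.normDGplus s ^ 2 + p.normDGsq t) := by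
  have hq := p.faceIntegrable_qDensity hs
  have hp := p.faceIntegrable_plusDensity hs
  have hqt := p.faceIntegrable_qDensity ht
  have h1 := (hq.add hp).const_mul (p.Cc ^ 2)
  have h := Mesh.faceIntegral_mono (p.faceIntegrable_aDensity hs ht) ((h1.add hqt).const_mul (1 / 2))
    (p.aDensity_le s t)
  rw [Mesh.faceIntegral_const_mul, Mesh.faceIntegral_add h1 hqt, Mesh.faceIntegral_const_mul,
    Mesh.faceIntegral_add hq hp] at h
  rw [A_eq_faceIntegral, p.normDGplus_eq_faceIntegral hs, Real.sq_sqrt, p.normDGsq_eq_faceIntegral ht]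
  · exact h
  · exact add_nonneg (Mesh.faceIntegral_nonneg (p.qDensity_nonneg s))
      (Mesh.faceIntegral_nonneg (p.plusDensity_nonneg s))

end FluxParams

end Pointwise

/-! ### Stability with respect to the data -/

section Stability

open AcousticProblem

/-- Young's inequality is used for `g w` with weight `1 - d` and for `g t` with weight `d h`; the
two contributions of `g²` combine to `½ h g²`, free of `d`. -/
theorem robin_data_le {d h a b g w t : ℝ} (hd : 0 < d) (hd1 : d < 1) (ha : 0 < a) (hb : 0 < b)
    (hh : h = b / a) :
    g * ((1 - d) * w - d * b / a * t) ≤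
      1 / 2 * (h * g ^ 2 + ((1 - d) * a / b * w ^ 2 + d * b / a * t ^ 2)) := by
  have hh0 : 0 < h := by rw [hh]; positivity
  have e1 : (1 - d) * a / b = (1 - d) * h⁻¹ := by rw [hh, inv_div]; ring
  have e2 : d * b / a = d * h := by rw [hh]; ring
  rw [e1, e2]
  have k1 : g * w ≤ 1 / 2 * (h * g ^ 2 + h⁻¹ * w ^ 2) := by
    have : h * g ^ 2 + h⁻¹ * w ^ 2 - 2 * (g * w) = h⁻¹ * (h * g - w) ^ 2 := by
      field_simp
      ring
    nlinarith [mul_nonneg (inv_pos.2 hh0).le (sq_nonneg (h * g - w))]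
  have k2 : -(g * t) ≤ 1 / 2 * (g ^ 2 + t ^ 2) := by nlinarith [sq_nonneg (g + t)]
  have l1 := mul_le_mul_of_nonneg_left k1 (sub_pos.2 hd1).le
  have l2 := mul_le_mul_of_nonneg_left k2 (mul_pos hd hh0).le
  linarith

namespace FluxParams

variable {n : ℕ} {P : AcousticProblem n} {M : Mesh P} (p : FluxParams M)

/-- Density of the norm of the initial and impedance data. -/
def dataDensity (P : AcousticProblem n) : Face → SpaceTime n → ℝ
  | .initial => fun z => 2 * ((P.c z.fst)⁻¹ * P.v₀ z.fst) ^ 2 + 2 * ‖P.σ₀ z.fst‖ ^ 2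
  | .robin => fun z => P.cB z / P.θ z * P.gR z ^ 2
  | _ => fun _ => 0

theorem memLp_cB_div_theta (M : Mesh P) :
    MemLp (fun z => P.cB z / P.θ z) ⊤ ((surf n).restrict P.FR) := by
  simp only [div_eq_mul_inv]
  exact (memLp_theta P).2.mul (memLp_cB M).1

theorem integrable_initial_data (M : Mesh P) :
    Integrable (fun z => ((P.c z.fst)⁻¹ * P.v₀ z.fst) ^ 2) ((surf n).restrict P.F0) ∧
    Integrable (fun z => ‖P.σ₀ z.fst‖ ^ 2) ((surf n).restrict P.F0) :=
  ⟨(MemLp.weight_mul (memLp_initial P.memLp_v₀) (Mesh.memLp_c_F0 M).1).integrable_sq,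
    (memLp_initial P.memLp_σ₀).norm.integrable_sq⟩

theorem faceIntegrable_dataDensity (M : Mesh P) : M.FaceIntegrable (dataDensity P) := by
  intro i
  cases i
  case initial =>
    exact ((integrable_initial_data M).1.const_mul 2).add
      ((integrable_initial_data M).2.const_mul 2)
  case robin => exact MemLp.integrable_weight_mul_sq P.memLp_gR (memLp_cB_div_theta M)
  all_goals exact integrable_zero _ _ _

theorem faceIntegral_dataDensity (M : Mesh P) : M.faceIntegral (dataDensity P) =
    2 * (∫ z in P.F0, ((P.c z.fst)⁻¹ * P.v₀ z.fst) ^ 2 ∂surf n)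
      + 2 * (∫ z in P.F0, ‖P.σ₀ z.fst‖ ^ 2 ∂surf n)
      + ∫ z in P.FR, P.cB z / P.θ z * P.gR z ^ 2 ∂surf n := by
  simp only [Mesh.faceIntegral, dataDensity, integral_zero]
  rw [integral_add ((integrable_initial_data M).1.const_mul 2)
    ((integrable_initial_data M).2.const_mul 2), integral_const_mul, integral_const_mul]
  ring

theorem lDensity_le (hD : ∀ᵐ z ∂(surf n).restrict P.FD, P.gD z = 0)
    (hN : ∀ᵐ z ∂(surf n).restrict P.FN, P.gN z = 0) (t : P.Field) (i : Face) :
    p.lDensity t i ≤ᵐ[M.faceMeasure i]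
      fun z => 1 / 2 * (dataDensity P i z + p.qDensity t i z) := by
  have hq := p.qDensity_nonneg t i
  cases i
  case space => filter_upwards [hq] with z hz using by simpa [lDensity, dataDensity] using hz
  case final => filter_upwards [hq] with z hz using by simpa [lDensity, dataDensity] using hz
  case time => filter_upwards [hq] with z hz using by simpa [lDensity, dataDensity] using hz
  case dirichlet =>
    filter_upwards [hq, hD] with z hz h0 using by simpa [lDensity, dataDensity, h0] using hz
  case neumann =>
    filter_upwards [hq, hN] with z hz h0 using by simpa [lDensity, dataDensity, h0] using hz
  case robin =>
    filter_upwards [p.ae_robin] with z ⟨h0, h1, ha, hb⟩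
    exact robin_data_le h0 h1 ha hb rfl
  case initial =>
    refine Eventually.of_forall fun z => ?_
    -- The norm carries only the factor `1 / 2` on the initial face and half of it is absorbed,
    -- leaving `1 / 4`; this is the source of the factor `2` in front of the initial data.
    have h1 := mul_le_young one_pos ((P.c z.fst)⁻¹ * P.v₀ z.fst)
      ((P.c z.fst)⁻¹ * tr t.1 z (-eT n))
    have h2 := inner_le_young one_pos (P.σ₀ z.fst) (tr t.2 z (-eT n))
    have h3 : (P.c z.fst ^ 2)⁻¹ * P.v₀ z.fst * tr t.1 z (-eT n) =
        ((P.c z.fst)⁻¹ * P.v₀ z.fst) * ((P.c z.fst)⁻¹ * tr t.1 z (-eT n)) := by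
      rw [← inv_pow]; ring
    simp only [lDensity, dataDensity, qDensity]
    rw [h3]
    simp only [inv_one, one_mul] at h1 h2
    linarith

/-- The bound of the functional by the data if the Dirichlet and Neumann data vanish. -/
theorem ell_le (hD : ∀ᵐ z ∂(surf n).restrict P.FD, P.gD z = 0)
    (hN : ∀ᵐ z ∂(surf n).restrict P.FN, P.gN z = 0) {t : P.Field} (ht : M.FieldTraces t) :
    p.ell t ≤ 1 / 2 * (M.faceIntegral (dataDensity P) + p.normDGsq t) := by
  have hd := faceIntegrable_dataDensity M
  have hq := p.faceIntegrable_qDensity ht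
  have h := Mesh.faceIntegral_mono (p.faceIntegrable_lDensity ht) ((hd.add hq).const_mul (1 / 2))
    (p.lDensity_le hD hN t)
  rwa [Mesh.faceIntegral_const_mul, Mesh.faceIntegral_add hd hq, ← p.normDGsq_eq_faceIntegral ht,
    ← p.ell_eq_faceIntegral] at h

end FluxParams

end Stability

/-! ### The DG norm is definite on Trefftz fields -/

section Definite

open AcousticProblem

theorem IsLipschitzPolytope.volume_frontier {n : ℕ} {K : Set (SpaceTime n)}
    (hK : IsLipschitzPolytope K) : volume (frontier K) = 0 := by
  obtain ⟨H, h0, hH⟩ := hK.flat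
  refine measure_mono_null hH ((measure_biUnion_null_iff H.countable_toSet).2 fun h hh => ?_)
  have := ae_inner_ne (h0 h hh) h.2
  rw [ae_iff] at this
  simpa using this

theorem fst_ne_zero_of_snd_eq_zero {n : ℕ} {z : SpaceTime n} (h : ‖z‖ = 1) (h0 : z.snd = 0) :
    z.fst ≠ 0 := fun h1 => by
  have := norm_sq_spaceTime z
  rw [h, h1, h0] at this
  norm_num at this

namespace Mesh

variable {n : ℕ} {P : AcousticProblem n} {M : Mesh P}

variable (M) in
theorem Q_ae_eq : P.Q =ᵐ[volume] ⋃ K ∈ M.elems, K := by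
  have h : ∀ᵐ z : SpaceTime n, ∀ K ∈ M.elems, z ∉ frontier K :=
    (eventually_all_finset M.elems).2 fun K hK =>
      compl_mem_ae_iff.2 (M.polytope K hK).volume_frontier
  filter_upwards [h] with z hz
  refine propext ⟨fun hQ => ?_, fun hK => ?_⟩
  · obtain ⟨K, hK, hzK⟩ := Set.mem_iUnion₂.1 (M.cover hQ)
    refine Set.mem_iUnion₂.2 ⟨K, hK, ?_⟩
    by_contra hn
    exact hz K hK ⟨hzK, fun h => hn (interior_subset h)⟩
  · obtain ⟨K, hK, hzK⟩ := Set.mem_iUnion₂.1 hK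
    exact M.subset K hK hzK

variable (M) in
theorem setIntegral_Q {f : SpaceTime n → ℝ} (hf : ∀ K ∈ M.elems, IntegrableOn f K) :
    ∫ z in P.Q, f z = ∑ K ∈ M.elems, ∫ z in K, f z := by
  rw [setIntegral_congr_set M.Q_ae_eq, integral_biUnion_finset M.elems
    (fun K hK => (M.polytope K hK).measurableSet)
    (fun K hK K' hK' hne => M.disjoint K hK K' hK' hne) hf]

theorem ae_Q_of_elem {p : SpaceTime n → Prop}
    (h : ∀ K ∈ M.elems, ∀ᵐ z ∂volume.restrict K, p z) : ∀ᵐ z ∂volume.restrict P.Q, p z := by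
  rw [Measure.restrict_congr_set M.Q_ae_eq]
  exact (ae_restrict_biUnion_finset_iff _ M.elems p).2 h

end Mesh

/-! ### The affine weight that vanishes at the final time. -/

section RemainingTime

variable {E : Type*} [NormedAddCommGroup E] [InnerProductSpace ℝ E]

theorem contDiff_const_sub_inner (T : ℝ) (v : E) : ContDiff ℝ ∞ fun z : E => T - ⟪z, v⟫ :=
  contDiff_const.sub (contDiff_id.inner ℝ contDiff_const)

theorem gradient_const_sub_inner [CompleteSpace E] (T : ℝ) (v z : E) :
    gradient (fun z : E => T - ⟪z, v⟫) z = -v := by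
  refine HasGradientAt.gradient ?_
  rw [hasGradientAt_iff_hasFDerivAt, map_neg]
  have h := ((InnerProductSpace.toDual ℝ E v).hasFDerivAt (x := z)).const_sub T
  refine h.congr_of_eventuallyEq (Eventually.of_forall fun y => ?_)
  change T - ⟪y, v⟫ = T - InnerProductSpace.toDual ℝ E v y
  rw [InnerProductSpace.toDual_apply_apply, real_inner_comm]

end RemainingTime

namespace FluxParams

variable {n : ℕ} {P : AcousticProblem n} {M : Mesh P} (p : FluxParams M)

theorem qDensity_ae_eq_zero {u : P.Field} (hu : M.FieldTraces u) (h : p.normDGsq u = 0) (i : Face) :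
    ∀ᵐ z ∂M.faceMeasure i, p.qDensity u i z = 0 :=
  Mesh.ae_eq_zero_of_faceIntegral_eq_zero (p.faceIntegrable_qDensity hu) (p.qDensity_nonneg u)
    ((p.normDGsq_eq_faceIntegral hu).symm.trans h) i

/-- Zero norm removes all jumps on space-like faces, the normal jumps on time-like ones, at least
one factor of the flux on lateral faces and both traces at the initial time. Only the final face is
not covered by this reasoning, and there the weight is assumed to vanish. -/
theorem energyDensity_ae_eq_zero {u : P.Field} (hu : M.FieldTraces u) (h : p.normDGsq u = 0)
    {b : SpaceTime n → ℝ} (hb : ∀ z ∈ P.FT, b z = 0) (i : Face) :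
    M.normalDensity (P.energyDensity b u u) i =ᵐ[M.faceMeasure i] fun _ => 0 := by
  have hq := p.qDensity_ae_eq_zero hu h i
  obtain ⟨B, hB⟩ := M.exists_bound_gamma
  cases i
  case space =>
    filter_upwards [hq, Mesh.ae_nF_Fspace (M := M), hB] with z hz hn hγ
    have hw : 0 < (1 - M.γ z) / (M.nF z).snd := div_pos (by linarith [hγ.2.1]) hn.2.2.1
    have hc := c_pos_of_mem_Q hn.1
    simp only [qDensity] at hz
    have e1 : (P.c z.fst)⁻¹ * M.jumpT u.1 z = 0 := by
      have : 0 ≤ (1 - M.γ z) / (M.nF z).snd * ‖M.jumpT u.2 z‖ ^ 2 := by positivity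
      have : 0 ≤ (1 - M.γ z) / (M.nF z).snd * ((P.c z.fst)⁻¹ * M.jumpT u.1 z) ^ 2 := by positivity
      refine pow_eq_zero_iff two_ne_zero |>.1 ((mul_eq_zero_iff_left hw.ne').1 ?_)
      linarith
    have e2 : M.jumpT u.2 z = 0 := by
      have : 0 ≤ (1 - M.γ z) / (M.nF z).snd * ‖M.jumpT u.2 z‖ ^ 2 := by positivity
      have : 0 ≤ (1 - M.γ z) / (M.nF z).snd * ((P.c z.fst)⁻¹ * M.jumpT u.1 z) ^ 2 := by positivity
      refine norm_eq_zero.1 (pow_eq_zero_iff two_ne_zero |>.1 ((mul_eq_zero_iff_left hw.ne').1 ?_))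
      linarith
    have e1 := (mul_eq_zero_iff_left (inv_pos.2 hc).ne').1 e1
    have key : ∀ {F : Type} [NormedAddCommGroup F] [NormedSpace ℝ F] (x y : F),
        (M.nF z).snd • x + (-M.nF z).snd • y = 0 → y = x := by
      intro F _ _ x y h
      rw [WithLp.neg_snd, neg_smul, ← sub_eq_add_neg, ← smul_sub, smul_eq_zero] at h
      exact (sub_eq_zero.1 (h.resolve_left hn.2.2.1.ne')).symm
    have f1 := key _ _ e1
    have f2 := key _ _ e2
    simp only [Mesh.lower, Mesh.upper] at f1 f2
    simp only [Mesh.normalDensity, energyDensity, f1, f2, WithLp.neg_fst, WithLp.neg_snd,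
      inner_neg_right]
    ring
  case final =>
    filter_upwards [ae_restrict_mem measurableSet_FT] with z hz
    simp only [Mesh.normalDensity, energyDensity, hb z hz, zero_mul]
  case time =>
    filter_upwards [hq, Mesh.ae_nF_Ftime (M := M), p.ae_alpha_pos_time, p.ae_beta_pos_time]
      with z hz hn hα hβ
    simp only [qDensity] at hz
    have h1 : 0 ≤ p.α z * ‖M.jumpN u.1 z‖ ^ 2 := by positivity
    have h2 : 0 ≤ p.β z * M.jumpNv u.2 z ^ 2 := by positivity
    have e1 : M.jumpN u.1 z = 0 := by
      refine norm_eq_zero.1 (pow_eq_zero_iff two_ne_zero |>.1 ((mul_eq_zero_iff_left hα.ne').1 ?_))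
      linarith
    have e2 : M.jumpNv u.2 z = 0 := by
      refine pow_eq_zero_iff two_ne_zero |>.1 ((mul_eq_zero_iff_left hβ.ne').1 ?_)
      linarith
    have hN : (M.nF z).fst ≠ 0 := fst_ne_zero_of_snd_eq_zero hn.2.1 hn.2.2
    have f1 : tr u.1 z (-M.nF z) = tr u.1 z (M.nF z) := by
      simp only [Mesh.jumpN, Mesh.lower, Mesh.upper, WithLp.neg_fst, smul_neg] at e1
      rw [← sub_eq_add_neg, ← sub_smul, smul_eq_zero] at e1
      exact (sub_eq_zero.1 (e1.resolve_right hN)).symm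
    have f2 : ⟪tr u.2 z (M.nF z), (M.nF z).fst⟫ = ⟪tr u.2 z (-M.nF z), (M.nF z).fst⟫ := by
      simp only [Mesh.jumpNv, Mesh.lower, Mesh.upper, WithLp.neg_fst, inner_neg_right] at e2
      linarith
    simp only [Mesh.normalDensity, energyDensity, f1, WithLp.neg_fst, WithLp.neg_snd, hn.2.2,
      inner_neg_right, f2]
    ring
  case dirichlet =>
    filter_upwards [hq, p.ae_alpha_pos_dirichlet] with z hz hα
    have e1 : tr u.1 z (P.nΩT z) = 0 :=
      pow_eq_zero_iff two_ne_zero |>.1 ((mul_eq_zero_iff_left hα.ne').1 hz)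
    have h2 : (P.nΩT z).snd = 0 := rfl
    simp only [Mesh.normalDensity, energyDensity, e1, h2]
    ring
  case neumann =>
    filter_upwards [hq, p.ae_beta_pos_neumann] with z hz hβ
    have e1 : ⟪tr u.2 z (P.nΩT z), (P.nΩT z).fst⟫ = 0 :=
      pow_eq_zero_iff two_ne_zero |>.1 ((mul_eq_zero_iff_left hβ.ne').1 hz)
    have h2 : (P.nΩT z).snd = 0 := rfl
    simp only [Mesh.normalDensity, energyDensity, e1, h2]
    ring
  case robin =>
    filter_upwards [hq, p.ae_robin] with z hz ⟨h0, h1, ha, hb⟩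
    have hw : 0 < (1 - p.δ z) * P.θ z / P.cB z := div_pos (mul_pos (by linarith) ha) hb
    have hw' : 0 < p.δ z * P.cB z / P.θ z := by positivity
    simp only [qDensity] at hz
    have e1 : tr u.1 z (P.nΩT z) = 0 := by
      refine pow_eq_zero_iff two_ne_zero |>.1 ((mul_eq_zero_iff_left hw.ne').1 ?_)
      have k1 : 0 ≤ (1 - p.δ z) * P.θ z / P.cB z * P.lat u.1 z ^ 2 := by positivity
      have k2 : 0 ≤ p.δ z * P.cB z / P.θ z * P.latN u.2 z ^ 2 := by positivity
      change (1 - p.δ z) * P.θ z / P.cB z * P.lat u.1 z ^ 2 = 0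
      linarith
    have h2 : (P.nΩT z).snd = 0 := rfl
    simp only [Mesh.normalDensity, energyDensity, e1, h2]
    ring
  case initial =>
    filter_upwards [hq, Mesh.ae_speed_F0 M] with z hz ⟨K, hK, hc⟩
    have hc0 : 0 < P.c z.fst := hc ▸ Mesh.speed_pos hK
    simp only [qDensity] at hz
    have k1 : 0 ≤ ((P.c z.fst)⁻¹ * tr u.1 z (-eT n)) ^ 2 := by positivity
    have k2 : 0 ≤ ‖tr u.2 z (-eT n)‖ ^ 2 := by positivity
    have e1 : tr u.1 z (-eT n) = 0 := by
      refine (mul_eq_zero_iff_left (inv_pos.2 hc0).ne').1 (pow_eq_zero_iff two_ne_zero |>.1 ?_)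
      linarith
    have e2 : tr u.2 z (-eT n) = 0 := by
      refine norm_eq_zero.1 (pow_eq_zero_iff two_ne_zero |>.1 ?_)
      linarith
    simp only [Mesh.normalDensity, energyDensity, e1, e2, inner_zero_left]
    ring

/-- A Trefftz field of vanishing DG norm is zero. -/
theorem eq_zero_of_normDGsq_eq_zero {u : P.Field} (hu : M.IsTrefftz u) (h : p.normDGsq u = 0) :
    u = 0 := by
  -- The weight `T - t` vanishes on the final face and its gradient is `-eT`, so the volume side of
  -- the energy identity is minus the space-time energy.
  have hb := contDiff_const_sub_inner P.T (eT n)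
  have hg : ∀ z, (gradient (fun z : SpaceTime n => P.T - ⟪z, eT n⟫) z).fst = 0 ∧
      (gradient (fun z : SpaceTime n => P.T - ⟪z, eT n⟫) z).snd = -1 := fun z => by
    rw [gradient_const_sub_inner]
    exact ⟨by simp [eT], rfl⟩
  have hsum := hu.faceIntegral_energy hu hb
  rw [Mesh.faceIntegral_congr (p.energyDensity_ae_eq_zero hu.fieldTraces h fun z hz => by
    rw [inner_eT, hz.2, sub_self])] at hsum
  have hz0 : M.faceIntegral (fun _ _ => (0 : ℝ)) = 0 := by simp [Mesh.faceIntegral]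
  rw [hz0] at hsum
  simp only [hg, inner_zero_right, mul_zero, add_zero, zero_add, neg_one_mul, integral_neg,
    Finset.sum_neg_distrib] at hsum
  have hnn : ∀ K ∈ M.elems, ∀ z, 0 ≤ (Mesh.speed (P := P) K ^ 2)⁻¹ * u.1 z * u.1 z +
      ⟪u.2 z, u.2 z⟫ := fun K hK z => by
    rw [mul_assoc]
    have := mul_self_nonneg (u.1 z)
    have := real_inner_self_nonneg (x := u.2 z)
    positivity
  have hK0 := (Finset.sum_eq_zero_iff_of_nonneg fun K hK => integral_nonneg (hnn K hK)).1
    (neg_eq_zero.1 hsum.symm)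
  have hae : ∀ᵐ z ∂volume.restrict P.Q, u.1 z = 0 ∧ u.2 z = 0 := by
    refine Mesh.ae_Q_of_elem (M := M) fun K hK => ?_
    have hint := (hu.energy hu hb hK).integrable.neg
    have hint : IntegrableOn (fun z => (Mesh.speed (P := P) K ^ 2)⁻¹ * u.1 z * u.1 z +
        ⟪u.2 z, u.2 z⟫) K := hint.congr (Eventually.of_forall fun z => by
          simp only [Pi.neg_apply, hg, inner_zero_right]; ring)
    have := (integral_eq_zero_iff_of_nonneg (hnn K hK) hint).1 (hK0 K hK)
    filter_upwards [this] with z hz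
    have hz : (Mesh.speed (P := P) K ^ 2)⁻¹ * u.1 z * u.1 z + ⟪u.2 z, u.2 z⟫ = 0 := hz
    have hκ : 0 < (Mesh.speed (P := P) K ^ 2)⁻¹ := inv_pos.2 (pow_pos (Mesh.speed_pos hK) 2)
    have k1 := mul_nonneg hκ.le (mul_self_nonneg (u.1 z))
    have k2 := real_inner_self_nonneg (x := u.2 z)
    rw [mul_assoc] at hz
    refine ⟨mul_self_eq_zero.1 ((mul_eq_zero_iff_left hκ.ne').1 ?_),
      inner_self_eq_zero (𝕜 := ℝ).1 ?_⟩ <;> linarith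
  refine Prod.ext ?_ ?_
  · exact (Lp.eq_zero_iff_ae_eq_zero).2 (hae.mono fun z hz => hz.1)
  · exact (Lp.eq_zero_iff_ae_eq_zero).2 (hae.mono fun z hz => hz.2)

end FluxParams

end Definite

/-! ### Consistency -/

section Consistency

open AcousticProblem

namespace AcousticProblem

variable {n : ℕ}

/-- Boundary density of the momentum equation, tested with the direction `ξ`. -/
def momentumDensity (P : AcousticProblem n) (u : P.Field) (ξ : Space n) (z ν : SpaceTime n) : ℝ :=
  ⟪ξ, tr u.1 z ν • ν.fst + ν.snd • tr u.2 z ν⟫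

/-- Boundary density of the mass equation. -/
def massDensity (P : AcousticProblem n) (u : P.Field) (z ν : SpaceTime n) : ℝ :=
  ⟪tr u.2 z ν, ν.fst⟫ + (P.c z.fst ^ 2)⁻¹ * tr u.1 z ν * ν.snd

end AcousticProblem

namespace Mesh

variable {n : ℕ} {P : AcousticProblem n} {M : Mesh P} {u : P.Field}

theorem IsTrefftz.momentum (hu : M.IsTrefftz u) {φ : SpaceTime n → ℝ} (hφ : ContDiff ℝ ∞ φ)
    (ξ : Space n) {K : Set (SpaceTime n)} (hK : K ∈ M.elems) :
    FluxIdentity K (fun z => ⟪ξ, u.1 z • (gradient φ z).fst + (gradient φ z).snd • u.2 z⟫)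
      (fun z => φ z * P.momentumDensity u ξ z (outerNormal K z)) :=
  (hu.isTrefftzOn hK).momentum (M.polytope K hK) hφ ξ

theorem IsTrefftz.mass (hu : M.IsTrefftz u) {φ : SpaceTime n → ℝ} (hφ : ContDiff ℝ ∞ φ)
    {K : Set (SpaceTime n)} (hK : K ∈ M.elems) :
    FluxIdentity K
      (fun z => ⟪u.2 z, (gradient φ z).fst⟫ + (P.c z.fst ^ 2)⁻¹ * u.1 z * (gradient φ z).snd)
      (fun z => φ z * P.massDensity u z (outerNormal K z)) := by
  refine ((hu.isTrefftzOn hK).mass (M.polytope K hK) hφ).congr ?_ (Eventually.of_forall fun z => ?_)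
  · filter_upwards [ae_restrict_mem (M.polytope K hK).measurableSet] with z hz
    rw [speed_eq hK hz]
  · by_cases h : (outerNormal K z).snd = 0
    · simp only [AcousticProblem.massDensity, h, mul_zero]
    · simp only [AcousticProblem.massDensity, speed_eq_of_normal hK h]

/-- This is the fundamental lemma of the calculus of variations for the surface measure: test
functions supported in `Q` do not see the boundary of `Q`, but they determine the flux jumps on the
internal faces. -/
theorem faceSum_ae_eq_zero {J : SpaceTime n → SpaceTime n → ℝ}
    (hJ : ∀ K ∈ M.elems, IntegrableOn (fun z => J z (outerNormal K z)) (frontier K) (surf n))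
    (h : ∀ φ : SpaceTime n → ℝ, ContDiff ℝ ∞ φ → HasCompactSupport φ → tsupport φ ⊆ P.Q →
      ∑ K ∈ M.elems, ∫ z in frontier K, φ z * J z (outerNormal K z) ∂surf n = 0) :
    ∀ᵐ z ∂surf n, z ∈ P.Q → M.faceSum J z = 0 := by
  have hi : Integrable (M.faceSum J) (surf n) :=
    memLp_one_iff_integrable.1 (memLp_faceSum fun K hK => memLp_one_iff_integrable.2 (hJ K hK))
  refine isOpen_Q.ae_eq_zero_of_integral_contDiff_smul_eq_zero
    (hi.locallyIntegrable.locallyIntegrableOn _) fun φ hφ hc hs => ?_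
  have hsum : ∀ z, φ z • M.faceSum J z = ∑ K ∈ M.elems,
      (frontier K).indicator (fun z => φ z * J z (outerNormal K z)) z := fun z => by
    rw [faceSum, smul_eq_mul, Finset.mul_sum]
    refine Finset.sum_congr rfl fun K _ => ?_
    by_cases hz : z ∈ frontier K <;> simp [hz]
  simp only [hsum]
  rw [integral_finsetSum]
  · rw [← h φ hφ hc hs]
    exact Finset.sum_congr rfl fun K _ => integral_indicator isClosed_frontier.measurableSet
  · intro K hK
    exact (integrable_indicator_iff isClosed_frontier.measurableSet).2
      (integrableOn_continuous_mul (M.polytope K hK).isBounded_frontier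
        isClosed_frontier.measurableSet hφ.continuous (hJ K hK))

theorem IsTrefftz.integrableOn_momentumDensity (hu : M.IsTrefftz u) (ξ : Space n)
    {K : Set (SpaceTime n)} (hK : K ∈ M.elems) :
    IntegrableOn (fun z => P.momentumDensity u ξ z (outerNormal K z)) (frontier K) (surf n) := by
  simpa only [one_mul] using (hu.momentum (contDiff_const (c := (1 : ℝ))) ξ hK).integrable_trace

theorem IsTrefftz.integrableOn_massDensity (hu : M.IsTrefftz u)
    {K : Set (SpaceTime n)} (hK : K ∈ M.elems) :
    IntegrableOn (fun z => P.massDensity u z (outerNormal K z)) (frontier K) (surf n) := by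
  simpa only [one_mul] using (hu.mass (contDiff_const (c := (1 : ℝ))) hK).integrable_trace

variable (M) in
theorem integrableOn_Q {F : Type*} [NormedAddCommGroup F] {f : SpaceTime n → F}
    (hf : ∀ K ∈ M.elems, IntegrableOn f K) : IntegrableOn f P.Q :=
  (integrableOn_finset_iUnion.2 hf).congr_set_ae M.Q_ae_eq

/-- Element by element, integration by parts turns the weak equation on all of `Q` into the
vanishing of the boundary terms. -/
theorem IsTrefftz.faceSum_momentum (hu : M.IsTrefftz u) (hs : P.IsSolution u) (ξ : Space n) :
    ∀ᵐ z ∂surf n, z ∈ P.Q → M.faceSum (P.momentumDensity u ξ) z = 0 := by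
  refine faceSum_ae_eq_zero (fun K hK => hu.integrableOn_momentumDensity ξ hK) fun φ hφ hc ht => ?_
  have hint : IntegrableOn (fun z => u.1 z • (gradient φ z).fst + (gradient φ z).snd • u.2 z) P.Q := by
    refine M.integrableOn_Q fun K hK => ?_
    have hK' := M.polytope K hK
    have hsub := Measure.restrict_mono (μ := (volume : Measure (SpaceTime n))) (M.subset K hK) le_rfl
    refine IntegrableOn.add ?_ ?_
    · have h1 : MemLp (fun z => (gradient φ z).fst) 2 (volume.restrict K) :=
        hK'.memLp_of_continuous (continuous_gradient_fst hφ)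
      exact memLp_one_iff_integrable.1 (h1.smul ((Lp.memLp u.1).mono_measure hsub))
    · have h1 : MemLp (fun z => (gradient φ z).snd) 2 (volume.restrict K) :=
        hK'.memLp_of_continuous (continuous_gradient_snd hφ)
      exact memLp_one_iff_integrable.1 (((Lp.memLp u.2).mono_measure hsub).smul h1)
  rw [← Finset.sum_congr rfl fun K hK => (hu.momentum hφ ξ hK).eq,
    ← M.setIntegral_Q fun K hK => (hu.momentum hφ ξ hK).integrable, integral_inner hint,
    hs.momentum φ hφ hc ht, inner_zero_right]

theorem IsTrefftz.faceSum_mass (hu : M.IsTrefftz u) (hs : P.IsSolution u) :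
    ∀ᵐ z ∂surf n, z ∈ P.Q → M.faceSum (P.massDensity u) z = 0 := by
  refine faceSum_ae_eq_zero (fun K hK => hu.integrableOn_massDensity hK) fun φ hφ hc ht => ?_
  rw [← Finset.sum_congr rfl fun K hK => (hu.mass hφ hK).eq,
    ← M.setIntegral_Q fun K hK => (hu.mass hφ hK).integrable, hs.mass φ hφ hc ht]

/-- These are the Rankine–Hugoniot conditions. Pairing the first with `N` and inserting the second
gives `(v - v') (m² - c²‖N‖²) = 0`, and a space-like face is not characteristic; then `m (s - s') =
0` remains. -/
theorem eq_of_spaceLike {c m v v' : ℝ} {N s s' : Space n} (hc : 0 < c) (hN : c * ‖N‖ < m)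
    (h1 : (v • N + m • s) + (v' • -N + (-m) • s') = 0)
    (h2 : (⟪s, N⟫ + (c ^ 2)⁻¹ * v * m) + (⟪s', -N⟫ + (c ^ 2)⁻¹ * v' * -m) = 0) :
    v' = v ∧ s' = s := by
  have hm : 0 < m := (by positivity : 0 ≤ c * ‖N‖).trans_lt hN
  have h3 : (v - v') • N + m • (s - s') = 0 := by
    rw [← h1, sub_smul, smul_sub, smul_neg, neg_smul]
    abel
  have h4 : ⟪s - s', N⟫ + (c ^ 2)⁻¹ * (v - v') * m = 0 := by
    rw [← h2, inner_sub_left, inner_neg_right]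
    ring
  have h5 : (v - v') * ‖N‖ ^ 2 + m * ⟪s - s', N⟫ = 0 := by
    have := congrArg (fun x => ⟪x, N⟫) h3
    simpa only [inner_add_left, real_inner_smul_left, real_inner_self_eq_norm_sq,
      inner_zero_left] using this
  have h6 : (v - v') * (m ^ 2 - (c * ‖N‖) ^ 2) = 0 := by
    have h7 : ⟪s - s', N⟫ = -((c ^ 2)⁻¹ * (v - v') * m) := eq_neg_of_add_eq_zero_left h4
    rw [h7] at h5
    have h8 : c ^ 2 * ((v - v') * ‖N‖ ^ 2 + m * -((c ^ 2)⁻¹ * (v - v') * m)) = 0 := by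
      rw [h5, mul_zero]
    have h9 : c ^ 2 * (c ^ 2)⁻¹ = 1 := mul_inv_cancel₀ (by positivity)
    linear_combination -h8 - (v - v') * m ^ 2 * h9
  have h7 : 0 < m ^ 2 - (c * ‖N‖) ^ 2 :=
    sub_pos.2 (pow_lt_pow_left₀ hN (by positivity) two_ne_zero)
  have hv : v - v' = 0 := (mul_eq_zero.1 h6).resolve_right h7.ne'
  rw [hv, zero_smul, zero_add, smul_eq_zero] at h3
  exact ⟨(sub_eq_zero.1 hv).symm, (sub_eq_zero.1 (h3.resolve_left hm.ne')).symm⟩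

theorem eq_zero_of_inner_basis {x : Space n}
    (h : ∀ i, ⟪EuclideanSpace.basisFun (Fin n) ℝ i, x⟫ = 0) : x = 0 := by
  ext i
  simpa [EuclideanSpace.inner_single_left] using h i

theorem IsTrefftz.ae_fluxes (hu : M.IsTrefftz u) (hs : P.IsSolution u) :
    ∀ᵐ z ∂surf n, z ∈ P.Q →
      (∀ i, M.faceSum (P.momentumDensity u (EuclideanSpace.basisFun (Fin n) ℝ i)) z = 0) ∧
      M.faceSum (P.massDensity u) z = 0 := by
  have h1 : ∀ᵐ z ∂surf n, ∀ i : Fin n, z ∈ P.Q →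
      M.faceSum (P.momentumDensity u (EuclideanSpace.basisFun (Fin n) ℝ i)) z = 0 :=
    ae_all_iff.2 fun i => hu.faceSum_momentum hs _
  filter_upwards [h1, hu.faceSum_mass hs] with z h1 h2 hz
  exact ⟨fun i => h1 i hz, h2 hz⟩

/-- An exact solution does not jump across space-like faces. -/
theorem IsTrefftz.ae_Fspace_continuous (hu : M.IsTrefftz u) (hs : P.IsSolution u) :
    ∀ᵐ z ∂(surf n).restrict M.Fspace,
      tr u.1 z (-M.nF z) = tr u.1 z (M.nF z) ∧ tr u.2 z (-M.nF z) = tr u.2 z (M.nF z) := by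
  have hall : ∀ᵐ z ∂(surf n).restrict M.Fspace, ∀ i : Fin n,
      M.faceSum (P.momentumDensity u (EuclideanSpace.basisFun (Fin n) ℝ i)) z =
      P.momentumDensity u (EuclideanSpace.basisFun (Fin n) ℝ i) z (M.nF z) +
      P.momentumDensity u (EuclideanSpace.basisFun (Fin n) ℝ i) z (-M.nF z) :=
    ae_all_iff.2 fun i => M.faceSum_Fspace _
  filter_upwards [ae_restrict_of_ae (hu.ae_fluxes hs), hall,
    M.faceSum_Fspace (P.massDensity u), ae_nF_Fspace (M := M)] with z h1 h2 h3 hn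
  obtain ⟨hm, hk⟩ := h1 hn.1
  rw [h3] at hk
  refine eq_of_spaceLike (FluxParams.c_pos_of_mem_Q hn.1) hn.2.2.2
    (eq_zero_of_inner_basis fun i => ?_) hk
  rw [inner_add_right]
  exact (h2 i).symm.trans (hm i)

/-- Across time-like faces the scalar field and the normal component of the vector field of an
exact solution do not jump. -/
theorem IsTrefftz.ae_Ftime_continuous (hu : M.IsTrefftz u) (hs : P.IsSolution u) :
    ∀ᵐ z ∂(surf n).restrict M.Ftime,
      tr u.1 z (-M.nF z) = tr u.1 z (M.nF z) ∧
      ⟪tr u.2 z (-M.nF z), (M.nF z).fst⟫ = ⟪tr u.2 z (M.nF z), (M.nF z).fst⟫ := by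
  have hall : ∀ᵐ z ∂(surf n).restrict M.Ftime, ∀ i : Fin n,
      M.faceSum (P.momentumDensity u (EuclideanSpace.basisFun (Fin n) ℝ i)) z =
      P.momentumDensity u (EuclideanSpace.basisFun (Fin n) ℝ i) z (M.nF z) +
      P.momentumDensity u (EuclideanSpace.basisFun (Fin n) ℝ i) z (-M.nF z) :=
    ae_all_iff.2 fun i => M.faceSum_Ftime _
  filter_upwards [ae_restrict_of_ae (hu.ae_fluxes hs), hall,
    M.faceSum_Ftime (P.massDensity u), ae_nF_Ftime (M := M)] with z h1 h2 h3 hn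
  obtain ⟨hm, hk⟩ := h1 hn.1
  rw [h3] at hk
  have hN : (M.nF z).fst ≠ 0 := fst_ne_zero_of_snd_eq_zero hn.2.1 hn.2.2
  have hv : (tr u.1 z (M.nF z) - tr u.1 z (-M.nF z)) • (M.nF z).fst = 0 := by
    refine eq_zero_of_inner_basis fun i => ?_
    have := (h2 i).symm.trans (hm i)
    simp only [momentumDensity, WithLp.neg_fst, WithLp.neg_snd, hn.2.2, neg_zero, zero_smul,
      add_zero, real_inner_smul_right, inner_neg_right] at this
    rw [real_inner_smul_right]
    linarith
  simp only [massDensity, WithLp.neg_fst, WithLp.neg_snd, hn.2.2, neg_zero, mul_zero,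
    add_zero, inner_neg_right] at hk
  exact ⟨(sub_eq_zero.1 ((smul_eq_zero.1 hv).resolve_right hN)).symm, by linarith⟩

end Mesh

namespace FluxParams

variable {n : ℕ} {P : AcousticProblem n} {M : Mesh P} (p : FluxParams M) {u : P.Field}

/-- With no jumps in `u`, the internal part of the form is exactly the polarised energy flux of `u`
and `t`. On the boundary of `Q` the initial and boundary conditions turn the difference from the
flux into `ℓ`. -/
theorem aDensity_of_solution (hu : M.IsTrefftz u) (hs : P.IsSolution u) (t : P.Field) (i : Face) :
    p.aDensity u t i =ᵐ[M.faceMeasure i]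
      fun z => p.lDensity t i z + M.normalDensity (P.energyDensity (fun _ => 1) u t) i z := by
  have h2 : ∀ z, (P.nΩT z).snd = 0 := fun _ => rfl
  cases i
  case space =>
    filter_upwards [hu.ae_Fspace_continuous hs] with z ⟨e1, e2⟩
    simp only [aDensity, lDensity, Mesh.normalDensity, energyDensity, Mesh.jumpT, Mesh.jumpN,
      Mesh.jumpNv, Mesh.lower, Mesh.upper, e1, e2, WithLp.neg_fst, WithLp.neg_snd, inner_add_right,
      real_inner_smul_right, inner_neg_right, smul_eq_mul]
    ring
  case final =>
    refine Eventually.of_forall fun z => ?_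
    have h0 : (eT n).fst = 0 := rfl
    simp only [aDensity, lDensity, Mesh.normalDensity, energyDensity, h0, inner_zero_right,
      Mesh.eT_snd]
    ring
  case time =>
    filter_upwards [hu.ae_Ftime_continuous hs, Mesh.ae_nF_Ftime (M := M)] with z ⟨e1, e2⟩ hn
    simp only [aDensity, lDensity, Mesh.normalDensity, energyDensity, Mesh.jumpN, Mesh.avg,
      Mesh.jumpNv, Mesh.lower, Mesh.upper, e1, WithLp.neg_fst, WithLp.neg_snd, hn.2.2,
      inner_add_right, inner_add_left, real_inner_smul_left, real_inner_smul_right,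
      inner_neg_right, inner_neg_left, smul_eq_mul, e2]
    ring
  case dirichlet =>
    filter_upwards [hs.dirichlet] with z hz
    simp only [aDensity, lDensity, Mesh.normalDensity, energyDensity, h2, ← hz]
    simp only [latN, lat]
    have h1 : (P.nΩT z).fst = P.nΩ z := rfl
    rw [h1]
    ring
  case neumann =>
    filter_upwards [hs.neumann] with z hz
    simp only [aDensity, lDensity, Mesh.normalDensity, energyDensity, h2, ← hz]
    simp only [latN, lat]
    have h1 : (P.nΩT z).fst = P.nΩ z := rfl
    rw [h1]
    ring
  case robin =>
    filter_upwards [hs.robin, p.ae_robin] with z hz ⟨_, _, ha, hb⟩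
    simp only [aDensity, lDensity, Mesh.normalDensity, energyDensity, h2, ← hz]
    simp only [latN, lat]
    have h1 : (P.nΩT z).fst = P.nΩ z := rfl
    rw [h1]
    field_simp
    ring
  case initial =>
    filter_upwards [hs.initial] with z ⟨e1, e2⟩
    have h0 : (-eT n).fst = 0 := by simp [eT]
    have h1 : (-eT n).snd = -1 := rfl
    simp only [aDensity, lDensity, Mesh.normalDensity, energyDensity, h0, h1, e1, e2,
      inner_zero_right]
    ring

/-- Consistency of the method: an exact solution in the Trefftz space solves the variational
problem for all Trefftz test fields. -/
theorem A_eq_ell_of_solution (hu : M.IsTrefftz u) (hs : P.IsSolution u) {t : P.Field}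
    (ht : M.IsTrefftz t) : p.A u t = p.ell t := by
  rw [A_eq_faceIntegral, Mesh.faceIntegral_congr (p.aDensity_of_solution hu hs t),
    Mesh.faceIntegral_add (p.faceIntegrable_lDensity ht.fieldTraces)
      (hu.faceIntegrable_energy ht contDiff_const), hu.faceIntegral_energy_one ht,
    ← ell_eq_faceIntegral, add_zero]

end FluxParams

end Consistency

/-! ### Well-posedness, quasi-optimality and stability of the method -/

section Method

open AcousticProblem

/-! ### The triangle inequality by way of Young's inequality. -/

section YoungSplitting

theorem norm_smul_add_sq_le {F : Type*} [NormedAddCommGroup F] [NormedSpace ℝ F] {r : ℝ}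
    (hr : 0 < r) (c : ℝ) (x y : F) :
    ‖c • x + y‖ ^ 2 ≤ (1 + r) * c ^ 2 * ‖x‖ ^ 2 + (1 + r⁻¹) * ‖y‖ ^ 2 := by
  have h1 : ‖c • x + y‖ ≤ |c| * ‖x‖ + ‖y‖ := by
    simpa [norm_smul] using norm_add_le (c • x) y
  have h2 : ‖c • x + y‖ ^ 2 ≤ (|c| * ‖x‖ + ‖y‖) ^ 2 := pow_le_pow_left₀ (norm_nonneg _) h1 2
  have h3 : r * (|c| * ‖x‖) ^ 2 + r⁻¹ * ‖y‖ ^ 2 - 2 * (|c| * ‖x‖) * ‖y‖ =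
      r⁻¹ * (r * (|c| * ‖x‖) - ‖y‖) ^ 2 := by
    field_simp
    ring
  have h4 := mul_nonneg (inv_pos.2 hr).le (sq_nonneg (r * (|c| * ‖x‖) - ‖y‖))
  have h5 : (|c| * ‖x‖) ^ 2 = c ^ 2 * ‖x‖ ^ 2 := by rw [mul_pow, sq_abs]
  nlinarith

theorem mul_add_sq_le {r : ℝ} (hr : 0 < r) (c x y : ℝ) :
    (c * x + y) ^ 2 ≤ (1 + r) * c ^ 2 * x ^ 2 + (1 + r⁻¹) * y ^ 2 := by
  simpa only [smul_eq_mul, Real.norm_eq_abs, sq_abs] using norm_smul_add_sq_le hr c x y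

/-- The optimal parameter is `r = b / a`, for which the bound is `(a + b)²`. Both numbers are first
enlarged by `ε / 2`, since either may be zero. In this form a triangle inequality for the norm can
be proved by comparing densities pointwise for each `r`. -/
theorem sqrt_le_add_of_forall {X a b : ℝ} (ha : 0 ≤ a) (hb : 0 ≤ b)
    (h : ∀ r : ℝ, 0 < r → X ≤ (1 + r) * a ^ 2 + (1 + r⁻¹) * b ^ 2) : √X ≤ a + b := by
  refine le_of_forall_pos_le_add fun ε hε => ?_
  have ha' : 0 < a + ε / 2 := by positivity
  have hb' : 0 < b + ε / 2 := by positivity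
  have hr : 0 < (b + ε / 2) / (a + ε / 2) := by positivity
  refine Real.sqrt_le_iff.2 ⟨by positivity, (h _ hr).trans ?_⟩
  have h1 : (1 + (b + ε / 2) / (a + ε / 2)) * a ^ 2 ≤
      (1 + (b + ε / 2) / (a + ε / 2)) * (a + ε / 2) ^ 2 := by gcongr; linarith
  have h2 : (1 + ((b + ε / 2) / (a + ε / 2))⁻¹) * b ^ 2 ≤
      (1 + ((b + ε / 2) / (a + ε / 2))⁻¹) * (b + ε / 2) ^ 2 := by gcongr; linarith
  refine (add_le_add h1 h2).trans (le_of_eq ?_)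
  field_simp
  ring

end YoungSplitting

/-- A map that respects linear combinations, as a linear map. -/
def linearMapOfSmulAdd {V W : Type*} [AddCommGroup V] [Module ℝ V] [AddCommGroup W] [Module ℝ W]
    (f : V → W) (h : ∀ (c : ℝ) (x y : V), f (c • x + y) = c • f x + f y) : V →ₗ[ℝ] W where
  toFun := f
  map_add' x y := by simpa using h 1 x y
  map_smul' c x := by
    have h0 : f 0 = 0 := by simpa using h 1 0 0
    simpa [h0] using h c x 0

namespace FluxParams

variable {n : ℕ} {P : AcousticProblem n} {M : Mesh P} (p : FluxParams M)

theorem qDensity_smul_add_le {s t : P.Field} (hs : M.FieldTraces s) (ht : M.FieldTraces t)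
    (c : ℝ) {r : ℝ} (hr : 0 < r) (i : Face) :
    p.qDensity (c • s + t) i ≤ᵐ[M.faceMeasure i]
      fun z => (1 + r) * c ^ 2 * p.qDensity s i z + (1 + r⁻¹) * p.qDensity t i z := by
  have H := hs.tr_smul_add ht c
  obtain ⟨B, hB⟩ := M.exists_bound_gamma
  cases i
  case space =>
    filter_upwards [H.Fspace, hB, Mesh.ae_nF_Fspace (M := M)] with z ⟨⟨a1, a2⟩, a3, a4⟩ h1 h2
    have hw : 0 ≤ (1 - M.γ z) / (M.nF z).snd := div_nonneg (by linarith [h1.2.1]) h2.2.2.1.le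
    have e1 : (P.c z.fst)⁻¹ * M.jumpT (c • s + t).1 z =
        c * ((P.c z.fst)⁻¹ * M.jumpT s.1 z) + (P.c z.fst)⁻¹ * M.jumpT t.1 z := by
      simp only [Mesh.jumpT, Mesh.lower, Mesh.upper, a1, a3, smul_eq_mul]
      ring
    have e2 : M.jumpT (c • s + t).2 z = c • M.jumpT s.2 z + M.jumpT t.2 z := by
      simp only [Mesh.jumpT, Mesh.lower, Mesh.upper, a2, a4]
      module
    simp only [qDensity, e1, e2]
    have k1 := mul_le_mul_of_nonneg_left (mul_add_sq_le hr c ((P.c z.fst)⁻¹ * M.jumpT s.1 z)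
      ((P.c z.fst)⁻¹ * M.jumpT t.1 z)) hw
    have k2 := mul_le_mul_of_nonneg_left
      (norm_smul_add_sq_le hr c (M.jumpT s.2 z) (M.jumpT t.2 z)) hw
    linarith
  case final =>
    filter_upwards [H.FT] with z ⟨a1, a2⟩
    have e1 : (P.c z.fst)⁻¹ * tr (c • s + t).1 z (eT n) =
        c * ((P.c z.fst)⁻¹ * tr s.1 z (eT n)) + (P.c z.fst)⁻¹ * tr t.1 z (eT n) := by
      rw [a1]; ring
    simp only [qDensity, e1, a2]
    have k1 := mul_add_sq_le hr c ((P.c z.fst)⁻¹ * tr s.1 z (eT n))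
      ((P.c z.fst)⁻¹ * tr t.1 z (eT n))
    have k2 := norm_smul_add_sq_le hr c (tr s.2 z (eT n)) (tr t.2 z (eT n))
    linarith
  case time =>
    filter_upwards [H.Ftime, p.ae_alpha_pos_time, p.ae_beta_pos_time]
      with z ⟨⟨a1, a2⟩, a3, a4⟩ hα hβ
    have e1 : M.jumpN (c • s + t).1 z = c • M.jumpN s.1 z + M.jumpN t.1 z := by
      simp only [Mesh.jumpN, Mesh.lower, Mesh.upper, a1, a3]
      module
    have e2 : M.jumpNv (c • s + t).2 z = c * M.jumpNv s.2 z + M.jumpNv t.2 z := by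
      simp only [Mesh.jumpNv, Mesh.lower, Mesh.upper, a2, a4, inner_add_left,
        real_inner_smul_left]
      ring
    simp only [qDensity, e1, e2]
    have k1 := mul_le_mul_of_nonneg_left
      (norm_smul_add_sq_le hr c (M.jumpN s.1 z) (M.jumpN t.1 z)) hα.le
    have k2 := mul_le_mul_of_nonneg_left
      (mul_add_sq_le hr c (M.jumpNv s.2 z) (M.jumpNv t.2 z)) hβ.le
    linarith
  case dirichlet =>
    filter_upwards [H.FD, p.ae_alpha_pos_dirichlet] with z ⟨a1, a2⟩ hα
    simp only [qDensity, lat, a1]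
    have k1 := mul_le_mul_of_nonneg_left
      (mul_add_sq_le hr c (tr s.1 z (P.nΩT z)) (tr t.1 z (P.nΩT z))) hα.le
    linarith
  case neumann =>
    filter_upwards [H.FN, p.ae_beta_pos_neumann] with z ⟨a1, a2⟩ hβ
    have e2 : P.latN (c • s + t).2 z = c * P.latN s.2 z + P.latN t.2 z := by
      simp only [latN, lat, a2, inner_add_left, real_inner_smul_left]
    simp only [qDensity, e2]
    have k2 := mul_le_mul_of_nonneg_left
      (mul_add_sq_le hr c (P.latN s.2 z) (P.latN t.2 z)) hβ.le
    linarith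
  case robin =>
    filter_upwards [H.FR, p.ae_robin] with z ⟨a1, a2⟩ ⟨h0, h1, ha, hb⟩
    have hw : 0 ≤ (1 - p.δ z) * P.θ z / P.cB z :=
      (div_pos (mul_pos (by linarith) ha) hb).le
    have hw' : 0 ≤ p.δ z * P.cB z / P.θ z := by positivity
    have e1 : P.lat (c • s + t).1 z = c * P.lat s.1 z + P.lat t.1 z := a1
    have e2 : P.latN (c • s + t).2 z = c * P.latN s.2 z + P.latN t.2 z := by
      simp only [latN, lat, a2, inner_add_left, real_inner_smul_left]
    simp only [qDensity, e1, e2]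
    have k1 := mul_le_mul_of_nonneg_left (mul_add_sq_le hr c (P.lat s.1 z) (P.lat t.1 z)) hw
    have k2 := mul_le_mul_of_nonneg_left (mul_add_sq_le hr c (P.latN s.2 z) (P.latN t.2 z)) hw'
    linarith
  case initial =>
    filter_upwards [H.F0] with z ⟨a1, a2⟩
    have e1 : (P.c z.fst)⁻¹ * tr (c • s + t).1 z (-eT n) =
        c * ((P.c z.fst)⁻¹ * tr s.1 z (-eT n)) + (P.c z.fst)⁻¹ * tr t.1 z (-eT n) := by
      rw [a1]; ring
    simp only [qDensity, e1, a2]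
    have k1 := mul_add_sq_le hr c ((P.c z.fst)⁻¹ * tr s.1 z (-eT n))
      ((P.c z.fst)⁻¹ * tr t.1 z (-eT n))
    have k2 := norm_smul_add_sq_le hr c (tr s.2 z (-eT n)) (tr t.2 z (-eT n))
    linarith

theorem normDGsq_nonneg {t : P.Field} (ht : M.FieldTraces t) : 0 ≤ p.normDGsq t := by
  rw [p.normDGsq_eq_faceIntegral ht]
  exact Mesh.faceIntegral_nonneg (p.qDensity_nonneg t)

theorem sq_normDG {t : P.Field} (ht : M.FieldTraces t) : p.normDG t ^ 2 = p.normDGsq t :=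
  Real.sq_sqrt (p.normDGsq_nonneg ht)

theorem normDG_sub_le {s t : P.Field} (hs : M.FieldTraces s) (ht : M.FieldTraces t) :
    p.normDG (s - t) ≤ p.normDG s + p.normDG t := by
  have hst : s - t = (-1 : ℝ) • t + s := by rw [neg_one_smul, sub_eq_neg_add]
  rw [add_comm]
  refine sqrt_le_add_of_forall (Real.sqrt_nonneg _) (Real.sqrt_nonneg _) fun r hr => ?_
  rw [hst]
  have hq := p.faceIntegrable_qDensity ((ht.smul (-1)).add hs)
  have h1 := (p.faceIntegrable_qDensity ht).const_mul ((1 + r) * (-1) ^ 2)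
  have h2 := (p.faceIntegrable_qDensity hs).const_mul (1 + r⁻¹)
  have h := Mesh.faceIntegral_mono hq (h1.add h2) (p.qDensity_smul_add_le ht hs (-1) hr)
  rw [Mesh.faceIntegral_add h1 h2, Mesh.faceIntegral_const_mul, Mesh.faceIntegral_const_mul,
    ← p.normDGsq_eq_faceIntegral ((ht.smul (-1)).add hs), ← p.normDGsq_eq_faceIntegral ht,
    ← p.normDGsq_eq_faceIntegral hs] at h
  rw [p.sq_normDG ht, p.sq_normDG hs]
  linarith

theorem normDG_le_normDGplus {t : P.Field} (ht : M.FieldTraces t) :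
    p.normDG t ≤ p.normDGplus t := by
  rw [p.normDGplus_eq_faceIntegral ht, normDG, p.normDGsq_eq_faceIntegral ht]
  exact Real.sqrt_le_sqrt (le_add_of_nonneg_right (Mesh.faceIntegral_nonneg (p.plusDensity_nonneg t)))

theorem A_sub_left {s s' t : P.Field} (hs : M.FieldTraces s) (hs' : M.FieldTraces s')
    (ht : M.FieldTraces t) : p.A (s - s') t = p.A s t - p.A s' t := by
  have hst : s - s' = (-1 : ℝ) • s' + s := by rw [neg_one_smul, sub_eq_neg_add]
  rw [hst, p.A_smul_add_left hs' hs ht]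
  ring

variable {V : Submodule ℝ P.Field}

/-- Coercivity and definiteness of the norm make `u ↦ A(u; ·)` injective from `V` into its dual,
which has the same finite dimension; hence it is bijective. -/
theorem existsUnique_isDiscreteSolution [FiniteDimensional ℝ V] (hV : ∀ u ∈ V, M.IsTrefftz u) :
    ∃! u : P.Field, p.IsDiscreteSolution V u := by
  have hT : ∀ u : V, M.FieldTraces (u : P.Field) := fun u => (hV u u.2).fieldTraces
  let B : V →ₗ[ℝ] V →ₗ[ℝ] ℝ := linearMapOfSmulAdd
    (fun u => linearMapOfSmulAdd (fun t : V => p.A u t)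
      fun c x y => p.A_smul_add_right (hT u) (hT x) (hT y) c)
    fun c x y => LinearMap.ext fun t => p.A_smul_add_left (hT x) (hT y) (hT t) c
  let L : V →ₗ[ℝ] ℝ := linearMapOfSmulAdd (fun t : V => p.ell t)
    fun c x y => p.ell_smul_add (hT x) (hT y) c
  have hB : Function.Injective B := by
    refine (injective_iff_map_eq_zero B).2 fun u hu => Subtype.ext ?_
    have h0 : p.A u u = 0 := LinearMap.congr_fun hu u
    exact p.eq_zero_of_normDGsq_eq_zero (hV u u.2)
      (le_antisymm ((p.normDGsq_le_A (hV u u.2)).trans h0.le) (p.normDGsq_nonneg (hT u)))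
  have hB' : Function.Surjective B :=
    (LinearMap.injective_iff_surjective_of_finrank_eq_finrank
      (Subspace.dual_finrank_eq (K := ℝ) (V := V)).symm).1 hB
  obtain ⟨u, hu⟩ := hB' L
  refine ⟨u, ⟨u.2, fun t ht => LinearMap.congr_fun hu ⟨t, ht⟩⟩, fun u' hu' => ?_⟩
  have : (⟨u', hu'.1⟩ : V) = u := by
    refine hB (LinearMap.ext fun t => ?_)
    rw [hu]
    exact hu'.2 t t.2
  exact congrArg Subtype.val this

variable {u_hp : P.Field}

theorem normDG_sub_le_mul_normDGplus (hV : ∀ u ∈ V, M.IsTrefftz u)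
    (h : p.IsDiscreteSolution V u_hp) {u : P.Field} (hs : P.IsSolution u) (hu : M.IsTrefftz u)
    {t : P.Field} (ht : t ∈ V) :
    p.normDG (u - u_hp) ≤ (1 + p.Cc) * p.normDGplus (u - t) := by
  have he : u_hp - t ∈ V := V.sub_mem h.1 ht
  have fe := (hV _ he).fieldTraces
  have ft := (hV t ht).fieldTraces
  have fu := hu.fieldTraces
  have f_hp := (hV _ h.1).fieldTraces
  have fut := fu.sub ft
  -- Galerkin orthogonality: `u_hp` and the exact `u` give the same value against every test field
  -- in `V`.
  have h1 : p.A (u_hp - t) (u_hp - t) = p.A (u - t) (u_hp - t) := by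
    rw [p.A_sub_left f_hp ft fe, p.A_sub_left fu ft fe, h.2 _ he,
      p.A_eq_ell_of_solution hu hs (hV _ he)]
  have h2 := p.normDGsq_le_A (hV _ he)
  have h3 := p.A_le fut fe
  have hC : 0 ≤ p.Cc := by linarith [p.two_le_Cc]
  have hplus : 0 ≤ p.normDGplus (u - t) := Real.sqrt_nonneg _
  have h4 : p.normDG (u_hp - t) ≤ p.Cc * p.normDGplus (u - t) := by
    -- Coercivity bounds the squared norm of `u_hp - t` by the form, and the continuity estimate
    -- returns half of this same square, which is absorbed on the left.
    refine Real.sqrt_le_iff.2 ⟨mul_nonneg hC hplus, ?_⟩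
    rw [mul_pow]
    linarith
  have h5 : u - u_hp = (u - t) - (u_hp - t) := by abel
  rw [h5]
  have h6 := p.normDG_sub_le fut fe
  have h7 := p.normDG_le_normDGplus fut
  linarith

/-- Testing with the discrete solution itself gives `|||u_hp|||² ≤ ℓ(u_hp)`, and the half of the
square occurring in the bound of `ℓ` is absorbed. -/
theorem normDG_le_data (hV : ∀ u ∈ V, M.IsTrefftz u) (h : p.IsDiscreteSolution V u_hp)
    (hD : ∀ᵐ z ∂(surf n).restrict P.FD, P.gD z = 0)
    (hN : ∀ᵐ z ∂(surf n).restrict P.FN, P.gN z = 0) :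
    p.normDG u_hp ≤ √(M.faceIntegral (dataDensity P)) := by
  have hu := hV _ h.1
  have h1 := p.normDGsq_le_A hu
  have h2 := p.ell_le hD hN hu.fieldTraces
  rw [h.2 _ h.1] at h1
  exact Real.sqrt_le_sqrt (by linarith)

end FluxParams

end Method

end TrefftzDG

end

theorem theorem1 {n : ℕ} (hn : 1 ≤ n) (P : TrefftzDG.AcousticProblem n) (M : TrefftzDG.Mesh P)
    (p : TrefftzDG.FluxParams M) (V : Submodule ℝ P.Field) [FiniteDimensional ℝ V]
    (hV : ∀ u ∈ V, M.IsTrefftz u) :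
    (∃! u : P.Field, p.IsDiscreteSolution V u) ∧
    ∀ u_hp : P.Field, p.IsDiscreteSolution V u_hp →
      (∀ u : P.Field, P.IsSolution u → M.IsTrefftz u →
        p.normDG (u - u_hp) ≤ (1 + p.Cc) * ⨅ t : V, p.normDGplus (u - (t : P.Field))) ∧
      ((∀ᵐ z ∂(TrefftzDG.surf n).restrict P.FD, P.gD z = 0) →
        (∀ᵐ z ∂(TrefftzDG.surf n).restrict P.FN, P.gN z = 0) →
        p.normDG u_hp ≤
          √(2 * (∫ z in P.F0, ((P.c z.fst)⁻¹ * P.v₀ z.fst) ^ 2 ∂(TrefftzDG.surf n))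
            + 2 * (∫ z in P.F0, ‖P.σ₀ z.fst‖ ^ 2 ∂(TrefftzDG.surf n))
            + ∫ z in P.FR, P.cB z / P.θ z * P.gR z ^ 2 ∂(TrefftzDG.surf n))) := by
  refine ⟨p.existsUnique_isDiscreteSolution hV, fun u_hp h => ⟨fun u hs hu => ?_, fun hD hN => ?_⟩⟩
  -- The nonnegative constant is moved inside the infimum, so the bound for each single competitor
  -- suffices.
  · rw [Real.mul_iInf_of_nonneg (by linarith [p.two_le_Cc])]
    exact le_ciInf fun t => p.normDG_sub_le_mul_normDGplus hV h hs hu t.2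
  · rw [← TrefftzDG.FluxParams.faceIntegral_dataDensity M]
    exact p.normDG_le_data hV h hD hN
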